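/- **Setting.** A *secure commitment scheme with perfect binding* is a pair of polynomial-time algorithms: for $k\ge 1$, a bit $b$ and a uniformly random string $r$ of length polynomial in $k$, $C$ returns a $k$-bit commitment string $C_1(1^k,b,r)$ and a $(k-1)$-bit key $C_2(1^k,b,r)$; a deterministic receiver $R$ satisfies $R(C_1(1^k,b,r),C_2(1^k,b,r))=b$ and $R(C_1(1^k,b,r),s)=\mathit{fail}$ for every other $s$; and the ensembles $\{C_1(1^k,0)\}_k$, $\{C_1(1^k,1)\}_k$ are computationally indistinguishable. Fix such a scheme for which the set of commitment strings $\{C_1(1^k,b,r)\}$ can be recognized in polynomial time. Let $\Gamma$ be a finite normal-form game with $c\ge 2$ players whose payoffs are polynomial-time computable real numbers (e.g. rationals), and let $\pi$ be a *nice* convex combination of Nash equilibria of $\Gamma$: $\pi=\sum_j q_j x^j$ with finitely many Nash equilibria $x^j$ having rational probabilities and rational $q_j>0$, $\sum_j q_j=1$. Let $\ell$ be the least common denominator of the $q_j$ and let $2^{d-1}\le\ell<2^d$. *The envelope game $G_{\mathrm{corr}}$.* Player 1 puts $a\in\{0,\dots,\ell-1\}$ in an envelope; player 2, not knowing $a$,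 picks $b\in\{0,\dots,\ell-1\}$; player 1 opens or destroys the envelope; $b$ and this last choice are public, and $a$ becomes public iff the envelope is opened. Then $\Gamma$ is played, the players moving in the order $2,1,3,\dots,c$ without seeing each other's actions in $\Gamma$. Payoffs are those of $\Gamma$. *The cryptographic sequence $\mathcal G_{\mathrm{corr}}=(G_1,G_2,\dots)$.* In $G_n$, player 1 plays $d$ commitment strings for security parameter $n$, in parallel; player 2 plays a $d$-bit string; player 1 plays a bitstring of length at most $dn$, intended to be the $d$ keys; all this is public. Then $\Gamma$ is played as before, with actions in binary. Payoffs are those of $\Gamma$. The map $f_n$ from histories of $G_n$ to histories of $G_{\mathrm{corr}}$ sends commitments to the number $s$ to "put $s \bmod \ell$ in the envelope", player 2's string to its value mod $\ell$, player 1's second string to "open" if it consists of $d$ valid keys and to "destroy" otherwise, and binary representations to the actions of $\Gamma$ that they represent. *Representation.* $\mathcal G$ $\langle\vec f,\mathcal F\rangle$-*represents* $G$ if $\mathcal G$ is a computable uniform sequence (actions of polynomial length; polynomial-time membership of histories, player function and utilities) with the same players, and: each $f_n$ maps the histories of $G_n$ onto those of $G$, preserving length, player to move, subhistories, membership in a common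 information set, and utilities of terminal histories, and the last action of $f_n(h\cdot a)$ depends only on $a$ and the information set of $h$; and $\mathcal F$ maps mixed strategies of $G$ with polynomial-time computable probabilities to polynomial-time randomized strategies of $\mathcal G$ (which remember their randomness) such that (a) for every profile $\vec\sigma$ the distribution on terminal histories of $G$ obtained from $\mathcal F(\vec\sigma)$ via $f_n$ is statistically close (within a negligible function of $n$) to that of $\vec\sigma$; (b) for every $\sigma_i$ a polynomial-time algorithm computes, from every view reachable when $i$ plays $\mathcal F(\sigma_i)$, the action of $G$ (with its information set) that $\mathcal F(\sigma_i)$ plays; (c) for every profile $\vec\sigma$, player $i$ and polynomial-time strategy $M'$ of $i$ there are strategies $\sigma'_1,\sigma'_2,\dots$ of $i$ in $G$ such that the ensemble on terminal histories of $G$ obtained from $(M',\mathcal F(\vec\sigma_{-i}))$ is computationally indistinguishable from the one induced by $(\sigma'_n,\vec\sigma_{-i})$, $n\ge1$. *Computational sequential equilibrium.* $\vec M$ is one if there are completely mixed polynomial-time profiles $\vec M^k$ converging to $\vec M$ (in total variation of the induced distributions on deterministic strategies of $G_n$, uniformly in $n$) and $0\le\delta_k\to0$ such that for all $k$ and $i$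 there is an $\vec M$-consistent partition $\mathcal I_i$ of the histories of $G$ at which $i$ moves, such that for every $I\in\mathcal I_i$ and every polynomial-time strategy $M'$ of $i$ there is a negligible $\epsilon$ such that for all $n$, conditional on reaching $f_n^{-1}(I)$, switching from $M^k_i$ to $M'$ from there on raises $i$'s expected utility against $\vec M^k_{-i}$ by at most $\epsilon(n)+\delta_k$. Here $\mathcal I_i$ is $\vec M$-*consistent* if for every non-singleton $I\in\mathcal I_i$ and $h\in I$ such that the probabilities of reaching the views of $i$ at $f_n^{-1}(h)$ and at $f_n^{-1}(I\setminus\{h\})$ are both non-negligible, the distributions on these two sets of views under $\vec M$ are computationally indistinguishable. **Theorem.** There is a map $\mathcal F$ such that $\mathcal G_{\mathrm{corr}}$ $\langle\vec f,\mathcal F\rangle$-represents $G_{\mathrm{corr}}$, with the maps $f_n$ above. Moreover, $G_{\mathrm{corr}}$ has a sequential equilibrium $\vec\sigma_\pi$ whose distribution on action profiles of $\Gamma$ is exactly $\pi$ and such that $\mathcal F(\vec\sigma_\pi)$ is a computational sequential equilibrium of $\mathcal G_{\mathrm{corr}}$; the distribution on action profiles of $\Gamma$ that $\mathcal F(\vec\sigma_\pi)$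 induces in $G_n$ is statistically close to $\pi$. (No mediator takes part in $\mathcal G_{\mathrm{corr}}$.) -/

import Mathlib

open Filter Topology

noncomputable section

/-! ## Bitstrings -/

/-- The unary string `1^n`. -/
def ones (n : ℕ) : List Bool := List.replicate n true

/-- Self-delimiting form of a bitstring: each bit is preceded by `true`, and `false` ends it. -/
def delimit : List Bool → List Bool
  | [] => [false]
  | b :: x => true :: b :: delimit x

/-- A list of bitstrings as one bitstring. -/
def packBits : List (List Bool) → List Bool
  | [] => []
  | x :: xs => delimit x ++ packBits xs

theorem delimit_append_inj :
    ∀ (x y u v : List Bool), delimit x ++ u = delimit y ++ v → x = y ∧ u = v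
  | [], [], u, v, h => by simpa [delimit] using h
  | [], b :: y, u, v, h => by simp [delimit] at h
  | a :: x, [], u, v, h => by simp [delimit] at h
  | a :: x, b :: y, u, v, h => by
      simp only [delimit, List.cons_append, List.cons.injEq, true_and] at h
      obtain ⟨h1, h2⟩ := delimit_append_inj x y u v h.2
      exact ⟨by rw [h.1, h1], h2⟩

theorem packBits_injective : Function.Injective packBits := by
  intro xs
  induction xs with
  | nil =>
    intro ys h
    cases ys with
    | nil => rfl
    | cons y ys => cases y <;> simp [packBits, delimit] at h
  | cons x xs ih =>
    intro ys h
    cases ys with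
    | nil => cases x <;> simp [packBits, delimit] at h
    | cons y ys =>
      obtain ⟨h1, h2⟩ := delimit_append_inj x y _ _ h
      rw [h1, ih h2]

/-- Objects that have a name as a bitstring, so that they can be given to a machine. -/
class BitCode (α : Type) where
  code : α → List Bool
  code_injective : Function.Injective code

instance : BitCode (List Bool) where
  code := id
  code_injective := Function.injective_id

instance {α : Type} [BitCode α] : BitCode (Option α) where
  code
    | none => []
    | some a => true :: BitCode.code a
  code_injective := by
    intro x y h
    cases x <;> cases y <;> simp_all
    exact BitCode.code_injective h

instance {α : Type} [BitCode α] : BitCode (List α) where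
  code l := packBits (l.map BitCode.code)
  code_injective := fun _ _ h =>
    List.map_injective_iff.2 BitCode.code_injective (packBits_injective h)

instance {α β : Type} [BitCode α] [BitCode β] : BitCode (α × β) where
  code p := packBits [BitCode.code p.1, BitCode.code p.2]
  code_injective := by
    intro x y h
    have h' := packBits_injective h
    simp only [List.cons.injEq, and_true] at h'
    exact Prod.ext (BitCode.code_injective h'.1) (BitCode.code_injective h'.2)

/-- The number with a given binary representation, least significant bit first. -/
def bitsVal (x : List Bool) : ℕ := x.foldr (fun b v => Nat.bit b v) 0

theorem bitsVal_bits (n : ℕ) : bitsVal (Nat.bits n) = n := by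
  induction n using Nat.binaryRec' with
  | zero => simp [bitsVal]
  | bit b n h ih =>
    rw [Nat.bits_append_bit n b h]
    simpa [bitsVal] using congrArg (Nat.bit b) ih

/-! ## Polynomial time

The machines have finitely many tapes, used as stacks of bits; a basic step reads, writes or
erases the top cell of one tape.  (A two-way tape is a pair of stacks.)  The finite control is
given in structured form. -/

/-- The control of a multi-tape machine. -/
inductive Machine : Type
  | skip : Machine
  | push (i : ℕ) (b : Bool) : Machine
  | pop (i : ℕ) : Machine
  | seq (p q : Machine) : Machine
  /-- branch on the top cell of tape `i`: tape empty, cell `0`, cell `1` -/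
  | branch (i : ℕ) (p q r : Machine) : Machine
  /-- repeat `p` as long as tape `i` is nonempty -/
  | loop (i : ℕ) (p : Machine) : Machine

/-- The contents of the tapes. -/
abbrev Tapes : Type := ℕ → List Bool

/-- `Runs p s t s'`: started on tapes `s`, the machine `p` halts after exactly `t` steps with
tapes `s'`. -/
inductive Runs : Machine → Tapes → ℕ → Tapes → Prop
  | skip (s : Tapes) : Runs Machine.skip s 1 s
  | push (i : ℕ) (b : Bool) (s : Tapes) :
      Runs (Machine.push i b) s 1 (Function.update s i (b :: s i))
  | pop (i : ℕ) (s : Tapes) :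
      Runs (Machine.pop i) s 1 (Function.update s i (s i).tail)
  | seq {p q : Machine} {s s' s'' : Tapes} {t t' : ℕ} :
      Runs p s t s' → Runs q s' t' s'' → Runs (Machine.seq p q) s (t + t') s''
  | branch_nil {i : ℕ} {p q r : Machine} {s s' : Tapes} {t : ℕ} :
      s i = [] → Runs p s t s' → Runs (Machine.branch i p q r) s (t + 1) s'
  | branch_zero {i : ℕ} {p q r : Machine} {s s' : Tapes} {t : ℕ} :
      (s i).head? = some false → Runs q s t s' → Runs (Machine.branch i p q r) s (t + 1) s'
  | branch_one {i : ℕ} {p q r : Machine} {s s' : Tapes} {t : ℕ} :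
      (s i).head? = some true → Runs r s t s' → Runs (Machine.branch i p q r) s (t + 1) s'
  | loop_done {i : ℕ} {p : Machine} {s : Tapes} :
      s i = [] → Runs (Machine.loop i p) s 1 s
  | loop_step {i : ℕ} {p : Machine} {s s' s'' : Tapes} {t t' : ℕ} :
      s i ≠ [] → Runs p s t s' → Runs (Machine.loop i p) s' t' s'' →
        Runs (Machine.loop i p) s (t + t' + 1) s''

/-- The inputs stand on the first tapes, one on each; the other tapes are empty. -/
def initTapes (xs : List (List Bool)) : Tapes := fun i => xs.getD i []

/-- `f` is computable in polynomial time when its argument `a` is presented as the list of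
bitstrings `inp a`: one machine computes `f a` (on tape `0`) for all `a`, in a number of steps
that is at most a fixed polynomial in the total length of the input. -/
def PolyTime {α : Type} (inp : α → List (List Bool)) (f : α → List Bool) : Prop :=
  ∃ (p : Machine) (B : Polynomial ℕ), ∀ a : α, ∃ (t : ℕ) (s : Tapes),
    Runs p (initTapes (inp a)) t s ∧ s 0 = f a ∧ t ≤ B.eval ((inp a).map List.length).sum

/-- An integer as a bitstring: sign and absolute value. -/
def intCode (z : ℤ) : List Bool := decide (z < 0) :: Nat.bits z.natAbs

/-- A polynomial-time computable real number: dyadic approximations with error at most `2^{-m}`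
are computed in time polynomial in `m`. -/
def PolyTimeReal (x : ℝ) : Prop :=
  ∃ z : ℕ → ℤ, PolyTime (fun m : ℕ => [ones m]) (fun m => intCode (z m)) ∧
    ∀ m : ℕ, |x - (z m : ℝ) / 2 ^ m| ≤ 1 / 2 ^ m

/-! ## Probability, negligible functions and computational indistinguishability -/

open Classical in
/-- Probability of an event under the uniform distribution on a finite type. -/
def prob {Ω : Type} [Fintype Ω] (E : Ω → Prop) : ℝ :=
  ((Finset.univ.filter E).card : ℝ) / (Fintype.card Ω : ℝ)

open Classical in
/-- Expectation of `g` given `E`, for the distribution on `Ω` proportional to the weights `w`. -/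
def condExpect {Ω : Type} [Fintype Ω] (w : Ω → ℝ) (E : Ω → Prop) (g : Ω → ℝ) : ℝ :=
  (∑ ω, if E ω then w ω * g ω else 0) / (∑ ω, if E ω then w ω else 0)

/-- Negligible functions of the security parameter. -/
def Negligible (ε : ℕ → ℝ) : Prop :=
  (∀ n, 0 ≤ ε n) ∧ ∀ c : ℕ, ∀ᶠ n : ℕ in atTop, ε n < 1 / (n : ℝ) ^ c

/-- A probabilistic polynomial-time distinguisher: on input `1^n` and `x` it tosses polynomially
many fair coins `r` and accepts or rejects. -/
structure Distinguisher where
  coins : Polynomial ℕ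
  run : ℕ → List Bool → List Bool → Bool
  polyTime : PolyTime (fun a : ℕ × List Bool × List Bool => [ones a.1, a.2.1, a.2.2])
    (fun a => [run a.1 a.2.1 a.2.2])

/-- The probability that `D` accepts on input `(1^n, x)`. -/
def Distinguisher.accept (D : Distinguisher) (n : ℕ) (x : List Bool) : ℝ :=
  prob (fun r : Fin (D.coins.eval n) → Bool => D.run n x (List.ofFn r) = true)

/-- Computational indistinguishability of two ensembles, given by their probability mass
functions (which have finite support wherever this is used).  Security parameters start at `1`. -/
def CompIndist {α : Type} [BitCode α] (X Y : ℕ → α → ℝ) : Prop :=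
  ∀ D : Distinguisher, ∃ ε : ℕ → ℝ, Negligible ε ∧ ∀ n, 1 ≤ n →
    |(∑ᶠ a, X n a * D.accept n (BitCode.code a)) -
      (∑ᶠ a, Y n a * D.accept n (BitCode.code a))| ≤ ε n

/-! ## Commitment schemes -/

/-- A secure commitment scheme with perfect binding.  `C₁ k b r` is the commitment string and
`C₂ k b r` the commitment key, for security parameter `k`, bit `b` and random string `r` of length
`coins k`; the receiver's output `none` stands for failure. -/
structure CommitmentScheme where
  coins : Polynomial ℕ
  C₁ : ℕ → Bool → List Bool → List Bool
  C₂ : ℕ → Bool → List Bool → List Bool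
  R : List Bool → List Bool → Option Bool
  polyTime₁ : PolyTime (fun a : ℕ × Bool × List Bool => [ones a.1, [a.2.1], a.2.2])
    (fun a => C₁ a.1 a.2.1 a.2.2)
  polyTime₂ : PolyTime (fun a : ℕ × Bool × List Bool => [ones a.1, [a.2.1], a.2.2])
    (fun a => C₂ a.1 a.2.1 a.2.2)
  polyTimeR : PolyTime (fun a : List Bool × List Bool => [a.1, a.2]) (fun a => (R a.1 a.2).toList)
  length₁ : ∀ k, 1 ≤ k → ∀ b r, r.length = coins.eval k → (C₁ k b r).length = k
  length₂ : ∀ k, 1 ≤ k → ∀ b r, r.length = coins.eval k → (C₂ k b r).length = k - 1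
  hides : CompIndist
    (fun k c => prob (fun r : Fin (coins.eval k) → Bool => C₁ k false (List.ofFn r) = c))
    (fun k c => prob (fun r : Fin (coins.eval k) → Bool => C₁ k true (List.ofFn r) = c))
  opens : ∀ k, 1 ≤ k → ∀ b r, r.length = coins.eval k → R (C₁ k b r) (C₂ k b r) = some b
  binding : ∀ k, 1 ≤ k → ∀ b r, r.length = coins.eval k →
    ∀ s, s ≠ C₂ k b r → R (C₁ k b r) s = none

/-- The commitment strings for security parameter `n`. -/
def CommitmentScheme.commitments (S : CommitmentScheme) (n : ℕ) : Set (List Bool) :=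
  {c | ∃ b r, r.length = S.coins.eval n ∧ S.C₁ n b r = c}

/-- Commitment strings can be recognized in polynomial time. -/
def CommitmentScheme.Recognizable (S : CommitmentScheme) : Prop :=
  ∃ g : ℕ → List Bool → Bool,
    PolyTime (fun a : ℕ × List Bool => [ones a.1, a.2]) (fun a => [g a.1 a.2]) ∧
    ∀ n, 1 ≤ n → ∀ c, g n c = true ↔ c ∈ S.commitments n

open Classical in
/-- The bit to which a commitment string commits. -/
def CommitmentScheme.committedBit (S : CommitmentScheme) (n : ℕ) (c : List Bool) : Bool :=
  decide (∃ r, r.length = S.coins.eval n ∧ S.C₁ n true r = c)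

/-! ## Finite extensive-form games -/

/-- A finite extensive-form game with players `0, …, c - 1`.  Histories list the actions in
chronological order.  The information partition is given by labels: two nonterminal histories lie
in the same information set iff they have the same label. -/
structure ExtGame (c : ℕ) (Act Info : Type) where
  H : Set (List Act)
  finite : H.Finite
  nil_mem : [] ∈ H
  prefix_mem : ∀ h a, h ++ [a] ∈ H → h ∈ H
  mover : List Act → Fin c
  util : List Act → Fin c → ℝ
  info : List Act → Info
  info_mover : ∀ h h' a a', h ++ [a] ∈ H → h' ++ [a'] ∈ H → info h = info h' → mover h = mover h'
  info_avail : ∀ h h' a a', h ++ [a] ∈ H → h' ++ [a'] ∈ H → info h = info h' → h' ++ [a] ∈ H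

namespace ExtGame

section

variable {c : ℕ} {Act Info : Type} (G : ExtGame c Act Info)

/-- Nonterminal histories. -/
def NT (h : List Act) : Prop := ∃ a, h ++ [a] ∈ G.H

/-- Terminal histories. -/
def Terminal (h : List Act) : Prop := h ∈ G.H ∧ ¬ G.NT h

/-- The finite set of terminal histories. -/
def terminals : Finset (List Act) :=
  (G.finite.subset (fun _ hh => hh.1 : {h | G.Terminal h} ⊆ G.H)).toFinset

/-- The histories after which player `i` moves. -/
def turns (i : Fin c) : Set (List Act) := {h | G.NT h ∧ G.mover h = i}

/-- The (labels of the) information sets of player `i`. -/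
def InfoSet (i : Fin c) : Type := {I : Info // ∃ h ∈ G.turns i, G.info h = I}

/-- The set of histories in an information set. -/
def cell {i : Fin c} (I : G.InfoSet i) : Set (List Act) := {h | h ∈ G.turns i ∧ G.info h = I.1}

/-- Deterministic strategies of player `i`. -/
def Det (i : Fin c) : Type :=
  (I : G.InfoSet i) → {a : Act // ∀ h ∈ G.cell I, h ++ [a] ∈ G.H}

instance finite_infoSet (i : Fin c) : Finite (G.InfoSet i) := by
  have hs : {I : Info | ∃ h ∈ G.turns i, G.info h = I}.Finite := by
    refine (G.finite.image G.info).subset ?_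
    rintro I ⟨h, ⟨⟨a, ha⟩, -⟩, rfl⟩
    exact ⟨h, G.prefix_mem _ _ ha, rfl⟩
  exact hs.to_subtype

instance finite_det (i : Fin c) : Finite (G.Det i) := by
  have : ∀ I : G.InfoSet i, Finite {a : Act // ∀ h ∈ G.cell I, h ++ [a] ∈ G.H} := by
    intro I
    obtain ⟨I, h, hh, hI⟩ := I
    have := G.finite.to_subtype
    refine Finite.of_injective
      (fun a : {a : Act // ∀ h' ∈ G.cell (⟨I, h, hh, hI⟩ : G.InfoSet i), h' ++ [a] ∈ G.H} =>
        (⟨h ++ [a.1], a.2 h ⟨hh, hI⟩⟩ : G.H)) ?_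
    intro a b hab
    simpa [Subtype.ext_iff] using hab
  exact Pi.finite

instance fintype_det (i : Fin c) : Fintype (G.Det i) := Fintype.ofFinite _

open Classical in
/-- One move, chosen by `pol`; terminal histories stay as they are. -/
def step (pol : ∀ h, G.NT h → Act) (h : List Act) : List Act :=
  if hh : G.NT h then h ++ [pol h hh] else h

/-- The history reached when play starts at the empty history and `pol` chooses every action. -/
def outcome (pol : ∀ h, G.NT h → Act) : List Act :=
  (G.step pol)^[G.finite.toFinset.sup List.length] []

/-- The action that a profile of deterministic strategies takes at a history. -/
def follow (s : ∀ i, G.Det i) (h : List Act) (hh : G.NT h) : Act :=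
  (s (G.mover h) ⟨G.info h, h, ⟨hh, rfl⟩, rfl⟩).1

open Classical in
/-- As `follow`, but player `i` switches to the strategy `t` once the set `I` is reached. -/
def followSwitch (s : ∀ i, G.Det i) (i : Fin c) (I : Set (List Act)) (t : G.Det i)
    (h : List Act) (hh : G.NT h) : Act :=
  G.follow (if ∃ h' ∈ I, h' <+: h then Function.update s i t else s) h hh

/-- Mixed strategies of player `i`: probability distributions over deterministic strategies. -/
abbrev Mixed (i : Fin c) : Type := ↥(stdSimplex ℝ (G.Det i))

/-- Mixed strategies whose probabilities are polynomial-time computable real numbers. -/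
abbrev EffMixed (i : Fin c) : Type := {σ : G.Mixed i // ∀ s, PolyTimeReal (σ.1 s)}

/-- Probability of a profile of deterministic strategies under a mixed strategy profile. -/
def weight (σ : ∀ i, G.Mixed i) (s : ∀ i, G.Det i) : ℝ := ∏ i, (σ i).1 (s i)

open Classical in
/-- The distribution on terminal histories induced by a mixed strategy profile. -/
def rho (σ : ∀ i, G.Mixed i) (h : List Act) : ℝ :=
  ∑ s : ∀ i, G.Det i, if G.outcome (G.follow s) = h then G.weight σ s else 0

/-- The set `I` of histories is reached on the way to `h`. -/
def Visits {Act : Type} (I : Set (List Act)) (h : List Act) : Prop := ∃ h' ∈ I, h' <+: h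

/-- Sequential equilibrium of a finite game with perfect recall, in the form that does not mention
beliefs: `σ` is a limit of completely mixed profiles `σ^k` such that, conditional on having
reached any information set of a player, no change of that player's strategy from there on
raises his utility by more than `δ_k → 0`. -/
def SeqEquilibrium (σ : ∀ i, G.Mixed i) : Prop :=
  ∃ (σs : ℕ → ∀ i, G.Mixed i) (δ : ℕ → ℝ),
    (∀ k, 0 ≤ δ k) ∧ Tendsto δ atTop (𝓝 0) ∧
    (∀ k h, G.Terminal h → 0 < G.rho (σs k) h) ∧
    (∀ i s, Tendsto (fun k => (σs k i).1 s) atTop (𝓝 ((σ i).1 s))) ∧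
    ∀ k i (I : G.InfoSet i) (τ : G.Mixed i),
      condExpect (fun x : (∀ j, G.Det j) × G.Det i => G.weight (σs k) x.1 * τ.1 x.2)
          (fun x => Visits (G.cell I) (G.outcome (G.followSwitch x.1 i (G.cell I) x.2)))
          (fun x => G.util (G.outcome (G.followSwitch x.1 i (G.cell I) x.2)) i) ≤
        condExpect (G.weight (σs k))
          (fun s => Visits (G.cell I) (G.outcome (G.follow s)))
          (fun s => G.util (G.outcome (G.follow s)) i) + δ k

end

end ExtGame

/-! ## Computational games -/

/-- Games in which actions are bitstrings and every information set is represented by a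
bitstring. -/
abbrev BitGame (c : ℕ) : Type := ExtGame c (List Bool) (List Bool)

/-- Computable uniform sequences of games `𝒢 1, 𝒢 2, …` with players `0, …, c - 1`.  (A machine
that decides membership without error may as well fix its coins, so it is taken deterministic.) -/
structure ComputableUniform {c : ℕ} (𝒢 : ℕ → BitGame c) : Prop where
  actions : ∃ p : Polynomial ℕ, ∀ n, 1 ≤ n → ∀ h a, h ++ [a] ∈ (𝒢 n).H → a.length ≤ p.eval n
  decidable : ∃ g : ℕ → List (List Bool) → Bool,
    PolyTime (fun a : ℕ × List (List Bool) => [ones a.1, packBits a.2])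
      (fun a => [g a.1 a.2]) ∧
    ∀ n, 1 ≤ n → ∀ h, g n h = true ↔ h ∈ (𝒢 n).H
  movers : ∃ P : List (List Bool) → Fin c,
    PolyTime (fun h : List (List Bool) => [packBits h]) (fun h => ones (P h : ℕ)) ∧
    ∀ n, 1 ≤ n → ∀ h, (𝒢 n).NT h → (𝒢 n).mover h = P h
  utilities : ∀ i : Fin c, ∃ z : List (List Bool) → ℕ → ℤ,
    PolyTime (fun a : List (List Bool) × ℕ => [packBits a.1, ones a.2])
      (fun a => intCode (z a.1 a.2)) ∧
    ∀ n, 1 ≤ n → ∀ h, (𝒢 n).Terminal h → ∀ m : ℕ,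
      |(𝒢 n).util h i - (z h m : ℝ) / 2 ^ m| ≤ 1 / 2 ^ m

/-- Polynomial-time strategies of player `i` in `𝒢`.  On input `1^n` and a view `(v, r)` – the
representation `v` of the current information set and the random bits `r` – the strategy returns
a legal action.  All `coins n` random bits are tossed at the player's first move in `𝒢 n` and
kept from then on. -/
structure Strat {c : ℕ} (𝒢 : ℕ → BitGame c) (i : Fin c) where
  coins : Polynomial ℕ
  act : ℕ → List Bool → List Bool → List Bool
  polyTime : PolyTime (fun a : ℕ × List Bool × List Bool => [ones a.1, a.2.1, a.2.2])
    (fun a => act a.1 a.2.1 a.2.2)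
  legal : ∀ n, 1 ≤ n → ∀ h ∈ (𝒢 n).turns i, ∀ r : List Bool, r.length = coins.eval n →
    h ++ [act n ((𝒢 n).info h) r] ∈ (𝒢 n).H

section

variable {c : ℕ} {𝒢 : ℕ → BitGame c}

/-- The random tapes of all players, where player `j` gets `N j` bits. -/
abbrev Coins {c : ℕ} (N : Fin c → ℕ) : Type := ∀ j, Fin (N j) → Bool

/-- The number of random bits each player of the profile `M` uses in `𝒢 n`. -/
def coinsOf (M : ∀ i, Strat 𝒢 i) (n : ℕ) (j : Fin c) : ℕ := (M j).coins.eval n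

/-- The action that strategy `M` of player `i` takes in `𝒢 n` at history `h` when the random tape
starts with the bits `x`; only as many bits are read as `M` uses. -/
def Strat.move {i : Fin c} (M : Strat 𝒢 i) (n : ℕ) (h : List (List Bool)) (x : List Bool) :
    List Bool :=
  M.act n ((𝒢 n).info h) (x.take (M.coins.eval n))

/-- The terminal history of `𝒢 n` reached by the profile `M` with random tapes `ω`. -/
def play (M : ∀ i, Strat 𝒢 i) (n : ℕ) {N : Fin c → ℕ} (ω : Coins N) : List (List Bool) :=
  (𝒢 n).outcome (fun h _ => (M ((𝒢 n).mover h)).move n h (List.ofFn (ω ((𝒢 n).mover h))))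

open Classical in
/-- As `play`, but player `i` follows `M i` up to the set `I` and `M'` from there on.  Both
strategies use the same random tape: `M'` remembers the bits that `M i` has used. -/
def playSwitch (M : ∀ i, Strat 𝒢 i) (i : Fin c) (I : Set (List (List Bool))) (M' : Strat 𝒢 i)
    (n : ℕ) {N : Fin c → ℕ} (ω : Coins N) : List (List Bool) :=
  (𝒢 n).outcome (fun h _ =>
    (if ∃ h' ∈ I, h' <+: h then Function.update M i M' ((𝒢 n).mover h)
      else M ((𝒢 n).mover h)).move n h (List.ofFn (ω ((𝒢 n).mover h))))

/-- The distribution on terminal histories of `𝒢 n` induced by the profile `M`. -/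
def psi (M : ∀ i, Strat 𝒢 i) (n : ℕ) (h : List (List Bool)) : ℝ :=
  prob (fun ω : Coins (coinsOf M n) => play M n ω = h)

/-- The distribution on deterministic strategies of `𝒢 n` induced by the strategy `M`. -/
def Strat.law {i : Fin c} (M : Strat 𝒢 i) (n : ℕ) (s : (𝒢 n).Det i) : ℝ :=
  prob (fun r : Fin (M.coins.eval n) → Bool => ∀ I, M.act n I.1 (List.ofFn r) = (s I).1)

variable {Act Info : Type}

/-- The push-forward `phi` of `psi` along the map `f n` to histories of the underlying game. -/
def phi (f : ℕ → List (List Bool) → List Act) (M : ∀ i, Strat 𝒢 i) (n : ℕ) (h : List Act) : ℝ :=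
  prob (fun ω : Coins (coinsOf M n) => f n (play M n ω) = h)

/-- History `h` of `𝒢 n` is reachable when player `i` plays `M` with random bits `r`: all actions of
player `i` in `h` are those that `M` takes. -/
def ReachableBy {i : Fin c} (M : Strat 𝒢 i) (n : ℕ) (r : List Bool) (h : List (List Bool)) : Prop :=
  ∀ h' a, h' ++ [a] <+: h → h' ∈ (𝒢 n).turns i → a = M.act n ((𝒢 n).info h') r

/-- `𝒢` represents the game `G` via the maps `f` of histories and `F` of strategies.
The strategies of `G` on which `F` acts are the mixed strategies with polynomial-time computable
probabilities.  Actions at different information sets count as different actions, so in `knows`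
an action of `G` is reported together with the information set at which it is taken. -/
structure Represents [BitCode Act] [BitCode Info] (𝒢 : ℕ → BitGame c) (G : ExtGame c Act Info)
    (f : ℕ → List (List Bool) → List Act) (F : ∀ i, G.EffMixed i → Strat 𝒢 i) : Prop where
  uniform : ComputableUniform 𝒢
  mapsTo : ∀ n, 1 ≤ n → Set.MapsTo (f n) (𝒢 n).H G.H
  surjective : ∀ n, 1 ≤ n → Set.SurjOn (f n) (𝒢 n).H G.H
  length_eq : ∀ n, 1 ≤ n → ∀ h ∈ (𝒢 n).H, (f n h).length = h.length
  same_mover : ∀ n, 1 ≤ n → ∀ h, (𝒢 n).NT h → G.NT (f n h) ∧ G.mover (f n h) = (𝒢 n).mover h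
  subhistory : ∀ n, 1 ≤ n → ∀ h ∈ (𝒢 n).H, ∀ h', h' <+: h → f n h' <+: f n h
  same_info : ∀ n, 1 ≤ n → ∀ h h', (𝒢 n).NT h → (𝒢 n).NT h' → (𝒢 n).info h = (𝒢 n).info h' →
    G.info (f n h) = G.info (f n h')
  last_action : ∀ n, 1 ≤ n → ∀ h h', (𝒢 n).NT h → (𝒢 n).NT h' → (𝒢 n).info h = (𝒢 n).info h' →
    ∀ a, h ++ [a] ∈ (𝒢 n).H → (f n (h ++ [a])).getLast? = (f n (h' ++ [a])).getLast?
  utility : ∀ n, 1 ≤ n → ∀ h, (𝒢 n).Terminal h →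
    G.Terminal (f n h) ∧ ∀ i, (𝒢 n).util h i = G.util (f n h) i
  corresponds : ∀ σ : ∀ i, G.EffMixed i, ∃ ε, Negligible ε ∧ ∀ n, 1 ≤ n →
    ∑ h ∈ G.terminals, |phi f (fun i => F i (σ i)) n h - G.rho (fun i => (σ i).1) h| ≤ ε n
  knows : ∀ (i : Fin c) (σ : G.EffMixed i), ∃ A : ℕ → List Bool → List Bool → List Bool,
    PolyTime (fun a : ℕ × List Bool × List Bool => [ones a.1, a.2.1, a.2.2])
      (fun a => A a.1 a.2.1 a.2.2) ∧
    ∀ n, 1 ≤ n → ∀ h ∈ (𝒢 n).turns i, ∀ r : List Bool, r.length = (F i σ).coins.eval n →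
      ReachableBy (F i σ) n r h →
      ∃ a, (f n (h ++ [(F i σ).act n ((𝒢 n).info h) r])).getLast? = some a ∧
        A n ((𝒢 n).info h) r = BitCode.code (G.info (f n h), a)
  deviations : ∀ (σ : ∀ i, G.EffMixed i) (i : Fin c) (M' : Strat 𝒢 i),
    ∃ σ' : ℕ → G.Mixed i,
      CompIndist (fun n => phi f (Function.update (fun j => F j (σ j)) i M') n)
        (fun n => G.rho (Function.update (fun j => (σ j).1) i (σ' n)))

/-! ## Computational sequential equilibrium -/

/-- The histories of `𝒢 n` that represent a history in `I`. -/
def liftSet (𝒢 : ℕ → BitGame c) (f : ℕ → List (List Bool) → List Act) (n : ℕ)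
    (I : Set (List Act)) : Set (List (List Bool)) :=
  {h | h ∈ (𝒢 n).H ∧ f n h ∈ I}

/-- Views: representation of an information set and random bits. -/
abbrev View : Type := List Bool × List Bool

/-- The views that player `i`, using the strategy `M i`, can have at histories in `S`. -/
def views (M : ∀ i, Strat 𝒢 i) (i : Fin c) (n : ℕ) (S : Set (List (List Bool))) : Set View :=
  {v | ∃ h ∈ S, h ∈ (𝒢 n).turns i ∧ v.1 = (𝒢 n).info h ∧ v.2.length = (M i).coins.eval n}

/-- The probability that player `i` reaches the view `v` when `M` is played in `𝒢 n`. -/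
def xi (M : ∀ i, Strat 𝒢 i) (i : Fin c) (n : ℕ) (v : View) : ℝ :=
  prob (fun ω : Coins (coinsOf M n) => List.ofFn (ω i) = v.2 ∧
    ∃ h ∈ (𝒢 n).turns i, h <+: play M n ω ∧ (𝒢 n).info h = v.1)

/-- The total probability of a set of views. -/
def xiSet (M : ∀ i, Strat 𝒢 i) (i : Fin c) (n : ℕ) (V : Set View) : ℝ :=
  ∑ᶠ v ∈ V, xi M i n v

open Classical in
/-- The distribution on the set `V` of views when `M` is played; uniform if `V` has
probability `0`. -/
def viewDist (M : ∀ i, Strat 𝒢 i) (i : Fin c) (n : ℕ) (V : Set View) (v : View) : ℝ :=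
  if v ∈ V then
    if 0 < xiSet M i n V then xi M i n v / xiSet M i n V else 1 / (V.ncard : ℝ)
  else 0

/-- A partition `P` of the histories of `G` at which player `i` moves is `M`-consistent. -/
def Consistent (f : ℕ → List (List Bool) → List Act) (M : ∀ i, Strat 𝒢 i) (i : Fin c)
    (P : Set (Set (List Act))) : Prop :=
  ∀ I ∈ P, I.Nontrivial → ∀ h ∈ I,
    ¬ Negligible (fun n => xiSet M i n (views M i n (liftSet 𝒢 f n {h}))) →
    ¬ Negligible (fun n => xiSet M i n (views M i n (liftSet 𝒢 f n (I \ {h})))) →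
    CompIndist (fun n => viewDist M i n (views M i n (liftSet 𝒢 f n {h})))
      (fun n => viewDist M i n (views M i n (liftSet 𝒢 f n (I \ {h}))))

/-- `P` is a partition of the set `T`. -/
def IsPartitionOf {α : Type} (P : Set (Set α)) (T : Set α) : Prop :=
  ∅ ∉ P ∧ P.PairwiseDisjoint id ∧ ⋃₀ P = T

/-- Computational sequential equilibrium of `𝒢`, which represents `G` via `f`.  The convergence of
the completely mixed profiles `M^k` to `M` is convergence in total variation of the induced
distributions over deterministic strategies, uniformly in the games `𝒢 n`.  Expected utilities
are computed in `G`, along `f`, conditional on reaching the cell `I`. -/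
def CompSeqEquilibrium (G : ExtGame c Act Info) (f : ℕ → List (List Bool) → List Act)
    (M : ∀ i, Strat 𝒢 i) : Prop :=
  ∃ (Ms : ℕ → ∀ i, Strat 𝒢 i) (δ : ℕ → ℝ),
    (∀ k, 0 ≤ δ k) ∧ Tendsto δ atTop (𝓝 0) ∧
    (∀ k n, 1 ≤ n → ∀ h, (𝒢 n).Terminal h → 0 < psi (Ms k) n h) ∧
    (∀ η : ℝ, 0 < η → ∀ᶠ k in atTop, ∀ n, 1 ≤ n → ∀ i,
      ∑ s : (𝒢 n).Det i, |(Ms k i).law n s - (M i).law n s| ≤ η) ∧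
    ∀ k i, ∃ P : Set (Set (List Act)), IsPartitionOf P (G.turns i) ∧ Consistent f M i P ∧
      ∀ I ∈ P, ∀ M' : Strat 𝒢 i, ∃ ε, Negligible ε ∧ ∀ n, 1 ≤ n →
        condExpect
            (fun _ : Coins (fun j => max (coinsOf (Ms k) n j) (M'.coins.eval n)) => 1)
            (fun ω => ExtGame.Visits (liftSet 𝒢 f n I)
              (playSwitch (Ms k) i (liftSet 𝒢 f n I) M' n ω))
            (fun ω => G.util (f n (playSwitch (Ms k) i (liftSet 𝒢 f n I) M' n ω)) i) ≤
          condExpect (fun _ : Coins (coinsOf (Ms k) n) => 1)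
            (fun ω => ExtGame.Visits (liftSet 𝒢 f n I) (play (Ms k) n ω))
            (fun ω => G.util (f n (play (Ms k) n ω)) i) + ε n + δ k

end

/-! ## Normal-form games and convex combinations of Nash equilibria -/

/-- A finite normal-form game with `m + 2` players; player `i` has the actions
`0, …, size i - 1`. -/
structure NormalForm (m : ℕ) where
  size : Fin (m + 2) → ℕ
  payoff : (∀ i, Fin (size i)) → Fin (m + 2) → ℝ

namespace NormalForm

section

variable {m : ℕ} (Γ : NormalForm m)

/-- Mixed strategy profiles. -/
abbrev Profile : Type := ∀ i, ↥(stdSimplex ℝ (Fin (Γ.size i)))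

/-- Probability of an action profile. -/
def profileProb (x : Γ.Profile) (a : ∀ i, Fin (Γ.size i)) : ℝ := ∏ i, (x i).1 (a i)

/-- Expected payoff of player `i`. -/
def expPayoff (x : Γ.Profile) (i : Fin (m + 2)) : ℝ := ∑ a, Γ.profileProb x a * Γ.payoff a i

/-- Nash equilibria. -/
def IsNash (x : Γ.Profile) : Prop :=
  ∀ i (y : ↥(stdSimplex ℝ (Fin (Γ.size i)))),
    Γ.expPayoff (Function.update x i y) i ≤ Γ.expPayoff x i

/-- A list `x` of numbers as an action profile: the payoff if all entries are legal. -/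
def payoffNat (x : Fin (m + 2) → ℕ) (i : Fin (m + 2)) : ℝ :=
  if hx : ∀ j, x j < Γ.size j then Γ.payoff (fun j => ⟨x j, hx j⟩) i else 0

/-- A nice convex combination of Nash equilibria: finitely many equilibria with rational
probabilities, with positive rational coefficients. -/
structure NiceCCNE where
  count : ℕ
  coeff : Fin count → ℚ
  coeff_pos : ∀ j, 0 < coeff j
  coeff_sum : ∑ j, coeff j = 1
  eqm : Fin count → Γ.Profile
  isNash : ∀ j, Γ.IsNash (eqm j)
  rational : ∀ j i a, ∃ q : ℚ, (eqm j i).1 a = (q : ℝ)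

/-- The distribution on action profiles given by the convex combination. -/
def NiceCCNE.dist {Γ : NormalForm m} (π : Γ.NiceCCNE) (a : ∀ i, Fin (Γ.size i)) : ℝ :=
  ∑ j, (π.coeff j : ℝ) * Γ.profileProb (π.eqm j) a

/-- The least common denominator of the coefficients. -/
def NiceCCNE.lcd {Γ : NormalForm m} (π : Γ.NiceCCNE) : ℕ :=
  Finset.univ.lcm (fun j => (π.coeff j).den)

end

end NormalForm

/-! ## The envelope game and the cryptographic sequence -/

section

variable {c : ℕ} {Act Info : Type}

/-- A game of `T` stages in which the set of actions and the player to move depend only on the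
stage. -/
def stageGame (T : ℕ) (L : ℕ → Set Act) (hL : ∀ t, (L t).Finite) (mover : ℕ → Fin c)
    (obs : List Act → Info) (hobs : ∀ h h', obs h = obs h' → h.length = h'.length)
    (u : List Act → Fin c → ℝ) : ExtGame c Act Info where
  H := {h | h.length ≤ T ∧ ∀ t a, h[t]? = some a → a ∈ L t}
  finite := by
    have hs : (⋃ t ∈ Finset.range T, L t).Finite :=
      Set.Finite.biUnion (Finset.range T).finite_toSet (fun t _ => hL t)
    have := hs.to_subtype
    refine ((List.finite_length_lt (↥(⋃ t ∈ Finset.range T, L t)) (T + 1)).image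
      (List.map Subtype.val)).subset ?_
    rintro h ⟨hT, hh⟩
    have hmem : ∀ a ∈ h, a ∈ ⋃ t ∈ Finset.range T, L t := by
      intro a ha
      obtain ⟨t, ht, rfl⟩ := List.getElem_of_mem ha
      refine Set.mem_biUnion (x := t) ?_ (hh t _ (List.getElem?_eq_getElem ht))
      exact Finset.mem_coe.2 (Finset.mem_range.2 (by omega))
    refine ⟨h.attach.map (fun a => ⟨a.1, hmem a.1 a.2⟩), ?_, ?_⟩
    · simpa using Nat.lt_succ_of_le hT
    · simp [Function.comp_def]
  nil_mem := by simp
  prefix_mem := by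
    rintro h a ⟨hT, hh⟩
    refine ⟨by simp at hT; omega, fun t b hb => hh t b ?_⟩
    obtain ⟨ht, -⟩ := List.getElem?_eq_some_iff.1 hb
    rw [List.getElem?_append_left ht, hb]
  mover h := mover h.length
  util := u
  info := obs
  info_mover := fun h h' _ _ _ _ e => by rw [hobs h h' e]
  info_avail := by
    rintro h h' a a' ⟨hT, hh⟩ ⟨hT', hh'⟩ e
    have hl := hobs h h' e
    refine ⟨by simpa using hT', fun t b hb => ?_⟩
    rcases lt_or_ge t h'.length with ht | ht
    · rw [List.getElem?_append_left ht] at hb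
      exact hh' t b (by rw [List.getElem?_append_left ht, hb])
    · apply hh t b
      rw [List.getElem?_append_right ht, ← hl] at hb
      rwa [List.getElem?_append_right (by omega)]

end

/-- The order in which the players move in the normal-form part: player `1` (the second player),
player `0` (the first player), then players `2, 3, …`. -/
def gOrder (m : ℕ) (t : ℕ) : Fin (m + 2) := Equiv.swap 0 1 (Fin.ofNat (m + 2) t)

/-- The player who moves at each stage: first player, second player, first player, and then the
normal-form part. -/
def corrMover (m : ℕ) : ℕ → Fin (m + 2)
  | 0 => 0
  | 1 => 1
  | 2 => 0
  | t + 3 => gOrder m t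

/-- The stage at which player `i` moves in the normal-form part. -/
def gStage {m : ℕ} (i : Fin (m + 2)) : ℕ := 3 + (Equiv.swap 0 1 i : Fin (m + 2)).val

/-- Actions of the envelope game. -/
inductive CorrAct : Type
  /-- put a number into the envelope -/
  | enclose (a : ℕ) : CorrAct
  /-- pick a number -/
  | pick (b : ℕ) : CorrAct
  /-- open the envelope -/
  | reveal : CorrAct
  /-- destroy the envelope -/
  | destroy : CorrAct
  /-- take an action in the normal-form game -/
  | move (x : ℕ) : CorrAct

/-- The action taken in the normal-form game. -/
def CorrAct.moveVal : CorrAct → ℕ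
  | CorrAct.move x => x
  | _ => 0

instance : BitCode CorrAct where
  code
    | CorrAct.enclose a => false :: false :: Nat.bits a
    | CorrAct.pick b => false :: true :: Nat.bits b
    | CorrAct.reveal => [true]
    | CorrAct.destroy => [true, false]
    | CorrAct.move x => true :: true :: Nat.bits x
  code_injective := by
    have hb : ∀ a b : ℕ, Nat.bits a = Nat.bits b → a = b := by
      intro a b h
      rw [← bitsVal_bits a, ← bitsVal_bits b, h]
    intro x y h
    cases x <;> cases y <;> simp at h <;> first | rfl | rw [hb _ _ h]

open Classical in
/-- What player `i` sees of an action in the history `h`: the number in the envelope is seen by the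
first player, and by everybody once the envelope has been opened; actions in the normal-form game
are not seen. -/
def corrSee {m : ℕ} (i : Fin (m + 2)) (h : List CorrAct) : CorrAct → Option CorrAct
  | CorrAct.enclose a => if i = 0 ∨ CorrAct.reveal ∈ h then some (CorrAct.enclose a) else none
  | CorrAct.move _ => none
  | a => some a

/-- The information of the player who moves at `h`. -/
def corrObs (m : ℕ) (h : List CorrAct) : List (Option CorrAct) :=
  h.map (corrSee (corrMover m h.length) h)

/-- The actions of the envelope game at each stage. -/
def corrActions {m : ℕ} (Γ : NormalForm m) (l : ℕ) : ℕ → Set CorrAct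
  | 0 => {x | ∃ a < l, x = CorrAct.enclose a}
  | 1 => {x | ∃ b < l, x = CorrAct.pick b}
  | 2 => {CorrAct.reveal, CorrAct.destroy}
  | t + 3 => {x | ∃ a < Γ.size (gOrder m t), x = CorrAct.move a}

/-- The number chosen by player `i` in the normal-form part of a history of the envelope game. -/
def corrChoice {m : ℕ} (h : List CorrAct) (i : Fin (m + 2)) : ℕ :=
  (h[gStage i]?.map CorrAct.moveVal).getD 0

/-- The envelope game `G_corr` for the normal-form game `Γ` and numbers `0, …, l - 1`. -/
def corrGame {m : ℕ} (Γ : NormalForm m) (l : ℕ) :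
    ExtGame (m + 2) CorrAct (List (Option CorrAct)) :=
  stageGame (m + 5) (corrActions Γ l)
    (by
      rintro (_ | _ | _ | t)
      · refine ((Set.finite_lt_nat l).image CorrAct.enclose).subset ?_
        rintro x ⟨a, ha, rfl⟩
        exact ⟨a, ha, rfl⟩
      · refine ((Set.finite_lt_nat l).image CorrAct.pick).subset ?_
        rintro x ⟨a, ha, rfl⟩
        exact ⟨a, ha, rfl⟩
      · exact Set.toFinite {CorrAct.reveal, CorrAct.destroy}
      · refine ((Set.finite_lt_nat (Γ.size (gOrder m t))).image CorrAct.move).subset ?_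
        rintro x ⟨a, ha, rfl⟩
        exact ⟨a, ha, rfl⟩)
    (corrMover m) (corrObs m)
    (by
      intro h h' e
      simpa [corrObs] using congrArg List.length e)
    (fun h => Γ.payoffNat (corrChoice h))

/-- The actions at each stage of the `n`-th cryptographic game, where `d = Nat.size l`, so that
`2^(d-1) ≤ l < 2^d`: `d` commitment strings in parallel; a string of `d` bits; any bitstring of
length at most `d * n`, intended to be the `d` keys of `n - 1` bits; and the binary representation
of an action of `Γ`. -/
def cryptoActions (S : CommitmentScheme) {m : ℕ} (Γ : NormalForm m) (l n : ℕ) :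
    ℕ → Set (List Bool)
  | 0 => {x | x.length = Nat.size l * n ∧ ∃ cs : Fin (Nat.size l) → List Bool,
      (∀ j, cs j ∈ S.commitments n) ∧ x = (List.ofFn cs).flatten}
  | 1 => {x | x.length = Nat.size l}
  | 2 => {x | x.length ≤ Nat.size l * n}
  | t + 3 => {x | ∃ a < Γ.size (gOrder m t), x = Nat.bits a}

/-- Representation of the information set of the player who moves at `h`: all actions are public,
except those in the normal-form part. -/
def cryptoObs (h : List (List Bool)) : List Bool :=
  packBits (h.take 3 ++ List.replicate (h.length - 3) [])

/-- The number chosen by player `i` in the normal-form part of a history of the cryptographic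
game. -/
def cryptoChoice {m : ℕ} (h : List (List Bool)) (i : Fin (m + 2)) : ℕ :=
  bitsVal (h[gStage i]?.getD [])

/-- The sequence `𝒢_corr` of cryptographic games. -/
def cryptoGame (S : CommitmentScheme) {m : ℕ} (Γ : NormalForm m) (l n : ℕ) : BitGame (m + 2) :=
  stageGame (m + 5) (cryptoActions S Γ l n)
    (by
      rintro (_ | _ | _ | t)
      · refine (List.finite_length_lt Bool (Nat.size l * n + 1)).subset ?_
        rintro x ⟨hx, -⟩
        exact Nat.lt_succ_of_le hx.le
      · refine (List.finite_length_lt Bool (Nat.size l + 1)).subset ?_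
        intro x hx
        exact Nat.lt_succ_of_le (le_of_eq hx)
      · refine (List.finite_length_lt Bool (Nat.size l * n + 1)).subset ?_
        intro x hx
        exact Nat.lt_succ_of_le hx
      · refine ((Set.finite_lt_nat (Γ.size (gOrder m t))).image Nat.bits).subset ?_
        rintro x ⟨a, ha, rfl⟩
        exact ⟨a, ha, rfl⟩)
    (corrMover m) cryptoObs
    (by
      intro h h' e
      have := congrArg List.length (packBits_injective e)
      simp at this
      omega)
    (fun h => Γ.payoffNat (cryptoChoice h))

/-- The `j`-th block of `k` bits of a string. -/
def block (k j : ℕ) (x : List Bool) : List Bool := (x.drop (j * k)).take k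

/-- The number committed to by `d` commitment strings. -/
def committedVal (S : CommitmentScheme) (d n : ℕ) (x : List Bool) : ℕ :=
  bitsVal (List.ofFn (fun j : Fin d => S.committedBit n (block n j x)))

/-- The string `y` consists of valid keys for the `d` commitment strings in `x`. -/
def ValidKeys (S : CommitmentScheme) (d n : ℕ) (x y : List Bool) : Prop :=
  y.length = d * (n - 1) ∧ ∀ j < d, S.R (block n j x) (block (n - 1) j y) ≠ none

open Classical in
/-- The map from histories of the cryptographic games to histories of the envelope game:
commitments to `s` are mapped to `s mod l`, the second player's string to its value mod `l`, the
revealed string to opening the envelope if it consists of valid keys and to destroying it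
otherwise, and binary representations to the actions they represent. -/
def corrMap (S : CommitmentScheme) (l n : ℕ) (h : List (List Bool)) : List CorrAct :=
  h.mapIdx fun t x =>
    match t with
    | 0 => CorrAct.enclose (committedVal S (Nat.size l) n x % l)
    | 1 => CorrAct.pick (bitsVal x % l)
    | 2 => if ValidKeys S (Nat.size l) n (h[0]?.getD []) x then CorrAct.reveal
        else CorrAct.destroy
    | _ => CorrAct.move (bitsVal x)

open Classical in
/-- The mixed strategy profile `σ` of the envelope game implements `π`. -/
def Implements {m : ℕ} {Γ : NormalForm m} (π : Γ.NiceCCNE)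
    (σ : ∀ i, (corrGame Γ π.lcd).Mixed i) : Prop :=
  ∀ a : ∀ i, Fin (Γ.size i),
    (∑ h ∈ (corrGame Γ π.lcd).terminals with ∀ i, corrChoice h i = (a i : ℕ),
      (corrGame Γ π.lcd).rho σ h) = π.dist a

/-- The strategy profile `M` of the cryptographic sequence implements `π`: the distribution on
action profiles of `Γ` is statistically close to `π`. -/
def CompImplements (S : CommitmentScheme) {m : ℕ} {Γ : NormalForm m} (π : Γ.NiceCCNE)
    (M : ∀ i, Strat (cryptoGame S Γ π.lcd) i) : Prop :=
  ∃ ε, Negligible ε ∧ ∀ n, 1 ≤ n →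
    ∑ a : ∀ i, Fin (Γ.size i),
      |prob (fun ω : Coins (coinsOf M n) => ∀ i, cryptoChoice (play M n ω) i = (a i : ℕ)) -
        π.dist a| ≤ ε n

end

noncomputable section

set_option linter.unusedSectionVars false
set_option linter.unusedVariables false

open Finset (sum_congr mul_sum mem_univ sum_le_sum sum_sub_distrib sum_nonneg sum_mul
  single_le_sum sum_comm abs_sum_le_sum_abs prod_nonneg sum_eq_single sum_nonpos card_univ
  sum_add_distrib sum_const sum_div sum_ite_eq prod_mul_distrib sum_filter sum_eq_zero prod_congr
  prod_univ_sum sum_ite_eq')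
open Function (update update_of_ne update_self update_apply Injective update_eq_self)
open List (ofFn ext_getElem take_of_length_le length_take getD_eq_getElem take_take map_ofFn
  getElem_ofFn getElem_cons_zero getElem?_eq_getElem getElem?_append_left getD_eq_getElem?_getD
  length_append length_cons length_ofFn)
open Nat (size mod_eq_of_lt bits)
open Fin (ofNat)
open CorrAct (enclose pick reveal destroy move)
open ExtGame (Visits)
open Fintype (card sum_prod_type card_fin piFinset_univ prod_eq_mul_prod_compl equivFin)
open Polynomial (X C eval_add eval_X eval_C eval_mul)
open BitCode (code)

/-- Bitstrings. -/
notation "Bits" => List Bool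

/-! ## Running machines -/

/-- `p` halts after at most `T` steps. -/
def RunsIn (p : Machine) (s : Tapes) (T : ℕ) (s' : Tapes) : Prop := ∃ t ≤ T, Runs p s t s'

namespace RunsIn

lemma mono {p s T T' s'} (h : RunsIn p s T s') (hT : T ≤ T') : RunsIn p s T' s' := by
  obtain ⟨t, ht, hr⟩ := h
  exact ⟨t, ht.trans hT, hr⟩

lemma congr {p s T s' s''} (h : RunsIn p s T s') (hs : s' = s'') : RunsIn p s T s'' := hs ▸ h

lemma seq {p q s T s' T' s''} (h : RunsIn p s T s') (h' : RunsIn q s' T' s'') :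
    RunsIn (Machine.seq p q) s (T + T') s'' := by
  obtain ⟨t, ht, hr⟩ := h
  obtain ⟨t', ht', hr'⟩ := h'
  exact ⟨t + t', by omega, Runs.seq hr hr'⟩

lemma skip (s : Tapes) : RunsIn Machine.skip s 1 s := ⟨1, le_rfl, Runs.skip s⟩

lemma push (i : ℕ) (b : Bool) (s : Tapes) :
    RunsIn (Machine.push i b) s 1 (update s i (b :: s i)) := ⟨1, le_rfl, Runs.push i b s⟩

lemma pop (i : ℕ) (s : Tapes) :
    RunsIn (Machine.pop i) s 1 (update s i (s i).tail) := ⟨1, le_rfl, Runs.pop i s⟩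

lemma branch_nil {i p q r s T s'} (hi : s i = []) (h : RunsIn p s T s') :
    RunsIn (Machine.branch i p q r) s (T + 1) s' := by
  obtain ⟨t, ht, hr⟩ := h
  exact ⟨t + 1, by omega, Runs.branch_nil hi hr⟩

lemma branch_cons {i p q r s T s'} {b : Bool} {x : Bits} (hi : s i = b :: x)
    (h : RunsIn (if b then r else q) s T s') : RunsIn (Machine.branch i p q r) s (T + 1) s' := by
  obtain ⟨t, ht, hr⟩ := h
  cases b
  · exact ⟨t + 1, by omega, Runs.branch_zero (by simp [hi]) hr⟩
  · exact ⟨t + 1, by omega, Runs.branch_one (by simp [hi]) hr⟩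

lemma loop_done {i p s} (hi : s i = []) : RunsIn (Machine.loop i p) s 1 s :=
  ⟨1, le_rfl, Runs.loop_done hi⟩

lemma loop_step {i p s T s' T' s''} (hi : s i ≠ []) (h : RunsIn p s T s')
    (h' : RunsIn (Machine.loop i p) s' T' s'') : RunsIn (Machine.loop i p) s (T + T' + 1) s'' := by
  obtain ⟨t, ht, hr⟩ := h
  obtain ⟨t', ht', hr'⟩ := h'
  exact ⟨t + t' + 1, by omega, Runs.loop_step hi hr hr'⟩

end RunsIn

namespace Machine

/-- Use tape `ρ i` in place of tape `i`. -/
def rename (ρ : ℕ → ℕ) : Machine → Machine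
  | skip => skip
  | push i b => push (ρ i) b
  | pop i => pop (ρ i)
  | seq p q => seq (rename ρ p) (rename ρ q)
  | branch i p q r => branch (ρ i) (rename ρ p) (rename ρ q) (rename ρ r)
  | loop i p => loop (ρ i) (rename ρ p)

/-- All tapes in use have a smaller index. -/
def bound : Machine → ℕ
  | skip => 0
  | push i _ => i + 1
  | pop i => i + 1
  | seq p q => max (bound p) (bound q)
  | branch i p q r => max (i + 1) (max (bound p) (max (bound q) (bound r)))
  | loop i p => max (i + 1) (bound p)

end Machine

lemma Runs.rename {ρ : ℕ → ℕ} (hρ : Injective ρ) {p s t s'} (h : Runs p s t s') :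
    ∀ u : Tapes, (∀ i, u (ρ i) = s i) → ∃ u', Runs (p.rename ρ) u t u' ∧
      (∀ i, u' (ρ i) = s' i) ∧ ∀ j, j ∉ Set.range ρ → u' j = u j := by
  induction h with
  | skip s => exact fun u hu => ⟨u, skip u, hu, fun _ _ => rfl⟩
  | push i b s =>
    intro u hu
    refine ⟨_, push _ _ _, fun j => ?_, fun j hj => ?_⟩
    · by_cases h : j = i
      · subst h; simp [hu]
      · rw [update_of_ne (hρ.ne h), update_of_ne h, hu]
    · rw [update_of_ne]
      rintro rfl
      exact hj ⟨i, rfl⟩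
  | pop i s =>
    intro u hu
    refine ⟨_, pop _ _, fun j => ?_, fun j hj => ?_⟩
    · by_cases h : j = i
      · subst h; simp [hu]
      · rw [update_of_ne (hρ.ne h), update_of_ne h, hu]
    · rw [update_of_ne]
      rintro rfl
      exact hj ⟨i, rfl⟩
  | seq _ _ ih1 ih2 =>
    intro u hu
    obtain ⟨u1, r1, e1, f1⟩ := ih1 u hu
    obtain ⟨u2, r2, e2, f2⟩ := ih2 u1 e1
    exact ⟨u2, seq r1 r2, e2, fun j hj => (f2 j hj).trans (f1 j hj)⟩
  | branch_nil hi _ ih =>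
    intro u hu
    obtain ⟨u1, r1, e1, f1⟩ := ih u hu
    exact ⟨u1, branch_nil (by rw [hu, hi]) r1, e1, f1⟩
  | branch_zero hi _ ih =>
    intro u hu
    obtain ⟨u1, r1, e1, f1⟩ := ih u hu
    exact ⟨u1, branch_zero (by rw [hu, hi]) r1, e1, f1⟩
  | branch_one hi _ ih =>
    intro u hu
    obtain ⟨u1, r1, e1, f1⟩ := ih u hu
    exact ⟨u1, branch_one (by rw [hu, hi]) r1, e1, f1⟩
  | loop_done hi => exact fun u hu => ⟨u, loop_done (by rw [hu, hi]), hu, fun _ _ => rfl⟩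
  | loop_step hi _ _ ih1 ih2 =>
    intro u hu
    obtain ⟨u1, r1, e1, f1⟩ := ih1 u hu
    obtain ⟨u2, r2, e2, f2⟩ := ih2 u1 e1
    exact ⟨u2, loop_step (by rw [hu]; exact hi) r1 r2, e2, fun j hj => (f2 j hj).trans (f1 j hj)⟩

lemma Runs.frame {p s t s'} (h : Runs p s t s') : ∀ i, p.bound ≤ i → s' i = s i := by
  induction h with
  | skip s => exact fun _ _ => rfl
  | push i b s =>
    intro j hj
    rw [update_of_ne]
    simp only [Machine.bound] at hj
    omega
  | pop i s =>
    intro j hj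
    rw [update_of_ne]
    simp only [Machine.bound] at hj
    omega
  | seq _ _ ih1 ih2 =>
    intro j hj
    simp only [Machine.bound, max_le_iff] at hj
    rw [ih2 j hj.2, ih1 j hj.1]
  | branch_nil _ _ ih | branch_zero _ _ ih | branch_one _ _ ih =>
    intro j hj
    simp only [Machine.bound, max_le_iff] at hj
    exact ih j (by tauto)
  | loop_done _ => exact fun _ _ => rfl
  | loop_step _ _ _ ih1 ih2 =>
    intro j hj
    rw [ih2 j hj, ih1 j (by simp only [Machine.bound, max_le_iff] at hj; exact hj.2)]

lemma Runs.length_le {p s t s'} (h : Runs p s t s') : ∀ i, (s' i).length ≤ (s i).length + t := by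
  induction h with
  | skip s => intro i; omega
  | push i b s =>
    intro j
    by_cases h : j = i
    · subst h; simp
    · rw [update_of_ne h]; omega
  | pop i s =>
    intro j
    by_cases h : j = i
    · subst h; simp; omega
    · rw [update_of_ne h]; omega
  | seq _ _ ih1 ih2 => intro j; have := ih1 j; have := ih2 j; omega
  | branch_nil _ _ ih | branch_zero _ _ ih | branch_one _ _ ih =>
    intro j; have := ih j; omega
  | loop_done _ => intro j; omega
  | loop_step _ _ _ ih1 ih2 => intro j; have := ih1 j; have := ih2 j; omega

namespace Machine

/-- Empty tape `i`. -/
def clear (i : ℕ) : Machine := loop i (pop i)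

/-- Empty the tapes `b, …, b + w - 1`. -/
def clearFrom (b : ℕ) : ℕ → Machine
  | 0 => skip
  | w + 1 => seq (clearFrom b w) (clear (b + w))

/-- Move tape `i` to tape `j`, in reverse order. -/
def mv (i j : ℕ) : Machine :=
  loop i (branch i skip (seq (pop i) (push j false)) (seq (pop i) (push j true)))

/-- Move tape `i` to tapes `j` and `q`, in reverse order. -/
def mv2 (i j q : ℕ) : Machine :=
  loop i (branch i skip (seq (pop i) (seq (push j false) (push q false)))
    (seq (pop i) (seq (push j true) (push q true))))

/-- Copy tape `i` to tape `j`, using tape `q`. -/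
def copy (i j q : ℕ) : Machine := seq (mv i q) (mv2 q i j)

end Machine

open Machine in
lemma runsIn_clear (i : ℕ) (u : Tapes) :
    RunsIn (clear i) u (2 * (u i).length + 1) (update u i []) := by
  generalize hx : u i = x
  induction x generalizing u with
  | nil => exact (RunsIn.loop_done hx).congr (by rw [← hx]; simp)
  | cons b x ih =>
    have h1 := RunsIn.pop i u
    have h2 := ih (update u i (u i).tail) (by simp [hx])
    exact ((RunsIn.loop_step (by simp [hx]) h1 h2).mono (by simp; omega)).congr (by simp)

open Machine in
lemma runsIn_clearFrom (b w K : ℕ) (u : Tapes) (hK : ∀ i, b ≤ i → i < b + w → (u i).length ≤ K) :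
    RunsIn (clearFrom b w) u (w * (2 * K + 1) + 1)
      (fun i => if b ≤ i ∧ i < b + w then [] else u i) := by
  induction w with
  | zero =>
    refine ((RunsIn.skip u).mono (by omega)).congr ?_
    funext i
    rw [if_neg (by omega)]
  | succ w ih =>
    have h1 := ih (fun i h h' => hK i h (by omega))
    have h2 := runsIn_clear (b + w) (fun i => if b ≤ i ∧ i < b + w then [] else u i)
    refine ((h1.seq h2).mono ?_).congr ?_
    · have := hK (b + w) (by omega) (by omega)
      simp only [lt_irrefl, and_false, if_false]
      nlinarith
    · funext i
      by_cases h : i = b + w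
      · subst h; simp
      · rw [update_of_ne h]
        have : (b ≤ i ∧ i < b + w) ↔ (b ≤ i ∧ i < b + (w + 1)) := by omega
        simp [this]

open Machine in
lemma runsIn_mv {i j : ℕ} (hij : i ≠ j) (u : Tapes) : RunsIn (mv i j) u (4 * (u i).length + 1)
      (update (update u j ((u i).reverse ++ u j)) i []) := by
  generalize hx : u i = x
  induction x generalizing u with
  | nil =>
    refine (RunsIn.loop_done hx).congr ?_
    funext k
    by_cases h : k = i
    · subst h; simp [hx]
    · simp [h]
  | cons b x ih =>
    have h1 : RunsIn (branch i skip (seq (pop i) (push j false)) (seq (pop i) (push j true))) u 3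
        (update (update u i x) j (b :: u j)) := by
      refine RunsIn.branch_cons hx ?_
      have h0 := (RunsIn.pop i u).seq (RunsIn.push j b _)
      have : (if b then seq (pop i) (push j true) else seq (pop i) (push j false)) =
          seq (pop i) (push j b) := by cases b <;> rfl
      rw [this]
      refine h0.congr ?_
      rw [hx, update_of_ne hij.symm]
      rfl
    have h2 := ih (update (update u i x) j (b :: u j)) (by
      rw [update_of_ne hij]; simp)
    refine ((RunsIn.loop_step (by simp [hx]) h1 h2).mono (by simp; omega)).congr ?_
    funext k
    by_cases h : k = i
    · subst h; simp
    · by_cases h' : k = j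
      · subst h'; simp [h]
      · simp [h, h']

open Machine in
lemma runsIn_mv2 {i j q : ℕ} (hij : i ≠ j) (hiq : i ≠ q) (hjq : j ≠ q) (u : Tapes) :
    RunsIn (mv2 i j q) u (5 * (u i).length + 1)
      (update (update (update u j ((u i).reverse ++ u j)) q ((u i).reverse ++ u q)) i []) := by
  generalize hx : u i = x
  induction x generalizing u with
  | nil =>
    refine (RunsIn.loop_done hx).congr ?_
    funext k
    by_cases h : k = i
    · subst h; simp [hx]
    · simp [h]
  | cons b x ih =>
    have h1 : RunsIn (branch i skip (seq (pop i) (seq (push j false) (push q false)))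
        (seq (pop i) (seq (push j true) (push q true)))) u 4
        (update (update (update u i x) j (b :: u j)) q (b :: u q)) := by
      refine RunsIn.branch_cons hx ?_
      have h0 := (RunsIn.pop i u).seq ((RunsIn.push j b _).seq (RunsIn.push q b _))
      have : (if b then (seq (pop i) (seq (push j true) (push q true))) else
          (seq (pop i) (seq (push j false) (push q false)))) =
          (seq (pop i) (seq (push j b) (push q b))) := by cases b <;> rfl
      rw [this]
      refine h0.congr ?_
      rw [hx, update_of_ne hij.symm, update_of_ne hjq.symm, update_of_ne hiq.symm]
      rfl
    have h2 := ih (update (update (update u i x) j (b :: u j)) q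
      (b :: u q)) (by rw [update_of_ne hiq, update_of_ne hij]; simp)
    refine ((RunsIn.loop_step (by simp [hx]) h1 h2).mono (by simp; omega)).congr ?_
    funext k
    by_cases h : k = i
    · subst h; simp
    · simp only [update_apply]
      split_ifs <;> simp_all

open Machine in
lemma runsIn_copy {i j q : ℕ} (hij : i ≠ j) (hiq : i ≠ q) (hjq : j ≠ q) (u : Tapes)
    (hj : u j = []) (hq : u q = []) :
    RunsIn (copy i j q) u (9 * (u i).length + 2) (update u j (u i)) := by
  have h1 := runsIn_mv hiq u
  have h2 := runsIn_mv2 hiq.symm hjq.symm hij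
    (update (update u q ((u i).reverse ++ u q)) i [])
  refine ((h1.seq h2).mono ?_).congr ?_
  · simp [update_of_ne hiq.symm, hq]; omega
  · funext k
    simp only [update_apply]
    split_ifs <;> simp_all

open Machine in
/-- Move tape `i` to the empty tape `j`, using tape `q`. -/
lemma runsIn_transfer {i j q : ℕ} (hij : i ≠ j) (hiq : i ≠ q) (hjq : j ≠ q) (u : Tapes)
    (hj : u j = []) (hq : u q = []) : RunsIn (seq (mv i q) (mv q j)) u (8 * (u i).length + 2)
      (update (update u j (u i)) i []) := by
  have h1 := runsIn_mv hiq u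
  have h2 := runsIn_mv hjq.symm
    (update (update u q ((u i).reverse ++ u q)) i [])
  refine ((h1.seq h2).mono ?_).congr ?_
  · simp [update_of_ne hiq.symm, hq]; omega
  · funext k
    simp only [update_apply]
    split_ifs <;> simp_all

/-! ## Polynomial bounds -/

/-- The total length of a list of inputs. -/
def totalSize (xs : List Bits) : ℕ := (xs.map List.length).sum

lemma Polynomial.eval_nat_mono (B : Polynomial ℕ) {a b : ℕ} (h : a ≤ b) : B.eval a ≤ B.eval b := by
  induction B using Polynomial.induction_on' with
  | add p q hp hq => simpa using add_le_add hp hq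
  | monomial n c => simp only [eval_monomial]; gcongr

/-- `T` is bounded by a polynomial in the length of the input. -/
def PolyBdd {α : Type} (inp : α → List Bits) (T : α → ℕ) : Prop :=
  ∃ B : Polynomial ℕ, ∀ a, T a ≤ B.eval (totalSize (inp a))

namespace PolyBdd

variable {α β : Type} {inp : α → List Bits} {T T' : α → ℕ}

lemma mono (h : PolyBdd inp T) (hT : ∀ a, T' a ≤ T a) : PolyBdd inp T' := by
  obtain ⟨B, hB⟩ := h
  exact ⟨B, fun a => (hT a).trans (hB a)⟩

lemma const (c : ℕ) : PolyBdd inp (fun _ => c) := ⟨C c, fun a => by simp⟩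

lemma size : PolyBdd inp (fun a => totalSize (inp a)) := ⟨X, fun a => by simp⟩

lemma add (h : PolyBdd inp T) (h' : PolyBdd inp T') : PolyBdd inp (fun a => T a + T' a) := by
  obtain ⟨B, hB⟩ := h
  obtain ⟨B', hB'⟩ := h'
  exact ⟨B + B', fun a => by simpa using add_le_add (hB a) (hB' a)⟩

lemma mul (h : PolyBdd inp T) (h' : PolyBdd inp T') : PolyBdd inp (fun a => T a * T' a) := by
  obtain ⟨B, hB⟩ := h
  obtain ⟨B', hB'⟩ := h'
  exact ⟨B * B', fun a => by simpa using Nat.mul_le_mul (hB a) (hB' a)⟩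

lemma comp {inp' : β → List Bits} {U : β → ℕ} (hU : PolyBdd inp' U) (φ : α → β)
    (h : PolyBdd inp (fun a => totalSize (inp' (φ a)))) : PolyBdd inp (fun a => U (φ a)) := by
  obtain ⟨B, hB⟩ := hU
  obtain ⟨B', hB'⟩ := h
  refine ⟨B.comp B', fun a => (hB _).trans ?_⟩
  rw [Polynomial.eval_comp]
  exact Polynomial.eval_nat_mono _ (hB' a)

lemma eval (P : Polynomial ℕ) (h : PolyBdd inp T) : PolyBdd inp (fun a => P.eval (T a)) := by
  obtain ⟨B, hB⟩ := h
  refine ⟨P.comp B, fun a => ?_⟩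
  rw [Polynomial.eval_comp]
  exact Polynomial.eval_nat_mono _ (hB a)

end PolyBdd

lemma polyTime_iff {α : Type} {inp : α → List Bits} {f : α → Bits} :
    PolyTime inp f ↔ ∃ (p : Machine) (T : α → ℕ), PolyBdd inp T ∧
      ∀ a, ∃ s, RunsIn p (initTapes (inp a)) (T a) s ∧ s 0 = f a := by
  constructor
  · rintro ⟨p, B, h⟩
    refine ⟨p, fun a => B.eval (totalSize (inp a)), ⟨B, fun a => le_rfl⟩, fun a => ?_⟩
    obtain ⟨t, s, hr, h0, ht⟩ := h a
    exact ⟨s, ⟨t, ht, hr⟩, h0⟩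
  · rintro ⟨p, T, ⟨B, hB⟩, h⟩
    refine ⟨p, B, fun a => ?_⟩
    obtain ⟨s, ⟨t, ht, hr⟩, h0⟩ := h a
    exact ⟨t, s, hr, h0, ht.trans (hB a)⟩

lemma length_getD_le (xs : List Bits) (i : ℕ) : (xs.getD i []).length ≤ totalSize xs := by
  induction xs generalizing i with
  | nil => simp
  | cons x xs ih =>
    cases i with
    | zero => simp [totalSize]
    | succ i => have := ih i; simp [totalSize] at *; omega

lemma PolyTime.size_bdd {α : Type} {inp : α → List Bits} {f : α → Bits}
    (h : PolyTime inp f) : PolyBdd inp (fun a => (f a).length) := by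
  obtain ⟨p, T, hT, h⟩ := polyTime_iff.1 h
  refine (hT.add PolyBdd.size).mono fun a => ?_
  obtain ⟨s, ⟨t, ht, hr⟩, h0⟩ := h a
  have := hr.length_le 0
  have := length_getD_le (inp a) 0
  rw [← h0]
  simp only [initTapes] at *
  omega

/-! ## Machines that keep their inputs and clean up -/

lemma initTapes_append (L : List Bits) (v : Bits) :
    initTapes (L ++ [v]) = update (initTapes L) L.length v := by
  funext i
  simp only [initTapes, update_apply, getD_eq_getElem?_getD]
  rcases lt_trichotomy i L.length with h | h | h
  · rw [getElem?_append_left h, if_neg h.ne]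
  · subst h; simp
  · rw [if_neg h.ne', List.getElem?_eq_none (by simp; omega), List.getElem?_eq_none (by omega)]

lemma initTapes_append_nil (L : List Bits) : initTapes (L ++ [[]]) = initTapes L := by
  rw [initTapes_append]
  funext i
  simp only [initTapes, update_apply]
  split_ifs with h
  · subst h; simp
  · rfl

lemma initTapes_of_le {L : List Bits} {i : ℕ} (h : L.length ≤ i) : initTapes L i = [] := by
  simp [initTapes, List.getElem?_eq_none h]

/-- The machine computes `f a` on the first free tape and leaves everything else unchanged. -/
def Clean {α : Type} (inp : α → List Bits) (f : α → Bits) : Prop :=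
  ∃ (p : Machine) (T : α → ℕ), PolyBdd inp T ∧
    ∀ a, RunsIn p (initTapes (inp a)) (T a) (initTapes (inp a ++ [f a]))

/-- All inputs have the same number of components. -/
class FixedArity {α : Type} (inp : α → List Bits) : Prop where
  arity : ∃ k, ∀ a, (inp a).length = k

/-- Read the inputs from the tapes in `src`, write the output to `dst`, work beyond `base`. -/
def layout (src : List ℕ) (dst base : ℕ) (i : ℕ) : ℕ :=
  if h : i < src.length then src[i] else if i = src.length then dst else base + i

lemma layout_injective {src : List ℕ} {dst base : ℕ} (hs : src.Nodup) (hd : dst ∉ src)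
    (hb : ∀ i ∈ src, i < base) (hb' : dst < base) : Injective (layout src dst base) := by
  intro i j h
  have key : ∀ i (h : i < src.length), src[i] < base := fun i h => hb _ (List.getElem_mem h)
  have key' : ∀ i (h : i < src.length), src[i] ≠ dst := fun i h e => hd (e ▸ List.getElem_mem h)
  unfold layout at h
  split_ifs at h with h1 h2 h3 h4 h5 h6 h7
  · exact (List.Nodup.getElem_inj_iff hs).1 h
  · exact absurd h (key' i h1)
  · have := key i h1; omega
  · exact absurd h.symm (key' j h5)
  · omega
  · omega
  · have := key j h7; omega
  · omega
  · omega

lemma RunsIn.relocate {p : Machine} {L : List Bits} {v : Bits} {T : ℕ}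
    (h : RunsIn p (initTapes L) T (initTapes (L ++ [v])))
    {src : List ℕ} {dst base : ℕ} (hs : src.Nodup) (hd : dst ∉ src)
    (hb : ∀ i ∈ src, i < base) (hb' : dst < base) (u : Tapes)
    (hu : src.map u = L) (hdst : u dst = []) (hbase : ∀ i, base ≤ i → u i = []) :
    RunsIn (p.rename (layout src dst base)) u T (update u dst (v)) := by
  obtain ⟨t, ht, hr⟩ := h
  have hinj := layout_injective hs hd hb hb'
  have hlen : src.length = L.length := by rw [← hu]; simp
  have hdl : layout src dst base src.length = dst := by simp [layout]
  obtain ⟨u', r, e, fr⟩ := hr.rename hinj u (by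
    intro i
    unfold layout
    split_ifs with h1 h2
    · simp [initTapes, ← hu, h1]
    · rw [hdst, initTapes_of_le (by omega)]
    · rw [hbase _ (by omega), initTapes_of_le (by omega)])
  refine ⟨t, ht, ?_⟩
  convert r using 1
  funext j
  by_cases hj : j ∈ Set.range (layout src dst base)
  · obtain ⟨i, rfl⟩ := hj
    rw [e, initTapes_append, ← hlen]
    by_cases hi : i = src.length
    · subst hi; rw [hdl]; simp
    · rw [update_of_ne hi, update_of_ne (fun h => hi (hinj (h.trans hdl.symm)))]
      unfold layout
      split_ifs with h1
      · simp [initTapes, ← hu, h1]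
      · rw [hbase _ (by omega), initTapes_of_le (by omega)]
  · rw [fr j hj, update_of_ne]
    rintro rfl
    exact hj ⟨_, hdl⟩

namespace Machine

/-- Copy the first tapes to the tapes after `k`, using tape `k`. -/
def copyAll (k : ℕ) : ℕ → Machine
  | 0 => skip
  | w + 1 => seq (copyAll k w) (copy w (k + 1 + w) k)

end Machine

open Machine in
lemma runsIn_copyAll (L : List Bits) (w : ℕ) (hw : w ≤ L.length) :
    RunsIn (copyAll L.length w) (initTapes L) (w * (9 * totalSize L + 2) + 1)
      (initTapes (L ++ [] :: L.take w)) := by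
  induction w with
  | zero =>
    refine ((RunsIn.skip _).mono (by omega)).congr ?_
    simp [initTapes_append_nil]
  | succ w ih =>
    have h1 := ih (by omega)
    have h2 := runsIn_copy (i := w) (j := L.length + 1 + w) (q := L.length) (by omega) (by omega)
      (by omega) (initTapes (L ++ [] :: L.take w)) (initTapes_of_le (by simp; omega))
      (by simp [initTapes])
    refine ((h1.seq h2).mono ?_).congr ?_
    · have : (initTapes (L ++ [] :: L.take w) w).length ≤ totalSize L := by
        rw [initTapes, List.getD_append _ _ _ _ (by omega)]
        exact length_getD_le _ _
      nlinarith
    · have e : L ++ [] :: L.take (w + 1) = (L ++ [] :: L.take w) ++ [L[w]] := by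
        simp [List.take_append_getElem]
      rw [e, initTapes_append]
      congr 1
      · simp; omega
      · simp [initTapes, getElem?_append_left (show w < L.length by omega),
          getElem?_eq_getElem (show w < L.length by omega)]

open Machine in
lemma PolyTime.clean {α : Type} {inp : α → List Bits} [hk : FixedArity inp]
    {f : α → Bits} (h : PolyTime inp f) : Clean inp f := by
  obtain ⟨k, hk⟩ := hk.arity
  obtain ⟨p, T, hT, h⟩ := polyTime_iff.1 h
  set W := p.bound + k with hW
  refine ⟨seq (copyAll k k) (seq (p.rename (fun i => i + (k + 1)))
    (seq (clearFrom (k + 2) W) (seq (mv (k + 1) (k + 2)) (mv (k + 2) k)))),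
    fun a => (k * (9 * totalSize (inp a) + 2) + 1) + (T a + ((W * (2 * (totalSize (inp a) + T a) + 1)
      + 1) + (8 * (totalSize (inp a) + T a) + 2))), ?_, fun a => ?_⟩
  · have hs := PolyBdd.size (inp := inp)
    have c := fun n => PolyBdd.const (inp := inp) n
    exact (((c k).mul (((c 9).mul hs).add (c 2))).add (c 1)).add (hT.add
      ((((c W).mul (((c 2).mul (hs.add hT)).add (c 1))).add (c 1)).add
      (((c 8).mul (hs.add hT)).add (c 2))))
  · obtain ⟨s, ⟨t, ht, hr⟩, h0⟩ := h a
    have hl := hk a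
    have h1 := runsIn_copyAll (inp a) k hl.ge
    rw [hl] at h1
    rw [take_of_length_le hl.le] at h1
    obtain ⟨u', r, e, fr⟩ := hr.rename (ρ := fun i => i + (k + 1)) (add_left_injective _)
      (initTapes (inp a ++ [] :: inp a)) (by
        intro i
        simp only [initTapes, getD_eq_getElem?_getD]
        rw [List.getElem?_append_right (by omega)]
        congr 1
        rw [show i + (k + 1) - (inp a).length = i + 1 by omega]
        simp)
    have hlow : ∀ i < k, u' i = initTapes (inp a) i := fun i hi => by
      rw [fr i (by rintro ⟨j, hj⟩; simp at hj; omega)]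
      simp [initTapes, getElem?_append_left (show i < (inp a).length by omega)]
    have hk' : u' k = [] := by
      rw [fr k (by rintro ⟨j, hj⟩; simp at hj; omega)]
      simp [initTapes, ← hl]
    have hsz : ∀ i, (u' (i + (k + 1))).length ≤ totalSize (inp a) + T a := fun i => by
      rw [e]
      have := hr.length_le i
      have := length_getD_le (inp a) i
      simp only [initTapes] at *
      omega
    have hhigh : ∀ i, k + 2 + W ≤ i → u' i = [] := fun i hi => by
      obtain ⟨j, rfl⟩ : ∃ j, i = j + (k + 1) := ⟨i - (k + 1), by omega⟩
      rw [e, hr.frame j (by omega), initTapes_of_le (by omega)]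
    have h3 := runsIn_clearFrom (k + 2) W (totalSize (inp a) + T a) u' (by
      intro i hi _
      obtain ⟨j, rfl⟩ : ∃ j, i = j + (k + 1) := ⟨i - (k + 1), by omega⟩
      exact hsz j)
    have h4 := runsIn_transfer (i := k + 1) (j := k) (q := k + 2) (by omega) (by omega) (by omega)
      (fun i => if k + 2 ≤ i ∧ i < k + 2 + W then [] else u' i)
      (by simp [hk']) (by
        by_cases hw : 0 < W
        · simp [hw]
        · simp only [ite_eq_left_iff]
          intro _
          exact hhigh _ (by omega))
    have h2 : RunsIn _ _ (T a) _ := ⟨t, ht, r⟩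
    refine ((h1.seq (h2.seq (h3.seq h4))).mono ?_).congr ?_
    · have := hsz 0
      simp only [zero_add] at this
      rw [if_neg (by omega)]
      dsimp only
      omega
    · have hf : u' (k + 1) = f a := by rw [← h0, ← e 0, zero_add]
      rw [initTapes_append, hl]
      funext i
      simp only [update_apply]
      by_cases h1 : i = k + 1
      · subst h1
        simp [initTapes_of_le (show (inp a).length ≤ k + 1 by omega)]
      · rw [if_neg h1]
        by_cases h2 : i = k
        · subst h2; simp [hf]
        · rw [if_neg h2, if_neg h2]
          by_cases h3 : i < k
          · rw [if_neg (by omega), hlow i h3]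
          · rw [initTapes_of_le (by omega)]
            split_ifs with h4
            · rfl
            · exact hhigh i (by omega)

open Machine in
lemma Clean.polyTime {α : Type} {inp : α → List Bits} [hk : FixedArity inp]
    {f : α → Bits} (h : Clean inp f) : PolyTime inp f := by
  obtain ⟨k, hk⟩ := hk.arity
  obtain ⟨p, T, hT, h⟩ := h
  rw [polyTime_iff]
  by_cases hk0 : k = 0
  · subst hk0
    refine ⟨p, T, hT, fun a => ⟨_, h a, ?_⟩⟩
    have := hk a
    rw [List.length_eq_zero_iff] at this
    simp [initTapes, this]
  refine ⟨seq p (seq (clear 0) (seq (mv k (k + 1)) (mv (k + 1) 0))),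
    fun a => T a + ((2 * totalSize (inp a) + 1) + (8 * (totalSize (inp a) + T a) + 2)), ?_,
    fun a => ?_⟩
  · have hs := PolyBdd.size (inp := inp)
    have c := fun n => PolyBdd.const (inp := inp) n
    exact hT.add ((((c 2).mul hs).add (c 1)).add (((c 8).mul (hs.add hT)).add (c 2)))
  · have hl := hk a
    have hfa : initTapes (inp a ++ [f a]) k = f a := by simp [initTapes, ← hl]
    have h0 : initTapes (inp a ++ [f a]) 0 = initTapes (inp a) 0 := by
      simp only [initTapes, getD_eq_getElem?_getD]
      rw [getElem?_append_left (by omega)]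
    have h2 := runsIn_clear 0 (initTapes (inp a ++ [f a]))
    have h3 := runsIn_transfer (i := k) (j := 0) (q := k + 1) hk0 (by omega) (by omega)
      (update (initTapes (inp a ++ [f a])) 0 []) (by simp) (by
        rw [update_of_ne (by omega), initTapes_of_le (by simp; omega)])
    refine ⟨_, ((h a).seq (h2.seq h3)).mono ?_, ?_⟩
    · rw [update_of_ne hk0, hfa, h0]
      obtain ⟨t, ht, hr⟩ := h a
      have h5 := hr.length_le k
      rw [hfa, initTapes_of_le (by omega)] at h5
      have := length_getD_le (inp a) 0
      simp only [initTapes, List.length_nil] at *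
      omega
    · rw [update_of_ne (Ne.symm hk0)]
      simp [update_of_ne hk0, hfa]

instance FixedArity.nil {α : Type} : FixedArity (fun _ : α => []) := ⟨⟨0, fun _ => rfl⟩⟩

instance FixedArity.cons {α : Type} (f : α → Bits) (inp : α → List Bits)
    [h : FixedArity inp] : FixedArity (fun a => f a :: inp a) := by
  obtain ⟨k, hk⟩ := h.arity
  exact ⟨⟨k + 1, fun a => by simp [hk]⟩⟩

instance FixedArity.comp_fst {α β : Type} (inp : α → List Bits) [h : FixedArity inp] :
    FixedArity (fun p : α × β => inp p.1) := by
  obtain ⟨k, hk⟩ := h.arity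
  exact ⟨⟨k, fun a => hk a.1⟩⟩

section

variable {α β : Type} {inp : α → List Bits}

open Machine in
lemma exists_evalAll [hk : FixedArity inp] (gs : List (α → Bits)) (hgs : ∀ g ∈ gs, Clean inp g) :
    ∃ (q : Machine) (T : α → ℕ), PolyBdd inp T ∧ ∀ a, RunsIn q (initTapes (inp a)) (T a)
      (initTapes (inp a ++ [] :: gs.map (fun g => g a))) := by
  obtain ⟨k, hk⟩ := hk.arity
  induction gs using List.reverseRecOn with
  | nil =>
    refine ⟨skip, fun _ => 1, PolyBdd.const 1, fun a => ?_⟩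
    simpa [initTapes_append_nil] using RunsIn.skip (initTapes (inp a))
  | append_singleton gs g ih =>
    obtain ⟨q, T, hT, h⟩ := ih (fun g' hg' => hgs g' (by simp [hg']))
    obtain ⟨p, T', hT', h'⟩ := hgs g (by simp)
    set n := k + 1 + gs.length with hn
    refine ⟨seq q (p.rename (layout (List.range k) n (n + 1))), fun a => T a + T' a,
      hT.add hT', fun a => ?_⟩
    have hlen : (inp a ++ [] :: gs.map (fun g => g a)).length = n := by simp [hk]; omega
    have h1 := RunsIn.relocate (h' a) (src := List.range k) (dst := n) (base := n + 1)
      List.nodup_range (by simp; omega) (by simp; omega) (by omega)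
      (initTapes (inp a ++ [] :: gs.map (fun g => g a)))
      (by
        apply ext_getElem
        · simp [hk]
        · intro i h1 h2
          simp [initTapes, getElem?_append_left h2, getElem?_eq_getElem h2])
      (initTapes_of_le hlen.le) (fun i hi => initTapes_of_le (by omega))
    refine ((h a).seq h1).congr ?_
    rw [show inp a ++ [] :: (gs ++ [g]).map (fun g => g a) =
      (inp a ++ [] :: gs.map (fun g => g a)) ++ [g a] by simp, initTapes_append, hlen]

lemma polyBdd_totalSize (gs : List (α → Bits)) (hgs : ∀ g ∈ gs, PolyTime inp g) :
    PolyBdd inp (fun a => totalSize (gs.map (fun g => g a))) := by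
  induction gs with
  | nil => exact (PolyBdd.const 0).mono (fun a => by simp [totalSize])
  | cons g gs ih =>
    refine (((hgs g (by simp)).size_bdd).add (ih (fun g' h => hgs g' (by simp [h])))).mono ?_
    intro a
    simp [totalSize]

open Machine in
lemma PolyTime.comp [hk : FixedArity inp] {inp' : β → List Bits} [FixedArity inp']
    {f : β → Bits} (hf : PolyTime inp' f) (φ : α → β) (gs : List (α → Bits))
    (hgs : ∀ g ∈ gs, PolyTime inp g) (hφ : ∀ a, inp' (φ a) = gs.map (fun g => g a)) :
    PolyTime inp (fun a => f (φ a)) := by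
  apply Clean.polyTime
  obtain ⟨q, T, hT, h⟩ := exists_evalAll gs (fun g hg => (hgs g hg).clean)
  obtain ⟨k, hk⟩ := hk.arity
  obtain ⟨p, T', hT', h'⟩ := hf.clean
  have hS := polyBdd_totalSize gs hgs
  set w := gs.length with hw
  refine ⟨seq q (seq (p.rename (layout ((List.range w).map (fun i => k + 1 + i)) k (k + 1 + w)))
    (clearFrom (k + 1) w)), fun a => T a + (T' (φ a) +
      (w * (2 * totalSize (gs.map (fun g => g a)) + 1) + 1)), ?_, fun a => ?_⟩
  · have c := fun n => PolyBdd.const (inp := inp) n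
    refine hT.add ((hT'.comp φ (by simpa only [hφ] using hS)).add ?_)
    exact ((c w).mul (((c 2).mul hS).add (c 1))).add (c 1)
  · set L := inp a ++ [] :: gs.map (fun g => g a) with hL
    have hlen : L.length = k + 1 + w := by simp [hL, hk]; omega
    have hget : ∀ i < w, initTapes L (k + 1 + i) = (gs.map (fun g => g a)).getD i [] := by
      intro i hi
      simp only [initTapes, hL, getD_eq_getElem?_getD]
      rw [List.getElem?_append_right (by rw [hk]; omega), hk, show k + 1 + i - k = i + 1 by omega]
      simp
    have h1 := RunsIn.relocate (h' (φ a)) (src := (List.range w).map (fun i => k + 1 + i)) (dst := k)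
      (base := k + 1 + w) (List.nodup_range.map (fun i j h => by simpa using h))
      (by simp; omega) (by simp) (by omega) (initTapes L)
      (by
        rw [hφ]
        apply ext_getElem
        · simp [hw]
        · intro i h1 h2
          simp only [List.length_map, List.length_range] at h1
          simp [hget i h1, getElem?_eq_getElem (show i < gs.length by omega)])
      (by simp [initTapes, hL, ← hk a]) (fun i hi => initTapes_of_le (by omega))
    have h2 := runsIn_clearFrom (k + 1) w (totalSize (gs.map (fun g => g a)))
      (update (initTapes L) k (f (φ a))) (by
        intro i hi hi'
        rw [update_of_ne (by omega)]
        obtain ⟨j, rfl⟩ : ∃ j, i = k + 1 + j := ⟨i - (k + 1), by omega⟩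
        rw [hget j (by omega)]
        exact length_getD_le _ _)
    refine ((h a).seq (h1.seq h2)).congr ?_
    rw [initTapes_append, hk]
    funext i
    simp only [update_apply]
    by_cases hi : i = k
    · subst hi; simp
    · rw [if_neg hi, if_neg hi]
      by_cases hik : i < k
      · rw [if_neg (by omega)]
        simp [initTapes, hL, getElem?_append_left (show i < (inp a).length by rw [hk]; exact hik)]
      · rw [initTapes_of_le (show (inp a).length ≤ i by rw [hk]; omega)]
        split_ifs with h3
        · rfl
        · exact initTapes_of_le (by omega)

lemma initTapes_append_two (L : List Bits) (x y : Bits) (i : ℕ) :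
    initTapes (L ++ [x, y]) i = if i = L.length then x else if i = L.length + 1 then y
      else initTapes L i := by
  rw [show L ++ [x, y] = (L ++ [x]) ++ [y] by simp, initTapes_append, initTapes_append]
  simp only [update_apply, length_append, List.length_singleton]
  split_ifs <;> first | rfl | omega

open Machine in
lemma PolyTime.foldl [hk : FixedArity inp] {g base : α → Bits}
    {step : α → Bits → Bool → Bits} (hg : PolyTime inp g) (hb : PolyTime inp base)
    (hstep : PolyTime (fun p : α × Bits × Bool => p.2.1 :: [p.2.2] :: inp p.1)
      (fun p => step p.1 p.2.1 p.2.2))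
    {P : α → ℕ} (hP : PolyBdd inp P)
    (hbd : ∀ a acc b, (step a acc b).length ≤ acc.length + P a) :
    PolyTime inp (fun a => (g a).foldl (step a) (base a)) := by
  apply Clean.polyTime
  obtain ⟨pg, Tg, hTg, rg⟩ := hg.clean
  obtain ⟨pb, Tb, hTb, rb⟩ := hb.clean
  obtain ⟨ps, Ts, ⟨Bs, hBs⟩, rs⟩ := hstep.clean
  obtain ⟨k, hk⟩ := hk.arity
  set body : Machine := seq (seq (branch (k + 1) skip (push (k + 2) false) (push (k + 2) true))
    (pop (k + 1))) (seq (ps.rename (layout (k :: (k + 2) :: List.range k) (k + 3) (k + 4)))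
      (seq (clear k) (seq (seq (mv (k + 3) (k + 4)) (mv (k + 4) k)) (clear (k + 2))))) with hbody
  -- one iteration
  have hiter : ∀ a acc b rest M, acc.length ≤ M → (step a acc b).length ≤ M →
      RunsIn body (initTapes (inp a ++ [acc, b :: rest]))
        (3 + (Bs.eval (M + 1 + totalSize (inp a)) + ((2 * M + 1) + ((8 * M + 2) + 3))))
        (initTapes (inp a ++ [step a acc b, rest])) := fun a acc b rest M hM hM' => by
    have hl := hk a
    have hget := initTapes_append_two (inp a) acc (b :: rest)
    rw [hl] at hget
    set u0 := initTapes (inp a ++ [acc, b :: rest]) with hu0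
    have hz : ∀ i, k + 2 ≤ i → u0 i = [] := fun i hi => initTapes_of_le (by simp [hl]; omega)
    have h1 : RunsIn (seq (branch (k + 1) skip (push (k + 2) false) (push (k + 2) true))
        (pop (k + 1))) u0 3 (update (update u0 (k + 2) [b]) (k + 1) rest) := by
      have e1 : RunsIn (branch (k + 1) skip (push (k + 2) false) (push (k + 2) true)) u0 2
          (update u0 (k + 2) [b]) := by
        refine RunsIn.branch_cons (b := b) (x := rest) (by rw [hget]; simp) ?_
        have := RunsIn.push (k + 2) b u0
        rw [hz _ le_rfl] at this
        cases b <;> exact this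
      refine (e1.seq (RunsIn.pop (k + 1) _)).congr ?_
      rw [update_of_ne (by omega), hget]
      simp
    set u1 := update (update u0 (k + 2) [b]) (k + 1) rest with hu1
    have h2 := RunsIn.relocate (rs (a, acc, b)) (src := k :: (k + 2) :: List.range k) (dst := k + 3)
      (base := k + 4) (by simp [List.nodup_range]) (by simp) (by simp; omega) (by omega) u1
      (by
        simp only [List.map_cons]
        congr 1
        · simp [hu1, hget]
        · congr 1
          · simp [hu1]
          · apply ext_getElem
            · simp [hl]
            · intro i h1 h2
              simp only [List.length_map, List.length_range] at h1
              rw [List.getElem_map, List.getElem_range, hu1, update_of_ne (by omega),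
                update_of_ne (by omega), hget, if_neg (by omega), if_neg (by omega)]
              simp [initTapes, getElem?_eq_getElem h2])
      (by rw [hu1, update_of_ne (by omega), update_of_ne (by omega), hz _ (by omega)])
      (fun i hi => by rw [hu1, update_of_ne (by omega), update_of_ne (by omega), hz _ (by omega)])
    set u2 := update u1 (k + 3) (step a acc b) with hu2
    have hu2k : u2 k = acc := by simp [hu2, hu1, hget]
    have h3 := runsIn_clear k u2
    rw [hu2k] at h3
    have h4 := runsIn_transfer (i := k + 3) (j := k) (q := k + 4) (by omega) (by omega) (by omega)
      (update u2 k []) (by simp) (by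
        rw [update_of_ne (by omega), hu2, update_of_ne (by omega), hu1,
          update_of_ne (by omega), update_of_ne (by omega), hz _ (by omega)])
    have e4 : update u2 k [] (k + 3) = step a acc b := by rw [update_of_ne (by omega), hu2]; simp
    rw [e4] at h4
    set u3 := update (update (update u2 k []) k (step a acc b)) (k + 3) []
      with hu3
    have h5 := runsIn_clear (k + 2) u3
    have e5 : u3 (k + 2) = [b] := by simp [hu3, hu2, hu1]
    rw [e5] at h5
    refine ((h1.seq (h2.seq (h3.seq (h4.seq h5)))).mono ?_).congr ?_
    · have h6 : Ts (a, acc, b) ≤ Bs.eval (M + 1 + totalSize (inp a)) := by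
        refine (hBs _).trans (Polynomial.eval_nat_mono _ ?_)
        simp [totalSize]
        omega
      simp only [List.length_singleton]
      omega
    · funext i
      rw [initTapes_append_two, hl]
      simp only [hu3, hu2, hu1, update_apply]
      have hgi := hget i
      split_ifs at hgi ⊢ <;> first | rfl | omega | (symm; exact initTapes_of_le (by omega))
  have hloop : ∀ a rest acc M, (∀ w, w <+: rest → (w.foldl (step a) acc).length ≤ M) →
      RunsIn (loop (k + 1) body) (initTapes (inp a ++ [acc, rest]))
        (rest.length * (3 + (Bs.eval (M + 1 + totalSize (inp a)) +
          ((2 * M + 1) + ((8 * M + 2) + 3))) + 1) + 1)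
        (initTapes (inp a ++ [rest.foldl (step a) acc, []])) := fun a rest => by
    induction rest with
    | nil =>
      intro acc M _
      refine (RunsIn.loop_done ?_).mono (by simp)
      rw [initTapes_append_two, hk]; simp
    | cons b rest ih =>
      intro acc M hM
      have h1 := hiter a acc b rest M (by simpa using hM [] (by simp))
        (by simpa using hM [b] (by simp))
      have h2 := ih (step a acc b) M (fun w hw => by simpa using hM (b :: w) (by simpa using hw))
      refine (RunsIn.loop_step ?_ h1 h2).mono ?_
      · rw [initTapes_append_two, hk]; simp
      · simp only [length_cons]
        ring_nf
        omega
  refine ⟨seq pb (seq (pg.rename (layout (List.range k) (k + 1) (k + 2))) (loop (k + 1) body)),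
    fun a => Tb a + (Tg a + ((g a).length * (3 + (Bs.eval (((base a).length + (g a).length * P a) + 1
      + totalSize (inp a)) + ((2 * ((base a).length + (g a).length * P a) + 1) +
      ((8 * ((base a).length + (g a).length * P a) + 2) + 3))) + 1) + 1)), ?_, fun a => ?_⟩
  · have c := fun n => PolyBdd.const (inp := inp) n
    have hM := hb.size_bdd.add (hg.size_bdd.mul hP)
    refine hTb.add (hTg.add ((hg.size_bdd.mul ((((c 3).add ((PolyBdd.eval Bs
      ((hM.add (c 1)).add PolyBdd.size)).add ((((c 2).mul hM).add (c 1)).add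
      ((((c 8).mul hM).add (c 2)).add (c 3))))).add (c 1)))).add (c 1)))
  · have hl := hk a
    have h1 := rb a
    have h2 := RunsIn.relocate (rg a) (src := List.range k) (dst := k + 1) (base := k + 2)
      List.nodup_range (by simp) (by simp; omega) (by omega) (initTapes (inp a ++ [base a]))
      (by
        apply ext_getElem
        · simp [hk]
        · intro i h1 h2
          simp [initTapes, getElem?_append_left h2, getElem?_eq_getElem h2])
      (initTapes_of_le (by simp [hl])) (fun i hi => initTapes_of_le (by simp [hl]; omega))
    have e2 : update (initTapes (inp a ++ [base a])) (k + 1) (g a) =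
        initTapes (inp a ++ [base a, g a]) := by
      rw [show inp a ++ [base a, g a] = (inp a ++ [base a]) ++ [g a] by simp,
        initTapes_append (inp a ++ [base a])]
      simp [hl]
    rw [e2] at h2
    have h3 := hloop a (g a) (base a) ((base a).length + (g a).length * P a) (by
      intro w hw
      have key : ∀ (w : Bits) acc, (w.foldl (step a) acc).length ≤ acc.length + w.length * P a := by
        intro w
        induction w with
        | nil => intro acc; simp
        | cons b w ih =>
          intro acc
          have := ih (step a acc b)
          have := hbd a acc b
          simp only [List.foldl_cons, length_cons]
          nlinarith
      have := key w (base a)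
      have := Nat.mul_le_mul_right (P a) hw.length_le
      omega)
    refine (h1.seq (h2.seq h3)).congr ?_
    rw [show inp a ++ [(g a).foldl (step a) (base a), []] =
      (inp a ++ [(g a).foldl (step a) (base a)]) ++ [[]] by simp, initTapes_append_nil]

/-! ## Basic functions -/

open Machine in
lemma polyTime_proj [hk : FixedArity inp] (j : ℕ) : PolyTime inp (fun a => (inp a).getD j []) := by
  apply Clean.polyTime
  obtain ⟨k, hk⟩ := hk.arity
  by_cases hj : j < k
  · refine ⟨copy j k (k + 1), fun a => 9 * totalSize (inp a) + 2,
      ((PolyBdd.const 9).mul PolyBdd.size).add (PolyBdd.const 2), fun a => ?_⟩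
    have hl := hk a
    have h := runsIn_copy (i := j) (j := k) (q := k + 1) (by omega) (by omega) (by omega)
      (initTapes (inp a)) (initTapes_of_le (by omega)) (initTapes_of_le (by omega))
    refine (h.mono ?_).congr ?_
    · have := length_getD_le (inp a) j
      simp only [initTapes]; omega
    · rw [initTapes_append, hl]; rfl
  · refine ⟨skip, fun _ => 1, PolyBdd.const 1, fun a => ?_⟩
    have hl := hk a
    have e : (inp a).getD j [] = [] := by
      simp [List.getElem?_eq_none (show (inp a).length ≤ j by omega)]
    refine (RunsIn.skip _).congr ?_
    simp only [e, initTapes_append_nil]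

/-- The input that stands on tape `j`. -/
lemma PolyTime.input [FixedArity inp] (j : ℕ) {f : α → Bits}
    (h : ∀ a, (inp a).getD j [] = f a) : PolyTime inp f := by
  have := polyTime_proj (inp := inp) j
  simpa only [h] using this

open Machine in
lemma PolyTime.const [hk : FixedArity inp] (w : Bits) : PolyTime inp (fun _ => w) := by
  apply Clean.polyTime
  obtain ⟨k, hk⟩ := hk.arity
  induction w with
  | nil =>
    refine ⟨skip, fun _ => 1, PolyBdd.const 1, fun a => ?_⟩
    rw [initTapes_append_nil]
    exact RunsIn.skip _
  | cons b w ih =>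
    obtain ⟨p, T, hT, h⟩ := ih
    refine ⟨seq p (push k b), fun a => T a + 1, hT.add (PolyBdd.const 1), fun a => ?_⟩
    refine ((h a).seq (RunsIn.push k b _)).congr ?_
    simp [initTapes_append, hk]

open Machine in
lemma polyTime_tail : PolyTime (fun x : Bits => [x]) List.tail := by
  rw [polyTime_iff]
  refine ⟨pop 0, fun _ => 1, PolyBdd.const 1, fun x => ⟨_, RunsIn.pop 0 _, ?_⟩⟩
  simp [initTapes]

open Machine in
lemma polyTime_cons (b : Bool) : PolyTime (fun x : Bits => [x]) (List.cons b) := by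
  rw [polyTime_iff]
  refine ⟨push 0 b, fun _ => 1, PolyBdd.const 1, fun x => ⟨_, RunsIn.push 0 b _, ?_⟩⟩
  simp [initTapes]

/-- Selection by the first bit. -/
def selectBits (c x y z : Bits) : Bits := match c with
  | [] => x
  | false :: _ => y
  | true :: _ => z

open Machine in
lemma polyTime_selectBits :
    PolyTime (fun a : Bits × Bits × Bits × Bits => [a.1, a.2.1, a.2.2.1, a.2.2.2])
      (fun a => selectBits a.1 a.2.1 a.2.2.1 a.2.2.2) := by
  apply Clean.polyTime
  refine ⟨branch 0 (copy 1 4 5) (copy 2 4 5) (copy 3 4 5), fun a =>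
    (9 * totalSize [a.1, a.2.1, a.2.2.1, a.2.2.2] + 2) + 1,
    (((PolyBdd.const 9).mul PolyBdd.size).add (PolyBdd.const 2)).add (PolyBdd.const 1), ?_⟩
  rintro ⟨c, x, y, z⟩
  have key : ∀ i, 0 < i → i < 4 → RunsIn (copy i 4 5) (initTapes [c, x, y, z])
      (9 * totalSize [c, x, y, z] + 2)
      (initTapes ([c, x, y, z] ++ [initTapes [c, x, y, z] i])) := fun i _ hi => by
    have h := runsIn_copy (i := i) (j := 4) (q := 5) (by omega) (by omega) (by omega)
      (initTapes [c, x, y, z]) (by simp [initTapes]) (by simp [initTapes])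
    refine (h.mono ?_).congr ?_
    · have := length_getD_le [c, x, y, z] i
      simp only [initTapes]; omega
    · rw [initTapes_append]; rfl
  match c with
  | [] => exact RunsIn.branch_nil rfl (key 1 (by omega) (by omega))
  | false :: c => exact RunsIn.branch_cons (b := false) rfl (key 2 (by omega) (by omega))
  | true :: c => exact RunsIn.branch_cons (b := true) rfl (key 3 (by omega) (by omega))

variable [FixedArity inp] {f g h k : α → Bits}

lemma PolyTime.tail (hf : PolyTime inp f) : PolyTime inp (fun a => (f a).tail) :=
  polyTime_tail.comp f [f] (by simpa using hf) (fun _ => rfl)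

lemma PolyTime.cons (b : Bool) (hf : PolyTime inp f) : PolyTime inp (fun a => b :: f a) :=
  (polyTime_cons b).comp f [f] (by simpa using hf) (fun _ => rfl)

lemma PolyTime.select (hf : PolyTime inp f) (hg : PolyTime inp g) (hh : PolyTime inp h)
    (hk : PolyTime inp k) : PolyTime inp (fun a => selectBits (f a) (g a) (h a) (k a)) :=
  polyTime_selectBits.comp (fun a => (f a, g a, h a, k a)) [f, g, h, k]
    (by simp [hf, hg, hh, hk]) (fun _ => rfl)

lemma PolyTime.reverse (hf : PolyTime inp f) : PolyTime inp (fun a => (f a).reverse) := by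
  have h1 : PolyTime inp (fun a => (f a).foldl (fun acc b => b :: acc) []) := by
    refine foldl (step := fun _ acc b => b :: acc) hf (const []) ?_ (PolyBdd.const 1) (by simp)
    have h0 := input
      (inp := fun p : α × Bits × Bool => p.2.1 :: [p.2.2] :: inp p.1) (f := fun p => p.2.1) 0
      (fun _ => rfl)
    have h1 := input
      (inp := fun p : α × Bits × Bool => p.2.1 :: [p.2.2] :: inp p.1) (f := fun p => [p.2.2]) 1
      (fun _ => rfl)
    refine (congrArg _ (funext fun p => ?_)).mp (h1.select h0 (h0.cons false) (h0.cons true))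
    rcases p with ⟨a, acc, b⟩
    cases b <;> rfl
  simpa using h1

end

section

variable {α : Type} {inp : α → List Bits} [FixedArity inp] {f g u : α → Bits}

lemma PolyTime.congr (h : PolyTime inp f) (e : ∀ a, f a = g a) : PolyTime inp g := by
  rwa [← funext e]

lemma PolyTime.of_subset {β : Type} {inp' : β → List Bits} [FixedArity inp']
    (φ : β → α) (hf : PolyTime inp f)
    (j : ℕ) (hj : ∀ b i, (inp' b).getD (j + i) [] = (inp (φ b)).getD i []) :
    PolyTime inp' (fun b => f (φ b)) := by
  obtain ⟨k, hk'⟩ := FixedArity.arity (inp := inp)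
  refine hf.comp φ ((List.range k).map (fun i b => (inp' b).getD (j + i) [])) ?_ ?_
  · intro g hg
    simp only [List.mem_map, List.mem_range] at hg
    obtain ⟨i, -, rfl⟩ := hg
    exact polyTime_proj _
  · intro b
    apply ext_getElem
    · simp [hk']
    · intro i h1 h2
      simp only [List.getElem_map, List.getElem_range, hj]
      simp [getElem?_eq_getElem h1]

/-- The inputs of one step of an iteration: accumulator, current bit, and the original inputs. -/
abbrev stepInput (inp : α → List Bits) (p : α × Bits × Bool) : List Bits :=
  p.2.1 :: [p.2.2] :: inp p.1

lemma PolyTime.lift (hf : PolyTime inp f) : PolyTime (stepInput inp) (fun p => f p.1) :=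
  hf.of_subset (fun p : α × Bits × Bool => p.1) 2 (fun p i => by
    rw [show 2 + i = i + 1 + 1 by omega]; simp)

lemma PolyTime.acc : PolyTime (stepInput inp) (fun p => p.2.1) := input 0 (fun _ => rfl)

lemma PolyTime.bit : PolyTime (stepInput inp) (fun p => [p.2.2]) := input 1 (fun _ => rfl)

lemma PolyTime.append (hf : PolyTime inp f) (hg : PolyTime inp g) :
    PolyTime inp (fun a => f a ++ g a) := by
  have h1 : PolyTime inp (fun a => (f a).reverse.foldl (fun acc b => b :: acc) (g a)) := by
    refine foldl (step := fun _ acc b => b :: acc) hf.reverse hg ?_ (PolyBdd.const 1) (by simp)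
    refine (PolyTime.bit.select acc (acc.cons false) (acc.cons true)).congr ?_
    rintro ⟨a, acc, b⟩
    cases b <;> rfl
  exact h1.congr (fun a => by simp)

lemma foldl_tail (u x : Bits) : u.foldl (fun acc _ => acc.tail) x = x.drop u.length := by
  induction u generalizing x with
  | nil => simp
  | cons b u ih => simp [ih]

/-- Drop as many bits as the string `u` has. -/
lemma PolyTime.drop (hf : PolyTime inp f) (hu : PolyTime inp u) :
    PolyTime inp (fun a => (f a).drop (u a).length) := by
  have h1 : PolyTime inp (fun a => (u a).foldl (fun acc _ => acc.tail) (f a)) :=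
    foldl (step := fun _ acc _ => acc.tail) hu hf acc.tail
      (PolyBdd.const 0) (by simp)
  exact h1.congr (fun a => foldl_tail _ _)

/-- Take as many bits as the string `u` has. -/
lemma PolyTime.take (hf : PolyTime inp f) (hu : PolyTime inp u) :
    PolyTime inp (fun a => (f a).take (u a).length) := by
  refine ((hf.reverse.drop (hf.drop hu)).reverse).congr (fun a => ?_)
  rw [List.drop_reverse, List.reverse_reverse]
  simp only [List.length_drop]
  by_cases h : (u a).length ≤ (f a).length
  · rw [Nat.sub_sub_self h]
  · rw [take_of_length_le (by omega), take_of_length_le (by omega)]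

lemma PolyTime.delimit (hf : PolyTime inp f) : PolyTime inp (fun a => delimit (f a)) := by
  have h1 : PolyTime inp (fun a =>
      (f a).reverse.foldl (fun acc b => true :: b :: acc) [false]) := by
    refine foldl (step := fun _ acc b => true :: b :: acc) hf.reverse
      (const _) ?_ (PolyBdd.const 2) (by simp)
    refine ((PolyTime.bit.select acc (acc.cons false) (acc.cons true)).cons true).congr ?_
    rintro ⟨a, acc, b⟩
    cases b <;> rfl
  refine h1.congr (fun a => ?_)
  rw [List.foldl_reverse]
  induction f a with
  | nil => rfl
  | cons b x ih => simp [_root_.delimit, ih]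

lemma PolyTime.packBits (gs : List (α → Bits)) (hgs : ∀ g ∈ gs, PolyTime inp g) :
    PolyTime inp (fun a => packBits (gs.map (fun g => g a))) := by
  induction gs with
  | nil => exact const []
  | cons g gs ih => exact ((hgs g (by simp)).delimit).append (ih (fun g' h => hgs g' (by simp [h])))

lemma PolyTime.flatten (gs : List (α → Bits)) (hgs : ∀ g ∈ gs, PolyTime inp g) :
    PolyTime inp (fun a => (gs.map (fun g => g a)).flatten) := by
  induction gs with
  | nil => exact const []
  | cons g gs ih => exact (hgs g (by simp)).append (ih (fun g' h => hgs g' (by simp [h])))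

/-! ### Unary numbers -/

lemma PolyTime.ones_length (hf : PolyTime inp f) : PolyTime inp (fun a => ones (f a).length) := by
  have h1 : PolyTime inp (fun a => (f a).foldl (fun acc _ => true :: acc) []) :=
    foldl (step := fun _ acc _ => true :: acc) hf (const [])
      (acc.cons true) (PolyBdd.const 1) (by simp)
  refine h1.congr (fun a => ?_)
  have : ∀ x y : Bits, x.foldl (fun acc _ => true :: acc) y = ones x.length ++ y := fun x => by
    induction x with
    | nil => simp [ones]
    | cons b x ih =>
      intro y
      simp only [List.foldl_cons, ih, length_cons, ones]
      rw [List.replicate_succ']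
      simp
  simpa using this (f a) []

lemma ones_add (x y : ℕ) : ones (x + y) = ones x ++ ones y := List.replicate_add ..

@[simp] theorem length_ones (n : ℕ) : (ones n).length = n := List.length_replicate

lemma PolyTime.ones_add {x y : α → ℕ} (hx : PolyTime inp (fun a => ones (x a)))
    (hy : PolyTime inp (fun a => ones (y a))) : PolyTime inp (fun a => ones (x a + y a)) :=
  (hx.append hy).congr (fun a => (_root_.ones_add _ _).symm)

lemma PolyTime.ones_mul {x y : α → ℕ} (hx : PolyTime inp (fun a => ones (x a)))
    (hy : PolyTime inp (fun a => ones (y a))) : PolyTime inp (fun a => ones (x a * y a)) := by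
  have h1 : PolyTime inp (fun a => (ones (x a)).foldl (fun acc _ => ones (y a) ++ acc) []) :=
    foldl (step := fun a acc _ => ones (y a) ++ acc) hx (const [])
      (hy.lift.append acc) hy.size_bdd (by simp [add_comm])
  refine h1.congr (fun a => ?_)
  induction x a with
  | zero => simp [ones]
  | succ k ih =>
    rw [_root_.ones_add k 1, List.foldl_append, ih, Nat.succ_mul, add_comm, _root_.ones_add]
    rfl

lemma PolyTime.ones_const (k : ℕ) : PolyTime inp (fun _ => ones k) := const _

lemma PolyTime.ones_eval (P : Polynomial ℕ) {x : α → ℕ} (hx : PolyTime inp (fun a => ones (x a))) :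
    PolyTime inp (fun a => ones (P.eval (x a))) := by
  induction P using Polynomial.induction_on' with
  | add p q hp hq => simpa using hp.ones_add hq
  | monomial k c =>
    simp only [Polynomial.eval_monomial]
    refine (ones_const c).ones_mul ?_
    induction k with
    | zero => simpa using ones_const 1
    | succ k ih => simpa only [pow_succ] using ih.ones_mul hx

end

/-! ### Decidable predicates and functions with finitely many values -/

open Classical in
/-- A predicate that can be decided in polynomial time. -/
def DecPT {α : Type} (inp : α → List Bits) (P : α → Prop) : Prop :=
  PolyTime inp (fun a => [decide (P a)])

/-- A function into a finite type that can be computed in polynomial time. -/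
def FinPT {α ι : Type} (inp : α → List Bits) (key : α → ι) : Prop :=
  ∀ i, DecPT inp (fun a => key a = i)

section

variable {α ι κ : Type} {inp : α → List Bits} [FixedArity inp] {f g u : α → Bits}
  {P Q : α → Prop} {key : α → ι} {key' : α → κ}

lemma DecPT.congr (h : DecPT inp P) (e : ∀ a, P a ↔ Q a) : DecPT inp Q := by
  have : P = Q := funext fun a => propext (e a)
  rwa [← this]

open Classical in
lemma PolyTime.ite (hP : DecPT inp P) (hf : PolyTime inp f) (hg : PolyTime inp g) :
    PolyTime inp (fun a => if P a then f a else g a) := by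
  refine (select hP hg hg hf).congr (fun a => ?_)
  by_cases h : P a <;> simp [h, selectBits]

lemma DecPT.const (p : Prop) : DecPT inp (fun _ => p) := PolyTime.const _

lemma DecPT.not (hP : DecPT inp P) : DecPT inp (fun a => ¬ P a) := by
  refine (PolyTime.ite hP (PolyTime.const [false]) (PolyTime.const [true])).congr (fun a => ?_)
  by_cases h : P a <;> simp [h]

lemma DecPT.and (hP : DecPT inp P) (hQ : DecPT inp Q) : DecPT inp (fun a => P a ∧ Q a) := by
  refine (PolyTime.ite hP hQ (PolyTime.const [false])).congr (fun a => ?_)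
  by_cases h : P a <;> simp [h]

lemma DecPT.or (hP : DecPT inp P) (hQ : DecPT inp Q) : DecPT inp (fun a => P a ∨ Q a) := by
  refine (PolyTime.ite hP (PolyTime.const [true]) hQ).congr (fun a => ?_)
  by_cases h : P a <;> simp [h]

lemma DecPT.forall_mem (L : List κ) {R : κ → α → Prop} (h : ∀ j ∈ L, DecPT inp (R j)) :
    DecPT inp (fun a => ∀ j ∈ L, R j a) := by
  induction L with
  | nil => exact (const True).congr (by simp)
  | cons j L ih => exact ((h j (by simp)).and (ih (fun i hi => h i (by simp [hi])))).congr (by simp)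

lemma DecPT.forall_finite [Finite κ] {R : κ → α → Prop} (h : ∀ j, DecPT inp (R j)) :
    DecPT inp (fun a => ∀ j, R j a) := by
  have := Fintype.ofFinite κ
  exact (forall_mem Finset.univ.toList (fun j _ => h j)).congr (by simp)

lemma DecPT.eq_nil (hf : PolyTime inp f) : DecPT inp (fun a => f a = []) := by
  refine (hf.select (PolyTime.const [true]) (PolyTime.const [false])
    (PolyTime.const [false])).congr (fun a => ?_)
  rcases h : f a with _ | ⟨_ | _, _⟩ <;> simp [selectBits, h]

lemma DecPT.head_eq (hf : PolyTime inp f) (b : Bool) :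
    DecPT inp (fun a => (f a).head? = some b) := by
  refine (hf.select (PolyTime.const [false]) (PolyTime.const [!b])
    (PolyTime.const [b])).congr (fun a => ?_)
  rcases h : f a with _ | ⟨_ | _, _⟩ <;> cases b <;> simp [selectBits, h]

lemma DecPT.eq_const (hf : PolyTime inp f) (w : Bits) : DecPT inp (fun a => f a = w) := by
  induction w generalizing f with
  | nil => exact eq_nil hf
  | cons b w ih =>
    refine ((head_eq hf b).and (ih hf.tail)).congr (fun a => ?_)
    rcases f a with _ | ⟨c, x⟩ <;> simp

lemma DecPT.length_le (hf : PolyTime inp f) (hg : PolyTime inp g) :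
    DecPT inp (fun a => (f a).length ≤ (g a).length) :=
  (eq_nil (hf.drop hg)).congr (fun a => by simp)

lemma DecPT.length_eq (hf : PolyTime inp f) (hg : PolyTime inp g) :
    DecPT inp (fun a => (f a).length = (g a).length) :=
  ((length_le hf hg).and (length_le hg hf)).congr (fun a => by omega)

lemma DecPT.of_bool {b : α → Bool} (h : PolyTime inp (fun a => [b a])) :
    DecPT inp (fun a => b a = true) := PolyTime.congr h (fun a => by simp)

lemma PolyTime.cases [Finite ι] (hk : FinPT inp key) {F : ι → α → Bits}
    (hF : ∀ i, PolyTime inp (F i)) : PolyTime inp (fun a => F (key a) a) := by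
  classical
  have := Fintype.ofFinite ι
  have h1 : ∀ L : List ι, PolyTime inp (fun a => if key a ∈ L then F (key a) a else []) := by
    intro L
    induction L with
    | nil => exact (const []).congr (by simp)
    | cons i L ih =>
      refine (ite (hk i) (hF i) ih).congr (fun a => ?_)
      by_cases h : key a = i <;> simp [h]
  exact (h1 Finset.univ.toList).congr (by simp)

lemma FinPT.congr {key₂ : α → ι} (h : FinPT inp key) (e : ∀ a, key a = key₂ a) :
    FinPT inp key₂ := by rwa [← funext e]

lemma FinPT.const (i : ι) : FinPT inp (fun _ => i) := fun _ => DecPT.const _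

lemma FinPT.cases [Finite ι] (hk : FinPT inp key) {F : ι → α → κ} (hF : ∀ i, FinPT inp (F i)) :
    FinPT inp (fun a => F (key a) a) := fun j => PolyTime.cases hk (fun i => hF i j)

lemma FinPT.map [Finite ι] (hk : FinPT inp key) (G : ι → κ) : FinPT inp (fun a => G (key a)) :=
  FinPT.cases hk (F := fun i _ => G i) (fun i => const _)

lemma FinPT.map₂ {ν : Type} [Finite ι] [Finite κ] (hk : FinPT inp key) (hk' : FinPT inp key')
    (G : ι → κ → ν) : FinPT inp (fun a => G (key a) (key' a)) :=
  FinPT.cases hk (F := fun i a => G i (key' a)) (fun i => hk'.map _)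

lemma FinPT.pi {ν : κ → Type} [Finite κ] {K : ∀ j, α → ν j} (h : ∀ j, FinPT inp (K j)) :
    FinPT inp (fun a j => K j a) := fun v =>
  (DecPT.forall_finite (fun j => h j (v j))).congr (fun a => by simp [funext_iff])

lemma FinPT.dec [Finite ι] (hk : FinPT inp key) (R : ι → Prop) : DecPT inp (fun a => R (key a)) := by
  classical
  exact PolyTime.congr (PolyTime.cases hk (F := fun i _ => [decide (R i)])
    (fun i => PolyTime.const _)) (fun a => by simp)

open Classical in
lemma DecPT.fin (h : DecPT inp P) : FinPT inp (fun a => decide (P a)) := fun b => by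
  cases b
  · exact h.not.congr (fun a => by simp)
  · exact h.congr (fun a => by simp)

lemma FinPT.ite [DecidablePred P] (hP : DecPT inp P) {k₁ k₂ : α → ι} (h₁ : FinPT inp k₁)
    (h₂ : FinPT inp k₂) : FinPT inp (fun a => if P a then k₁ a else k₂ a) := fun i => by
  refine ((hP.and (h₁ i)).or (hP.not.and (h₂ i))).congr (fun a => ?_)
  by_cases h : P a <;> simp [h]

/-- A string that equals one of finitely many constants, as an element of a finite type. -/
lemma FinPT.decode [Finite ι] (hf : PolyTime inp f) (c : ι → Bits) (G : (ι → Prop) → κ) :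
    FinPT inp (fun a => G (fun i => f a = c i)) := by
  classical
  have h : FinPT inp (fun a (i : ι) => decide (f a = c i)) := pi (ν := fun _ => Bool) (fun i => by
      have := (DecPT.eq_const hf (c i)).fin
      exact this.congr (fun a => by congr))
  exact (h.map (fun v => G (fun i => v i = true))).congr (fun a => by simp)

/-- The bit at the position given by the length of `u`. -/
lemma DecPT.getElem_eq (hf : PolyTime inp f) (hu : PolyTime inp u) (b : Bool) :
    DecPT inp (fun a => (f a)[(u a).length]? = some b) :=
  (head_eq (hf.drop hu) b).congr (fun a => by simp)

lemma FinPT.comp {β : Type} {inp' : β → List Bits} [FixedArity inp']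
    {kb : β → ι} (hf : FinPT inp' kb) (φ : α → β) (gs : List (α → Bits))
    (hgs : ∀ g ∈ gs, PolyTime inp g) (hφ : ∀ a, inp' (φ a) = gs.map (fun g => g a)) :
    FinPT inp (fun a => kb (φ a)) := fun i => PolyTime.comp (hf i) φ gs hgs hφ

/-- Iteration of a map on a finite type. -/
lemma FinPT.iterate [Finite ι] {q₀ : α → ι} (hq : FinPT inp q₀) {δ : α → ℕ → ι → ι}
    (hδ : ∀ i, FinPT (fun p : α × ℕ => ones p.2 :: inp p.1) (fun p => δ p.1 p.2 i))
    {N : α → ℕ} (hN : PolyTime inp (fun a => ones (N a))) :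
    FinPT inp (fun a => Nat.rec (motive := fun _ => ι) (q₀ a) (fun t q => δ a t q) (N a)) := by
  classical
  intro i₀
  have := Fintype.ofFinite ι
  set w := card ι with hw
  set c : ι → Bits := fun i => ofFn (fun j : Fin w => decide (equivFin ι i = j))
    with hc
  have hcl : ∀ i, (c i).length = w := fun i => by simp [hc]
  have hcinj : ∀ i j, c i = c j ↔ i = j := fun i j => by
    constructor
    · intro h
      have := congrFun (List.ofFn_injective h) (equivFin ι i)
      simp only [decide_true] at this
      have := of_decide_eq_true this.symm
      exact ((equivFin ι).injective this).symm
    · rintro rfl; rfl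
  set dec : (ι → Prop) → ι := fun R => if h : ∃ i, R i then h.choose else i₀ with hdec
  have hdecc : ∀ i, dec (fun j => c i = c j) = i := fun i => by
    have h : ∃ j, c i = c j := ⟨i, rfl⟩
    simp only [hdec, dif_pos h]
    exact ((hcinj _ _).1 h.choose_spec).symm
  set st : α → Bits → Bool → Bits := fun a acc _ =>
    c (δ a (acc.drop w).length (dec (fun j => acc.take w = c j))) ++ true :: acc.drop w with hst
  have hfold : PolyTime inp (fun a => (ones (N a)).foldl (st a) (c (q₀ a))) := by
    refine PolyTime.foldl hN ?_ ?_ (PolyBdd.const (w + 1)) ?_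
    · exact PolyTime.cases hq (F := fun i _ => c i) (fun i => PolyTime.const _)
    · have hdrop : PolyTime (stepInput inp) (fun p => p.2.1.drop w) :=
        (PolyTime.acc.drop (PolyTime.const (ones w))).congr (fun p => by simp)
      have htake : PolyTime (stepInput inp) (fun p => p.2.1.take w) :=
        (PolyTime.acc.take (PolyTime.const (ones w))).congr (fun p => by simp)
      have hkey : FinPT (stepInput inp) (fun p => dec (fun j => p.2.1.take w = c j)) :=
        decode htake c dec
      have hnew : FinPT (stepInput inp) (fun p =>
          δ p.1 (p.2.1.drop w).length (dec (fun j => p.2.1.take w = c j))) := by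
        refine FinPT.cases hkey (F := fun i p => δ p.1 (p.2.1.drop w).length i) (fun i => ?_)
        intro j
        obtain ⟨k, hk⟩ := FixedArity.arity (inp := inp)
        refine PolyTime.comp (hδ i j) (fun p : α × Bits × Bool => (p.1, (p.2.1.drop w).length))
          ((fun p => ones (p.2.1.drop w).length) ::
            (List.range k).map (fun i p => (inp p.1).getD i [])) ?_ ?_
        · intro g hg
          simp only [List.mem_cons, List.mem_map, List.mem_range] at hg
          rcases hg with rfl | ⟨i, -, rfl⟩
          · exact hdrop.ones_length
          · exact (polyTime_proj i).lift
        · intro p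
          simp only [List.map_cons, List.map_map]
          congr 1
          apply ext_getElem
          · simp [hk]
          · intro i h1 h2
            simp [getElem?_eq_getElem h1]
      exact (PolyTime.cases hnew (F := fun i _ => c i) (fun i => PolyTime.const _)).append
        (hdrop.cons true)
    · intro a acc b
      simp only [hst, length_append, hcl, length_cons, List.length_drop]
      omega
  have hval : ∀ a k, (ones k).foldl (st a) (c (q₀ a)) =
      c (Nat.rec (motive := fun _ => ι) (q₀ a) (fun t q => δ a t q) k) ++ ones k := fun a k => by
    induction k with
    | zero => simp [ones]
    | succ k ih =>
      rw [ones_add k 1, List.foldl_append, ih]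
      change st a _ true = _
      simp only [hst]
      rw [List.drop_append_of_le_length (hcl _).ge, List.take_append_of_le_length (hcl _).ge,
        take_of_length_le (hcl _).le, List.drop_of_length_le (hcl _).le, hdecc]
      simp only [List.nil_append, length_ones]
      congr 1
      rw [← ones_add, add_comm, ones_add]
      rfl
  refine (DecPT.eq_const (hfold.take (PolyTime.const (ones w))) (c i₀)).congr (fun a => ?_)
  rw [hval, length_ones, List.take_append_of_le_length (hcl _).ge,
    take_of_length_le (hcl _).le, hcinj]

end

/-! ### Unpacking -/

/-- The first component of a packed list. -/
def fstBits (v : Bits) : Bits :=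
  (v.foldl (fun acc _ => selectBits (v.drop (acc ++ acc).length) acc acc
    (selectBits (v.drop (acc ++ acc).length).tail acc (false :: acc) (true :: acc))) []).reverse

/-- A packed list without its first component. -/
def sndBits (v : Bits) : Bits := v.drop (false :: (fstBits v ++ fstBits v)).length

lemma length_delimit (x : Bits) : (delimit x).length = 2 * x.length + 1 := by
  induction x with
  | nil => rfl
  | cons b x ih => simp [delimit, ih]; omega

lemma drop_delimit (x y : Bits) : (delimit (x ++ y)).drop (2 * x.length) = delimit y := by
  induction x with
  | nil => simp
  | cons b x ih =>
    rw [length_cons, show 2 * (x.length + 1) = 2 * x.length + 1 + 1 by omega]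
    simpa [delimit] using ih

lemma fstBits_delimit (x u : Bits) : fstBits (delimit x ++ u) = x := by
  set v := delimit x ++ u with hv
  have hdrop : ∀ y z, x = y ++ z → v.drop (y.reverse ++ y.reverse).length = delimit z ++ u := by
    rintro y z rfl
    rw [hv, List.drop_append_of_le_length, show (y.reverse ++ y.reverse).length = 2 * y.length by
      simp; omega, drop_delimit]
    rw [length_delimit]
    simp
    omega
  have key : ∀ (s y z : Bits), x = y ++ z → z.length ≤ s.length →
      s.foldl (fun acc _ => selectBits (v.drop (acc ++ acc).length) acc acc
        (selectBits (v.drop (acc ++ acc).length).tail acc (false :: acc) (true :: acc))) y.reverse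
        = x.reverse := fun s => by
    induction s with
    | nil =>
      intro y z hx hz
      have : z = [] := List.length_eq_zero_iff.1 (by simpa using hz)
      simp [hx, this]
    | cons b s ih =>
      intro y z hx hz
      rw [List.foldl_cons, hdrop y z hx]
      rcases z with _ | ⟨c, z⟩
      · simpa [delimit, selectBits] using ih y [] hx (by simp)
      · have := ih (y ++ [c]) z (by simp [hx]) (by simpa using hz)
        cases c <;> simpa [delimit, selectBits] using this
  have := key v [] x rfl (by rw [hv, length_append, length_delimit]; omega)
  rw [fstBits]
  rw [List.reverse_nil] at this
  rw [this, List.reverse_reverse]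

lemma sndBits_delimit (x u : Bits) : sndBits (delimit x ++ u) = u := by
  rw [sndBits, fstBits_delimit]
  rw [show (false :: (x ++ x)).length = (delimit x).length by simp [length_delimit]; omega]
  simp

lemma sndBits_iterate (xs : List Bits) (j : ℕ) :
    sndBits^[j] (packBits xs) = packBits (xs.drop j) := by
  induction j generalizing xs with
  | zero => rfl
  | succ j ih =>
    rw [Function.iterate_succ_apply]
    rcases xs with _ | ⟨x, xs⟩
    · have e : sndBits (packBits []) = packBits [] := rfl
      rw [e, ih [], List.drop_nil, List.drop_nil]
    · rw [packBits, sndBits_delimit]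
      exact ih xs

lemma fstBits_nth (xs : List Bits) (j : ℕ) :
    fstBits (sndBits^[j] (packBits xs)) = xs.getD j [] := by
  rw [sndBits_iterate, getD_eq_getElem?_getD, ← List.head?_drop]
  rcases xs.drop j with _ | ⟨x, ys⟩
  · rfl
  · exact fstBits_delimit _ _

lemma packBits_eq_nil (xs : List Bits) : packBits xs = [] ↔ xs = [] :=
  ⟨fun h => packBits_injective h, fun h => by rw [h]; rfl⟩

section

variable {α : Type} {inp : α → List Bits} [FixedArity inp] {f : α → Bits}

lemma PolyTime.fstBits (hf : PolyTime inp f) : PolyTime inp (fun a => fstBits (f a)) := by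
  refine (foldl (step := fun a acc _ => selectBits ((f a).drop (acc ++ acc).length) acc acc
    (selectBits ((f a).drop (acc ++ acc).length).tail acc (false :: acc) (true :: acc)))
    hf (const []) ?_ (PolyBdd.const 1) ?_).reverse
  · have hd := hf.lift.drop (acc.append acc)
    exact hd.select acc acc (hd.tail.select acc (acc.cons false) (acc.cons true))
  · intro a acc b
    generalize (f a).drop (acc ++ acc).length = v
    rcases v with _ | ⟨_ | _, v⟩
    · simp [selectBits]
    · simp [selectBits]
    · rcases v with _ | ⟨_ | _, v⟩ <;> simp [selectBits]

lemma PolyTime.sndBits (hf : PolyTime inp f) : PolyTime inp (fun a => sndBits (f a)) :=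
  hf.drop ((hf.fstBits.append hf.fstBits).cons false)

lemma PolyTime.sndBits_iterate (hf : PolyTime inp f) (j : ℕ) :
    PolyTime inp (fun a => _root_.sndBits^[j] (f a)) := by
  induction j with
  | zero => exact hf
  | succ j ih =>
    simp only [Function.iterate_succ_apply']
    exact ih.sndBits

end

open PolyTime (const input ones_const ones_eval)

/-! ## Averages over finite sample spaces -/

section

variable {Ω Ω' : Type} [Fintype Ω] [Fintype Ω']

/-- The average of a function. -/
def avg (g : Ω → ℝ) : ℝ := (∑ ω, g ω) / (card Ω : ℝ)

open Classical in
lemma prob_eq_avg (E : Ω → Prop) : prob E = avg (fun ω => if E ω then (1 : ℝ) else 0) := by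
  rw [prob, avg, Finset.sum_boole]

lemma avg_add (f g : Ω → ℝ) : avg (fun ω => f ω + g ω) = avg f + avg g := by
  simp [avg, sum_add_distrib, add_div]

lemma avg_sub (f g : Ω → ℝ) : avg (fun ω => f ω - g ω) = avg f - avg g := by
  simp [avg, sum_sub_distrib, sub_div]

lemma avg_mul_left (c : ℝ) (f : Ω → ℝ) : avg (fun ω => c * f ω) = c * avg f := by
  simp only [avg]
  rw [← mul_sum, mul_div_assoc]

lemma avg_mul_right (c : ℝ) (f : Ω → ℝ) : avg (fun ω => f ω * c) = avg f * c := by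
  simp only [mul_comm _ c, avg_mul_left]

lemma avg_sum {ι : Type*} (s : Finset ι) (f : ι → Ω → ℝ) :
    avg (fun ω => ∑ i ∈ s, f i ω) = ∑ i ∈ s, avg (f i) := by
  simp only [avg, ← sum_div]
  rw [sum_comm]

lemma avg_mono {f g : Ω → ℝ} (h : ∀ ω, f ω ≤ g ω) : avg f ≤ avg g := by
  unfold avg
  gcongr with ω
  exact h ω

lemma avg_const [Nonempty Ω] (c : ℝ) : avg (fun _ : Ω => c) = c := by
  have : (card Ω : ℝ) ≠ 0 := by exact_mod_cast Fintype.card_ne_zero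
  simp [avg, this]

lemma abs_avg_le (f : Ω → ℝ) : |avg f| ≤ avg (fun ω => |f ω|) := by
  rw [avg, avg, abs_div, Nat.abs_cast]
  gcongr
  exact abs_sum_le_sum_abs _ _

lemma prob_nonneg (E : Ω → Prop) : 0 ≤ prob E := div_nonneg (Nat.cast_nonneg _) (Nat.cast_nonneg _)

lemma prob_mono {E E' : Ω → Prop} (h : ∀ ω, E ω → E' ω) : prob E ≤ prob E' := by
  classical
  rw [prob_eq_avg, prob_eq_avg]
  refine avg_mono fun ω => ?_
  by_cases h1 : E ω
  · simp [h1, h ω h1]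
  · rw [if_neg h1]; split_ifs <;> norm_num

lemma prob_le_one (E : Ω → Prop) : prob E ≤ 1 := by
  classical
  refine div_le_one_of_le₀ ?_ (Nat.cast_nonneg _)
  exact_mod_cast Finset.card_le_univ _

lemma prob_pos {E : Ω → Prop} {ω : Ω} (h : E ω) : 0 < prob E := by
  classical
  have : Nonempty Ω := ⟨ω⟩
  refine div_pos ?_ (by exact_mod_cast Fintype.card_pos)
  exact_mod_cast Finset.card_pos.2 ⟨ω, by simpa using h⟩

lemma prob_congr {E E' : Ω → Prop} (h : ∀ ω, E ω ↔ E' ω) : prob E = prob E' := by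
  rw [funext fun ω => propext (h ω)]

lemma abs_avg_sub_le {f g : Ω → ℝ} {E : Ω → Prop} {B : ℝ} (hB : ∀ ω, |f ω - g ω| ≤ B)
    (h : ∀ ω, ¬ E ω → f ω = g ω) : |avg f - avg g| ≤ B * prob E := by
  classical
  rw [← avg_sub, prob_eq_avg, ← avg_mul_left]
  refine (abs_avg_le _).trans (avg_mono fun ω => ?_)
  by_cases hE : E ω
  · simpa [hE] using hB ω
  · simp [hE, h ω hE]

lemma prob_or_le (E E' : Ω → Prop) : prob (fun ω => E ω ∨ E' ω) ≤ prob E + prob E' := by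
  classical
  rw [prob_eq_avg, prob_eq_avg, prob_eq_avg, ← avg_add]
  refine avg_mono fun ω => ?_
  by_cases h1 : E ω <;> by_cases h2 : E' ω <;> simp [h1, h2]

lemma abs_prob_sub_le {E E' D : Ω → Prop} (h : ∀ ω, ¬ D ω → (E ω ↔ E' ω)) :
    |prob E - prob E'| ≤ prob D := by
  classical
  rw [prob_eq_avg, prob_eq_avg]
  refine (abs_avg_sub_le (B := 1) (E := D) (fun ω => ?_) (fun ω hω => ?_)).trans (one_mul _).le
  · split_ifs <;> norm_num
  · simp only [h ω hω]

lemma sum_prob_eq {ι : Type*} [Fintype ι] [Nonempty Ω] (q : Ω → ι) :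
    ∑ i, prob (fun ω => q ω = i) = 1 := by
  classical
  simp only [prob_eq_avg]
  rw [← avg_sum]
  simp [avg_const]

lemma avg_prod (F : Ω × Ω' → ℝ) : avg F = avg (fun ω => avg (fun ω' => F (ω, ω'))) := by
  simp only [avg, sum_prod_type, Fintype.card_prod, Nat.cast_mul, sum_div, div_div]
  simp only [mul_comm]

lemma avg_comm (F : Ω → Ω' → ℝ) :
    avg (fun ω => avg (fun ω' => F ω ω')) = avg (fun ω' => avg (fun ω => F ω ω')) := by
  simp only [avg, sum_div, div_div]
  rw [sum_comm]
  simp only [mul_comm]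

lemma avg_equiv (e : Ω ≃ Ω') (F : Ω' → ℝ) : avg (fun ω => F (e ω)) = avg F := by
  rw [avg, avg, Fintype.card_congr e, e.sum_comp]

/-- The map carries the uniform distribution to the uniform distribution. -/
def Unif (q : Ω → Ω') : Prop := ∀ F : Ω' → ℝ, avg (fun ω => F (q ω)) = avg F

lemma Unif.prob_comp {q : Ω → Ω'} (h : Unif q) (E : Ω' → Prop) :
    prob (fun ω => E (q ω)) = prob E := by
  classical
  rw [prob_eq_avg, prob_eq_avg]
  exact h (fun ω => if E ω then 1 else 0)

lemma Unif.of_equiv (e : Ω ≃ Ω') : Unif e := avg_equiv e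

lemma Unif.comp {Ω'' : Type} [Fintype Ω''] {q : Ω → Ω'} {q' : Ω' → Ω''} (h : Unif q)
    (h' : Unif q') : Unif (fun ω => q' (q ω)) := fun F => by
  rw [h (fun ω => F (q' ω)), h' F]

lemma Unif.snd [Nonempty Ω] : Unif (Prod.snd : Ω × Ω' → Ω') := fun F => by
  rw [avg_prod]
  change avg (fun _ : Ω => avg F) = avg F
  exact avg_const _

lemma Unif.fst [Nonempty Ω'] : Unif (Prod.fst : Ω × Ω' → Ω) := fun F => by
  rw [avg_prod]
  simp only [avg_const]

lemma unif_precomp {ι κ : Type} [Fintype ι] [Fintype κ] [DecidableEq ι] [DecidableEq κ] {j : κ → ι}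
    (hj : Injective j) : Unif (fun (ω : ι → Bool) (k : κ) => ω (j k)) := by
  classical
  intro F
  let e1 := Equiv.piEquivPiSubtypeProd (fun i => i ∈ Set.range j) (fun _ => Bool)
  let e2 : (({i // i ∈ Set.range j}) → Bool) ≃ (κ → Bool) :=
    Equiv.arrowCongr (Equiv.ofInjective j hj).symm (Equiv.refl Bool)
  have h1 := Unif.of_equiv e1
  have h2 : Unif (Prod.fst : ({i // i ∈ Set.range j} → Bool) × ({i // i ∉ Set.range j} → Bool) → _) :=
    Unif.fst
  have h3 := Unif.of_equiv e2
  have := (h1.comp h2).comp h3 F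
  rw [← this]
  rfl

lemma unif_sum_split {ι κ : Type} [Fintype ι] [Fintype κ] [DecidableEq ι] [DecidableEq κ] :
    Unif (fun (ω : ι ⊕ κ → Bool) => ((fun i => ω (Sum.inl i), fun k => ω (Sum.inr k)) :
      (ι → Bool) × (κ → Bool))) := fun F => by
  rw [← avg_equiv (Equiv.sumArrowEquivProdArrow ι κ Bool) F]
  rfl

/-- Expectation of a function of independent random variables. -/
lemma avg_pi_map {ι : Type} [Fintype ι] [DecidableEq ι] {X A : ι → Type} [∀ i, Fintype (X i)]
    [∀ i, Fintype (A i)] (q : ∀ i, X i → A i) (Φ : (∀ i, A i) → ℝ) :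
    avg (fun ω : ∀ i, X i => Φ (fun i => q i (ω i))) =
      ∑ a : ∀ i, A i, (∏ i, prob (fun x => q i x = a i)) * Φ a := by
  classical
  have h1 : ∀ ω : ∀ i, X i, Φ (fun i => q i (ω i)) =
      ∑ a : ∀ i, A i, (if (fun i => q i (ω i)) = a then (1 : ℝ) else 0) * Φ a := by
    intro ω; simp
  simp only [h1]
  rw [avg_sum]
  refine sum_congr rfl fun a _ => ?_
  rw [avg_mul_right]
  congr 1
  simp only [avg, prob, Finset.sum_boole, Finset.prod_div_distrib, Fintype.card_pi, Nat.cast_prod]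
  congr 1
  rw [← Nat.cast_prod, ← Fintype.card_piFinset]
  congr 2
  ext ω
  simp [funext_iff]

end

/-! ## Negligible functions -/

namespace Negligible

lemma zero : Negligible (fun _ => 0) := by
  refine ⟨fun _ => le_rfl, fun c => ?_⟩
  filter_upwards [eventually_gt_atTop 0] with n hn
  positivity

/-- A bound that holds from some point on can be made to hold everywhere. -/
lemma of_eventually {ε : ℕ → ℝ} (h0 : ∀ n, 0 ≤ ε n)
    (h : ∃ ε', Negligible ε' ∧ ∀ᶠ n in atTop, ε n ≤ ε' n) : Negligible ε := by
  obtain ⟨ε', h', he⟩ := h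
  exact ⟨h0, fun c => (he.and (h'.2 c)).mono fun n hn => hn.1.trans_lt hn.2⟩

lemma const_mul {ε : ℕ → ℝ} (h : Negligible ε) {C : ℝ} (hC : 0 ≤ C) :
    Negligible (fun n => C * ε n) := by
  refine ⟨fun n => mul_nonneg hC (h.1 n), fun c => ?_⟩
  filter_upwards [h.2 (c + 1), eventually_gt_atTop 0,
    tendsto_natCast_atTop_atTop.eventually_ge_atTop (C + 1 : ℝ)] with n h1 h2 h3
  have hn : (0 : ℝ) < n := by exact_mod_cast h2
  calc C * ε n ≤ C * (1 / (n : ℝ) ^ (c + 1)) := by gcongr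
    _ < (C + 1) * (1 / (n : ℝ) ^ (c + 1)) := by
      apply mul_lt_mul_of_pos_right (by linarith)
      positivity
    _ ≤ n * (1 / (n : ℝ) ^ (c + 1)) := by gcongr
    _ = 1 / (n : ℝ) ^ c := by rw [pow_succ]; field_simp

lemma add {ε ε' : ℕ → ℝ} (h : Negligible ε) (h' : Negligible ε') :
    Negligible (fun n => ε n + ε' n) := by
  refine ⟨fun n => add_nonneg (h.1 n) (h'.1 n), fun c => ?_⟩
  filter_upwards [(h.const_mul (C := 2) (by norm_num)).2 c,
    (h'.const_mul (C := 2) (by norm_num)).2 c] with n h1 h2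
  linarith

lemma sum {ι : Type*} (s : Finset ι) {ε : ι → ℕ → ℝ} (h : ∀ i ∈ s, Negligible (ε i)) :
    Negligible (fun n => ∑ i ∈ s, ε i n) := by
  classical
  induction s using Finset.induction_on with
  | empty => simpa using zero
  | insert i s hi ih =>
    simp only [Finset.sum_insert hi]
    exact (h i (by simp)).add (ih fun j hj => h j (by simp [hj]))

lemma two_pow_inv : Negligible (fun n => 1 / 2 ^ n) := by
  refine ⟨fun n => by positivity, fun c => ?_⟩
  have h := tendsto_pow_const_mul_const_pow_of_abs_lt_one c (r := 1 / 2) (by norm_num [abs_of_pos])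
  filter_upwards [h.eventually (gt_mem_nhds one_pos), eventually_gt_atTop 0] with n h1 h2
  have hn : (0 : ℝ) < n := by exact_mod_cast h2
  rw [lt_div_iff₀ (by positivity)]
  rw [one_div_pow] at h1
  linarith

end Negligible

/-! ## Binary numbers -/

lemma bitsVal_cons (b : Bool) (x : Bits) : bitsVal (b :: x) = 2 * bitsVal x + b.toNat := by
  simp only [bitsVal, List.foldr_cons, Nat.bit_val]

lemma bitsVal_lt (x : Bits) : bitsVal x < 2 ^ x.length := by
  induction x with
  | nil => simp [bitsVal]
  | cons b x ih =>
    rw [bitsVal_cons, length_cons, pow_succ]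
    cases b <;> simp <;> omega

lemma bitsVal_inj {x y : Bits} (hl : x.length = y.length) (h : bitsVal x = bitsVal y) : x = y := by
  induction x generalizing y with
  | nil => exact (List.length_eq_zero_iff.1 hl.symm).symm
  | cons b x ih =>
    rcases y with _ | ⟨c, y⟩
    · simp at hl
    · rw [bitsVal_cons, bitsVal_cons] at h
      have hbc : b = c := by cases b <;> cases c <;> simp at h ⊢ <;> omega
      subst hbc
      rw [ih (by simpa using hl) (by omega)]

lemma bitsVal_take_succ (x : Bits) (t : ℕ) :
    bitsVal (x.take (t + 1)) = bitsVal (x.take t) + 2 ^ t * (decide (x[t]? = some true)).toNat := by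
  induction x generalizing t with
  | nil => simp
  | cons b x ih =>
    cases t with
    | zero => cases b <;> simp [bitsVal]
    | succ t =>
      simp only [List.take_succ_cons, bitsVal_cons, ih t, List.getElem?_cons_succ]
      ring

/-- The number that a random string represents is uniformly distributed. -/
lemma prob_bitsVal_lt (n C : ℕ) :
    prob (fun ω : Fin n → Bool => bitsVal (ofFn ω) < C) = (min C (2 ^ n) : ℕ) / 2 ^ n := by
  classical
  have hb : Function.Bijective (fun ω : Fin n → Bool =>
      (⟨bitsVal (ofFn ω), by simpa using bitsVal_lt (ofFn ω)⟩ : Fin (2 ^ n))) := by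
    rw [Fintype.bijective_iff_injective_and_card]
    refine ⟨fun ω ω' h => ?_, by simp⟩
    exact List.ofFn_injective (bitsVal_inj (by simp) (by simpa using h))
  rw [prob]
  congr 1
  · congr 1
    have h1 : (Finset.univ.filter (fun ω : Fin n → Bool => bitsVal (ofFn ω) < C)).card =
        (Finset.univ.filter (fun k : Fin (2 ^ n) => (k : ℕ) < C)).card := by
      refine Finset.card_bij (fun ω _ => (Equiv.ofBijective _ hb) ω) ?_ ?_ ?_
      · intro ω h; simpa using h
      · intro ω _ ω' _ h; exact (Equiv.ofBijective _ hb).injective h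
      · intro k hk
        refine ⟨(Equiv.ofBijective _ hb).symm k, ?_, by simp⟩
        have := congrArg Fin.val ((Equiv.ofBijective _ hb).apply_symm_apply k)
        simp only [Equiv.ofBijective_apply] at this
        simp only [Finset.mem_filter, mem_univ, true_and] at hk ⊢
        rw [this]; exact hk
    rw [Fin.card_filter_val_lt, min_comm] at h1
    convert h1
  · simp

section

variable {α : Type} {inp : α → List Bits} [FixedArity inp] {f : α → Bits}

/-- Comparison with a sum of finitely many numbers. -/
lemma DecPT.lt_sum {ι : Type} [Fintype ι] {u : α → Bits} {z : ι → α → Bits}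
    (hu : PolyTime inp u) (hz : ∀ i, PolyTime inp (z i)) :
    DecPT inp (fun a => bitsVal (u a) < ∑ i, bitsVal (z i a)) := by
  classical
  set K := card ι with hK
  let bit : Bits → ℕ → Bool := fun x t => decide (x[t]? = some true)
  let stp : (ι → Bool) → Bool → Fin (K + 1) × Bool → Fin (K + 1) × Bool := fun bs ub q =>
    let s := q.1.val + ∑ i, (bs i).toNat
    (ofNat (K + 1) (s / 2), if ub = decide (s % 2 = 1) then q.2 else decide (s % 2 = 1))
  let δ : α → ℕ → Fin (K + 1) × Bool → Fin (K + 1) × Bool := fun a t q =>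
    stp (fun i => bit (z i a) t) (bit (u a) t) q
  let N : α → ℕ := fun a => (u a ++ (Finset.univ.toList.map (fun i => z i a)).flatten).length
  have hN : PolyTime inp (fun a => ones (N a)) := by
    refine (hu.append ?_).ones_length
    have := PolyTime.flatten (inp := inp) (Finset.univ.toList.map z) (by
      intro g hg
      simp only [List.mem_map] at hg
      obtain ⟨i, -, rfl⟩ := hg
      exact hz i)
    exact this.congr (fun a => by simp [Function.comp_def])
  have hδ : ∀ q, FinPT (fun p : α × ℕ => ones p.2 :: inp p.1) (fun p => δ p.1 p.2 q) := fun q => by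
    have hbit : ∀ g : α → Bits, PolyTime inp g →
        FinPT (fun p : α × ℕ => ones p.2 :: inp p.1) (fun p => bit (g p.1) p.2) := fun g hg => by
      have h1 : PolyTime (fun p : α × ℕ => ones p.2 :: inp p.1) (fun p => g p.1) :=
        hg.of_subset (fun p : α × ℕ => p.1) 1 (fun p i => by rw [add_comm]; simp)
      have h2 : PolyTime (fun p : α × ℕ => ones p.2 :: inp p.1) (fun p => ones p.2) :=
        input 0 (fun _ => rfl)
      exact (getElem_eq h1 h2 true).fin.congr (fun p => by simp [bit])
    exact (FinPT.pi (ν := fun _ : ι => Bool) (fun i => hbit _ (hz i))).map₂ (hbit u hu)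
      (fun bs ub => stp bs ub q)
  have hfin := FinPT.iterate (FinPT.const (inp := inp) ((0 : Fin (K + 1)), false)) hδ hN
  refine (hfin.dec (fun q => 0 < q.1.val ∨ q.2 = true)).congr (fun a => ?_)
  have hinv : ∀ t, ∃ S < 2 ^ t, ∑ i, bitsVal ((z i a).take t) =
      (Nat.rec (motive := fun _ => Fin (K + 1) × Bool) (0, false) (fun t q => δ a t q) t).1.val * 2 ^ t + S ∧
      ((Nat.rec (motive := fun _ => Fin (K + 1) × Bool) (0, false) (fun t q => δ a t q) t).2 = true ↔
        bitsVal ((u a).take t) < S) := fun t => by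
    induction t with
    | zero => exact ⟨0, by simp [bitsVal]⟩
    | succ t ih =>
      obtain ⟨S, hS, h1, h2⟩ := ih
      set q := (Nat.rec (motive := fun _ => Fin (K + 1) × Bool) (0, false)
        (fun t q => δ a t q) t) with hq
      set s := q.1.val + ∑ i, (bit (z i a) t).toNat with hs
      have hsK : ∑ i, (bit (z i a) t).toNat ≤ K := by
        calc ∑ i, (bit (z i a) t).toNat ≤ ∑ i : ι, 1 := sum_le_sum fun i _ => Bool.toNat_le _
          _ = K := by simp [hK]
      have hq1 : (δ a t q).1.val = s / 2 := by
        simp only [δ, stp, ofNat]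
        apply mod_eq_of_lt
        have := q.1.isLt
        omega
      have hmod : s = 2 * (s / 2) + s % 2 := (Nat.div_add_mod s 2).symm
      have hr : s % 2 < 2 := Nat.mod_lt _ (by norm_num)
      refine ⟨2 ^ t * (s % 2) + S, ?_, ?_, ?_⟩
      · rw [pow_succ]; nlinarith
      · change _ = (δ a t q).1.val * _ + _
        rw [hq1]
        simp only [bitsVal_take_succ, sum_add_distrib, h1, ← mul_sum]
        have : q.1.val * 2 ^ t + S + 2 ^ t * ∑ i, (bit (z i a) t).toNat = s * 2 ^ t + S := by
          rw [hs]; ring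
        rw [this]
        conv_lhs => rw [hmod]
        ring
      · change (δ a t q).2 = true ↔ _
        rw [bitsVal_take_succ]
        have hu2 := bitsVal_lt ((u a).take t)
        have hut : bitsVal ((u a).take t) < 2 ^ t :=
          hu2.trans_le (Nat.pow_le_pow_right (by norm_num) (by simp))
        change (if bit (u a) t = decide (s % 2 = 1) then q.2 else decide (s % 2 = 1)) = true ↔
          _ + 2 ^ t * (bit (u a) t).toNat < _
        rcases (show s % 2 = 0 ∨ s % 2 = 1 by omega) with h | h <;> rw [h] <;>
          cases bit (u a) t <;> simp [h2] <;> omega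
  obtain ⟨S, hS, h1, h2⟩ := hinv (N a)
  have hzN : ∀ i, (z i a).length ≤ N a := fun i => by
    have : z i a ∈ Finset.univ.toList.map (fun i => z i a) := by simp
    have := List.Sublist.length_le (List.sublist_flatten_of_mem this)
    simp only [N, length_append]
    omega
  have huN : (u a).length ≤ N a := by simp [N]
  rw [take_of_length_le huN] at h2
  rw [sum_congr rfl (fun i _ => by rw [take_of_length_le (hzN i)])] at h1
  rw [h2, h1]
  have huv : bitsVal (u a) < 2 ^ N a :=
    (bitsVal_lt _).trans_le (Nat.pow_le_pow_right (by norm_num) huN)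
  generalize (Nat.rec (motive := fun _ => Fin (K + 1) × Bool) (0, false)
    (fun t q => δ a t q) (N a)).1.val = c at *
  rcases Nat.eq_zero_or_pos c with hc | hc
  · subst hc; simp
  · have : 2 ^ N a ≤ c * 2 ^ N a := Nat.le_mul_of_pos_left _ hc
    constructor
    · intro; omega
    · intro; exact Or.inl hc

/-- Remove leading zeros (the most significant bits come last). -/
def trimBits (x : Bits) : Bits :=
  x.foldr (fun b acc => selectBits acc (if b then [true] else []) (b :: acc) (b :: acc)) []

lemma trimBits_eq (x : Bits) : trimBits x = bits (bitsVal x) := by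
  induction x with
  | nil => simp [trimBits, bitsVal]
  | cons b x ih =>
    have h : trimBits (b :: x) = selectBits (trimBits x) (if b then [true] else [])
        (b :: trimBits x) (b :: trimBits x) := rfl
    have hb : bitsVal (b :: x) = Nat.bit b (bitsVal x) := rfl
    rw [h, ih, hb]
    generalize bitsVal x = k
    rcases Nat.eq_zero_or_pos k with hk | hk
    · subst hk
      cases b <;> simp [selectBits]
    · rw [Nat.bits_append_bit k b (by omega)]
      rcases hb : bits k with _ | ⟨c, y⟩
      · have := bitsVal_bits k
        rw [hb] at this
        simp [bitsVal] at this
        omega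
      · cases c <;> rfl

lemma PolyTime.trimBits (hf : PolyTime inp f) : PolyTime inp (fun a => trimBits (f a)) := by
  have h1 : PolyTime inp (fun a => (f a).reverse.foldl (fun acc b =>
      selectBits acc (if b then [true] else []) (b :: acc) (b :: acc)) []) := by
    refine foldl (step := fun _ acc b =>
      selectBits acc (if b then [true] else []) (b :: acc) (b :: acc)) hf.reverse
      (const []) ?_ (PolyBdd.const 1) ?_
    · have hc : PolyTime (stepInput inp) (fun p => p.2.2 :: p.2.1) :=
        (PolyTime.bit.append acc).congr (fun p => rfl)
      have hb : PolyTime (stepInput inp) (fun p => if p.2.2 then [true] else []) := by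
        refine (PolyTime.bit.select (const []) (const []) (const [true])).congr ?_
        rintro ⟨a, acc, b⟩
        cases b <;> rfl
      exact acc.select hb hc hc
    · intro a acc b
      rcases acc with _ | ⟨_ | _, acc⟩ <;> cases b <;> simp [selectBits]
  refine h1.congr (fun a => ?_)
  rw [List.foldl_reverse]
  rfl

end

/-! ## Computable real numbers -/

lemma polyTimeReal_natDiv (N D : ℕ) (hD : 0 < D) (hN : N ≤ D) : PolyTimeReal ((N : ℝ) / D) := by
  have : NeZero D := ⟨hD.ne'⟩
  let inp : ℕ → List Bits := fun k => [ones k]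
  have hones : PolyTime inp ones := input 0 (fun _ => rfl)
  -- the remainders of long division
  let rem : ℕ → Fin D := fun t =>
    Nat.rec (motive := fun _ => Fin D) (ofNat D N) (fun _ r => ofNat D (2 * r.val)) t
  have hrem : ∀ t, (rem t).val = N * 2 ^ t % D := fun t => by
    induction t with
    | zero => simp [rem, ofNat]
    | succ t ih =>
      change (2 * (rem t).val) % D = _
      rw [ih, Nat.mul_mod_mod]
      congr 1
      ring
  let dig : ℕ → Bool := fun t => decide (D ≤ 2 * (rem t).val)
  let st : ℕ → Bits → Bool → Bits := fun _ acc _ => dig acc.tail.length :: acc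
  have hfold : PolyTime inp (fun k => (ones k).foldl (st k) [decide (N = D)]) := by
    refine PolyTime.foldl hones (const _) ?_ (PolyBdd.const 1) (by simp [st])
    have hst := FinPT.iterate (inp := stepInput inp)
      (FinPT.const (ofNat D N)) (δ := fun _ _ r => ofNat D (2 * r.val))
      (fun i => FinPT.const _) (N := fun p => p.2.1.tail.length)
      (PolyTime.acc.tail.ones_length)
    have hd := hst.dec (fun r => D ≤ 2 * r.val)
    exact (PolyTime.append hd PolyTime.acc).congr (fun p => by
      simp only [st, dig, rem, List.singleton_append]; congr)
  have hval : ∀ k, ((ones k).foldl (st k) [decide (N = D)]).length = k + 1 ∧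
      bitsVal ((ones k).foldl (st k) [decide (N = D)]) = N * 2 ^ k / D := by
    have key : ∀ k j, ((ones k).foldl (st j) [decide (N = D)]).length = k + 1 ∧
      bitsVal ((ones k).foldl (st j) [decide (N = D)]) = N * 2 ^ k / D := fun k j => by
      induction k with
      | zero =>
        refine ⟨rfl, ?_⟩
        by_cases h : N = D
        · subst h; simp [ones, bitsVal, Nat.div_self hD]
        · simp [ones, bitsVal, h]
          exact (Nat.div_eq_of_lt (by omega)).symm
      | succ k ih =>
        rw [ones_add k 1, List.foldl_append]
        set x := (ones k).foldl (st j) [decide (N = D)]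
        change (dig x.tail.length :: x).length = _ ∧ bitsVal (dig x.tail.length :: x) = _
        refine ⟨by simp [ih.1], ?_⟩
        rw [bitsVal_cons, ih.2, List.length_tail, ih.1, Nat.add_sub_cancel]
        have h1 : N * 2 ^ k = D * (N * 2 ^ k / D) + N * 2 ^ k % D := (Nat.div_add_mod _ _).symm
        have h2 := Nat.mod_lt (N * 2 ^ k) hD
        set Q := N * 2 ^ k / D
        have h3 : N * 2 ^ (k + 1) = D * (2 * Q) + 2 * (N * 2 ^ k % D) := by
          rw [pow_succ, ← mul_assoc, h1]
          simp only [Nat.mul_add_mod_self_left, Nat.mod_mod]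
          ring
        rw [h3, Nat.mul_add_div hD]
        congr 1
        simp only [dig, hrem]
        by_cases h : D ≤ 2 * (N * 2 ^ k % D)
        · simp only [h, decide_true, Bool.toNat_true]
          symm
          rw [Nat.div_eq_iff hD]
          omega
        · simp only [h, decide_false, Bool.toNat_false]
          exact (Nat.div_eq_of_lt (by omega)).symm
    exact fun k => key k k
  let w : ℕ → ℕ := fun k => N * 2 ^ k / D
  refine ⟨fun k => (w k : ℤ), ?_, fun k => ?_⟩
  · refine (hfold.trimBits.cons false).congr (fun k => ?_)
    rw [trimBits_eq, (hval k).2]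
    have hcode : ∀ v : ℕ, intCode (v : ℤ) = false :: bits v := fun v => by simp [intCode]
    exact (hcode (w k)).symm
  · have hDr : (0 : ℝ) < D := by exact_mod_cast hD
    have h1 : (N * 2 ^ k / D : ℕ) * D ≤ N * 2 ^ k := Nat.div_mul_le_self _ _
    have h2 : N * 2 ^ k < (N * 2 ^ k / D : ℕ) * D + D := Nat.lt_div_mul_add hD
    change |_ - ((w k : ℤ) : ℝ) / 2 ^ k| ≤ _
    have hw : N * 2 ^ k / D = w k := rfl
    rw [hw] at h1 h2
    set Q := w k
    have h1' : (Q : ℝ) * D ≤ N * 2 ^ k := by exact_mod_cast h1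
    have h2' : (N : ℝ) * 2 ^ k < Q * D + D := by exact_mod_cast h2
    have h2k : (0 : ℝ) < 2 ^ k := by positivity
    have e : (N : ℝ) / D - ((Q : ℤ) : ℝ) / 2 ^ k = (N * 2 ^ k - Q * D) / (D * 2 ^ k) := by
      push_cast
      field_simp
    rw [e, abs_of_nonneg (div_nonneg (by linarith) (by positivity)),
      div_le_div_iff₀ (by positivity) h2k]
    nlinarith

lemma polyTimeReal_rat (q : ℚ) (h0 : 0 ≤ q) (h1 : q ≤ 1) : PolyTimeReal (q : ℝ) := by
  have h := polyTimeReal_natDiv q.num.toNat q.den q.den_pos (by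
    have := Rat.num_le_denom_iff.2 h1
    omega)
  convert h using 1
  have hn : ((q.num.toNat : ℕ) : ℝ) = (q.num : ℝ) := by
    have : ((q.num.toNat : ℤ)) = q.num := Int.toNat_of_nonneg (Rat.num_nonneg.2 h0)
    exact_mod_cast congrArg (Int.cast (R := ℝ)) this
  rw [hn]
  exact (Rat.cast_def q)

/-! ## Sampling -/

/-- A security parameter and a string as input. -/
notation "inp₂" => fun a : ℕ × Bits => [ones (Prod.fst a), Prod.snd a]

/-- A security parameter and two strings as input. -/
notation "inp₃" => fun a : ℕ × Bits × Bits =>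
  [ones (Prod.fst a), Prod.fst (Prod.snd a), Prod.snd (Prod.snd a)]

lemma PolyTime.args₂ : PolyTime inp₂ (fun a => ones a.1) ∧ PolyTime inp₂ (fun a => a.2) :=
  ⟨input 0 fun _ => rfl, input 1 fun _ => rfl⟩

lemma PolyTime.args₃ : PolyTime inp₃ (fun a => ones a.1) ∧ PolyTime inp₃ (fun a => a.2.1) ∧
    PolyTime inp₃ (fun a => a.2.2) :=
  ⟨input 0 fun _ => rfl, input 1 fun _ => rfl, input 2 fun _ => rfl⟩

/-- Distributions on a finite set with polynomial-time computable probabilities can be sampled in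
polynomial time, with an exponentially small error. -/
lemma exists_sampler {ι : Type} [Fintype ι] [Nonempty ι] (p : ι → ℝ) (hp0 : ∀ i, 0 ≤ p i)
    (hp1 : ∑ i, p i = 1) (hp : ∀ i, PolyTimeReal (p i)) : ∃ samp : ℕ → Bits → ι,
      FinPT inp₂ (fun a => samp a.1 a.2) ∧ ∃ C : ℝ, 0 ≤ C ∧ ∀ n i,
        |prob (fun ω : Fin n → Bool => samp n (ofFn ω) = i) - p i| ≤ C * (1 / 2 ^ n) := by
  classical
  choose z hz hzp using hp
  set K := card ι with hK
  have hK0 : 0 < K := Fintype.card_pos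
  let e : Fin K ≃ ι := (equivFin ι).symm
  let Cs : ℕ → ℕ → ℕ := fun n t => ∑ i : Fin K, if i.val < t then (z (e i) n).toNat else 0
  let P : (Fin K → Bool) → Fin K → Prop := fun v s => s.val + 1 = K ∨ v s = true
  have hP : ∀ v, ({s | P v s} : Set (Fin K)).Nonempty :=
    fun v => ⟨⟨K - 1, by omega⟩, Or.inl (by simp; omega)⟩
  let idx : (Fin K → Bool) → Fin K := fun v => WellFounded.min wellFounded_lt {s | P v s} (hP v)
  let vec : ℕ → Bits → Fin K → Bool := fun n r s => decide (bitsVal r < Cs n (s.val + 1))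
  refine ⟨fun n r => e (idx (vec n r)), ?_, 2 * K, by positivity, ?_⟩
  · refine FinPT.map (FinPT.pi (ν := fun _ => Bool) (fun s => ?_)) (fun v => e (idx v))
    obtain ⟨hones, hr⟩ := PolyTime.args₂
    have hzi : ∀ i : Fin K, PolyTime inp₂
        (fun a => if i.val < s.val + 1 then bits (z (e i) a.1).toNat else []) := fun i => by
      by_cases h : i.val < s.val + 1
      · simp only [h, if_true]
        have h1 := (hz (e i)).comp (inp := inp₂)
          (fun a : ℕ × Bits => a.1) [fun a => ones a.1] (by simpa using hones) (fun _ => rfl)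
        refine (h1.select (const []) h1.tail (const [])).congr (fun a => ?_)
        by_cases hneg : z (e i) a.1 < 0
        · simp [intCode, selectBits, hneg, Int.toNat_of_nonpos hneg.le]
        · simp only [intCode, selectBits, hneg, decide_false, List.tail_cons]
          congr 1
          omega
      · simp only [h, if_false]
        exact const []
    refine ((DecPT.lt_sum hr hzi).fin).congr (fun a => ?_)
    simp only [Cs]
    congr 2
    have : ∀ i : Fin K, bitsVal (if i.val < s.val + 1 then bits (z (e i) a.1).toNat else []) =
        if i.val < s.val + 1 then (z (e i) a.1).toNat else 0 := fun i => by
      split_ifs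
      · exact bitsVal_bits _
      · rfl
    rw [sum_congr rfl fun i _ => this i]
  · intro n i
    have hmono : ∀ s t, s ≤ t → Cs n s ≤ Cs n t := fun s t hst => by
      refine sum_le_sum fun i _ => ?_
      split_ifs <;> omega
    have hidx : ∀ r t, t ≤ K → ((idx (vec n r)).val < t ↔ t = K ∨ bitsVal r < Cs n t) := by
      intro r t ht
      have hmem := WellFounded.min_mem wellFounded_lt {s | P (vec n r) s} (hP _)
      have hmin := fun x hx => WellFounded.not_lt_min wellFounded_lt {s | P (vec n r) s} (x := x) hx
      change P (vec n r) (idx (vec n r)) at hmem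
      change ∀ x, P (vec n r) x → ¬ x < idx (vec n r) at hmin
      constructor
      · intro h
        rcases hmem with h1 | h1
        · left; omega
        · right
          exact (of_decide_eq_true h1).trans_le (hmono _ _ h)
      · rintro (h | h)
        · subst h; exact (idx (vec n r)).isLt
        · rcases Nat.eq_zero_or_pos t with h0 | h0
          · subst h0
            simp [Cs] at h
          · have := hmin ⟨t - 1, by omega⟩ (Or.inr (by
              simp only [vec, decide_eq_true_eq]
              rw [show t - 1 + 1 = t by omega]; exact h))
            rw [Fin.lt_def] at this
            simp only at this
            omega
    let T : ℕ → ℝ := fun t => prob (fun ω : Fin n → Bool => (idx (vec n (ofFn ω))).val < t)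
    let c : ℕ → ℝ := fun t => ∑ i : Fin K, if i.val < t then p (e i) else 0
    have hcle : ∀ t, c t ≤ 1 := fun t => by
      rw [← hp1, ← e.sum_comp]
      refine sum_le_sum fun i _ => ?_
      split_ifs
      · exact le_rfl
      · exact hp0 _
    have h2n : (0 : ℝ) < 2 ^ n := by positivity
    have hT : ∀ t ≤ K, |T t - c t| ≤ K * (1 / 2 ^ n) := fun t ht => by
      by_cases htK : t = K
      · have h1 : T t = 1 := by
          have : T t = prob (fun ω : Fin n → Bool => True) := prob_congr fun ω => by rw [htK]; simp
          rw [this, prob_eq_avg]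
          simp [avg_const]
        have h2 : c t = 1 := by
          rw [← hp1, ← e.sum_comp]
          exact sum_congr rfl fun i _ => if_pos (by rw [htK]; exact i.isLt)
        rw [h1, h2, sub_self, abs_zero]
        positivity
      · have h1 : T t = (min (Cs n t) (2 ^ n) : ℕ) / 2 ^ n := by
          rw [← prob_bitsVal_lt]
          exact prob_congr fun ω => by rw [hidx _ _ ht]; simp [htK]
        have h2 : |(Cs n t : ℝ) / 2 ^ n - c t| ≤ K * (1 / 2 ^ n) := by
          have : (Cs n t : ℝ) / 2 ^ n - c t =
              ∑ i : Fin K, if i.val < t then ((z (e i) n).toNat : ℝ) / 2 ^ n - p (e i) else 0 := by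
            simp only [Cs, c]
            push_cast
            rw [sum_div, ← sum_sub_distrib]
            refine sum_congr rfl fun i _ => ?_
            split_ifs <;> simp
          rw [this]
          refine (abs_sum_le_sum_abs _ _).trans ?_
          calc _ ≤ ∑ i : Fin K, (1 / 2 ^ n : ℝ) := by
                refine sum_le_sum fun i _ => ?_
                split_ifs
                · have hi := hzp (e i) n
                  have h0 := hp0 (e i)
                  rcases le_or_gt 0 (z (e i) n) with hz0 | hz0
                  · have : ((z (e i) n).toNat : ℝ) = (z (e i) n : ℝ) := by
                      exact_mod_cast congrArg (Int.cast (R := ℝ)) (Int.toNat_of_nonneg hz0)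
                    rw [this, abs_sub_comm]; exact hi
                  · rw [Int.toNat_of_nonpos hz0.le]
                    have hzr : (z (e i) n : ℝ) / 2 ^ n ≤ 0 :=
                      div_nonpos_of_nonpos_of_nonneg (by exact_mod_cast hz0.le) h2n.le
                    rw [abs_of_nonneg (by linarith)] at hi
                    simp only [Nat.cast_zero, zero_div, zero_sub, abs_neg, abs_of_nonneg h0]
                    linarith
                · simp
            _ = K * (1 / 2 ^ n) := by simp

        rw [h1]
        push_cast
        rw [← min_div_div_right h2n.le, div_self h2n.ne']
        refine le_trans ?_ h2
        rcases le_total ((Cs n t : ℝ) / 2 ^ n) 1 with h | h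
        · rw [min_eq_left h]
        · rw [min_eq_right h, abs_of_nonneg (by linarith [hcle t]),
            abs_of_nonneg (by linarith [hcle t])]
          linarith
    obtain ⟨s, rfl⟩ := e.surjective i
    have hsplit : prob (fun ω : Fin n → Bool => e (idx (vec n (ofFn ω))) = e s) =
        T (s.val + 1) - T s.val := by
      simp only [T, prob_eq_avg]
      rw [← avg_sub]
      congr 1
      funext ω
      simp only [e.injective.eq_iff, Fin.ext_iff]
      rcases lt_trichotomy (idx (vec n (ofFn ω))).val s.val with h | h | h
      · rw [if_neg h.ne, if_pos (by omega), if_pos h]; norm_num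
      · rw [if_pos h, if_pos (by omega), if_neg (by omega)]; norm_num
      · rw [if_neg h.ne', if_neg (by omega), if_neg (by omega)]; norm_num
    have hps : p (e s) = c (s.val + 1) - c s.val := by
      simp only [c]
      rw [← sum_sub_distrib, sum_eq_single s]
      · simp
      · intro b _ hb
        have : b.val ≠ s.val := fun h => hb (Fin.ext h)
        split_ifs <;> first | omega | simp
      · simp
    rw [hsplit, hps]
    have h1 := hT (s.val + 1) s.isLt
    have h2 := hT s.val s.isLt.le
    rw [abs_le] at *
    constructor <;> linarith

/-! ## Plays of finite games -/

/-- The history after `t` moves when every action is chosen by `p`. -/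
def histOf {Act : Type} (p : List Act → Act) : ℕ → List Act
  | 0 => []
  | t + 1 => histOf p t ++ [p (histOf p t)]

@[simp] theorem length_histOf {Act : Type} (p : List Act → Act) (t : ℕ) :
    (histOf p t).length = t := by
  induction t with
  | zero => rfl
  | succ t ih => simp [histOf, ih]

lemma histOf_eq {Act : Type} {p : List Act → Act} {h : List Act}
    (hh : ∀ t (ht : t < h.length), p (h.take t) = h[t]) : histOf p h.length = h := by
  have key : ∀ t ≤ h.length, histOf p t = h.take t := fun t => by
    induction t with
    | zero => intro _; simp [histOf]
    | succ t ih =>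
      intro ht
      rw [histOf, ih (by omega), hh t ht, List.take_append_getElem]
  rw [key _ le_rfl, List.take_length]

lemma histOf_prefix {Act : Type} (p : List Act → Act) {s t : ℕ} (h : s ≤ t) :
    histOf p s <+: histOf p t := by
  induction t with
  | zero => rw [Nat.le_zero.1 h]
  | succ t ih =>
    rcases Nat.lt_or_ge t s with h1 | h1
    · rw [show s = t + 1 by omega]
    · exact (ih h1).trans (List.prefix_append _ _)

lemma prefix_histOf_iff {Act : Type} (p : List Act → Act) {t : ℕ} {h : List Act} :
    h <+: histOf p t ↔ h.length ≤ t ∧ h = histOf p h.length := by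
  constructor
  · intro hp
    have hl : h.length ≤ t := by simpa using hp.length_le
    refine ⟨hl, ?_⟩
    exact (List.prefix_of_prefix_length_le hp (histOf_prefix p hl) (by simp)).eq_of_length (by simp)
  · rintro ⟨hl, he⟩
    rw [he]
    exact histOf_prefix p hl

lemma histOf_congr {Act : Type} {p q : List Act → Act} {T : ℕ}
    (h : ∀ t < T, p (histOf p t) = q (histOf p t)) : histOf p T = histOf q T := by
  have key : ∀ t ≤ T, histOf p t = histOf q t := fun t => by
    induction t with
    | zero => intro _; rfl
    | succ t ih =>
      intro ht
      rw [histOf, histOf, ← ih (by omega), h t ht]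
  exact key T le_rfl

section

variable {c : ℕ} {Act Info : Type} (G : ExtGame c Act Info)

lemma ExtGame.outcome_eq {pol : ∀ h, G.NT h → Act} {p : List Act → Act} {T : ℕ}
    (hpol : ∀ h hh, pol h hh = p h) (hp : ∀ t < T, G.NT (histOf p t))
    (hm : ∀ h, G.NT h → h ++ [p h] ∈ G.H) (hT : ¬ G.NT (histOf p T)) :
    G.outcome pol = histOf p T := by
  have hit : ∀ k, (G.step pol)^[k] [] = histOf p (min k T) := fun k => by
    induction k with
    | zero => simp [histOf]
    | succ k ih =>
      rw [Function.iterate_succ_apply', ih, step]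
      rcases Nat.lt_or_ge k T with h | h
      · rw [min_eq_left h.le, min_eq_left h, dif_pos (hp k h), hpol]
        rfl
      · rw [min_eq_right h, min_eq_right (by omega), dif_neg hT]
  rw [outcome, hit, min_eq_right]
  rcases Nat.eq_zero_or_pos T with h0 | h0
  · omega
  · have hmem : histOf p T ∈ G.H := by
      obtain ⟨t, rfl⟩ : ∃ t, T = t + 1 := ⟨T - 1, by omega⟩
      exact hm _ (hp t (by omega))
    have := Finset.le_sup (f := List.length) (G.finite.mem_toFinset.2 hmem)
    simpa using this

end

section

variable {c : ℕ} {Act Info : Type} {T : ℕ} {L : ℕ → Set Act} {hL : ∀ t, (L t).Finite}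
  {mover : ℕ → Fin c} {obs : List Act → Info} {hobs : ∀ h h', obs h = obs h' → h.length = h'.length}
  {u : List Act → Fin c → ℝ}

lemma stageGame_append {h : List Act} {a : Act} : h ++ [a] ∈ (stageGame T L hL mover obs hobs u).H ↔
      h ∈ (stageGame T L hL mover obs hobs u).H ∧ h.length < T ∧ a ∈ L h.length := by
  constructor
  · intro hm
    refine ⟨ExtGame.prefix_mem _ _ _ hm, ?_, hm.2 h.length a (by simp)⟩
    have := hm.1
    simp at this
    omega
  · rintro ⟨hm, hl, ha⟩
    refine ⟨by simpa using hl, fun t b hb => ?_⟩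
    rcases lt_or_ge t h.length with ht | ht
    · rw [getElem?_append_left ht] at hb
      exact hm.2 t b hb
    · rw [List.getElem?_append_right ht] at hb
      obtain ⟨ht', hb'⟩ := getElem?_eq_some_iff.1 hb
      simp only [List.length_singleton] at ht'
      have : t = h.length := by omega
      subst this
      simp at hb'
      rwa [← hb']

lemma stageGame_NT (hne : ∀ t < T, (L t).Nonempty) {h : List Act} :
    (stageGame T L hL mover obs hobs u).NT h ↔
      h ∈ (stageGame T L hL mover obs hobs u).H ∧ h.length < T := by
  constructor
  · rintro ⟨a, ha⟩
    have := stageGame_append.1 ha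
    exact ⟨this.1, this.2.1⟩
  · rintro ⟨hm, hl⟩
    obtain ⟨a, ha⟩ := hne _ hl
    exact ⟨a, stageGame_append.2 ⟨hm, hl, ha⟩⟩

lemma stageGame_terminal (hne : ∀ t < T, (L t).Nonempty) {h : List Act} :
    (stageGame T L hL mover obs hobs u).Terminal h ↔
      h ∈ (stageGame T L hL mover obs hobs u).H ∧ h.length = T := by
  rw [ExtGame.Terminal, stageGame_NT hne]
  constructor
  · rintro ⟨hm, hn⟩
    have h1 : h.length ≤ T := hm.1
    exact ⟨hm, by by_contra h2; exact hn ⟨hm, by omega⟩⟩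
  · rintro ⟨hm, hl⟩
    exact ⟨hm, fun h => by omega⟩

lemma stageGame_histOf_mem (hne : ∀ t < T, (L t).Nonempty) {p : List Act → Act}
    (hm : ∀ h, (stageGame T L hL mover obs hobs u).NT h →
      h ++ [p h] ∈ (stageGame T L hL mover obs hobs u).H) {t : ℕ} (ht : t ≤ T) :
    histOf p t ∈ (stageGame T L hL mover obs hobs u).H := by
  induction t with
  | zero => exact ExtGame.nil_mem _
  | succ t ih => exact hm _ ((stageGame_NT hne).2 ⟨ih (by omega), by simpa using ht⟩)

lemma stageGame_outcome (hne : ∀ t < T, (L t).Nonempty)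
    {pol : ∀ h, (stageGame T L hL mover obs hobs u).NT h → Act} {p : List Act → Act}
    (hpol : ∀ h hh, pol h hh = p h)
    (hm : ∀ h, (stageGame T L hL mover obs hobs u).NT h →
      h ++ [p h] ∈ (stageGame T L hL mover obs hobs u).H) :
    (stageGame T L hL mover obs hobs u).outcome pol = histOf p T := by
  refine ExtGame.outcome_eq _ hpol (fun t ht => ?_) hm ?_
  · exact (stageGame_NT hne).2 ⟨stageGame_histOf_mem hne hm ht.le, by simpa using ht⟩
  · rw [stageGame_NT hne]
    simp

end

/-! ## The order of moves -/

lemma gOrder_fin (m : ℕ) (t : Fin (m + 2)) : gOrder m t = Equiv.swap 0 1 t := by simp [gOrder]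

lemma gStage_gOrder {m : ℕ} (t : Fin (m + 2)) : gStage (gOrder m t) = 3 + t := by
  rw [gOrder_fin, gStage, Equiv.swap_apply_self]

lemma three_le_gStage {m : ℕ} (i : Fin (m + 2)) : 3 ≤ gStage i := by simp [gStage]

lemma gStage_lt {m : ℕ} (i : Fin (m + 2)) : gStage i < m + 5 := by
  have := (Equiv.swap 0 1 i : Fin (m + 2)).isLt
  simp only [gStage]
  omega

lemma gOrder_gStage {m : ℕ} (i : Fin (m + 2)) : gOrder m (gStage i - 3) = i := by
  rw [gStage, Nat.add_sub_cancel_left, gOrder_fin, Equiv.swap_apply_self]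

lemma corrMover_add (m t : ℕ) : corrMover m (3 + t) = gOrder m t := by
  rw [show 3 + t = t + 3 from Nat.add_comm 3 t]; rfl

lemma corrMover_gStage {m : ℕ} (i : Fin (m + 2)) : corrMover m (gStage i) = i := by
  have h := three_le_gStage i
  rw [show gStage i = 3 + (gStage i - 3) by omega, corrMover_add, gOrder_gStage]

/-! ## The envelope game -/

instance : DecidableEq CorrAct := Classical.decEq _

/-- The number in an action. -/
def CorrAct.num : CorrAct → ℕ
  | enclose a => a
  | pick b => b
  | move x => x
  | _ => 0

/-- What a player knows in the normal-form part: the number in the envelope if he knows it, the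
number that has been picked, and whether the envelope has been opened. -/
abbrev Lab (l : ℕ) : Type := Option (Fin l) × Fin l × Bool

/-- What player `i` knows after the first three moves. -/
def labOf {l m : ℕ} (i : Fin (m + 2)) (a b : Fin l) (r : Bool) : Lab l :=
  (if i = 0 ∨ r = true then some a else none, b, r)

section

variable {m : ℕ} (Γ : NormalForm m) (l : ℕ)

/-- A deterministic strategy of player `i`: the number he puts into the envelope or picks, whether
he opens the envelope, and his action in the normal-form part. -/
abbrev Data (i : Fin (m + 2)) : Type := (Fin l × (Fin l → Fin l → Bool)) × (Lab l → Fin (Γ.size i))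

/-- Terminal histories: the numbers, whether the envelope is opened, and the action profile. -/
abbrev Out : Type := Fin l × Fin l × Bool × (∀ i, Fin (Γ.size i))

end

section

variable {S : CommitmentScheme} {m : ℕ} {Γ : NormalForm m} {l n : ℕ} [NeZero l]
  [∀ i, NeZero (Γ.size i)] {i : Fin (m + 2)}

/-- The players of `Γ`. -/
local notation "ℙ" => Fin (m + 2)

/-- The envelope game. -/
local notation "✉" => corrGame Γ l

/-- The sequence of cryptographic games. -/
local notation "⌘" => cryptoGame S Γ l

/-- The map to histories of the envelope game. -/
local notation "♮" => corrMap S l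

/-- The outcome of a profile of deterministic strategies. -/
def outOf (D : ∀ i, Data Γ l i) : Out Γ l := ((D 0).1.1, (D 1).1.1, (D 0).1.2 (D 0).1.1 (D 1).1.1,
    fun i => (D i).2 (labOf i (D 0).1.1 (D 1).1.1 ((D 0).1.2 (D 0).1.1 (D 1).1.1)))

/-- The third action. -/
def revAct (r : Bool) : CorrAct := if r then reveal else destroy

/-- The list of the moves in the normal-form part. -/
def moveList (u : ∀ i, Fin (Γ.size i)) : List CorrAct := ofFn (fun t : ℙ => move (u (gOrder m t)))

/-- The terminal history with given data. -/
def mkHist (o : Out Γ l) : List CorrAct :=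
  enclose o.1 :: pick o.2.1 :: revAct o.2.2.1 :: moveList o.2.2.2

lemma length_mkHist (o : Out Γ l) : (mkHist o).length = m + 5 := by simp [mkHist, moveList]

lemma revAct_injective : Injective revAct := fun a b h => by
  cases a <;> cases b <;> simp [revAct] at h ⊢

lemma mkHist_injective : Injective (mkHist (Γ := Γ) (l := l)) := by
  rintro ⟨a, b, r, u⟩ ⟨a', b', r', u'⟩ h
  simp only [mkHist, List.cons.injEq, enclose.injEq, pick.injEq] at h
  obtain ⟨h1, h2, h3, h4⟩ := h
  rw [Fin.ext h1, Fin.ext h2, revAct_injective h3]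
  congr 3
  funext i
  have hg : gOrder m (Equiv.swap 0 1 i : ℙ) = i := by rw [gOrder_fin, Equiv.swap_apply_self]
  have := congrFun (List.ofFn_injective h4) (Equiv.swap 0 1 i)
  simp only [move.injEq] at this
  rw [hg] at this
  exact Fin.ext this

/-- The information set of player `i` in the normal-form part. -/
def labInfo (i : ℙ) (L : Lab l) : List (Option CorrAct) :=
  L.1.map (fun a : Fin l => enclose a) :: some (pick L.2.1) :: some (revAct L.2.2) ::
    List.replicate (gStage i - 3) none

lemma corrObs_three {a b : Fin l} {r : Bool} {ms : List CorrAct}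
    (hms : ∀ x ∈ ms, ∃ k, x = move k) (hlen : ms.length < m + 2) :
    corrObs m (enclose a :: pick b :: revAct r :: ms) =
      labInfo (gOrder m ms.length) (labOf (gOrder m ms.length) a b r) := by
  have hmv : corrMover m (enclose a :: pick b :: revAct r :: ms).length = gOrder m ms.length := rfl
  have hr : reveal ∈ (enclose a :: pick b :: revAct r :: ms) ↔ r = true := by
    simp only [List.mem_cons, reduceCtorEq, false_or]
    constructor
    · rintro (h | h)
      · cases r
        · simp [revAct] at h
        · rfl
      · obtain ⟨k, hk⟩ := hms _ h
        simp at hk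
    · rintro rfl; simp [revAct]
  rw [corrObs, hmv]
  simp only [List.map_cons, corrSee, hr]
  rw [labInfo]
  congr 1
  · simp only [labOf]
    split_ifs <;> rfl
  · congr 1
    congr 1
    · cases r <;> rfl
    · rw [show gStage (gOrder m ms.length) - 3 = ms.length by
        have := gStage_gOrder (m := m) ⟨ms.length, hlen⟩
        simp only at this
        omega]
      apply ext_getElem
      · simp
      · intro n h1 h2
        obtain ⟨k, hk⟩ := hms _ (List.getElem_mem (by simpa using h1 : n < ms.length))
        simp only [List.getElem_map, hk, List.getElem_replicate]
        rfl

lemma moveList_take_mem {u : ∀ i, Fin (Γ.size i)} {t : ℕ} {x : CorrAct}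
    (hx : x ∈ (moveList u).take t) : ∃ k, x = move k := by
  have := List.mem_of_mem_take hx
  simp only [moveList, List.mem_ofFn] at this
  obtain ⟨s, rfl⟩ := this
  exact ⟨_, rfl⟩

lemma corrObs_mkHist_take (o : Out Γ l) {t : ℕ} (ht : t < m + 2) :
    corrObs m ((mkHist o).take (t + 3)) =
      labInfo (gOrder m t) (labOf (gOrder m t) o.1 o.2.1 o.2.2.1) := by
  have hl : ((moveList o.2.2.2).take t).length = t := by simp [moveList]; omega
  have := corrObs_three (a := o.1) (b := o.2.1) (r := o.2.2.1)
    (ms := (moveList o.2.2.2).take t) (fun x hx => moveList_take_mem hx) (by rw [hl]; exact ht)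
  rw [hl] at this
  exact this

lemma mkHist_getElem (o : Out Γ l) {t : ℕ} (ht : t < m + 2) (h : t + 3 < (mkHist o).length) :
    (mkHist o)[t + 3] = move (o.2.2.2 (gOrder m t)) := by
  simp only [mkHist, List.getElem_cons_succ, moveList, getElem_ofFn]

lemma corrChoice_mkHist (o : Out Γ l) (i : ℙ) : corrChoice (mkHist o) i = o.2.2.2 i := by
  have h3 := three_le_gStage i
  have hlt := gStage_lt i
  obtain ⟨t, ht⟩ : ∃ t, gStage i = t + 3 := ⟨gStage i - 3, by omega⟩
  have hg : gOrder m t = i := by rw [← gOrder_gStage i, ht]; rfl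
  rw [corrChoice, ht, getElem?_eq_getElem (by rw [length_mkHist]; omega),
    mkHist_getElem o (by omega)]
  simp only [Option.map_some, Option.getD_some, CorrAct.moveVal]
  rw [hg]

lemma corrActions_nonempty (t : ℕ) : (corrActions Γ l t).Nonempty := by
  rcases t with _ | _ | _ | t
  · exact ⟨_, 0, pos_of_ne_zero (NeZero.ne l), rfl⟩
  · exact ⟨_, 0, pos_of_ne_zero (NeZero.ne l), rfl⟩
  · exact ⟨_, Or.inl rfl⟩
  · exact ⟨_, 0, pos_of_ne_zero (NeZero.ne _), rfl⟩

lemma corrGame_append {h : List CorrAct} {a : CorrAct} : h ++ [a] ∈ ✉.H ↔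
      h ∈ ✉.H ∧ h.length < m + 5 ∧ a ∈ corrActions Γ l h.length := stageGame_append

lemma corrGame_NT {h : List CorrAct} : ✉.NT h ↔ h ∈ ✉.H ∧ h.length < m + 5 :=
  stageGame_NT (fun t _ => corrActions_nonempty t)

lemma mkHist_mem_actions (o : Out Γ l) {t : ℕ} (h : t < (mkHist o).length) :
    (mkHist o)[t] ∈ corrActions Γ l t := by
  rw [length_mkHist] at h
  rcases t with _ | _ | _ | t
  · exact ⟨o.1, o.1.2, rfl⟩
  · exact ⟨o.2.1, o.2.1.2, rfl⟩
  · change revAct _ ∈ ({reveal, destroy} : Set CorrAct)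
    cases o.2.2.1 <;> simp [revAct]
  · rw [mkHist_getElem o (by omega)]
    exact ⟨_, (o.2.2.2 _).2, rfl⟩

lemma mkHist_mem (o : Out Γ l) : mkHist o ∈ ✉.H := by
  refine ⟨(length_mkHist o).le, fun t a ha => ?_⟩
  obtain ⟨ht, rfl⟩ := getElem?_eq_some_iff.1 ha
  exact mkHist_mem_actions o ht

lemma mkHist_take_mem (o : Out Γ l) (t : ℕ) : (mkHist o).take t ∈ ✉.H := by
  refine ⟨by simp [length_mkHist], fun s a ha => ?_⟩
  obtain ⟨hs, rfl⟩ := getElem?_eq_some_iff.1 ha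
  rw [List.getElem_take]
  exact mkHist_mem_actions o _

/-- Every history is part of a terminal history. -/
lemma exists_mkHist {h : List CorrAct} (hh : h ∈ ✉.H) :
    ∃ o : Out Γ l, h = (mkHist o).take h.length := by
  let o : Out Γ l := (ofNat l (h.getD 0 destroy).num,
    ofNat l (h.getD 1 destroy).num, decide (h[2]? = some reveal),
    fun i => ofNat _ (h.getD (gStage i) destroy).num)
  refine ⟨o, ?_⟩
  have hlen : h.length ≤ m + 5 := hh.1
  apply ext_getElem
  · simp [length_mkHist, hlen]
  · intro t h1 h2
    rw [List.getElem_take]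
    have hm := hh.2 t _ (getElem?_eq_getElem h1)
    have hget : h.getD t destroy = h[t] := by simp [getElem?_eq_getElem h1]
    rcases t with _ | _ | _ | t
    · obtain ⟨a, ha, he⟩ := hm
      change _ = enclose (ofNat l _)
      rw [hget, he]
      simp [CorrAct.num, mod_eq_of_lt ha]
    · obtain ⟨a, ha, he⟩ := hm
      change _ = pick (ofNat l _)
      rw [hget, he]
      simp [CorrAct.num, mod_eq_of_lt ha]
    · change _ = revAct (decide _)
      rw [getElem?_eq_getElem h1]
      rcases hm with he | he
      · simp [he, revAct]
      · have he' : h[0 + 1 + 1] = destroy := he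
        simp [he', revAct]
    · rw [mkHist_getElem o (by omega)]
      have hg : gStage (gOrder m t) = t + 1 + 1 + 1 := by
        have := gStage_gOrder (m := m) ⟨t, by omega⟩
        simp only at this; omega
      obtain ⟨a, ha, he⟩ := hm
      simp only [o, hg, hget]
      rw [he]
      simp [CorrAct.num, mod_eq_of_lt ha]

lemma corrGame_terminal {h : List CorrAct} : ✉.Terminal h ↔ ∃ o : Out Γ l, mkHist o = h := by
  have h1 : ✉.Terminal h ↔ h ∈ ✉.H ∧ h.length = m + 5 :=
    stageGame_terminal (fun t _ => corrActions_nonempty t)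
  rw [h1]
  constructor
  · rintro ⟨hm, hl⟩
    obtain ⟨o, ho⟩ := exists_mkHist hm
    refine ⟨o, ?_⟩
    rw [ho, take_of_length_le (by rw [length_mkHist, hl])]
  · rintro ⟨o, rfl⟩
    exact ⟨mkHist_mem o, length_mkHist o⟩

lemma corrGame_terminals :
    ✉.terminals = Finset.univ.map ⟨mkHist (Γ := Γ) (l := l), mkHist_injective⟩ := by
  ext h
  simp [ExtGame.terminals, corrGame_terminal]

lemma corrGame_util (o : Out Γ l) (i : ℙ) : ✉.util (mkHist o) i = Γ.payoff o.2.2.2 i := by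
  change Γ.payoffNat (corrChoice (mkHist o)) i = _
  rw [NormalForm.payoffNat]
  have h : ∀ j, corrChoice (mkHist o) j = o.2.2.2 j := corrChoice_mkHist o
  rw [dif_pos (fun j => by rw [h]; exact (o.2.2.2 j).2)]
  congr 1
  funext j
  exact Fin.ext (h j)

/-! ### Deterministic strategies -/

open Classical in
/-- The action of a deterministic strategy at the information set with a given label. -/
def detAct (s : ✉.Det i) (I : List (Option CorrAct)) : CorrAct :=
  if h : ∃ h ∈ ✉.turns i, ✉.info h = I then (s ⟨I, h⟩).1
  else destroy

/-- The data of a deterministic strategy. -/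
def toData (s : ✉.Det i) : Data Γ l i := ((ofNat l (detAct s (if i = 0 then [] else [none])).num,
    fun a b => decide (detAct s [some (enclose a), some (pick b)] = reveal)),
    fun L => ofNat _ (detAct s (labInfo i L)).num)

/-- The action that belongs to the data of a strategy at an information set. -/
def dataAct (D : Data Γ l i) : List (Option CorrAct) → CorrAct
  | [] => enclose D.1.1
  | [_] => pick D.1.1
  | [x, y] => revAct (D.1.2 (ofNat l (x.getD destroy).num) (ofNat l (y.getD destroy).num))
  | x :: y :: z :: _ => move (D.2 (x.map (fun c => ofNat l c.num),
      ofNat l (y.getD destroy).num, decide (z = some reveal)))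

lemma dataAct_mem (D : Data Γ l i) {h : List CorrAct}
    (hh : h ∈ ✉.turns i) : h ++ [dataAct D (corrObs m h)] ∈ ✉.H := by
  obtain ⟨hN, hi⟩ := hh
  rw [corrGame_NT] at hN
  refine corrGame_append.2 ⟨hN.1, hN.2, ?_⟩
  change corrMover m h.length = i at hi
  have hl : (corrObs m h).length = h.length := by simp [corrObs]
  rw [← hl] at hi ⊢
  generalize corrObs m h = I at hi ⊢
  rcases I with _ | ⟨x, _ | ⟨y, _ | ⟨z, I⟩⟩⟩
  · exact ⟨_, D.1.1.2, rfl⟩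
  · exact ⟨_, D.1.1.2, rfl⟩
  · change revAct _ ∈ ({reveal, destroy} : Set CorrAct)
    generalize D.1.2 _ _ = r
    cases r <;> simp [revAct]
  · subst hi
    exact ⟨_, Fin.isLt _, rfl⟩

/-- The deterministic strategy with given data. -/
def ofData (D : Data Γ l i) : ✉.Det i := fun I => ⟨dataAct D I.1, fun h hh => by
    rw [← hh.2]
    exact dataAct_mem D hh.1⟩

lemma detAct_mem (s : ✉.Det i) {h : List CorrAct}
    (hh : h ∈ ✉.turns i) : h ++ [detAct s (corrObs m h)] ∈ ✉.H := by
  have he : ∃ h' ∈ ✉.turns i, ✉.info h' = corrObs m h := ⟨h, hh, rfl⟩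
  rw [detAct, dif_pos he]
  exact (s ⟨corrObs m h, he⟩).2 h ⟨hh, rfl⟩

lemma detAct_ofData (D : Data Γ l i) {h : List CorrAct}
    (hh : h ∈ ✉.turns i) : detAct (ofData D) (corrObs m h) = dataAct D (corrObs m h) := by
  have he : ∃ h' ∈ ✉.turns i, ✉.info h' = corrObs m h := ⟨h, hh, rfl⟩
  rw [detAct, dif_pos he]
  rfl

/-- Two strategies of player `i` that agree at all information sets. -/
def Agree (i : ℙ) (D D' : Data Γ l i) : Prop :=
  (i = 0 ∨ i = 1 → D.1.1 = D'.1.1) ∧ (i = 0 → D.1.2 = D'.1.2) ∧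
    ∀ a b r, D.2 (labOf i a b r) = D'.2 (labOf i a b r)

lemma outOf_congr {D D' : ∀ i, Data Γ l i} (h : ∀ i, Agree i (D i) (D' i)) :
    outOf D = outOf D' := by
  simp only [outOf, (h 0).1 (Or.inl rfl), (h 1).1 (Or.inr rfl), (h 0).2.1 rfl]
  congr 3
  funext i
  exact (h i).2.2 _ _ _

lemma mkHist_take_turns (o : Out Γ l) {t : ℕ} (ht : t < m + 5) :
    (mkHist o).take t ∈ ✉.turns (corrMover m t) := by
  refine ⟨corrGame_NT.2 ⟨mkHist_take_mem o t, by simp [length_mkHist]; omega⟩, ?_⟩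
  change corrMover m ((mkHist o).take t).length = _
  simp [length_mkHist, min_eq_left ht.le]

lemma corrObs_one (m : ℕ) (a : ℕ) : corrObs m [enclose a] = [none] := by
  have : ¬ ((1 : Fin (m + 2)) = 0) := by simp
  simp [corrObs, corrSee, corrMover, this]

lemma corrObs_two (m : ℕ) (a b : ℕ) : corrObs m [enclose a, pick b] =
    [some (enclose a), some (pick b)] := by
  simp [corrObs, corrSee, corrMover]

lemma dataAct_labInfo (D : Data Γ l i) (L : Lab l) : dataAct D (labInfo i L) = move (D.2 L) := by
  obtain ⟨oa, b, r⟩ := L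
  simp only [labInfo, dataAct]
  refine congrArg (fun L => move (D.2 L)) ?_
  refine Prod.ext ?_ (Prod.ext ?_ ?_)
  · cases oa <;> simp [CorrAct.num]
  · simp [CorrAct.num]
  · cases r <;> simp [revAct]

lemma agree_toData_ofData (D : Data Γ l i) : Agree i (toData (ofData D)) D := by
  have hsz : ∀ j, 0 < Γ.size j := fun j => pos_of_ne_zero (NeZero.ne _)
  refine ⟨?_, ?_, ?_⟩
  · rintro (rfl | rfl)
    · have h := detAct_ofData D (h := []) (mkHist_take_turns
        ((0, 0, true, fun _ => 0) : Out Γ l) (t := 0) (by omega))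
      have e : corrObs m [] = [] := rfl
      rw [e] at h
      simp [toData, h, dataAct, CorrAct.num]
    · have h := detAct_ofData D (h := [enclose (0 : Fin l)]) (mkHist_take_turns
        ((0, 0, true, fun _ => 0) : Out Γ l) (t := 1) (by omega))
      rw [corrObs_one] at h
      simp [toData, h, dataAct, CorrAct.num]
  · rintro rfl
    funext a b
    have h := detAct_ofData D (h := [enclose a, pick b]) (mkHist_take_turns
        ((a, b, true, fun _ => 0) : Out Γ l) (t := 2) (by omega))
    rw [corrObs_two] at h
    simp only [toData, h, dataAct, Option.getD_some, CorrAct.num, Fin.ofNat_val_eq_self]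
    cases D.1.2 a b <;> simp [revAct]
  · intro a b r
    let o : Out Γ l := (a, b, r, fun _ => 0)
    have h3 := three_le_gStage i
    have hlt := gStage_lt i
    have ht := mkHist_take_turns o hlt
    rw [corrMover_gStage] at ht
    have h := detAct_ofData D ht
    have e := corrObs_mkHist_take o (t := gStage i - 3) (by omega)
    rw [show gStage i - 3 + 3 = gStage i by omega, gOrder_gStage] at e
    rw [e, dataAct_labInfo] at h
    simp only [toData]
    change ofNat _ (detAct (ofData D) (labInfo i (labOf i o.1 o.2.1 o.2.2.1))).num = _
    rw [h]
    simp [CorrAct.num, o]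

lemma corrGame_outcome_aux {pol : ∀ h, ✉.NT h → CorrAct} {D : ∀ i, Data Γ l i}
    {p : List CorrAct → CorrAct} (hpol : ∀ h hh, pol h hh = p h)
    (hm : ∀ h, ✉.NT h → h ++ [p h] ∈ ✉.H)
    (hp : ∀ t (ht : t < m + 5), p ((mkHist (outOf D)).take t) =
      (mkHist (outOf D))[t]'(by rw [length_mkHist]; exact ht)) :
    ✉.outcome pol = mkHist (outOf D) := by
  have h1 : ✉.outcome pol = histOf p (m + 5) :=
    stageGame_outcome (fun t _ => corrActions_nonempty t) hpol hm
  rw [h1, ← length_mkHist (outOf D)]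
  exact histOf_eq (fun t ht => hp t (by rw [length_mkHist] at ht; exact ht))

lemma detAct_pick (s : ✉.Det i) (o : Out Γ l) {t : ℕ} (ht : t < m + 5) (hi : corrMover m t = i) :
    detAct s (corrObs m ((mkHist o).take t)) ∈ corrActions Γ l t := by
  have h := mkHist_take_turns o ht
  rw [hi] at h
  have := (corrGame_append.1 (detAct_mem s h)).2.2
  rwa [length_take, length_mkHist, min_eq_left ht.le] at this

lemma outcome_follow (s : ∀ i, ✉.Det i) :
    ✉.outcome (✉.follow s) = mkHist (outOf (fun i => toData (s i))) := by
  refine corrGame_outcome_aux (p := fun h => detAct (s (corrMover m h.length)) (corrObs m h))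
    ?_ ?_ ?_
  · intro h hh
    have he : ∃ h' ∈ ✉.turns (✉.mover h), ✉.info h' = corrObs m h := ⟨h, ⟨hh, rfl⟩, rfl⟩
    change _ = detAct (s (✉.mover h)) (corrObs m h)
    rw [detAct, dif_pos he]
    rfl
  · intro h hh
    exact detAct_mem (s _) ⟨hh, rfl⟩
  · intro t ht
    set D : ∀ i, Data Γ l i := fun i => toData (s i) with hD
    have hlen : ((mkHist (outOf D)).take t).length = t := by simp [length_mkHist]; omega
    have hmem := detAct_pick (s (corrMover m t)) (outOf D) ht rfl
    have gen : ∀ k I, k = t → detAct (s (corrMover m k)) I = detAct (s (corrMover m t)) I := by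
      rintro _ I rfl
      rfl
    refine (gen _ _ hlen).trans ?_
    rcases t with _ | _ | _ | t
    · obtain ⟨a, ha, he⟩ := hmem
      rw [he]
      have he' : detAct (s 0) [] = enclose a := he
      change _ = enclose (ofNat l _)
      simp [he', CorrAct.num, mod_eq_of_lt ha]
    · obtain ⟨a, ha, he⟩ := hmem
      rw [he]
      have e1 : corrObs m ((mkHist (outOf D)).take (0 + 1)) = [none] := corrObs_one m _
      rw [e1] at he
      have he' : detAct (s 1) [none] = pick a := he
      change _ = pick (ofNat l _)
      simp [he', CorrAct.num, mod_eq_of_lt ha]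
    · have e1 : corrObs m ((mkHist (outOf D)).take (0 + 1 + 1)) = _ := corrObs_two m _ _
      rw [e1] at hmem ⊢
      change _ = revAct (decide (detAct (s 0) [some (enclose (outOf D).1),
        some (pick (outOf D).2.1)] = reveal))
      rcases hmem with he | he
      · have he' : detAct (s 0) _ = reveal := he
        rw [he, he', decide_eq_true rfl]
        rfl
      · have he' : detAct (s 0) _ = destroy := he
        rw [he, he', decide_eq_false (by simp)]
        rfl
    · rw [mkHist_getElem _ (by omega)]
      have e1 := corrObs_mkHist_take (outOf D) (t := t) (by omega)
      rw [e1] at hmem ⊢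
      obtain ⟨a, ha, he⟩ := hmem
      rw [he]
      have he' : detAct (s (gOrder m t)) (labInfo (gOrder m t) (labOf (gOrder m t) (D 0).1.1
        (D 1).1.1 ((D 0).1.2 (D 0).1.1 (D 1).1.1))) = move a := he
      change _ = move (ofNat _ (detAct (s (gOrder m t)) _).num)
      rw [he']
      simp [CorrAct.num, mod_eq_of_lt ha]

/-! ## Strings of several commitments -/

lemma length_block {k j : ℕ} {x : Bits} (h : (j + 1) * k ≤ x.length) :
    (block k j x).length = k := by
  have : (j + 1) * k = j * k + k := by ring
  simp only [block, length_take, List.length_drop]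
  omega

lemma block_flatten {d k : ℕ} {f : Fin d → Bits} (hf : ∀ j, (f j).length = k) (j : Fin d) :
    block k j (ofFn f).flatten = f j := by
  induction d with
  | zero => exact j.elim0
  | succ d ih =>
    rw [List.ofFn_succ, List.flatten_cons, block]
    refine Fin.cases ?_ (fun i => ?_) j
    · simp [← hf 0]
    · have h := ih (f := fun i => f i.succ) (fun i => hf _) i
      rw [block] at h
      rw [Fin.val_succ, show ((i : ℕ) + 1) * k = (f 0).length + i * k by rw [hf 0]; ring,
        List.drop_append, Nat.add_sub_cancel_left, List.drop_eq_nil_of_le (by omega),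
        List.nil_append, h]

lemma length_flatten_ofFn {d k : ℕ} {f : Fin d → Bits} (hf : ∀ j, (f j).length = k) :
    (ofFn f).flatten.length = d * k := by
  rw [List.length_flatten, map_ofFn, List.sum_ofFn]
  simp [hf]

/-- The binary digits of a number. -/
def numBits (d a : ℕ) : Fin d → Bool := fun j => a.testBit j

lemma bitsVal_numBits {d a : ℕ} (h : a < 2 ^ d) : bitsVal (ofFn (numBits d a)) = a := by
  induction d generalizing a with
  | zero => simp [bitsVal]; simp at h; omega
  | succ d ih =>
    rw [List.ofFn_succ, bitsVal_cons]
    have h1 : (fun i : Fin d => numBits (d + 1) a i.succ) = numBits d (a / 2) := by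
      funext i
      simp [numBits, Nat.testBit_succ]
    rw [h1, ih (by rw [pow_succ] at h; omega)]
    simp only [numBits, Fin.val_zero, Nat.testBit_zero]
    rcases Nat.mod_two_eq_zero_or_one a with h2 | h2 <;> simp [h2] <;> omega

lemma lt_two_pow_size (a : ℕ) : a < 2 ^ size a := Nat.lt_size_self a

section

variable (S)

instance (d n : ℕ) (x z : Bits) : Decidable (ValidKeys S d n x z) := Classical.propDecidable _

/-- Commitments to several bits. -/
def commitStr {d : ℕ} (n : ℕ) (e : Fin d → Bool) (r : Bits) : Bits :=
  (ofFn fun j : Fin d => S.C₁ n (e j) (block (S.coins.eval n) j r)).flatten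

/-- The keys that belong to several commitments. -/
def keyStr {d : ℕ} (n : ℕ) (e : Fin d → Bool) (r : Bits) : Bits :=
  (ofFn fun j : Fin d => S.C₂ n (e j) (block (S.coins.eval n) j r)).flatten

/-- The bits revealed by keys. -/
def openBits (d n : ℕ) (x z : Bits) : Fin d → Bool := fun j =>
  decide (S.R (block n j x) (block (n - 1) j z) = some true)

variable {S} {d n : ℕ}

lemma length_block_coins {r : Bits} {c : ℕ} (hr : d * c ≤ r.length) (j : Fin d) :
    (block c j r).length = c := length_block ((Nat.mul_le_mul_right c j.isLt).trans hr)

lemma committedBit_C₁ (hn : 1 ≤ n) (b : Bool) {r : Bits} (hr : r.length = S.coins.eval n) :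
    S.committedBit n (S.C₁ n b r) = b := by
  cases b
  · classical
    rw [CommitmentScheme.committedBit, decide_eq_false_iff_not]
    rintro ⟨r', hr', he⟩
    have h1 := S.opens n hn false r hr
    rw [← he] at h1
    by_cases h : S.C₂ n false r = S.C₂ n true r'
    · rw [h, S.opens n hn true r' hr'] at h1
      simp at h1
    · rw [S.binding n hn true r' hr' _ h] at h1
      simp at h1
  · classical
    rw [CommitmentScheme.committedBit, decide_eq_true_iff]
    exact ⟨r, hr, rfl⟩

lemma R_eq_some {c s : Bits} (hn : 1 ≤ n) (hc : c ∈ S.commitments n) (h : S.R c s ≠ none) :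
    S.R c s = some (S.committedBit n c) := by
  obtain ⟨b, r, hr, rfl⟩ := hc
  rw [committedBit_C₁ hn b hr]
  by_contra h'
  refine h (S.binding n hn b r hr s (fun hs => h' ?_))
  rw [hs, S.opens n hn b r hr]

variable {e : Fin d → Bool} {r : Bits}

lemma block_commitStr (hn : 1 ≤ n) (hr : d * S.coins.eval n ≤ r.length) (j : Fin d) :
    block n j (commitStr S n e r) = S.C₁ n (e j) (block (S.coins.eval n) j r) :=
  block_flatten (f := fun j : Fin d => S.C₁ n (e j) (block (S.coins.eval n) j r))
    (fun j => S.length₁ n hn _ _ (length_block_coins hr j)) j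

lemma block_keyStr (hn : 1 ≤ n) (hr : d * S.coins.eval n ≤ r.length) (j : Fin d) :
    block (n - 1) j (keyStr S n e r) = S.C₂ n (e j) (block (S.coins.eval n) j r) :=
  block_flatten (f := fun j : Fin d => S.C₂ n (e j) (block (S.coins.eval n) j r))
    (fun j => S.length₂ n hn _ _ (length_block_coins hr j)) j

lemma length_commitStr (hn : 1 ≤ n) (hr : d * S.coins.eval n ≤ r.length) :
    (commitStr S n e r).length = d * n :=
  length_flatten_ofFn (fun j => S.length₁ n hn _ _ (length_block_coins hr j))

lemma length_keyStr (hn : 1 ≤ n) (hr : d * S.coins.eval n ≤ r.length) :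
    (keyStr S n e r).length = d * (n - 1) :=
  length_flatten_ofFn (fun j => S.length₂ n hn _ _ (length_block_coins hr j))

lemma committedVal_commitStr (hn : 1 ≤ n) (hr : d * S.coins.eval n ≤ r.length) :
    committedVal S d n (commitStr S n e r) = bitsVal (ofFn e) := by
  rw [committedVal]
  congr 2
  funext j
  rw [block_commitStr hn hr, committedBit_C₁ hn _ (length_block_coins hr j)]

lemma validKeys_keyStr (hn : 1 ≤ n) (hr : d * S.coins.eval n ≤ r.length) :
    ValidKeys S d n (commitStr S n e r) (keyStr S n e r) := by
  refine ⟨length_keyStr hn hr, fun j hj => ?_⟩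
  have h1 := block_commitStr (e := e) hn hr ⟨j, hj⟩
  have h2 := block_keyStr (e := e) hn hr ⟨j, hj⟩
  simp only at h1 h2
  rw [h1, h2, S.opens n hn _ _ (length_block_coins hr ⟨j, hj⟩)]
  simp

lemma openBits_eq {x z : Bits} (hn : 1 ≤ n)
    (hx : ∀ j : Fin d, block n j x ∈ S.commitments n) (h : ValidKeys S d n x z) :
    bitsVal (ofFn (openBits S d n x z)) = committedVal S d n x := by
  rw [committedVal]
  congr 2
  funext j
  rw [openBits, R_eq_some hn (hx j) (h.2 j j.isLt)]
  simp

lemma not_validKeys_ones {x : Bits} (hn : 1 ≤ n) (hd : 0 < d) :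
    ¬ ValidKeys S d n x (ones (d * n)) := by
  rintro ⟨h, -⟩
  rw [length_ones] at h
  have := Nat.eq_of_mul_eq_mul_left hd h
  omega

end

/-! ## The cryptographic games -/

lemma mem_cryptoActions_zero {x : Bits} (hn : 1 ≤ n) : x ∈ cryptoActions S Γ l n 0 ↔
    x.length = size l * n ∧ ∀ j : Fin (size l), block n j x ∈ S.commitments n := by
  have hlen : ∀ c ∈ S.commitments n, c.length = n := by
    rintro c ⟨b, r, hr, rfl⟩
    exact S.length₁ n hn b r hr
  constructor
  · rintro ⟨h1, cs, hcs, rfl⟩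
    refine ⟨h1, fun j => ?_⟩
    rw [block_flatten (fun j => hlen _ (hcs j))]
    exact hcs j
  · rintro ⟨h1, h2⟩
    refine ⟨h1, fun j => block n j x, h2, ?_⟩
    have h3 : (ofFn fun j : Fin (size l) => block n j x).flatten.length = x.length := by
      rw [length_flatten_ofFn (fun j => hlen _ (h2 j)), h1]
    generalize size l = d at *
    clear h2 h3
    induction d generalizing x with
    | zero => simpa using h1
    | succ d ih =>
      have h4 : (x.drop n).length = d * n := by
        rw [List.length_drop, h1]
        have : (d + 1) * n = d * n + n := by ring
        omega
      rw [List.ofFn_succ, List.flatten_cons]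
      have h5 := ih h4
      have h6 : (fun j : Fin d => block n j.succ x) = fun j : Fin d => block n j (x.drop n) := by
        funext j
        rw [block, block, List.drop_drop, Fin.val_succ]
        congr 2
        ring
      rw [h6, ← h5]
      simp [block]

lemma commitStr_mem (hn : 1 ≤ n) {e : Fin (size l) → Bool} {r : Bits}
    (hr : size l * S.coins.eval n ≤ r.length) : commitStr S n e r ∈ cryptoActions S Γ l n 0 :=
  (mem_cryptoActions_zero hn).2 ⟨length_commitStr hn hr, fun j => by
    rw [block_commitStr hn hr]
    exact ⟨_, _, length_block_coins hr j, rfl⟩⟩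

lemma exists_commitStr {x : Bits} (hx : x ∈ cryptoActions S Γ l n 0) :
    ∃ (e : Fin (size l) → Bool) (r : Bits),
      r.length = size l * S.coins.eval n ∧ commitStr S n e r = x := by
  obtain ⟨-, cs, hcs, rfl⟩ := hx
  choose b r hr hb using hcs
  refine ⟨b, (ofFn r).flatten, length_flatten_ofFn hr, ?_⟩
  rw [commitStr]
  congr 2
  funext j
  rw [block_flatten hr, hb]

lemma size_pos_of_neZero (l : ℕ) [NeZero l] : 0 < size l :=
  Nat.size_pos.2 (pos_of_ne_zero (NeZero.ne l))

lemma cryptoActions_nonempty (hn : 1 ≤ n) (t : ℕ) : (cryptoActions S Γ l n t).Nonempty := by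
  rcases t with _ | _ | _ | t
  · exact ⟨_, commitStr_mem (e := fun _ => false) (r := ones (size l * S.coins.eval n)) hn
      (by simp)⟩
  · exact ⟨ones (size l), length_ones _⟩
  · exact ⟨[], Nat.zero_le _⟩
  · exact ⟨_, 0, pos_of_ne_zero (NeZero.ne _), rfl⟩

lemma cryptoGame_append {h : List Bits} {a : Bits} : h ++ [a] ∈ (⌘ n).H ↔
      h ∈ (⌘ n).H ∧ h.length < m + 5 ∧ a ∈ cryptoActions S Γ l n h.length := stageGame_append

lemma cryptoGame_NT (hn : 1 ≤ n) {h : List Bits} : (⌘ n).NT h ↔ h ∈ (⌘ n).H ∧ h.length < m + 5 :=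
  stageGame_NT (fun t _ => cryptoActions_nonempty hn t)

lemma cryptoGame_terminal (hn : 1 ≤ n) {h : List Bits} :
    (⌘ n).Terminal h ↔ h ∈ (⌘ n).H ∧ h.length = m + 5 :=
  stageGame_terminal (fun t _ => cryptoActions_nonempty hn t)

/-! ### The map of histories -/

variable (S l n) in
open Classical in
/-- The image of the action `x` at stage `t` under the map of histories, when `x₀` is the first
action. -/
def corrMapAct (x₀ : Bits) (t : ℕ) (x : Bits) : CorrAct := match t with
  | 0 => enclose (committedVal S (size l) n x % l)
  | 1 => pick (bitsVal x % l)
  | 2 => if ValidKeys S (size l) n x₀ x then reveal else destroy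
  | _ => move (bitsVal x)

lemma corrMap_eq (h : List Bits) :
    ♮ n h = h.mapIdx (corrMapAct S l n (h[0]?.getD [])) := by
  rw [corrMap]
  congr 1

lemma corrMap_length (h : List Bits) : (♮ n h).length = h.length := by simp [corrMap]

lemma corrMap_getElem? (h : List Bits) (t : ℕ) :
    (♮ n h)[t]? = h[t]?.map (corrMapAct S l n (h[0]?.getD []) t) := by
  rw [corrMap_eq, List.getElem?_mapIdx]

lemma corrMap_take (h : List Bits) (t : ℕ) :
    ♮ n (h.take t) = (♮ n h).take t := by
  apply List.ext_getElem?
  intro s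
  rw [corrMap_getElem?, List.getElem?_take, List.getElem?_take]
  rcases Nat.lt_or_ge s t with hs | hs
  · rw [if_pos hs, if_pos (by omega), List.getElem?_take, if_pos hs, corrMap_getElem?]
  · simp [not_lt.2 hs]

lemma corrMap_append (h : List Bits) (a : Bits) : ♮ n (h ++ [a]) = ♮ n h ++
      [corrMapAct S l n (h[0]?.getD []) h.length a] := by
  have h1 := corrMap_take (S := S) (l := l) (n := n) (h ++ [a]) h.length
  rw [List.take_left] at h1
  have h2 : (♮ n (h ++ [a]))[h.length]? =
      some (corrMapAct S l n (h[0]?.getD []) h.length a) := by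
    rw [corrMap_getElem?]
    rcases h with _ | ⟨x, h⟩
    · simp [corrMapAct]
    · simp
  obtain ⟨h3, h4⟩ := getElem?_eq_some_iff.1 h2
  rw [h1, ← h4, List.take_append_getElem, take_of_length_le]
  simp [corrMap_length]

lemma corrMap_cons₃ (x y z : Bits) (ws : List Bits) : ♮ n (x :: y :: z :: ws) =
      enclose (committedVal S (size l) n x % l) :: pick (bitsVal y % l) ::
        revAct (decide (ValidKeys S (size l) n x z)) :: ws.map (fun w => move (bitsVal w)) := by
  rw [corrMap]
  simp only [List.mapIdx_cons]
  congr 3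
  · by_cases h : ValidKeys S (size l) n x z <;> simp [h, revAct]
  · apply List.ext_getElem?
    intro t
    rw [List.getElem?_mapIdx, List.getElem?_map]

lemma corrMapAct_mem {x₀ x : Bits} {t : ℕ} (hx : x ∈ cryptoActions S Γ l n t) :
    corrMapAct S l n x₀ t x ∈ corrActions Γ l t := by
  have hl : 0 < l := pos_of_ne_zero (NeZero.ne l)
  rcases t with _ | _ | _ | t
  · exact ⟨_, Nat.mod_lt _ hl, rfl⟩
  · exact ⟨_, Nat.mod_lt _ hl, rfl⟩
  · simp only [corrMapAct]
    split_ifs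
    · exact Or.inl rfl
    · exact Or.inr rfl
  · obtain ⟨a, ha, rfl⟩ := hx
    exact ⟨a, ha, congrArg move (bitsVal_bits a)⟩

lemma corrMap_mem {h : List Bits} (hh : h ∈ (⌘ n).H) : ♮ n h ∈ ✉.H := by
  refine ⟨(corrMap_length h).trans_le hh.1, fun t a ha => ?_⟩
  rw [corrMap_getElem?] at ha
  obtain ⟨x, hx, rfl⟩ := Option.map_eq_some_iff.1 ha
  exact corrMapAct_mem (hh.2 t x hx)

lemma corrMap_NT (hn : 1 ≤ n) {h : List Bits} (hh : (⌘ n).NT h) : ✉.NT (♮ n h) := by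
  rw [cryptoGame_NT hn] at hh
  exact corrGame_NT.2 ⟨corrMap_mem hh.1, by rw [corrMap_length]; exact hh.2⟩

/-- The terminal history with given actions. -/
def cHist (x y z : Bits) (w : ℙ → Bits) : List Bits :=
  x :: y :: z :: ofFn (fun t : ℙ => w (gOrder m t))

variable (S Γ l n) in
/-- The image of a terminal history. -/
def cOut (x y z : Bits) (w : ℙ → Bits) : Out Γ l :=
  (ofNat l (committedVal S (size l) n x), ofNat l (bitsVal y),
    decide (ValidKeys S (size l) n x z), fun i => ofNat _ (bitsVal (w i)))

lemma corrMap_cHist (x y z : Bits) {w : ℙ → Bits} (hw : ∀ i, bitsVal (w i) < Γ.size i) :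
    ♮ n (cHist x y z w) = mkHist (cOut S Γ l n x y z w) := by
  rw [cHist, corrMap_cons₃, mkHist, moveList, map_ofFn]
  simp only [cOut, ofNat]
  congr 4
  funext t
  simp [mod_eq_of_lt (hw _)]

lemma cHist_mem {x y z : Bits} {w : ℙ → Bits}
    (hx : x ∈ cryptoActions S Γ l n 0) (hy : y.length = size l)
    (hz : z.length ≤ size l * n) (hw : ∀ i, ∃ a < Γ.size i, w i = bits a) :
    cHist x y z w ∈ (⌘ n).H := by
  refine ⟨by simp [cHist], fun t a ha => ?_⟩
  rcases t with _ | _ | _ | t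
  · simp [cHist] at ha; rwa [← ha]
  · simp [cHist] at ha; rw [← ha]; exact hy
  · simp [cHist] at ha; rw [← ha]; exact hz
  · simp only [cHist, List.getElem?_cons_succ] at ha
    obtain ⟨ht, rfl⟩ := getElem?_eq_some_iff.1 ha
    rw [getElem_ofFn]
    exact hw _

lemma exists_cHist (hn : 1 ≤ n) (o : Out Γ l) : ∃ h ∈ (⌘ n).H, ♮ n h = mkHist o := by
  set d := size l
  have hl : ∀ a : Fin l, (a : ℕ) < 2 ^ d := fun a => a.2.trans (lt_two_pow_size l)
  let r := ones (d * S.coins.eval n)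
  have hr : d * S.coins.eval n ≤ r.length := by simp [r]
  let x := commitStr S n (numBits d o.1) r
  let z := if o.2.2.1 then keyStr S n (numBits d o.1) r else ones (d * n)
  have hz : ValidKeys S d n x z ↔ o.2.2.1 = true := by
    by_cases h : o.2.2.1
    · simp only [z, h, if_true, iff_true]; exact validKeys_keyStr hn hr
    · simp only [z, h]
      simpa using not_validKeys_ones hn (size_pos_of_neZero l)
  have hzl : z.length ≤ d * n := by
    simp only [z]
    split_ifs
    · rw [length_keyStr hn hr]; exact Nat.mul_le_mul_left _ (Nat.sub_le _ _)
    · simp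
  refine ⟨cHist x (ofFn (numBits d o.2.1)) z (fun i => bits (o.2.2.2 i)),
    cHist_mem (commitStr_mem hn hr) (by simp [d]) hzl (fun i => ⟨_, (o.2.2.2 i).2, rfl⟩), ?_⟩
  rw [corrMap_cHist (Γ := Γ) _ _ _ (fun i => by rw [bitsVal_bits]; exact (o.2.2.2 i).2)]
  congr 1
  obtain ⟨a, b, rv, u⟩ := o
  refine Prod.ext ?_ (Prod.ext ?_ (Prod.ext ?_ ?_))
  · simp only [cOut]
    rw [committedVal_commitStr hn hr, bitsVal_numBits (hl _)]
    simp
  · simp only [cOut]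
    rw [bitsVal_numBits (hl _)]
    simp
  · simp only [cOut]
    rw [Bool.eq_iff_iff, decide_eq_true_iff]
    exact hz
  · simp only [cOut, bitsVal_bits]
    simp

lemma corrMap_surjOn (hn : 1 ≤ n) : Set.SurjOn (♮ n) (⌘ n).H ✉.H := fun g hg => by
  obtain ⟨o, ho⟩ := exists_mkHist hg
  obtain ⟨h, hh, he⟩ := exists_cHist (S := S) hn o
  refine ⟨h.take g.length, ⟨(List.length_take_le' _ _).trans hh.1, fun t a ha => ?_⟩, ?_⟩
  · rw [List.getElem?_take] at ha
    split_ifs at ha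
    exact hh.2 t a ha
  · rw [corrMap_take, he, ← ho]

lemma corrObs_corrMap_cons₃ {x y z : Bits} {ws : List Bits} (hws : ws.length < m + 2) :
    corrObs m (♮ n (x :: y :: z :: ws)) = labInfo (gOrder m ws.length)
      (labOf (gOrder m ws.length) (ofNat l (committedVal S (size l) n x))
        (ofNat l (bitsVal y)) (decide (ValidKeys S (size l) n x z))) := by
  rw [corrMap_cons₃]
  have := corrObs_three (m := m) (a := ofNat l (committedVal S (size l) n x))
    (b := ofNat l (bitsVal y)) (r := (decide (ValidKeys S (size l) n x z)))
    (ms := ws.map (fun w => move (bitsVal w))) (by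
      intro w hw
      obtain ⟨v, -, rfl⟩ := List.mem_map.1 hw
      exact ⟨_, rfl⟩) (by simpa using hws)
  simpa using this

lemma cryptoObs_eq {h h' : List Bits} (e : cryptoObs h = cryptoObs h') :
    h.length = h'.length ∧ h.take 3 = h'.take 3 := by
  have h1 := packBits_injective e
  have hl := congrArg List.length h1
  simp at hl
  have hl' : h.length = h'.length := by omega
  exact ⟨hl', List.append_inj_left h1 (by simp [hl'])⟩

lemma corrObs_corrMap_congr {h h' : List Bits} (hl : h.length < m + 5)
    (e : cryptoObs h = cryptoObs h') :
    corrObs m (♮ n h) = corrObs m (♮ n h') := by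
  obtain ⟨h1, h2⟩ := cryptoObs_eq e
  rcases h with _ | ⟨x, _ | ⟨y, _ | ⟨z, ws⟩⟩⟩ <;> rcases h' with _ | ⟨x', _ | ⟨y', _ | ⟨z', ws'⟩⟩⟩ <;>
    simp at h1 h2 hl ⊢
  · rw [h2]
  · rw [h2.1, h2.2]
  · obtain ⟨rfl, rfl, rfl⟩ := h2
    rw [corrObs_corrMap_cons₃ (by omega), corrObs_corrMap_cons₃ (by omega), h1]

lemma corrChoice_corrMap (h : List Bits) (i : ℙ) :
    corrChoice (♮ n h) i = cryptoChoice h i := by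
  rw [corrChoice, cryptoChoice, corrMap_getElem?, Option.map_map]
  have h3 := three_le_gStage i
  obtain ⟨t, ht⟩ : ∃ t, gStage i = t + 3 := ⟨gStage i - 3, by omega⟩
  rw [ht]
  rcases h[t + 3]? with _ | x
  · simp [bitsVal]
  · rfl

/-! ## The cryptographic games form a computable uniform sequence -/

section

variable {α ι κ : Type} {inp : α → List Bits} [FixedArity inp] {P : ι → α → Prop} {f z x : α → Bits}

lemma DecPT.exists_finite [Finite ι] (h : ∀ j, DecPT inp (P j)) : DecPT inp (fun a => ∃ j, P j a) :=
  (forall_finite (fun j => (h j).not)).not.congr (fun a => by push Not; exact Iff.rfl)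

lemma DecPT.fin_dec {P : α → Prop} [∀ a, Decidable (P a)] (h : DecPT inp P) :
    FinPT inp (fun a => decide (P a)) := h.fin.congr (fun a => by congr)

lemma DecPT.imp {P Q : α → Prop} (hP : DecPT inp P) (hQ : DecPT inp Q) :
    DecPT inp (fun a => P a → Q a) := (hP.not.or hQ).congr (fun a => by tauto)

lemma PolyTime.block {k : α → ℕ} (hk : PolyTime inp (fun a => ones (k a))) (j : ℕ)
    (hx : PolyTime inp x) : PolyTime inp (fun a => block (k a) j (x a)) := by
  refine ((hx.drop ((ones_const j).ones_mul hk)).take hk).congr (fun a => ?_)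
  rw [_root_.block, length_ones, length_ones]

lemma PolyTime.ones_pred {k : α → ℕ} (hk : PolyTime inp (fun a => ones (k a))) :
    PolyTime inp (fun a => ones (k a - 1)) := hk.tail.congr (fun a => by simp [ones])

lemma DecPT.length_eq_ones {k : α → ℕ} (hx : PolyTime inp x)
    (hk : PolyTime inp (fun a => ones (k a))) : DecPT inp (fun a => (x a).length = k a) :=
  (length_eq hx hk).congr (fun a => by rw [length_ones])

lemma DecPT.length_le_ones {k : α → ℕ} (hx : PolyTime inp x)
    (hk : PolyTime inp (fun a => ones (k a))) : DecPT inp (fun a => (x a).length ≤ k a) :=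
  (length_le hx hk).congr (fun a => by rw [length_ones])

variable {N : α → ℕ}

lemma DecPT.R_eq (hx : PolyTime inp x) (hz : PolyTime inp z) (o : Option Bool) :
    DecPT inp (fun a => S.R (x a) (z a) = o) := by
  have h : PolyTime inp (fun a => (S.R (x a) (z a)).toList) :=
    S.polyTimeR.comp (fun a => (x a, z a)) [x, z] (by simp [hx, hz]) (fun _ => rfl)
  refine (eq_const h o.toList).congr (fun a => ?_)
  rcases S.R (x a) (z a) with _ | b <;> cases o <;> simp

lemma DecPT.validKeys (d : ℕ) (hN : PolyTime inp (fun a => ones (N a))) (hx : PolyTime inp x)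
    (hz : PolyTime inp z) : DecPT inp (fun a => ValidKeys S d (N a) (x a) (z a)) := by
  refine (DecPT.and (length_eq_ones hz ((ones_const d).ones_mul hN.ones_pred))
    (forall_finite (κ := Fin d) (R := fun j a =>
      ¬ S.R (block (N a) j (x a)) (block (N a - 1) j (z a)) = none)
      (fun j => (R_eq (PolyTime.block hN j hx) (PolyTime.block hN.ones_pred j hz) none).not))).congr
      (fun a => ?_)
  rw [ValidKeys]
  exact and_congr Iff.rfl ⟨fun h j hj => h ⟨j, hj⟩, fun h j => h j j.isLt⟩

lemma FinPT.openBits (d : ℕ) (hN : PolyTime inp (fun a => ones (N a))) (hx : PolyTime inp x)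
    (hz : PolyTime inp z) : FinPT inp (fun a => openBits S d (N a) (x a) (z a)) :=
  pi (ν := fun _ => Bool) (fun j =>
    (DecPT.R_eq (PolyTime.block hN j hx) (PolyTime.block hN.ones_pred j hz) (some true)).fin_dec)

end

section

variable {α : Type} {inp : α → List Bits} [FixedArity inp] {h : α → List Bits}

lemma PolyTime.nth (hh : PolyTime inp (fun a => _root_.packBits (h a))) (j : ℕ) : PolyTime inp (fun a => (h a).getD j []) :=
  ((hh.sndBits_iterate j).fstBits).congr (fun a => fstBits_nth _ _)

lemma DecPT.packed_length_le (hh : PolyTime inp (fun a => _root_.packBits (h a))) (j : ℕ) : DecPT inp (fun a => (h a).length ≤ j) :=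
  (eq_nil (hh.sndBits_iterate j)).congr (fun a => by
    rw [sndBits_iterate, packBits_eq_nil, List.drop_eq_nil_iff])

end

lemma decPT_cryptoActions {α : Type} {inp : α → List Bits} [FixedArity inp]
    (hS : S.Recognizable) {N : α → ℕ} {x : α → Bits}
    (hN : PolyTime inp (fun a => ones (N a))) (hx : PolyTime inp x) (t : ℕ) :
    ∃ Q : α → Prop, DecPT inp Q ∧ ∀ a, 1 ≤ N a → (Q a ↔ x a ∈ cryptoActions S Γ l (N a) t) := by
  obtain ⟨g, hg, hgS⟩ := hS
  have hd : PolyTime inp (fun a => ones (size l * N a)) := (ones_const _).ones_mul hN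
  rcases t with _ | _ | _ | t
  · have hb : ∀ j : Fin (size l), DecPT inp (fun a => g (N a) (block (N a) j (x a)) = true) := by
      intro j
      refine DecPT.of_bool ?_
      exact hg.comp (fun a => (N a, block (N a) j (x a)))
        [fun a => ones (N a), fun a => block (N a) j (x a)]
        (by simp [hN, PolyTime.block hN j hx]) (fun _ => rfl)
    refine ⟨_, (DecPT.length_eq_ones hx hd).and (DecPT.forall_finite hb), fun a ha => ?_⟩
    rw [mem_cryptoActions_zero ha]
    simp only [hgS _ ha]
  · exact ⟨_, DecPT.length_eq_ones hx (ones_const (size l)), fun a ha => Iff.rfl⟩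
  · exact ⟨_, DecPT.length_le_ones hx hd, fun a ha => Iff.rfl⟩
  · refine ⟨_, DecPT.exists_finite (ι := Fin (Γ.size (gOrder m t)))
      (fun j => DecPT.eq_const hx (bits j)), fun a ha => ?_⟩
    exact ⟨fun ⟨j, hj⟩ => ⟨j, j.2, hj⟩, fun ⟨j, hj, he⟩ => ⟨⟨j, hj⟩, he⟩⟩

lemma decPT_mem_cryptoGame {α : Type} {inp : α → List Bits} [FixedArity inp]
    (hS : S.Recognizable) {N : α → ℕ} {h : α → List Bits}
    (hN : PolyTime inp (fun a => ones (N a))) (hh : PolyTime inp (fun a => _root_.packBits (h a))) :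
    ∃ Q : α → Prop, DecPT inp Q ∧ ∀ a, 1 ≤ N a → (Q a ↔ h a ∈ (⌘ (N a)).H) := by
  choose Q hQ hQ' using fun t => decPT_cryptoActions (Γ := Γ) (l := l) hS hN (hh.nth t) t
  refine ⟨_, (DecPT.packed_length_le hh (m + 5)).and (DecPT.forall_finite (κ := Fin (m + 5))
    (fun t => (DecPT.packed_length_le hh t).not.imp (hQ t))), fun a ha => ?_⟩
  refine and_congr_right fun hlen => ⟨fun H t b hb => ?_, fun H t ht => ?_⟩
  · obtain ⟨ht, he⟩ := getElem?_eq_some_iff.1 hb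
    have h1 := H ⟨t, ht.trans_le hlen⟩ (by simpa using ht)
    rw [hQ' _ _ ha, getD_eq_getElem?_getD, hb] at h1
    exact h1
  · rw [hQ' _ _ ha, getD_eq_getElem?_getD, getElem?_eq_getElem (by simpa using ht)]
    exact H t _ (getElem?_eq_getElem (by simpa using ht))

lemma cryptoGame_actions : ∃ p : Polynomial ℕ, ∀ n, 1 ≤ n → ∀ h a,
    h ++ [a] ∈ (⌘ n).H → a.length ≤ p.eval n := by
  refine ⟨C (size l) * X + C (size l + ∑ i, Γ.size i), fun n hn h a ha => ?_⟩
  have h1 := (cryptoGame_append.1 ha).2.2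
  simp only [eval_add, eval_mul, eval_C, eval_X]
  generalize h.length = t at h1
  rcases t with _ | _ | _ | t
  · have := h1.1; omega
  · have : a.length = size l := h1; omega
  · have : a.length ≤ size l * n := h1; omega
  · obtain ⟨b, hb, rfl⟩ := h1
    have h2 : (bits b).length ≤ b := by
      rw [Nat.size_eq_bits_len]
      exact Nat.size_le.2 b.lt_two_pow_self
    have h3 := single_le_sum (f := Γ.size) (fun _ _ => Nat.zero_le _)
      (mem_univ (gOrder m t))
    omega

lemma polyTime_mover : PolyTime (fun h : List Bits => [packBits h])
    (fun h => ones (corrMover m (min h.length (m + 5)) : ℕ)) := by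
  have hh : PolyTime (fun h : List Bits => [packBits h]) (fun h => packBits h) :=
    input 0 (fun _ => rfl)
  have hk : FinPT (fun h : List Bits => [packBits h])
      (fun h => (fun j : Fin (m + 5) => decide (h.length ≤ j))) :=
    FinPT.pi (ν := fun _ => Bool) (fun j => (DecPT.packed_length_le hh j).fin_dec)
  refine (PolyTime.cases hk (F := fun k _ => ones (corrMover m
    (Finset.univ.filter (fun j => k j = false)).card : ℕ)) (fun k => const _)).congr
    (fun h => ?_)
  congr 3
  rw [show (Finset.univ.filter fun j : Fin (m + 5) => decide (h.length ≤ j) = false) =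
    Finset.univ.filter (fun j : Fin (m + 5) => (j : ℕ) < h.length) by ext; simp]
  rw [Fin.card_filter_val_lt, min_comm]

lemma polyTime_utility (hΓ : ∀ a i, PolyTimeReal (Γ.payoff a i))
    (i : ℙ) : ∃ z : List Bits → ℕ → ℤ, PolyTime (fun a : List Bits × ℕ => [packBits a.1, ones a.2])
      (fun a => intCode (z a.1 a.2)) ∧ ∀ h : List Bits, (∀ j, cryptoChoice h j < Γ.size j ∧
        h.getD (gStage j) [] = bits (cryptoChoice h j)) →
      ∀ k : ℕ, |Γ.payoffNat (cryptoChoice h) i - (z h k : ℝ) / 2 ^ k| ≤ 1 / 2 ^ k := by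
  classical
  choose z hz hz' using hΓ
  let inp : List Bits × ℕ → List Bits := fun a => [packBits a.1, ones a.2]
  have hh : PolyTime inp (fun a => packBits a.1) := input 0 (fun _ => rfl)
  have hk : PolyTime inp (fun a => ones a.2) := input 1 (fun _ => rfl)
  let dec : ∀ j, (Fin (Γ.size j) → Prop) → Fin (Γ.size j) := fun j P =>
    if hP : ∃ x, P x then Classical.choose hP else 0
  let key : ∀ j, List Bits → Fin (Γ.size j) := fun j h =>
    dec j (fun x => h.getD (gStage j) [] = bits x)
  have hkey : FinPT inp (fun a => (fun j => key j a.1)) := FinPT.pi (fun j =>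
    FinPT.decode (hh.nth (gStage j)) (fun x : Fin (Γ.size j) => bits x) (dec j))
  refine ⟨fun h k => z (fun j => key j h) i k,
    PolyTime.cases hkey (F := fun u a => intCode (z u i a.2)) (fun u =>
      (hz u i).comp (fun a : List Bits × ℕ => a.2) [fun a => ones a.2] (by simpa using hk)
        (fun _ => rfl)), fun h hh k => ?_⟩
  have h1 : ∀ j, key j h = ⟨cryptoChoice h j, (hh j).1⟩ := fun j => by
    have hP : ∃ x : Fin (Γ.size j), h.getD (gStage j) [] = bits x := ⟨⟨_, (hh j).1⟩, (hh j).2⟩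
    have h2 : key j h = Classical.choose hP := dif_pos hP
    have h3 := Classical.choose_spec hP
    rw [h2]
    apply Fin.ext
    have h4 := congrArg bitsVal (h3.symm.trans (hh j).2)
    rwa [bitsVal_bits, bitsVal_bits] at h4
  rw [NormalForm.payoffNat, dif_pos (fun j => (hh j).1)]
  simp only [h1]
  exact hz' _ i k

lemma cryptoChoice_legal {h : List Bits} (hh : h ∈ (⌘ n).H) (hl : h.length = m + 5) (j : ℙ) :
    cryptoChoice h j < Γ.size j ∧ h.getD (gStage j) [] = bits (cryptoChoice h j) := by
  have h3 := three_le_gStage j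
  have hlt := gStage_lt j
  have h1 := hh.2 (gStage j) _ (getElem?_eq_getElem (by omega))
  obtain ⟨t, ht⟩ : ∃ t, gStage j = t + 3 := ⟨gStage j - 3, by omega⟩
  have hg : gOrder m t = j := by rw [← gOrder_gStage j, ht]; rfl
  rw [cryptoChoice, getD_eq_getElem?_getD, getElem?_eq_getElem (by omega)]
  simp only [Option.getD_some]
  generalize h[gStage j] = x at h1
  rw [ht] at h1
  obtain ⟨a, ha, rfl⟩ := h1
  rw [bitsVal_bits]
  rw [hg] at ha
  exact ⟨ha, rfl⟩

lemma cryptoGame_uniform (hS : S.Recognizable) (hΓ : ∀ a i, PolyTimeReal (Γ.payoff a i)) :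
    ComputableUniform ⌘ where
  actions := cryptoGame_actions
  decidable := by
    classical
    obtain ⟨Q, hQ, hQ'⟩ := decPT_mem_cryptoGame (Γ := Γ) (l := l)
      (inp := fun a : ℕ × List Bits => [ones a.1, packBits a.2]) hS (N := fun a => a.1)
      (h := fun a => a.2) (input 0 (fun _ => rfl)) (input 1 (fun _ => rfl))
    refine ⟨fun n h => decide (Q (n, h)), PolyTime.congr hQ (fun a => by simp), fun n hn h => ?_⟩
    rw [decide_eq_true_iff]
    exact hQ' (n, h) hn
  movers := by
    refine ⟨fun h => corrMover m (min h.length (m + 5)), polyTime_mover, fun n hn h hh => ?_⟩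
    simp only [min_eq_left ((cryptoGame_NT hn).1 hh).2.le]
    rfl
  utilities := fun i => by
    obtain ⟨z, hz, hz'⟩ := polyTime_utility hΓ i
    refine ⟨z, hz, fun n hn h hh k => ?_⟩
    rw [cryptoGame_terminal hn] at hh
    exact hz' h (cryptoChoice_legal hh.1 hh.2) k

/-! ## Plays of the cryptographic games -/

/-- What a player sees in the normal-form part. -/
def gView (i : ℙ) (x y z : Bits) : Bits :=
  packBits (x :: y :: z :: List.replicate (gStage i - 3) [])

section

/-- The first action of a profile of responses. -/
def act₀ (ρ : ℙ → Bits → Bits) : Bits := ρ 0 (packBits [])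

/-- The second action. -/
def act₁ (ρ : ℙ → Bits → Bits) : Bits := ρ 1 (packBits [act₀ ρ])

/-- The third action. -/
def act₂ (ρ : ℙ → Bits → Bits) : Bits := ρ 0 (packBits [act₀ ρ, act₁ ρ])

/-- The play that results from a profile of responses to views. -/
def playR (ρ : ℙ → Bits → Bits) : List Bits :=
  cHist (act₀ ρ) (act₁ ρ) (act₂ ρ) (fun i => ρ i (gView i (act₀ ρ) (act₁ ρ) (act₂ ρ)))

variable (S Γ l n)

/-- Responses of player `i` that are legal actions. -/
def LegalResp (i : ℙ) (ρ : Bits → Bits) : Prop :=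
  ∀ h ∈ (⌘ n).turns i, h ++ [ρ (cryptoObs h)] ∈ (⌘ n).H

/-- The terminal history of the envelope game that represents the play. -/
def outR (ρ : ℙ → Bits → Bits) : Out Γ l :=
  cOut S Γ l n (act₀ ρ) (act₁ ρ) (act₂ ρ) (fun i => ρ i (gView i (act₀ ρ) (act₁ ρ) (act₂ ρ)))

end

section

variable {ρ : Fin (m + 2) → Bits → Bits}

lemma cryptoObs_cons₃ (x y z : Bits) (ws : List Bits) :
    cryptoObs (x :: y :: z :: ws) = packBits (x :: y :: z :: List.replicate ws.length []) := by
  simp [cryptoObs]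

lemma playR_step {t : ℕ} (ht : t < (playR ρ).length) :
    ρ (corrMover m t) (cryptoObs ((playR ρ).take t)) = (playR ρ)[t] := by
  have hlen : (playR ρ).length = m + 5 := by simp [playR, cHist]
  rcases t with _ | _ | _ | t
  · rfl
  · rfl
  · rfl
  · simp only [playR, cHist, List.take_succ_cons, List.getElem_cons_succ, getElem_ofFn]
    rw [cryptoObs_cons₃]
    have hg : gStage (gOrder m t) - 3 = t := by
      have := gStage_gOrder (m := m) ⟨t, by omega⟩
      simp only at this; omega
    rw [length_take, length_ofFn, min_eq_left (by omega), gView, hg]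
    rfl

lemma cryptoGame_outcome (hn : 1 ≤ n) (hρ : ∀ i, LegalResp S Γ l n i (ρ i))
    {pol : ∀ h, (⌘ n).NT h → Bits}
    (hpol : ∀ h hh, pol h hh = ρ ((⌘ n).mover h) (cryptoObs h)) : (⌘ n).outcome pol = playR ρ := by
  have h1 : (⌘ n).outcome pol = histOf (fun h => ρ (corrMover m h.length) (cryptoObs h)) (m + 5) :=
    stageGame_outcome (fun t _ => cryptoActions_nonempty hn t) hpol
      (fun h hh => hρ _ h ⟨hh, rfl⟩)
  have hlen : (playR ρ).length = m + 5 := by simp [playR, cHist]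
  rw [h1, ← hlen]
  refine histOf_eq (fun t ht => ?_)
  rw [← playR_step ht]
  simp only [length_take, min_eq_left ht.le]

lemma playR_take_turns (hn : 1 ≤ n) (hρ : ∀ i, LegalResp S Γ l n i (ρ i)) {t : ℕ}
    (ht : t < m + 5) : (playR ρ).take t ∈ (⌘ n).turns (corrMover m t) := by
  have hlen : (playR ρ).length = m + 5 := by simp [playR, cHist]
  have hmem : ∀ s ≤ m + 5, (playR ρ).take s ∈ (⌘ n).H := fun s => by
    induction s with
    | zero => intro _; exact ExtGame.nil_mem _
    | succ s ih =>
      intro hs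
      have h1 := ih (by omega)
      have h2 : (playR ρ).take s ∈ (⌘ n).turns (corrMover m s) := by
        refine ⟨(cryptoGame_NT hn).2 ⟨h1, by rw [length_take]; omega⟩, ?_⟩
        change corrMover m ((playR ρ).take s).length = _
        rw [length_take, min_eq_left (by omega)]
      have h3 := hρ _ _ h2
      rwa [playR_step (ρ := ρ) (t := s) (by omega), List.take_append_getElem] at h3
  refine ⟨(cryptoGame_NT hn).2 ⟨hmem t ht.le, by rw [length_take]; omega⟩, ?_⟩
  change corrMover m ((playR ρ).take t).length = _
  rw [length_take, min_eq_left (by omega)]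

lemma playR_getElem_mem (hn : 1 ≤ n) (hρ : ∀ i, LegalResp S Γ l n i (ρ i)) {t : ℕ}
    (ht : t < (playR ρ).length) : (playR ρ)[t] ∈ cryptoActions S Γ l n t := by
  have hlen : (playR ρ).length = m + 5 := by simp [playR, cHist]
  have h1 := hρ _ _ (playR_take_turns hn hρ (t := t) (by omega))
  rw [playR_step ht] at h1
  have h2 := (cryptoGame_append.1 h1).2.2
  rwa [length_take, min_eq_left ht.le] at h2

lemma act₀_mem (hn : 1 ≤ n) (hρ : ∀ i, LegalResp S Γ l n i (ρ i)) :
    act₀ ρ ∈ cryptoActions S Γ l n 0 := playR_getElem_mem hn hρ (t := 0) (by simp [playR, cHist])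

lemma resp_bits (hn : 1 ≤ n) (hρ : ∀ i, LegalResp S Γ l n i (ρ i)) (i : ℙ) :
    ∃ a < Γ.size i, ρ i (gView i (act₀ ρ) (act₁ ρ) (act₂ ρ)) = bits a := by
  have h3 := three_le_gStage i
  have hlt := gStage_lt i
  obtain ⟨t, ht⟩ : ∃ t, gStage i = t + 3 := ⟨gStage i - 3, by omega⟩
  have hg : gOrder m t = i := by rw [← gOrder_gStage i, ht]; rfl
  have h1 := playR_getElem_mem hn hρ (t := t + 3) (by simp [playR, cHist]; omega)
  simp only [playR, cHist, List.getElem_cons_succ, getElem_ofFn, hg] at h1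
  obtain ⟨a, ha, he⟩ := h1
  rw [hg] at ha
  exact ⟨a, ha, he⟩

lemma corrMap_playR (hn : 1 ≤ n) (hρ : ∀ i, LegalResp S Γ l n i (ρ i)) :
    ♮ n (playR ρ) = mkHist (outR S Γ l n ρ) := by
  rw [playR, corrMap_cHist (Γ := Γ)]
  · rfl
  · intro i
    obtain ⟨a, ha, he⟩ := resp_bits hn hρ i
    rw [he, bitsVal_bits]
    exact ha

/-- The responses of a profile of strategies with given random bits. -/
def respOf (M : ∀ i, Strat ⌘ i) (n : ℕ) {N : ℙ → ℕ} (ω : Coins N) (i : ℙ) (v : Bits) : Bits :=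
  (M i).act n v ((ofFn (ω i)).take ((M i).coins.eval n))

lemma Strat.legalResp (M : Strat ⌘ i) (hn : 1 ≤ n) {r : Bits} (hr : r.length = M.coins.eval n) :
    LegalResp S Γ l n i (fun v => M.act n v r) := fun h hh => M.legal n hn h hh r hr

lemma respOf_legal (M : ∀ i, Strat ⌘ i) (hn : 1 ≤ n) {N : ℙ → ℕ}
    (hN : ∀ i, (M i).coins.eval n ≤ N i) (ω : Coins N) (i : ℙ) :
    LegalResp S Γ l n i (respOf M n ω i) := (M i).legalResp hn (by simp [hN])

lemma play_eq (M : ∀ i, Strat ⌘ i) (hn : 1 ≤ n) {N : ℙ → ℕ}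
    (hN : ∀ i, (M i).coins.eval n ≤ N i) (ω : Coins N) : play M n ω = playR (respOf M n ω) :=
  cryptoGame_outcome hn (respOf_legal M hn hN ω) (fun h hh => rfl)

lemma corrMap_play (M : ∀ i, Strat ⌘ i) (hn : 1 ≤ n) {N : ℙ → ℕ}
    (hN : ∀ i, (M i).coins.eval n ≤ N i) (ω : Coins N) :
    ♮ n (play M n ω) = mkHist (outR S Γ l n (respOf M n ω)) := by
  rw [play_eq M hn hN, corrMap_playR hn (respOf_legal M hn hN ω)]

end

/-! ## Plans -/

/-- The `j`-th component of a view. -/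
def viewComp (j : ℕ) (v : Bits) : Bits := fstBits (sndBits^[j] v)

lemma viewComp_packBits (xs : List Bits) (j : ℕ) :
    viewComp j (packBits xs) = xs.getD j [] := fstBits_nth xs j

lemma PolyTime.viewComp {α : Type} {inp : α → List Bits} [FixedArity inp]
    {f : α → Bits} (hf : PolyTime inp f) (j : ℕ) :
    PolyTime inp (fun a => viewComp j (f a)) := (hf.sndBits_iterate j).fstBits

section

/-- What a plan prescribes: whether the third action is a prepared string instead of an invalid
string, the bits of the number for the envelope or to be picked, when to open the envelope, and the
action in the normal-form part. -/
abbrev Beh (Γ : NormalForm m) (l : ℕ) (i : ℙ) : Type :=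
  Bool × (Fin (size l) → Bool) × (Fin l → Fin l → Bool) × (Lab l → Fin (Γ.size i))

variable (S Γ l)

/-- The number with given bits. -/
def bitsNum (l : ℕ) [NeZero l] (e : Fin (size l) → Bool) : Fin l := ofNat l (bitsVal (ofFn e))

variable {l} in
/-- The information of player `i` in the normal-form part. -/
def viewLab (i : ℙ) (e : Fin (size l) → Bool) (n : ℕ) (v : Bits) : Lab l :=
  (if i = 0 then some (bitsNum l e) else
    if ValidKeys S (size l) n (viewComp 0 v) (viewComp 2 v) then
      some (bitsNum l (openBits S (size l) n (viewComp 0 v) (viewComp 2 v))) else none,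
    ofNat l (bitsVal (viewComp 1 v)), decide (ValidKeys S (size l) n (viewComp 0 v) (viewComp 2 v)))

variable {Γ l}

/-- The action at a view. -/
def behAct (n : ℕ) (X : Beh Γ l i) (cc junk v : Bits) : Bits :=
  if v = [] then commitStr S n X.2.1 cc
  else if sndBits v = [] then ofFn X.2.1
  else if sndBits (sndBits v) = [] then
    if X.2.2.1 (bitsNum l X.2.1) (ofNat l (bitsVal (viewComp 1 v))) = true then keyStr S n X.2.1 cc
    else if X.1 = true then junk else ones (size l * n)
  else bits (X.2.2.2 (viewLab S i X.2.1 n v))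

end

section

variable {α : Type} {inp : α → List Bits} [FixedArity inp] {d : ℕ} {N : α → ℕ} {r : α → Bits}

lemma PolyTime.commitStr (e : Fin d → Bool) (hN : PolyTime inp (fun a => ones (N a)))
    (hr : PolyTime inp r) : PolyTime inp (fun a => commitStr S (N a) e (r a)) := by
  have := flatten (inp := inp) (ofFn fun (j : Fin d) (a : α) =>
    S.C₁ (N a) (e j) (_root_.block (S.coins.eval (N a)) j (r a))) (by
      intro g hg
      obtain ⟨j, rfl⟩ := (List.mem_ofFn' _ _).1 hg
      have hb := PolyTime.block (ones_eval S.coins hN) j hr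
      exact S.polyTime₁.comp (fun a => (N a, e j, _root_.block (S.coins.eval (N a)) j (r a)))
        [fun a => ones (N a), fun a => [e j], fun a => _root_.block (S.coins.eval (N a)) j (r a)]
        (by simp [hN, hb, const]) (fun _ => rfl))
  exact this.congr (fun a => by rw [map_ofFn]; rfl)

lemma PolyTime.keyStr (e : Fin d → Bool) (hN : PolyTime inp (fun a => ones (N a)))
    (hr : PolyTime inp r) : PolyTime inp (fun a => keyStr S (N a) e (r a)) := by
  have := flatten (inp := inp) (ofFn fun (j : Fin d) (a : α) =>
    S.C₂ (N a) (e j) (_root_.block (S.coins.eval (N a)) j (r a))) (by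
      intro g hg
      obtain ⟨j, rfl⟩ := (List.mem_ofFn' _ _).1 hg
      have hb := PolyTime.block (ones_eval S.coins hN) j hr
      exact S.polyTime₂.comp (fun a => (N a, e j, _root_.block (S.coins.eval (N a)) j (r a)))
        [fun a => ones (N a), fun a => [e j], fun a => _root_.block (S.coins.eval (N a)) j (r a)]
        (by simp [hN, hb, const]) (fun _ => rfl))
  exact this.congr (fun a => by rw [map_ofFn]; rfl)

lemma FinPT.bitsVal_mod (l : ℕ) [NeZero l] (hr : PolyTime inp r) :
    FinPT inp (fun a => ofNat l (bitsVal (r a))) := by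
  classical
  let δ : α → ℕ → Fin l × Fin l → Fin l × Fin l := fun a t q =>
    if (r a)[t]? = some true then (ofNat l (q.1 + q.2), ofNat l (2 * q.2))
    else (q.1, ofNat l (2 * q.2))
  have hδ : ∀ q, FinPT (fun p : α × ℕ => ones p.2 :: inp p.1) (fun p => δ p.1 p.2 q) := fun q => by
    refine ite ?_ (const _) (const _)
    have h1 : PolyTime (fun p : α × ℕ => ones p.2 :: inp p.1) (fun p => r p.1) :=
      hr.of_subset (fun p : α × ℕ => p.1) 1 (fun p i => by rw [add_comm]; rfl)
    have h2 : PolyTime (fun p : α × ℕ => ones p.2 :: inp p.1) (fun p => ones p.2) :=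
      input 0 (fun _ => rfl)
    exact (DecPT.getElem_eq h1 h2 true).congr (fun p => by rw [length_ones])
  have hit := iterate (const (inp := inp) ((0, ofNat l 1) : Fin l × Fin l)) hδ
    hr.ones_length
  refine (hit.map Prod.fst).congr (fun a => ?_)
  have key : ∀ t, Nat.rec (motive := fun _ => Fin l × Fin l) (0, ofNat l 1)
      (fun t q => δ a t q) t = (ofNat l (bitsVal ((r a).take t)), ofNat l (2 ^ t)) := fun t => by
    induction t with
    | zero => simp [bitsVal]
    | succ t ih =>
      simp only [ih, δ]
      rw [bitsVal_take_succ]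
      by_cases h : (r a)[t]? = some true
      · rw [if_pos h]
        refine Prod.ext (Fin.ext ?_) (Fin.ext ?_)
        · simp [h]
        · simp [pow_succ, mul_comm]
      · rw [if_neg h]
        refine Prod.ext (Fin.ext ?_) (Fin.ext ?_)
        · simp [h]
        · simp [pow_succ, mul_comm]
  rw [key, List.take_length]

lemma FinPT.viewLab (e : Fin (size l) → Bool)
    (hN : PolyTime inp (fun a => ones (N a))) (hr : PolyTime inp r) :
    FinPT inp (fun a => viewLab S i e (N a) (r a)) := by
  have h0 := hr.viewComp 0
  have h2 := hr.viewComp 2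
  have hv := DecPT.validKeys (S := S) (size l) hN h0 h2
  have h3 : FinPT inp (fun a => if i = 0 then some (bitsNum l e) else
      if ValidKeys S (size l) (N a) (_root_.viewComp 0 (r a)) (_root_.viewComp 2 (r a)) then
        some (bitsNum l (_root_.openBits S (size l) (N a) (_root_.viewComp 0 (r a))
          (_root_.viewComp 2 (r a)))) else none) := by
    refine ite (DecPT.const _) (const _) (ite hv ?_ (const _))
    exact (openBits (S := S) (size l) hN h0 h2).map (fun b => some (bitsNum l b))
  exact map₂ h3 (map₂ (bitsVal_mod l (hr.viewComp 1)) hv.fin_dec Prod.mk) Prod.mk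

lemma PolyTime.behAct {X : α → Beh Γ l i} {cc junk v : α → Bits} (hX : FinPT inp X)
    (hN : PolyTime inp (fun a => ones (N a))) (hc : PolyTime inp cc) (hj : PolyTime inp junk)
    (hv : PolyTime inp v) : PolyTime inp (fun a => behAct S (N a) (X a) (cc a) (junk a) (v a)) := by
  refine PolyTime.cases hX (F := fun X a => _root_.behAct S (N a) X (cc a) (junk a) (v a))
    (fun X => ?_)
  have hb := FinPT.bitsVal_mod l (hv.viewComp 1)
  have h2 : PolyTime inp (fun a => if X.2.2.1 (bitsNum l X.2.1)
      (ofNat l (bitsVal (_root_.viewComp 1 (v a)))) = true then _root_.keyStr S (N a) X.2.1 (cc a)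
    else if X.1 = true then junk a else ones (size l * N a)) := by
    refine (ite (hb.dec (fun b => X.2.2.1 (bitsNum l X.2.1) b = true))
      (keyStr (S := S) X.2.1 hN hc) (ite (DecPT.const (X.1 = true)) hj
        ((ones_const (size l)).ones_mul hN))).congr (fun a => ?_)
    split_ifs <;> rfl
  have h3 : PolyTime inp (fun a => bits (X.2.2.2 (_root_.viewLab S i X.2.1 (N a) (v a)))) :=
    PolyTime.cases (FinPT.viewLab (S := S) (i := i) X.2.1 hN hv)
      (F := fun L _ => bits (X.2.2.2 L)) (fun L => const _)
  refine (ite (DecPT.eq_nil hv) (commitStr (S := S) X.2.1 hN hc)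
    (ite (DecPT.eq_nil hv.sndBits) (const (ofFn X.2.1))
      (ite (DecPT.eq_nil hv.sndBits.sndBits) h2 h3))).congr (fun a => ?_)
  simp only [_root_.behAct]
  split_ifs <;> rfl

end

section

variable {X : Beh Γ l i} {cc junk : Bits}

lemma sndBits_packBits_cons (x : Bits) (xs : List Bits) :
    sndBits (packBits (x :: xs)) = packBits xs := sndBits_delimit x _

lemma packBits_cons_ne_nil (x : Bits) (xs : List Bits) : packBits (x :: xs) ≠ [] :=
  fun h => by simpa using (packBits_eq_nil _).1 h

lemma behAct_zero : behAct S n X cc junk (packBits []) = commitStr S n X.2.1 cc := rfl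

lemma behAct_one (x : Bits) : behAct S n X cc junk (packBits [x]) = ofFn X.2.1 := by
  rw [behAct, if_neg (packBits_cons_ne_nil _ _), sndBits_packBits_cons, if_pos (show packBits [] = [] from rfl)]

lemma behAct_two (x y : Bits) : behAct S n X cc junk (packBits [x, y]) =
    if X.2.2.1 (bitsNum l X.2.1) (ofNat l (bitsVal y)) = true then keyStr S n X.2.1 cc
    else if X.1 = true then junk else ones (size l * n) := by
  rw [behAct, if_neg (packBits_cons_ne_nil _ _), sndBits_packBits_cons,
    if_neg (packBits_cons_ne_nil _ _), sndBits_packBits_cons, if_pos (show packBits [] = [] from rfl), viewComp_packBits]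
  rfl

lemma behAct_three (x y z : Bits) (ws : List Bits) :
    behAct S n X cc junk (packBits (x :: y :: z :: ws)) =
      bits (X.2.2.2 (viewLab S i X.2.1 n (packBits (x :: y :: z :: ws)))) := by
  rw [behAct, if_neg (packBits_cons_ne_nil _ _), sndBits_packBits_cons,
    if_neg (packBits_cons_ne_nil _ _), sndBits_packBits_cons, if_neg (packBits_cons_ne_nil _ _)]

lemma viewLab_eq (hn : 1 ≤ n) {x y z : Bits} {ws : List Bits}
    {e : Fin (size l) → Bool} (hx : x ∈ cryptoActions S Γ l n 0)
    (hi : i = 0 → committedVal S (size l) n x = bitsVal (ofFn e)) :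
    viewLab S i e n (packBits (x :: y :: z :: ws)) =
      labOf i (ofNat l (committedVal S (size l) n x)) (ofNat l (bitsVal y))
        (decide (ValidKeys S (size l) n x z)) := by
  simp only [viewLab, viewComp_packBits, List.getD_cons_zero, List.getD_cons_succ, labOf]
  refine Prod.ext ?_ rfl
  simp only [decide_eq_true_iff]
  by_cases h0 : i = 0
  · rw [if_pos h0, if_pos (Or.inl h0), hi h0]
    rfl
  · rw [if_neg h0]
    by_cases hv : ValidKeys S (size l) n x z
    · rw [if_pos hv, if_pos (Or.inr hv), bitsNum,
        openBits_eq hn ((mem_cryptoActions_zero hn).1 hx).2 hv]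
    · rw [if_neg hv, if_neg (by tauto)]

lemma behAct_legal (hn : 1 ≤ n)
    (hcc : size l * S.coins.eval n ≤ cc.length) (hj : junk.length ≤ size l * n) :
    LegalResp S Γ l n i (behAct S n X cc junk) := by
  rintro h ⟨hN, rfl⟩
  rw [cryptoGame_NT hn] at hN
  refine cryptoGame_append.2 ⟨hN.1, hN.2, ?_⟩
  rcases h with _ | ⟨x, _ | ⟨y, _ | ⟨z, ws⟩⟩⟩
  · exact commitStr_mem hn hcc
  · have : cryptoObs [x] = packBits [x] := by simp [cryptoObs]
    rw [this, behAct_one]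
    exact length_ofFn
  · have : cryptoObs [x, y] = packBits [x, y] := by simp [cryptoObs]
    rw [this, behAct_two]
    change List.length _ ≤ _
    split_ifs
    · rw [length_keyStr hn hcc]
      exact Nat.mul_le_mul_left _ (Nat.sub_le _ _)
    · exact hj
    · simp
  · rw [cryptoObs_cons₃, behAct_three]
    exact ⟨_, Fin.isLt _, rfl⟩

end

/-- A plan of player `i`: what to do is determined by random bits, and the commitments are made with
further random bits. -/
structure Plan {m : ℕ} (Γ : NormalForm m) (l : ℕ) (i : Fin (m + 2)) where
  coins : Polynomial ℕ
  samp : ℕ → Bits → Beh Γ l i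
  junk : ℕ → Bits → Bits
  samp_fin : FinPT inp₂ (fun a => samp a.1 a.2)
  junk_poly : PolyTime inp₂ (fun a => junk a.1 a.2)
  junk_length : ∀ n r, (junk n r).length ≤ size l * n

section

variable (S)

variable (l n) in
/-- The number of random bits used for commitments. -/
def commitCoins : ℕ := size l * S.coins.eval n

local notation "¢" => commitCoins S l

/-- The responses of a plan. -/
def Plan.act (P : Plan Γ l i) (n : ℕ) (v r : Bits) : Bits :=
  behAct S n (P.samp n (r.drop (¢ n))) (r.take (¢ n))
    (P.junk n (r.drop (¢ n))) v

lemma Plan.act_polyTime (P : Plan Γ l i) {α : Type} {inp : α → List Bits} [FixedArity inp]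
    {N : α → ℕ} {v r : α → Bits} (hN : PolyTime inp (fun a => ones (N a)))
    (hv : PolyTime inp v) (hr : PolyTime inp r) :
    PolyTime inp (fun a => P.act S (N a) (v a) (r a)) ∧
    FinPT inp (fun a => P.samp (N a) ((r a).drop (¢ (N a)))) := by
  have hc : PolyTime inp (fun a => ones (¢ (N a))) :=
    (ones_const _).ones_mul (ones_eval S.coins hN)
  have hd : PolyTime inp (fun a => (r a).drop (¢ (N a))) :=
    (hr.drop hc).congr (fun a => by rw [length_ones])
  have ht : PolyTime inp (fun a => (r a).take (¢ (N a))) :=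
    (hr.take hc).congr (fun a => by rw [length_ones])
  have hs : FinPT inp (fun a => P.samp (N a) ((r a).drop (¢ (N a)))) :=
    P.samp_fin.comp (fun a => (N a, (r a).drop (¢ (N a))))
      [fun a => ones (N a), fun a => (r a).drop (¢ (N a))] (by simp [hN, hd])
      (fun _ => rfl)
  have hj : PolyTime inp (fun a => P.junk (N a) ((r a).drop (¢ (N a)))) :=
    P.junk_poly.comp (fun a => (N a, (r a).drop (¢ (N a))))
      [fun a => ones (N a), fun a => (r a).drop (¢ (N a))] (by simp [hN, hd])
      (fun _ => rfl)
  exact ⟨PolyTime.behAct hs hN ht hj hv, hs⟩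

/-- The strategy given by a plan. -/
def Plan.toStrat (P : Plan Γ l i) : Strat ⌘ i where
  coins := C (size l) * S.coins + P.coins
  act := P.act S
  polyTime := (P.act_polyTime S (input 0 (fun _ => rfl)) (input 1 (fun _ => rfl))
    (input 2 (fun _ => rfl))).1
  legal := fun n hn h hh r hr => by
    refine behAct_legal hn ?_ (P.junk_length _ _) h hh
    simp only [eval_add, eval_mul, eval_C] at hr
    rw [length_take, hr, commitCoins]
    omega

lemma Plan.toStrat_coins (P : Plan Γ l i) (n : ℕ) :
    (P.toStrat S).coins.eval n = ¢ n + P.coins.eval n := by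
  simp [toStrat, commitCoins]

end

local notation "¢" => commitCoins S l

lemma corrMap_getLast (n : ℕ) (h : List Bits) (a : Bits) : (♮ n (h ++ [a])).getLast? =
      some (corrMapAct S l n (h[0]?.getD []) h.length a) := by
  rw [corrMap_append, List.getLast?_concat]

lemma corrMap_single (n : ℕ) (x : Bits) :
    ♮ n [x] = [enclose (committedVal S (size l) n x % l)] := by
  simp [corrMap]

lemma corrMap_pair (n : ℕ) (x y : Bits) :
    ♮ n [x, y] = [enclose (committedVal S (size l) n x % l), pick (bitsVal y % l)] := by
  simp [corrMap]

/-- The code of an information set of the envelope game and an action. -/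
def knownCode (i : ℙ) (t : Bool × Bool × Bool) (a b : Fin l) (r : Bool) (L : Lab l)
    (x : ℕ) : Bits := code ((if t.1 then ([], enclose a) else if t.2.1 then ([none], pick a)
    else if t.2.2 then ([some (enclose a), some (pick b)], revAct r)
    else (labInfo i L, move x)) : List (Option CorrAct) × CorrAct)

lemma reachableBy_first {𝒢 : ℕ → BitGame (m + 2)} {M : Strat 𝒢 i} {r x : Bits}
    {h : List Bits} (hr : ReachableBy M n r (x :: h)) (h0 : [] ∈ (𝒢 n).turns i) :
    x = M.act n ((𝒢 n).info []) r := hr [] x ⟨h, rfl⟩ h0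

lemma Plan.knows (P : Plan Γ l i) : ∃ A : ℕ → Bits → Bits → Bits, PolyTime inp₃
      (fun a => A a.1 a.2.1 a.2.2) ∧ ∀ n, 1 ≤ n → ∀ h ∈ (⌘ n).turns i, ∀ r : Bits,
      r.length = (P.toStrat S).coins.eval n → ReachableBy (P.toStrat S) n r h →
      ∃ a, (♮ n (h ++ [(P.toStrat S).act n ((⌘ n).info h) r])).getLast? = some a ∧
        A n ((⌘ n).info h) r = code (✉.info (♮ n h), a) := by
  obtain ⟨hN, hv, hr⟩ := PolyTime.args₃
  obtain ⟨hA, hX⟩ := P.act_polyTime S hN hv hr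
  have ht : FinPT inp₃ (fun a => (decide (a.2.1 = []), decide (sndBits a.2.1 = []),
      decide (sndBits (sndBits a.2.1) = []))) :=
    FinPT.map₂ (DecPT.eq_nil hv).fin_dec (FinPT.map₂ (DecPT.eq_nil hv.sndBits).fin_dec
      (DecPT.eq_nil hv.sndBits.sndBits).fin_dec Prod.mk) Prod.mk
  have hb : FinPT inp₃ (fun a => ofNat l (bitsVal (viewComp 1 a.2.1))) :=
    FinPT.bitsVal_mod l (hv.viewComp 1)
  have hk : FinPT inp₃ (fun a => decide (ValidKeys S (size l) a.1 (viewComp 0 a.2.1)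
      (P.act S a.1 a.2.1 a.2.2))) := (DecPT.validKeys _ hN (hv.viewComp 0) hA).fin_dec
  let A : Beh Γ l i → ℕ → Bits → Bits → Bits := fun X n v r =>
    knownCode i (decide (v = []), decide (sndBits v = []), decide (sndBits (sndBits v) = []))
      (bitsNum l X.2.1) (ofNat l (bitsVal (viewComp 1 v)))
      (decide (ValidKeys S (size l) n (viewComp 0 v) (P.act S n v r)))
      (viewLab S i X.2.1 n v) (X.2.2.2 (viewLab S i X.2.1 n v))
  refine ⟨fun n v r => A (P.samp n (r.drop (¢ n))) n v r,
    PolyTime.cases hX (F := fun X a => A X a.1 a.2.1 a.2.2) (fun X => ?_), ?_⟩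
  · exact PolyTime.cases (FinPT.map₂ ht (FinPT.map₂ hb (FinPT.map₂ hk
      (FinPT.viewLab (S := S) (i := i) X.2.1 hN hv) Prod.mk) Prod.mk) Prod.mk)
      (F := fun k _ => knownCode i k.1 (bitsNum l X.2.1) k.2.1 k.2.2.1 k.2.2.2 (X.2.2.2 k.2.2.2))
      (fun k => const _)
  · intro n hn h hh r hrl hreach
    refine ⟨_, corrMap_getLast n h _, ?_⟩
    set X := P.samp n (r.drop (¢ n)) with hXdef
    have hcc : size l * S.coins.eval n ≤ (r.take (¢ n)).length := by
      rw [toStrat_coins] at hrl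
      rw [length_take, hrl, ← commitCoins]
      omega
    have hh' := (cryptoGame_NT hn).1 hh.1
    have hmov : corrMover m h.length = i := hh.2
    change A X n (cryptoObs h) r = code ((corrObs m (♮ n h),
      corrMapAct S l n (h[0]?.getD []) h.length (P.act S n (cryptoObs h) r)) : List (Option CorrAct) × CorrAct)
    have hown : ∀ x h', h = x :: h' → i = 0 →
        committedVal S (size l) n x = bitsVal (ofFn X.2.1) := by
      rintro x h' rfl rfl
      have h0 := reachableBy_first hreach ⟨(cryptoGame_NT hn).2 ⟨ExtGame.nil_mem _, by simp⟩, rfl⟩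
      have h1 : x = commitStr S n X.2.1 (r.take (¢ n)) := h0
      rw [h1, committedVal_commitStr hn hcc]
    rcases h with _ | ⟨x, _ | ⟨y, _ | ⟨z, ws⟩⟩⟩
    · have h1 : P.act S n (cryptoObs []) r = commitStr S n X.2.1 (r.take (¢ n)) := rfl
      rw [h1]
      change code _ = _
      congr 1
      simp only [corrMapAct, List.length_nil]
      rw [committedVal_commitStr hn hcc]
      simp [cryptoObs, packBits, corrMap, corrObs, bitsNum]
    · have e1 : cryptoObs [x] = packBits [x] := by simp [cryptoObs]
      rw [e1]
      have h1 : P.act S n (packBits [x]) r = ofFn X.2.1 := behAct_one x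
      rw [h1, corrMap_single, corrObs_one]
      change code _ = _
      congr 1
      rw [if_neg (by simpa using packBits_cons_ne_nil _ _), if_pos (decide_eq_true (by rw [sndBits_packBits_cons]; rfl))]
      rfl
    · have e1 : cryptoObs [x, y] = packBits [x, y] := by simp [cryptoObs]
      rw [e1, corrMap_pair, corrObs_two]
      change code _ = _
      congr 1
      rw [if_neg (by simpa using packBits_cons_ne_nil _ _),
        if_neg (by simpa [sndBits_packBits_cons] using packBits_cons_ne_nil _ _),
        if_pos (decide_eq_true (by rw [sndBits_packBits_cons, sndBits_packBits_cons]; rfl))]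
      simp only [viewComp_packBits]
      have h1 := hown x [y] rfl hmov.symm
      rw [h1]
      refine Prod.ext rfl ?_
      change revAct (decide (ValidKeys S (size l) n x _)) = if ValidKeys S (size l) n x _ then
        reveal else destroy
      rw [revAct]
      simp only [decide_eq_true_iff]
    · rw [cryptoObs_cons₃]
      have hws : ws.length < m + 2 := by
        have := hh'.2
        simp at this
        omega
      have hx : x ∈ cryptoActions S Γ l n 0 := hh'.1.2 0 x rfl
      have hg : gOrder m ws.length = i := hmov
      rw [corrObs_corrMap_cons₃ hws, hg]
      have h1 := behAct_three (S := S) (n := n) (X := X) (cc := r.take (¢ n))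
        (junk := P.junk n (r.drop (¢ n))) x y z (List.replicate ws.length [])
      have h2 : P.act S n (packBits (x :: y :: z :: List.replicate ws.length [])) r = _ := h1
      rw [h2]
      change code _ = _
      congr 1
      rw [if_neg (by simpa using packBits_cons_ne_nil _ _),
        if_neg (by simpa [sndBits_packBits_cons] using packBits_cons_ne_nil _ _),
        if_neg (by simpa [sndBits_packBits_cons] using packBits_cons_ne_nil _ _)]
      rw [viewLab_eq hn hx (hown x _ rfl)]
      refine Prod.ext rfl ?_
      exact congrArg move (bitsVal_bits _).symm

lemma corrMap_last_action (hn : 1 ≤ n) (h h' : List Bits)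
    (e : cryptoObs h = cryptoObs h') (a : Bits) :
    (♮ n (h ++ [a])).getLast? = (♮ n (h' ++ [a])).getLast? := by
  obtain ⟨h1, h2⟩ := cryptoObs_eq e
  rw [corrMap_getLast, corrMap_getLast, h1]
  have h3 := congrArg (fun L => L[0]?) h2
  simp only [List.getElem?_take] at h3
  simp at h3
  rw [h3]

/-- The bits of a number below `l`. -/
local notation "♭" => numBits (size l)


/-! ## Product distributions -/

section

variable {ι κ : Type} [Fintype ι] [DecidableEq ι] [Fintype κ]

lemma sum_pi_mul {X : ι → Type} [∀ i, Fintype (X i)] (γ : ∀ i, X i → ℝ)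
    (hγ : ∀ i, ∑ x, γ i x = 1) (i₀ : ι) (g : X i₀ → ℝ) :
    ∑ f : ∀ i, X i, (∏ i, γ i (f i)) * g (f i₀) = ∑ x, γ i₀ x * g x := by
  classical
  let γ' : ∀ i, X i → ℝ := fun i x => if h : i = i₀ then γ i x * g (h ▸ x) else γ i x
  have h1 : ∀ f : ∀ i, X i, (∏ i, γ i (f i)) * g (f i₀) = ∏ i, γ' i (f i) := fun f => by
    rw [prod_eq_mul_prod_compl i₀, prod_eq_mul_prod_compl i₀ (fun i => γ' i (f i))]
    have h2 : γ' i₀ (f i₀) = γ i₀ (f i₀) * g (f i₀) := by simp [γ']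
    have h3 : ∏ i ∈ {i₀}ᶜ, γ' i (f i) = ∏ i ∈ {i₀}ᶜ, γ i (f i) := prod_congr rfl fun i hi => by
        have : i ≠ i₀ := by simpa using hi
        simp [γ', this]
    rw [h2, h3]
    ring
  simp only [h1]
  have h4 := prod_univ_sum (t := fun i : ι => (Finset.univ : Finset (X i))) (f := γ')
  rw [piFinset_univ] at h4
  rw [← h4, prod_eq_mul_prod_compl i₀, Finset.prod_eq_one, mul_one]
  · simp [γ']
  · intro i hi
    have : i ≠ i₀ := by simpa using hi
    simp [γ', this, hγ]

lemma sum_pi_eq_one {X : ι → Type} [∀ i, Fintype (X i)] (γ : ∀ i, X i → ℝ)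
    (hγ : ∀ i, ∑ x, γ i x = 1) : ∑ f : ∀ i, X i, ∏ i, γ i (f i) = 1 := by
  have h4 := prod_univ_sum (t := fun i : ι => (Finset.univ : Finset (X i))) (f := γ)
  rw [piFinset_univ] at h4
  rw [← h4, Finset.prod_eq_one]
  exact fun i _ => hγ i

end

section

/-- The behaviour of a deterministic strategy. -/
def cleanBeh (D : Data Γ l i) : Beh Γ l i := (false, numBits _ D.1.1, D.1.2, D.2)

/-- The deterministic strategy that a behaviour represents. -/
def behData (X : Beh Γ l i) : Data Γ l i := ((bitsNum l X.2.1, X.2.2.1), X.2.2.2)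

lemma bitsVal_num (a : Fin l) : bitsVal (ofFn (♭ a)) = a :=
  bitsVal_numBits (a.2.trans (lt_two_pow_size l))

lemma bitsNum_num (a : Fin l) : bitsNum l (♭ a) = a := by
  rw [bitsNum, bitsVal_num]
  simp

lemma behData_cleanBeh (D : Data Γ l i) : behData (cleanBeh D) = D := by
  simp only [behData, cleanBeh, bitsNum_num]

variable {ρ : Fin (m + 2) → Bits → Bits}

/-- The conditions for the outcome `o` on the strategies of the players other than `i`. -/
def Compat (i : ℙ) (D : ∀ j, Data Γ l j) (o : Out Γ l) : Prop :=
  (i ≠ 0 → (D 0).1.1 = o.1 ∧ (D 0).1.2 o.1 o.2.1 = o.2.2.1) ∧ (i ≠ 1 → (D 1).1.1 = o.2.1) ∧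
    ∀ j ≠ i, (D j).2 (labOf j o.1 o.2.1 o.2.2.1) = o.2.2.2 j

/-- The conditions for the outcome `o` on the strategy of player `i`. -/
def Own (i : ℙ) (t : Data Γ l i) (o : Out Γ l) : Prop :=
  (i = 0 → t.1.1 = o.1 ∧ t.1.2 o.1 o.2.1 = o.2.2.1) ∧ (i = 1 → t.1.1 = o.2.1) ∧
    t.2 (labOf i o.1 o.2.1 o.2.2.1) = o.2.2.2 i

lemma outOf_eq_iff (D : ∀ j, Data Γ l j) (o : Out Γ l) : outOf D = o ↔ ∀ j, Own j (D j) o := by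
  obtain ⟨a, b, r, u⟩ := o
  simp only [outOf, Prod.mk.injEq]
  constructor
  · rintro ⟨rfl, rfl, rfl, rfl⟩ j
    refine ⟨?_, ?_, rfl⟩
    · rintro rfl; exact ⟨rfl, rfl⟩
    · rintro rfl; rfl
  · intro h
    obtain ⟨h1, h2⟩ := (h 0).1 rfl
    have h3 := (h 1).2.1 rfl
    simp only at h1 h2 h3
    refine ⟨h1, h3, by rw [h1, h3, h2], ?_⟩
    funext j
    rw [h1, h3, h2]
    exact (h j).2.2

lemma compat_iff (i : ℙ) (D : ∀ j, Data Γ l j) (o : Out Γ l) :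
    Compat i D o ↔ ∀ j ≠ i, Own j (D j) o := by
  constructor
  · rintro ⟨h1, h2, h3⟩ j hj
    refine ⟨?_, ?_, h3 j hj⟩
    · rintro rfl; exact h1 hj.symm
    · rintro rfl; exact h2 hj.symm
  · intro h
    exact ⟨fun h0 => (h 0 h0.symm).1 rfl, fun h0 => (h 1 h0.symm).2.1 rfl, fun j hj => (h j hj).2.2⟩

lemma outOf_update_eq_iff (i : ℙ) (D : ∀ j, Data Γ l j) (t : Data Γ l i) (o : Out Γ l) :
    outOf (update D i t) = o ↔ Compat i D o ∧ Own i t o := by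
  rw [outOf_eq_iff, compat_iff]
  constructor
  · intro h
    refine ⟨fun j hj => ?_, ?_⟩
    · have := h j; rwa [update_of_ne hj] at this
    · have := h i; rwa [update_self] at this
  · rintro ⟨h1, h2⟩ j
    by_cases hj : j = i
    · subst hj; rwa [update_self]
    · rw [update_of_ne hj]; exact h1 j hj

variable (S l n) in
/-- The string that follows commitments if they are opened or not. -/
def thirdStr (a : ℕ) (r : Bool) (cc : Bits) : Bits :=
  if r then keyStr S n (♭ a) cc else ones (size l * n)

variable (S l n) in
/-- The view of player `i` in the normal-form part when the others follow plans. -/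
def testView (i : ℙ) (ρ : Bits → Bits) (a b : ℕ) (r : Bool) (cc x : Bits) : Bits :=
  gView i x (if i = 1 then ρ (packBits [x]) else ofFn (♭ b))
    (thirdStr S l n a r cc)

variable (S Γ l n) in
/-- The deviator `i` picks `b` and finally plays `u`, when the others play for the outcome
`(a, b, r, _)` and the first string is `x`. -/
def DevTest (i : ℙ) (ρ : Bits → Bits) (a b : Fin l) (r : Bool)
    (u : Fin (Γ.size i)) (cc x : Bits) : Prop :=
  (i = 1 → ofNat l (bitsVal (ρ (packBits [x]))) = b) ∧
    ofNat _ (bitsVal (ρ (testView S l n i ρ a b r cc x))) = u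

lemma cleanBeh_act₂ {D : Data Γ l (0 : ℙ)} {cc junk x y : Bits} :
    behAct S n (cleanBeh D) cc junk (packBits [x, y]) =
      thirdStr S l n D.1.1 (D.1.2 D.1.1 (ofNat l (bitsVal y))) cc := by
  rw [behAct_two, thirdStr]
  simp only [cleanBeh, bitsNum_num]
  split_ifs <;> simp_all

lemma validKeys_thirdStr (hn : 1 ≤ n) {a : ℕ} {r : Bool} {cc : Bits}
    (hcc : size l * S.coins.eval n ≤ cc.length) :
    ValidKeys S (size l) n (commitStr S n (♭ a) cc) (thirdStr S l n a r cc) ↔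
      r = true := by
  cases r
  · simpa [thirdStr] using not_validKeys_ones hn (size_pos_of_neZero l)
  · simpa [thirdStr] using validKeys_keyStr hn hcc

lemma outR_deviate_iff (hn : 1 ≤ n) (hi : i ≠ 0) {D : ∀ j, Data Γ l j}
    {cc junk : ℙ → Bits} (hcc : size l * S.coins.eval n ≤ (cc 0).length)
    (hρ : ∀ j ≠ i, ρ j = behAct S n (cleanBeh (D j)) (cc j) (junk j)) (o : Out Γ l) :
    outR S Γ l n ρ = o ↔ Compat i D o ∧ DevTest S Γ l n i (ρ i) o.1 o.2.1 o.2.2.1 (o.2.2.2 i) (cc 0)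
        (commitStr S n (♭ o.1) (cc 0)) := by
  have hx0 : act₀ ρ = commitStr S n (♭ (D 0).1.1) (cc 0) := by
    rw [act₀, hρ 0 hi.symm, behAct_zero]; rfl
  have hz : act₂ ρ = thirdStr S l n (D 0).1.1 ((D 0).1.2 (D 0).1.1
      (ofNat l (bitsVal (act₁ ρ)))) (cc 0) := by
    rw [act₂, hρ 0 hi.symm, cleanBeh_act₂]
  have hxmem : act₀ ρ ∈ cryptoActions S Γ l n 0 := by rw [hx0]; exact commitStr_mem hn hcc
  have hcv : ofNat l (committedVal S (size l) n (act₀ ρ)) = (D 0).1.1 := by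
    rw [hx0, committedVal_commitStr hn hcc, bitsVal_num]; simp
  have hval : decide (ValidKeys S (size l) n (act₀ ρ) (act₂ ρ)) =
      (D 0).1.2 (D 0).1.1 (ofNat l (bitsVal (act₁ ρ))) := by
    rw [Bool.eq_iff_iff, decide_eq_true_iff, hz, hx0, validKeys_thirdStr hn hcc]
  have hmov : ∀ j ≠ i, ofNat (Γ.size j) (bitsVal (ρ j (gView j (act₀ ρ) (act₁ ρ) (act₂ ρ)))) =
      (D j).2 (labOf j (D 0).1.1 (ofNat l (bitsVal (act₁ ρ)))
        ((D 0).1.2 (D 0).1.1 (ofNat l (bitsVal (act₁ ρ))))) := fun j hj => by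
    rw [hρ j hj, gView, behAct_three, viewLab_eq hn hxmem, bitsVal_bits, hcv, hval]
    · simp [cleanBeh]
    · rintro rfl
      rw [hx0, committedVal_commitStr hn hcc]
      rfl
  have hb : i ≠ 1 → act₁ ρ = ofFn (♭ (D 1).1.1) := fun h1 => by
    rw [act₁, hρ 1 h1.symm, behAct_one]
    rfl
  have hb' : i ≠ 1 → ofNat l (bitsVal (act₁ ρ)) = (D 1).1.1 := fun h1 => by
    rw [hb h1, bitsVal_num]; simp
  obtain ⟨a, b, r, u⟩ := o
  simp only [outR, cOut, hcv, hval, Prod.mk.injEq]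
  have htest : a = (D 0).1.1 → b = ofNat l (bitsVal (act₁ ρ)) →
      r = (D 0).1.2 (D 0).1.1 (ofNat l (bitsVal (act₁ ρ))) →
      testView S l n i (ρ i) a b r (cc 0) (commitStr S n (♭ a) (cc 0)) =
        gView i (act₀ ρ) (act₁ ρ) (act₂ ρ) := by
    rintro rfl hbb rfl
    rw [testView, ← hx0, hz]
    congr 1
    by_cases h1 : i = 1
    · rw [if_pos h1]; subst h1; rfl
    · rw [if_neg h1, hb h1, hbb, hb' h1]
  constructor
  · rintro ⟨ha, hbb, hr, hu⟩
    rw [hbb] at hr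
    refine ⟨⟨fun _ => ⟨ha, by rw [← hr, ← ha]⟩, fun h1 => by rw [← hb' h1, hbb], fun j hj => ?_⟩, ?_, ?_⟩
    · refine Eq.trans ?_ (congrFun hu j)
      simp only
      rw [hmov j hj, hbb, hr, ha]
    · rintro rfl
      rw [← ha, ← hx0]
      exact hbb
    · refine Eq.trans ?_ (congrFun hu i)
      rw [htest ha.symm hbb.symm (by rw [hbb, hr])]
  · rintro ⟨⟨h1, h2, h3⟩, h4, h5⟩
    simp only at h1 h2 h3 h4 h5
    obtain ⟨ha, hr⟩ := h1 hi
    have hbb : ofNat l (bitsVal (act₁ ρ)) = b := by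
      by_cases h : i = 1
      · have := h4 h
        rw [← ha, ← hx0] at this
        subst h
        exact this
      · rw [hb' h, h2 h]
    have hr' : (D 0).1.2 (D 0).1.1 b = r := by rw [ha, hr]
    refine ⟨ha, hbb, by rw [hbb, hr'], ?_⟩
    funext j
    by_cases hj : j = i
    · subst hj
      rw [htest ha.symm hbb.symm (by rw [hbb, hr'])] at h5
      exact h5
    · rw [hmov j hj, hbb, hr', ha]
      exact h3 j hj

variable (S Γ l n) in
/-- The deterministic strategy that the responses of the first player amount to when the others
follow plans. -/
def respData (ρ : Bits → Bits) : Data Γ l (0 : ℙ) := let x := ρ (packBits [])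
  let z := fun b : Fin l => ρ (packBits [x, ofFn (♭ b)])
  ((ofNat l (committedVal S (size l) n x), fun _ b => decide (ValidKeys S (size l) n x (z b))),
    fun L => ofNat _ (bitsVal (ρ (gView (0 : ℙ) x (ofFn (♭ L.2.1)) (z L.2.1)))))

lemma outR_first (hn : 1 ≤ n) {D : ∀ j, Data Γ l j} {cc junk : ℙ → Bits}
    (hx : act₀ ρ ∈ cryptoActions S Γ l n 0)
    (hρ : ∀ j ≠ 0, ρ j = behAct S n (cleanBeh (D j)) (cc j) (junk j)) :
    outR S Γ l n ρ = outOf (update D 0 (respData S Γ l n (ρ 0))) := by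
  have h10 : (1 : ℙ) ≠ 0 := by simp
  have hy : act₁ ρ = ofFn (♭ (D 1).1.1) := by rw [act₁, hρ 1 h10, behAct_one]; rfl
  have hb : ofNat l (bitsVal (act₁ ρ)) = (D 1).1.1 := by rw [hy, bitsVal_num]; simp
  symm
  rw [outOf_eq_iff]
  intro j
  by_cases hj : j = 0
  · subst hj
    rw [update_self]
    refine ⟨fun _ => ⟨rfl, ?_⟩, fun h => absurd h (by simp), ?_⟩
    · simp only [outR, cOut, respData, hb]
      rw [act₂, hy]; rfl
    · simp only [outR, cOut, respData, labOf, hb]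
      rw [act₂, hy]; rfl
  · rw [update_of_ne hj]
    refine ⟨fun h => absurd h hj, ?_, ?_⟩
    · rintro rfl
      exact hb.symm
    · simp only [outR, cOut]
      rw [hρ j hj, gView, behAct_three, viewLab_eq hn hx (fun h => absurd h hj), bitsVal_bits]
      simp [cleanBeh]

end

/-! ## Hiding for several commitments -/

lemma finsum_prob_mul {Ω β : Type} [Fintype Ω] (g : Ω → β) (φ : β → ℝ) :
    ∑ᶠ c, prob (fun ω => g ω = c) * φ c = avg (fun ω => φ (g ω)) := by
  classical
  rw [finsum_eq_sum_of_support_subset (s := Finset.univ.image g)]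
  · simp only [prob_eq_avg, ← avg_mul_right]
    rw [← avg_sum]
    congr 1
    funext ω
    rw [sum_eq_single (g ω)]
    · simp
    · intro c _ hc
      simp [hc.symm]
    · intro h
      simp at h
  · intro c hc
    by_contra h
    refine hc ?_
    have h0 : prob (fun ω => g ω = c) = 0 := by
      rw [prob_eq_avg]
      have : ∀ ω, (if g ω = c then (1 : ℝ) else 0) = 0 := fun ω => by
        rw [if_neg]
        rintro rfl
        exact h (by simp)
      simp [this, avg]
    simp only [h0, zero_mul]

lemma block_ofFn {N c j : ℕ} (ω : Fin N → Bool) (h : j * c + c ≤ N) :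
    block c j (ofFn ω) = ofFn (fun k : Fin c => ω ⟨j * c + k, by omega⟩) := by
  apply ext_getElem
  · simp [block]
    omega
  · intro t h1 h2
    simp [block]

lemma drop_ofFn {N a q : ℕ} (ω : Fin N → Bool) (h : N = a + q) :
    (ofFn ω).drop a = ofFn (fun k : Fin q => ω ⟨a + k, by omega⟩) := by
  apply ext_getElem
  · simp [h]
  · intro t h1 h2
    simp

lemma take_ofFn {N a : ℕ} (ω : Fin N → Bool) (h : a ≤ N) :
    (ofFn ω).take a = ofFn (fun k : Fin a => ω ⟨k, by omega⟩) := by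
  apply ext_getElem
  · simp [h]
  · intro t h1 h2
    simp

section

variable {d : ℕ}

/-- Random bits for `d` commitments, with those for the `j`-th one replaced. -/
def replaceBlock {c N q : ℕ} (j : ℕ) (h : N = d * c + q)
    (ω : (Fin c → Bool) × (Fin N → Bool)) : (Fin (d * c) → Bool) × (Fin q → Bool) :=
  (fun k => if hk : j * c ≤ k ∧ k < j * c + c then ω.1 ⟨k - j * c, by omega⟩
    else ω.2 ⟨k, by omega⟩, fun k => ω.2 ⟨d * c + k, by omega⟩)

lemma unif_replaceBlock {c N q j : ℕ} (h : N = d * c + q) :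
    Unif (replaceBlock (d := d) (c := c) j h) := by
  let J : Fin (d * c) ⊕ Fin q → Fin c ⊕ Fin N := fun k => match k with
    | Sum.inl k => if hk : j * c ≤ k ∧ k < j * c + c then Sum.inl ⟨k - j * c, by omega⟩
        else Sum.inr ⟨k, by omega⟩
    | Sum.inr k => Sum.inr ⟨d * c + k, by omega⟩
  have hJ : Injective J := by
    rintro (a | a) (b | b) hab
    · simp only [J] at hab
      split_ifs at hab with h1 h2 h2
      · simp at hab; congr 1; apply Fin.ext; omega
      · simp at hab; congr 1; exact Fin.ext hab
    · simp only [J] at hab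
      split_ifs at hab
      simp at hab; omega
    · simp only [J] at hab
      split_ifs at hab
      simp at hab; omega
    · simp [J] at hab; congr 1; exact Fin.ext hab
  have h1 := (Unif.of_equiv (Equiv.sumArrowEquivProdArrow (Fin c) (Fin N) Bool).symm).comp
    ((unif_precomp hJ).comp unif_sum_split)
  convert h1 using 1
  funext ω
  refine Prod.ext (funext fun k => ?_) (funext fun k => ?_)
  · simp only [replaceBlock, J]
    split_ifs <;> rfl
  · rfl

lemma block_disjoint {c d : ℕ} {j j' : Fin d} (h : j' ≠ j) (k : Fin c) :
    ¬ ((j : ℕ) * c ≤ j' * c + k ∧ j' * c + k < j * c + c) := by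
  rintro ⟨h1, h2⟩
  have hk := k.isLt
  rcases lt_or_gt_of_ne (fun e => h (Fin.ext e) : (j' : ℕ) ≠ j) with h3 | h3
  · have : ((j' : ℕ) + 1) * c ≤ j * c := Nat.mul_le_mul_right c h3
    rw [add_mul] at this; omega
  · have : ((j : ℕ) + 1) * c ≤ j' * c := Nat.mul_le_mul_right c h3
    rw [add_mul] at this; omega

variable (S) in
/-- The probability that `T` accepts commitments to the bits `e`. -/
def commitProb (q : Polynomial ℕ) (T : ℕ → Bits → Bits → Prop) (n : ℕ) (e : Fin d → Bool) : ℝ :=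
  prob fun ω : (Fin (d * S.coins.eval n) → Bool) × (Fin (q.eval n) → Bool) =>
    T n (commitStr S n e (ofFn ω.1)) (ofFn ω.2)

lemma commit_hiding_step {q : Polynomial ℕ} {T : ℕ → Bits → Bits → Prop} (hT : DecPT inp₃
      (fun a => T a.1 a.2.1 a.2.2)) (e : Fin d → Bool) (j : Fin d) :
    ∃ ε, Negligible ε ∧ ∀ n, 1 ≤ n →
      |commitProb S q T n (update e j false) - commitProb S q T n (update e j true)| ≤ ε n := by
  classical
  let sim : ℕ → Bits → Bits → Bits := fun n x r => (ofFn fun j' : Fin d => if j' = j then x else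
      S.C₁ n (e j') (block (S.coins.eval n) j' r)).flatten
  obtain ⟨hN, hx, hr⟩ := PolyTime.args₃
  have hsim : PolyTime inp₃ (fun a => sim a.1 a.2.1 a.2.2) := by
    have := PolyTime.flatten (inp := inp₃) (ofFn fun (j' : Fin d) a => if j' = j then a.2.1 else
      S.C₁ a.1 (e j') (block (S.coins.eval a.1) j' a.2.2)) (by
        intro g hg
        obtain ⟨j', rfl⟩ := (List.mem_ofFn' _ _).1 hg
        by_cases h : j' = j
        · simpa [h] using hx
        · simp only [h, if_false]
          have hb := PolyTime.block (ones_eval S.coins hN) j' hr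
          exact S.polyTime₁.comp (fun a : ℕ × Bits × Bits => (a.1, e j', block (S.coins.eval a.1) j' a.2.2))
            [fun a => ones a.1, fun a => [e j'], fun a => block (S.coins.eval a.1) j' a.2.2]
            (by simp [hN, hb, const]) (fun _ => rfl))
    exact this.congr (fun a => by rw [map_ofFn]; rfl)
  have hdrop : PolyTime inp₃ (fun a => a.2.2.drop (d * S.coins.eval a.1)) :=
    (hr.drop ((ones_const d).ones_mul (ones_eval S.coins hN))).congr
      fun a => by rw [length_ones]
  have hrun : DecPT inp₃ (fun a => T a.1 (sim a.1 a.2.1 a.2.2)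
      (a.2.2.drop (d * S.coins.eval a.1))) :=
    PolyTime.comp hT (fun a : ℕ × Bits × Bits => (a.1, sim a.1 a.2.1 a.2.2, a.2.2.drop (d * S.coins.eval a.1)))
      [fun a => ones a.1, fun a => sim a.1 a.2.1 a.2.2, fun a => a.2.2.drop (d * S.coins.eval a.1)]
      (by simp [hN, hsim, hdrop]) (fun _ => rfl)
  let D : Distinguisher :=
    { coins := C d * S.coins + q
      run := fun n x r => decide (T n (sim n x r) (r.drop (d * S.coins.eval n)))
      polyTime := hrun }
  obtain ⟨ε, hε, hle⟩ := S.hides D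
  refine ⟨ε, hε, fun n hn => ?_⟩
  have key : ∀ b : Bool, commitProb S q T n (update e j b) =
      ∑ᶠ c, prob (fun r : Fin (S.coins.eval n) → Bool => S.C₁ n b (ofFn r) = c) *
        D.accept n (code c) := fun b => by
    rw [finsum_prob_mul, commitProb]
    set c := S.coins.eval n with hc
    have hNq : D.coins.eval n = d * c + q.eval n := by simp [D, hc]
    rw [← (unif_replaceBlock (j := j) hNq).prob_comp, prob_eq_avg, avg_prod]
    congr 1
    funext r'
    rw [Distinguisher.accept, prob_eq_avg]
    congr 1
    funext ω
    have h1 : sim n (S.C₁ n b (ofFn r')) (ofFn ω) =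
        commitStr S n (update e j b) (ofFn (replaceBlock (j : ℕ) hNq (r', ω)).1) := by
      simp only [sim, commitStr, ← hc]
      congr 2
      funext j'
      have hle' : (j' : ℕ) * c + c ≤ d * c := by
        have : ((j' : ℕ) + 1) * c ≤ d * c := Nat.mul_le_mul_right c j'.isLt
        rwa [add_mul, one_mul] at this
      rw [block_ofFn _ hle', block_ofFn _ (by omega)]
      by_cases h : j' = j
      · subst h
        rw [if_pos rfl, update_self]
        congr 2
        funext k
        simp only [replaceBlock]
        rw [dif_pos (by simp)]
        congr 1
        apply Fin.ext
        simp
      · rw [if_neg h, update_of_ne h]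
        congr 2
        funext k
        simp only [replaceBlock]
        rw [dif_neg (block_disjoint h k)]
    have h2 : (ofFn ω).drop (d * c) = ofFn (replaceBlock (j : ℕ) hNq (r', ω)).2 := drop_ofFn ω hNq
    have h3 : (D.run n (code (S.C₁ n b (ofFn r'))) (ofFn ω) = true) ↔
        T n (commitStr S n (update e j b) (ofFn (replaceBlock (j : ℕ) hNq (r', ω)).1))
          (ofFn (replaceBlock (j : ℕ) hNq (r', ω)).2) := by
      rw [← h1, ← h2]
      simp only [D, decide_eq_true_iff]
      rfl
    simp only [h3]
  rw [key, key]
  exact hle n hn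

lemma commit_hiding {q : Polynomial ℕ} {T : ℕ → Bits → Bits → Prop} (hT : DecPT inp₃
      (fun a => T a.1 a.2.1 a.2.2)) (e e' : Fin d → Bool) : ∃ ε, Negligible ε ∧ ∀ n, 1 ≤ n →
      |commitProb S q T n e - commitProb S q T n e'| ≤ ε n := by
  classical
  have hstep : ∀ (e : Fin d → Bool) (j : Fin d) (b : Bool), ∃ ε, Negligible ε ∧
      ∀ n, 1 ≤ n → |commitProb S q T n e - commitProb S q T n (update e j b)| ≤ ε n := fun e j b => by
    obtain ⟨ε, hε, h⟩ := commit_hiding_step (S := S) (q := q) hT e j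
    refine ⟨ε, hε, fun n hn => ?_⟩
    by_cases hb : b = e j
    · rw [hb, update_eq_self]
      simpa using hε.1 n
    · have he : update e j (e j) = e := update_eq_self _ _
      have h1 := h n hn
      cases hbv : b <;> cases hev : e j <;> rw [hbv, hev] at hb <;> simp at hb
      · rw [hev] at he
        rw [abs_sub_comm]
        simpa only [he] using h1
      · rw [hev] at he
        simpa only [he] using h1
  have hset : ∀ s : Finset (Fin d), ∃ ε, Negligible ε ∧ ∀ n, 1 ≤ n →
      |commitProb S q T n e - commitProb S q T n (fun j => if j ∈ s then e' j else e j)| ≤ ε n := fun s => by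
    induction s using Finset.induction_on with
    | empty => exact ⟨_, Negligible.zero, fun n _ => by simp⟩
    | insert j s hj ih =>
      obtain ⟨ε, hε, h⟩ := ih
      obtain ⟨ε', hε', h'⟩ := hstep (fun j => if j ∈ s then e' j else e j) j (e' j)
      refine ⟨_, hε.add hε', fun n hn => ?_⟩
      have he : update (fun j => if j ∈ s then e' j else e j) j (e' j) =
          fun i => if i ∈ insert j s then e' i else e i := by
        funext i
        by_cases hi : i = j
        · subst hi; simp
        · simp [hi, update_of_ne hi]
      rw [← he]
      exact (abs_sub_le _ _ _).trans (add_le_add (h n hn) (h' n hn))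
  obtain ⟨ε, hε, h⟩ := hset Finset.univ
  refine ⟨ε, hε, fun n hn => ?_⟩
  simpa using h n hn

end

/-! ## Resampling -/

section

variable {ι : Type} [Fintype ι] [DecidableEq ι] {X Y : ι → Type} [∀ i, Fintype (X i)]
  [∀ i, Fintype (Y i)]

lemma Unif.pi {q : ∀ i, X i → Y i} (h : ∀ i, Unif (q i)) :
    Unif (fun (ω : ∀ i, X i) i => q i (ω i)) := fun F => by
  rw [avg_pi_map q F]
  have h1 := avg_pi_map (fun i (y : Y i) => y) F
  rw [h1]
  refine sum_congr rfl fun a _ => ?_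
  congr 1
  refine prod_congr rfl fun i _ => ?_
  exact (h i).prob_comp (fun y => y = a i)

lemma Unif.of_involutive {Ω Ω' : Type} [Fintype Ω] [Fintype Ω'] [Nonempty Ω']
    {s : Ω' → Ω → Ω' × Ω} (h : ∀ a ω, s (s a ω).1 (s a ω).2 = (a, ω)) :
    Unif (fun p : Ω' × Ω => (s p.1 p.2).2) := by
  have h1 : Function.Involutive (fun p : Ω' × Ω => s p.1 p.2) := fun p => h p.1 p.2
  exact (of_equiv h1.toPerm).comp snd

lemma unif_update (i : ι) [Nonempty (X i)] : Unif (fun p : X i × (∀ j, X j) => update p.2 i p.1) :=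
  Unif.of_involutive (s := fun (x : X i) (ω : ∀ j, X j) => (ω i, update ω i x))
    (fun a ω => by simp)

lemma abs_prod_sub_prod_le (s : Finset ι) {a b : ι → ℝ} (ha : ∀ i, 0 ≤ a i ∧ a i ≤ 1)
    (hb : ∀ i, 0 ≤ b i ∧ b i ≤ 1) : |∏ i ∈ s, a i - ∏ i ∈ s, b i| ≤ ∑ i ∈ s, |a i - b i| := by
  induction s using Finset.induction_on with
  | empty => simp
  | insert i s hi ih =>
    rw [Finset.prod_insert hi, Finset.prod_insert hi, Finset.sum_insert hi]
    have h1 : a i * ∏ j ∈ s, a j - b i * ∏ j ∈ s, b j =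
        (a i - b i) * ∏ j ∈ s, a j + b i * (∏ j ∈ s, a j - ∏ j ∈ s, b j) := by ring
    have h2 : |∏ j ∈ s, a j| ≤ 1 := by
      rw [abs_of_nonneg (prod_nonneg fun j _ => (ha j).1)]
      exact Finset.prod_le_one (fun j _ => (ha j).1) (fun j _ => (ha j).2)
    rw [h1]
    refine (abs_add_le _ _).trans (add_le_add ?_ ?_)
    · rw [abs_mul]
      exact mul_le_of_le_one_right (abs_nonneg _) h2
    · rw [abs_mul, abs_of_nonneg (hb i).1]
      exact (mul_le_of_le_one_left (abs_nonneg _) (hb i).2).trans ih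

end

/-- Probability distributions on a finite type. -/
def IsDist {ι : Type} [Fintype ι] (W : ι → ℝ) : Prop := (∀ x, 0 ≤ W x) ∧ ∑ x, W x = 1

lemma IsDist.le_one {ι : Type} [Fintype ι] {W : ι → ℝ} (h : IsDist W) (x : ι) : W x ≤ 1 := by
  rw [← h.2]
  exact single_le_sum (fun y _ => h.1 y) (mem_univ x)

lemma isDist_prob {ι Ω : Type} [Fintype ι] [Fintype Ω] [Nonempty Ω] (q : Ω → ι) :
    IsDist (fun i => prob (fun ω => q ω = i)) := ⟨fun _ => prob_nonneg _, sum_prob_eq q⟩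

lemma prob_exists_le {ι Ω : Type} [Fintype ι] [Fintype Ω] (E : ι → Ω → Prop) :
    prob (fun ω => ∃ i, E i ω) ≤ ∑ i, prob (E i) := by
  classical
  simp only [prob_eq_avg]
  rw [← avg_sum]
  refine avg_mono fun ω => ?_
  by_cases h : ∃ i, E i ω
  · obtain ⟨i, hi⟩ := h
    rw [if_pos ⟨i, hi⟩]
    refine le_trans ?_ (single_le_sum (f := fun i => if E i ω then (1 : ℝ) else 0)
      (fun j _ => by positivity) (mem_univ i))
    rw [if_pos hi]
  · rw [if_neg h]
    exact sum_nonneg fun j _ => by positivity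

/-- The behaviour that a plan prescribes is distributed, up to a negligible error, as a random
deterministic strategy with distribution `W`. -/
def PlanSpec (P : Plan Γ l i) (W : Data Γ l i → ℝ) : Prop := ∃ ε, Negligible ε ∧ ∀ n, 1 ≤ n → ∀ D,
    |prob (fun r : Fin (P.coins.eval n) → Bool => P.samp n (ofFn r) = cleanBeh D) - W D| ≤ ε n

variable (S) in
/-- The random bits of a tape that determine the behaviour. -/
def sampCoins (P : Plan Γ l i) (n : ℕ) {N : ℕ}
    (hN : ¢ n + P.coins.eval n ≤ N) (ω : Fin N → Bool) : Fin (P.coins.eval n) → Bool :=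
  fun k => ω ⟨¢ n + k, by omega⟩

lemma unif_sampCoins (P : Plan Γ l i) (n : ℕ) {N : ℕ}
    (hN : ¢ n + P.coins.eval n ≤ N) : Unif (sampCoins S P n hN) :=
  unif_precomp (j := fun k : Fin (P.coins.eval n) => (⟨¢ n + k, by omega⟩ : Fin N))
    (fun a b h => by simp at h; exact Fin.ext h)

lemma cleanBeh_injective : Injective (cleanBeh (Γ := Γ) (l := l) (i := i)) :=
  Function.LeftInverse.injective behData_cleanBeh

lemma sum_prob_clean {Ω : Type} [Fintype Ω] (q : Ω → Beh Γ l i) [Nonempty Ω] :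
    prob (fun ω => ∀ D, q ω ≠ cleanBeh D) = 1 - ∑ D, prob (fun ω => q ω = cleanBeh D) := by
  classical
  have h1 : (1 : ℝ) = avg (fun _ : Ω => (1 : ℝ)) := (avg_const 1).symm
  rw [h1]
  simp only [prob_eq_avg]
  rw [← avg_sum, ← avg_sub]
  congr 1
  funext ω
  by_cases h : ∃ D, q ω = cleanBeh D
  · obtain ⟨D, hD⟩ := h
    rw [if_neg (fun h => h D hD), sum_eq_single D]
    · simp [hD]
    · intro D' _ hne
      rw [if_neg]
      intro h'
      exact hne (cleanBeh_injective (h'.symm.trans hD))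
    · simp
  · have h' : ∀ D, q ω ≠ cleanBeh D := fun D hD => h ⟨D, hD⟩
    rw [if_pos h']
    simp [h']

lemma mixture {P : ∀ j, Plan Γ l j} {W : ∀ j, Data Γ l j → ℝ} (hW : ∀ j, IsDist (W j))
    (hP : ∀ j, PlanSpec (P j) (W j)) : ∃ ε, Negligible ε ∧ ∀ n, 1 ≤ n → ∀ (N : ℙ → ℕ)
      (hN : ∀ j, ¢ n + (P j).coins.eval n ≤ N j) (Θ : Type) [Fintype Θ] [Nonempty Θ]
      (U : Θ × Coins N → Coins N) (hU : Unif U) (E : Coins N → Prop)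
      (H : Θ → (∀ j, Data Γ l j) → Prop),
      (∀ θ ω D, (∀ j, (P j).samp n (ofFn (sampCoins S (P j) n (hN j) (ω j))) = cleanBeh (D j)) →
        (E (U (θ, ω)) ↔ H θ D)) →
      |prob E - ∑ D, (∏ j, W j (D j)) * prob (fun θ => H θ D)| ≤ ε n := by
  classical
  choose ε hε hle using hP
  let C : ℝ := ∑ j, (card (Data Γ l j) : ℝ)
  let B : ℝ := (card (∀ j, Data Γ l j) : ℝ)
  refine ⟨fun n => ∑ j, ((card (Data Γ l j) : ℝ) + B * (1 + card (Data Γ l j))) * ε j n,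
    Negligible.sum _ (fun j _ => (hε j).const_mul (by positivity)), ?_⟩
  intro n hn N hN Θ _ _ U hU E H hEH
  let q : ∀ j, (Fin (N j) → Bool) → Beh Γ l j := fun j ω =>
    (P j).samp n (ofFn (sampCoins S (P j) n (hN j) ω))
  have hq : ∀ j (R : Beh Γ l j → Prop), prob (fun ω => R (q j ω)) =
      prob (fun r : Fin ((P j).coins.eval n) → Bool => R ((P j).samp n (ofFn r))) := fun j R =>
    (unif_sampCoins (P j) n (hN j)).prob_comp (fun r => R ((P j).samp n (ofFn r)))
  have hbad : ∀ j, prob (fun ω => ∀ D, q j ω ≠ cleanBeh D) ≤ card (Data Γ l j) * ε j n := by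
    intro j
    rw [sum_prob_clean, ← (hW j).2, ← sum_sub_distrib]
    refine (sum_le_sum (g := fun _ => ε j n) (fun D _ => ?_)).trans (by simp)
    rw [hq j (fun X => X = cleanBeh D)]
    have := hle j n hn D
    rw [abs_sub_comm] at this
    exact (le_abs_self _).trans this
  have hlaw : ∀ j D, |prob (fun ω => behData (q j ω) = D) - W j D| ≤
      (1 + card (Data Γ l j)) * ε j n := fun j D => by
    have h1 := hle j n hn D
    rw [← hq j (fun X => X = cleanBeh D)] at h1
    have h2 : |prob (fun ω => behData (q j ω) = D) - prob (fun ω => q j ω = cleanBeh D)| ≤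
        prob (fun ω => ∀ D, q j ω ≠ cleanBeh D) := by
      refine abs_prob_sub_le (fun ω h => ?_)
      push Not at h
      obtain ⟨D', hD'⟩ := h
      rw [hD', behData_cleanBeh, cleanBeh_injective.eq_iff]
    have h3 := abs_sub_le (prob (fun ω => behData (q j ω) = D)) (prob (fun ω => q j ω = cleanBeh D))
      (W j D)
    have h4 := hbad j
    rw [add_mul, one_mul]
    linarith
  let g : (∀ j, Data Γ l j) → ℝ := fun D => prob (fun θ => H θ D)
  have h1 : |prob E - prob (fun p : Θ × Coins N => H p.1 (fun j => behData (q j (p.2 j))))| ≤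
      ∑ j, card (Data Γ l j) * ε j n := by
    rw [← hU.prob_comp]
    have h2 : |prob (fun p : Θ × Coins N => E (U p)) -
        prob (fun p : Θ × Coins N => H p.1 (fun j => behData (q j (p.2 j))))| ≤
        prob (fun p : Θ × Coins N => ∃ j, ∀ D, q j (p.2 j) ≠ cleanBeh D) := by
      refine abs_prob_sub_le (fun p h => ?_)
      push Not at h
      choose D hD using h
      rw [← Prod.mk.eta (p := p), hEH p.1 p.2 D hD]
      have : (fun j => behData (q j (p.2 j))) = D := by
        funext j
        rw [hD j, behData_cleanBeh]
      rw [this]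
    refine h2.trans ((prob_exists_le _).trans (sum_le_sum fun j _ => ?_))
    refine le_trans (le_of_eq ?_) (hbad j)
    have hsnd : Unif (fun p : Θ × Coins N => p.2 j) :=
      Unif.comp (q := Prod.snd) (q' := fun ω : Coins N => ω j) Unif.snd
        (by
          have := (unif_update (X := fun j => Fin (N j) → Bool) j)
          intro F
          have h5 := this (fun ω => F (ω j))
          simp only [update_self] at h5
          rw [← h5]
          exact Unif.fst F)
    exact hsnd.prob_comp (fun ω => ∀ D, q j ω ≠ cleanBeh D)
  have h2 : prob (fun p : Θ × Coins N => H p.1 (fun j => behData (q j (p.2 j)))) =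
      ∑ D, (∏ j, prob (fun ω => behData (q j ω) = D j)) * g D := by
    rw [← avg_pi_map (fun j ω => behData (q j ω)) g, prob_eq_avg, avg_prod, avg_comm]
    congr 1
    funext ω
    simp only [g]
    rw [prob_eq_avg]
  have h3 : |∑ D, (∏ j, prob (fun ω => behData (q j ω) = D j)) * g D -
      ∑ D, (∏ j, W j (D j)) * g D| ≤ B * ∑ j, (1 + card (Data Γ l j)) * ε j n := by
    rw [← sum_sub_distrib]
    refine (abs_sum_le_sum_abs _ _).trans ?_
    refine (sum_le_sum (g := fun _ => ∑ j, (1 + card (Data Γ l j)) * ε j n)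
      (fun D _ => ?_)).trans (by simp [B])
    rw [← sub_mul, abs_mul]
    refine (mul_le_of_le_one_right (abs_nonneg _) ?_).trans ?_
    · rw [abs_of_nonneg (prob_nonneg _)]
      exact prob_le_one _
    · refine (abs_prod_sub_prod_le _ (fun j => ⟨prob_nonneg _, prob_le_one _⟩)
        (fun j => ⟨(hW j).1 _, (hW j).le_one _⟩)).trans ?_
      exact sum_le_sum fun j _ => hlaw j _
  rw [h2] at h1
  refine (abs_sub_le _ _ _).trans ((add_le_add h1 h3).trans (le_of_eq ?_))
  rw [mul_sum, ← sum_add_distrib]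
  refine sum_congr rfl fun j _ => by ring

/-! ### Longer tapes -/

lemma unif_shorten {N N' : ℙ → ℕ} (h : ∀ j, N' j ≤ N j) :
    Unif (fun (ω : Coins N) (j : ℙ) (k : Fin (N' j)) => ω j (Fin.castLE (h j) k)) :=
  Unif.pi (q := fun j (x : Fin (N j) → Bool) (k : Fin (N' j)) => x (Fin.castLE (h j) k))
    (fun j => unif_precomp (Fin.castLE_injective (h j)))

lemma respOf_shorten (M : ∀ i, Strat ⌘ i) (n : ℕ) {N N' : ℙ → ℕ}
    (h : ∀ j, N' j ≤ N j) (hN : ∀ j, (M j).coins.eval n ≤ N' j) (ω : Coins N) :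
    respOf M n (fun (j : ℙ) (k : Fin (N' j)) => ω j (Fin.castLE (h j) k)) = respOf M n ω := by
  funext i v
  rw [respOf, respOf, take_ofFn _ (hN i), take_ofFn _ ((hN i).trans (h i))]
  rfl

lemma prob_play_eq (M : ∀ i, Strat ⌘ i) (hn : 1 ≤ n)
    {N N' : ℙ → ℕ} (hN' : ∀ j, (M j).coins.eval n ≤ N' j) (h : ∀ j, N' j ≤ N j)
    (E : Out Γ l → Prop) : prob (fun ω : Coins N' => E (outR S Γ l n (respOf M n ω))) =
      prob (fun ω : Coins N => E (outR S Γ l n (respOf M n ω))) := by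
  rw [← (unif_shorten h).prob_comp]
  simp only [respOf_shorten M n h hN']

lemma phi_eq (M : ∀ i, Strat ⌘ i) (hn : 1 ≤ n)
    {N : ℙ → ℕ} (hN : ∀ j, (M j).coins.eval n ≤ N j) (o : Out Γ l) :
    phi ♮ M n (mkHist o) =
      prob (fun ω : Coins N => outR S Γ l n (respOf M n ω) = o) := by
  rw [← prob_play_eq M hn (N' := coinsOf M n) (fun _ => le_rfl) hN (fun o' => o' = o), phi]
  refine prob_congr fun ω => ?_
  rw [corrMap_play M hn (N := coinsOf M n) (fun _ => le_rfl) ω]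
  exact mkHist_injective.eq_iff

/-! ### Profiles of plans -/

lemma Plan.respOf_toStrat (P : ∀ j, Plan Γ l j) (M : ∀ i, Strat ⌘ i)
    {j : ℙ} (hj : M j = (P j).toStrat S) (n : ℕ) {N : ℙ → ℕ}
    (hN : ¢ n + (P j).coins.eval n ≤ N j) (ω : Coins N) :
    respOf M n ω j = behAct S n ((P j).samp n (ofFn (sampCoins S (P j) n hN (ω j))))
      (ofFn (fun k : Fin (¢ n) => ω j ⟨k, by omega⟩))
      ((P j).junk n (ofFn (sampCoins S (P j) n hN (ω j)))) := by
  funext v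
  have hc := (P j).toStrat_coins S n
  rw [respOf, hj, hc, take_ofFn _ hN]
  change (P j).act S n v _ = _
  rw [act, drop_ofFn _ (rfl : _ = ¢ n + (P j).coins.eval n),
    take_ofFn _ (Nat.le_add_right _ _)]
  rfl

lemma outR_clean (hn : 1 ≤ n) {D : ∀ j, Data Γ l j} {cc junk : ℙ → Bits}
    (hcc : size l * S.coins.eval n ≤ (cc 0).length) :
    outR S Γ l n (fun j => behAct S n (cleanBeh (D j)) (cc j) (junk j)) = outOf D := by
  set ρ : ℙ → Bits → Bits := fun j => behAct S n (cleanBeh (D j)) (cc j) (junk j) with hρ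
  have hx : ρ 0 (packBits []) = commitStr S n (♭ (D 0).1.1) (cc 0) := rfl
  have hxm : ρ 0 (packBits []) ∈ cryptoActions S Γ l n 0 := by rw [hx]; exact commitStr_mem hn hcc
  rw [outR_first hn (D := D) (cc := cc) (junk := junk) hxm (fun j _ => rfl)]
  have hcv : ofNat l (committedVal S (size l) n (ρ 0 (packBits []))) = (D 0).1.1 := by
    rw [hx, committedVal_commitStr hn hcc, bitsVal_num]; simp
  have hz : ∀ b : Fin l, ρ 0 (packBits [ρ 0 (packBits []), ofFn (♭ b)]) =
      thirdStr S l n (D 0).1.1 ((D 0).1.2 (D 0).1.1 b) (cc 0) := fun b => by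
    simp only [hρ]
    rw [cleanBeh_act₂, bitsVal_num]
    simp
  have hval : ∀ b : Fin l, decide (ValidKeys S (size l) n (ρ 0 (packBits []))
      (ρ 0 (packBits [ρ 0 (packBits []), ofFn (♭ b)]))) = (D 0).1.2 (D 0).1.1 b := by
    intro b
    rw [Bool.eq_iff_iff, decide_eq_true_iff, hz, hx, validKeys_thirdStr hn hcc]
  rw [outOf_update_eq_iff, compat_iff]
  have hD := (outOf_eq_iff D (outOf D)).1 rfl
  refine ⟨fun j _ => hD j, fun _ => ⟨hcv, ?_⟩, fun h => absurd h (by simp), ?_⟩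
  · exact hval _
  · simp only [respData]
    have h3 := viewLab_eq (Γ := Γ) (i := 0) (S := S) hn (x := ρ 0 (packBits []))
      (y := ofFn (♭ (D 1).1.1))
      (z := ρ 0 (packBits [ρ 0 (packBits []), ofFn (♭ (D 1).1.1)]))
      (ws := List.replicate (gStage (0 : ℙ) - 3) [])
      (e := (cleanBeh (D 0)).2.1) hxm (fun _ => by rw [hx, committedVal_commitStr hn hcc]; rfl)
    rw [hcv, hval, bitsVal_num] at h3
    have h4 := behAct_three (S := S) (n := n) (X := cleanBeh (D 0)) (cc := cc 0) (junk := junk 0)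
      (ρ 0 (packBits [])) (ofFn (♭ (D 1).1.1))
      (ρ 0 (packBits [ρ 0 (packBits []), ofFn (♭ (D 1).1.1)]))
      (List.replicate (gStage (0 : ℙ) - 3) [])
    rw [h3] at h4
    have h5 := congrArg bitsVal h4
    rw [bitsVal_bits] at h5
    refine Eq.trans (congrArg (ofNat _) h5) ?_
    simp [cleanBeh, outOf]

lemma phi_plans {P : ∀ j, Plan Γ l j} {W : ∀ j, Data Γ l j → ℝ} (hW : ∀ j, IsDist (W j))
    (hP : ∀ j, PlanSpec (P j) (W j)) : ∃ ε, Negligible ε ∧ ∀ n, 1 ≤ n → ∀ E : Out Γ l → Prop,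
      |prob (fun ω : Coins (coinsOf (fun j => (P j).toStrat S) n) =>
          E (outR S Γ l n (respOf (fun j => (P j).toStrat S) n ω))) -
        ∑ D, (∏ j, W j (D j)) * (open Classical in if E (outOf D) then 1 else 0)| ≤ ε n := by
  classical
  obtain ⟨ε, hε, h⟩ := mixture (S := S) hW hP
  refine ⟨ε, hε, fun n hn E => ?_⟩
  have hN : ∀ j, ¢ n + (P j).coins.eval n ≤ coinsOf (fun j => (P j).toStrat S) n j :=
    fun j => by rw [coinsOf, Plan.toStrat_coins]
  have h1 := h n hn _ hN Unit Prod.snd Unif.snd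
    (fun ω => E (outR S Γ l n (respOf (fun j => (P j).toStrat S) n ω)))
    (fun _ D => E (outOf D)) (fun θ ω D hD => by
      have h2 : respOf (fun j => (P j).toStrat S) n ω = _ :=
        funext fun j => Plan.respOf_toStrat P (fun j => (P j).toStrat S) rfl n (hN j) ω
      simp only [hD] at h2
      simp only [h2]
      rw [outR_clean hn]
      simp [commitCoins])
  convert h1 using 4 with D
  congr 1
  rw [prob_eq_avg, avg_const]

/-! ## Deviations from profiles of plans -/

lemma prob_pushforward {Ω ι : Type} [Fintype Ω] [Fintype ι] (q : Ω → ι) (R : ι → Prop)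
    [DecidablePred R] : prob (fun ω => R (q ω)) = ∑ t, prob (fun ω => q ω = t) * if R t then 1 else 0 := by
  classical
  simp only [prob_eq_avg, ← avg_mul_right]
  rw [← avg_sum]
  congr 1
  funext ω
  rw [sum_eq_single (q ω)]
  · by_cases h : R (q ω) <;> simp [h]
  · intro t _ ht; simp [ht.symm]
  · simp

/-- The sequence `ω` with its beginning replaced by `x`. -/
def splice {k N : ℕ} (x : Fin k → Bool) (ω : Fin N → Bool) : Fin N → Bool :=
  fun t => if h : (t : ℕ) < k then x ⟨t, h⟩ else ω t

lemma splice_prefix {k N : ℕ} (h : k ≤ N) (x : Fin k → Bool) (ω : Fin N → Bool) :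
    splice (fun s => ω (Fin.castLE h s)) (splice x ω) = ω := by
  funext t
  by_cases ht : (t : ℕ) < k
  · simp [splice, ht]
  · simp [splice, ht]

lemma prefix_splice {k N : ℕ} (h : k ≤ N) (x : Fin k → Bool) (ω : Fin N → Bool) :
    (fun s => splice x ω (Fin.castLE h s)) = x := by
  funext s
  simp [splice]

lemma unif_splice₂ {ι : Type} [Fintype ι] [DecidableEq ι] {N : ι → ℕ} {i j : ι} (hij : i ≠ j)
    {k k' : ℕ} (h : k ≤ N i) (h' : k' ≤ N j) :
    Unif (fun p : ((Fin k → Bool) × (Fin k' → Bool)) × (∀ t, Fin (N t) → Bool) =>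
      update (update p.2 i (splice p.1.1 (p.2 i))) j (splice p.1.2 (p.2 j))) :=
  Unif.of_involutive (s := fun (x : (Fin k → Bool) × (Fin k' → Bool)) (ω : ∀ t, Fin (N t) → Bool) =>
      (((fun s => ω i (Fin.castLE h s)), (fun s => ω j (Fin.castLE h' s))),
        update (update ω i (splice x.1 (ω i))) j (splice x.2 (ω j))))
    (by
      rintro ⟨x, y⟩ ω
      simp only [update_self, update_of_ne hij, Prod.mk.injEq]
      refine ⟨⟨prefix_splice h _ _, prefix_splice h' _ _⟩, ?_⟩
      funext t
      by_cases hj : t = j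
      · subst hj; simp only [update_self, splice_prefix]
      · by_cases hi : t = i
        · subst hi
          simp only [update_of_ne hij, update_self, splice_prefix]
        · simp only [update_of_ne hj, update_of_ne hi])

section

variable {P : ∀ j, Plan Γ l j} {W : ∀ j, Data Γ l j → ℝ}

lemma isDist_prod (hW : ∀ j, IsDist (W j)) : IsDist (fun D : ∀ j, Data Γ l j => ∏ j, W j (D j)) :=
  ⟨fun _ => prod_nonneg fun j _ => (hW j).1 _, sum_pi_eq_one _ fun j => (hW j).2⟩

/-- The probability of the outcome `o` when player `i` plays `σ` and the others play `W`. -/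
def mixProb (W : ∀ j, Data Γ l j → ℝ) (i : ℙ) (σ : Data Γ l i → ℝ) (o : Out Γ l) : ℝ :=
  open Classical in
  ∑ D, (∏ j, W j (D j)) * ∑ t, σ t * if outOf (update D i t) = o then 1 else 0

variable (S) in
/-- The strategy `M'` of player `i` is, up to a negligible error, as good as a sequence of
strategies of the envelope game. -/
def DevApprox (P : ∀ j, Plan Γ l j) (W : ∀ j, Data Γ l j → ℝ) (i : ℙ) (M' : Strat ⌘ i) : Prop :=
  ∃ σ : ℕ → Data Γ l i → ℝ, (∀ n, IsDist (σ n)) ∧ ∃ ε, Negligible ε ∧ ∀ n, 1 ≤ n → ∀ o,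
    |prob (fun ω : Coins (coinsOf (update (fun j => (P j).toStrat S) i M') n) =>
        outR S Γ l n (respOf (update (fun j => (P j).toStrat S) i M') n ω) = o) -
      mixProb W i (σ n) o| ≤ ε n

variable (S) in
/-- The number of random bits provided to player `j`. -/
def devCoins (P : ∀ j, Plan Γ l j) (M' : Strat ⌘ i) (n : ℕ) (j : ℙ) : ℕ :=
  ¢ n + (P j).coins.eval n + M'.coins.eval n

lemma coinsOf_le_devCoins (M' : Strat ⌘ i) (n : ℕ)
    (j : ℙ) : coinsOf (update (fun j => (P j).toStrat S) i M') n j ≤ devCoins S P M' n j := by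
  rw [coinsOf, devCoins]
  by_cases hj : j = i
  · subst hj
    rw [update_self]; omega
  · rw [update_of_ne hj, Plan.toStrat_coins]; omega

lemma devApprox_zero (hW : ∀ j, IsDist (W j)) (hP : ∀ j, PlanSpec (P j) (W j))
    (M' : Strat ⌘ 0) : DevApprox S P W 0 M' := by
  classical
  obtain ⟨ε, hε, hmix⟩ := mixture (S := S) hW hP
  let resp := fun n (τ : Fin (devCoins S P M' n 0) → Bool) =>
    respData S Γ l n (fun v => M'.act n v ((ofFn τ).take (M'.coins.eval n)))
  refine ⟨fun n t => prob (fun τ => resp n τ = t), fun n => isDist_prob _, ε, hε, fun n hn o => ?_⟩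
  set M := update (fun j => (P j).toStrat S) 0 M' with hM
  have hpl := prob_play_eq M hn (N' := coinsOf M n) (fun _ => le_rfl)
    (coinsOf_le_devCoins (P := P) M' n) (fun o' => o' = o)
  rw [hpl]
  have hN : ∀ j, ¢ n + (P j).coins.eval n ≤ devCoins S P M' n j := fun j => by
    rw [devCoins]; omega
  have h1 := hmix n hn (devCoins S P M' n) hN (Fin (devCoins S P M' n 0) → Bool)
    (fun p => update p.2 0 p.1) (unif_update 0)
    (fun ω => outR S Γ l n (respOf M n ω) = o)
    (fun τ D => outOf (update D 0 (resp n τ)) = o) (fun τ ω D hD => by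
      set ω' : Coins (devCoins S P M' n) := update ω 0 τ with hω'
      have h0 : respOf M n ω' 0 = fun v => M'.act n v ((ofFn τ).take (M'.coins.eval n)) := by
        funext v
        rw [respOf, hM, update_self, hω', update_self]
      have h2 := outR_first (S := S) hn (ρ := respOf M n ω') (D := D)
        (cc := fun j => ofFn (fun k : Fin (¢ n) => ω' j ⟨k, by have := hN j; omega⟩))
        (junk := fun j => (P j).junk n (ofFn (sampCoins S (P j) n (hN j) (ω' j))))
        (act₀_mem hn (respOf_legal M hn (coinsOf_le_devCoins M' n) ω'))
        (fun j hj => by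
          rw [Plan.respOf_toStrat P M (by rw [hM, update_of_ne hj]) n (hN j), ← hD j]
          simp only [hω', update_of_ne hj])
      rw [h2, h0])
  refine le_trans (le_of_eq ?_) h1
  rw [mixProb]
  congr 2
  refine sum_congr rfl fun D _ => ?_
  rw [← prob_pushforward (resp n) (fun t => outOf (update D 0 t) = o)]

lemma isDist_data {β : Fin l → ℝ} (hβ : IsDist β) {δ : (Fin l → Fin l → Bool) → ℝ}
    (hδ : IsDist δ) {γ : Lab l → Fin (Γ.size i) → ℝ} (hγ : ∀ L, IsDist (γ L)) :
    IsDist (fun t : Data Γ l i => β t.1.1 * δ t.1.2 * ∏ L, γ L (t.2 L)) := by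
  refine ⟨fun t => mul_nonneg (mul_nonneg (hβ.1 _) (hδ.1 _))
    (prod_nonneg fun L _ => (hγ L).1 _), ?_⟩
  rw [sum_prod_type]
  simp only [← mul_sum, sum_pi_eq_one γ (fun L => (hγ L).2), mul_one]
  rw [sum_prod_type]
  simp only [← mul_sum, hδ.2, mul_one, hβ.2]

lemma isDist_dirac {ι : Type} [Fintype ι] [DecidableEq ι] (x : ι) : IsDist (fun y => if y = x then (1 : ℝ) else 0) :=
  ⟨fun y => by positivity, by simp⟩

lemma sum_data (β : Fin l → ℝ) (δ : (Fin l → Fin l → Bool) → ℝ)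
    {γ : Lab l → Fin (Γ.size i) → ℝ} (hγ : ∀ L, IsDist (γ L)) (L : Lab l) (f : Fin l → ℝ)
    (k : (Fin l → Fin l → Bool) → ℝ) (g : Fin (Γ.size i) → ℝ) :
    ∑ t : Data Γ l i, β t.1.1 * δ t.1.2 * (∏ L, γ L (t.2 L)) * (f t.1.1 * k t.1.2 * g (t.2 L)) =
      (∑ b, β b * f b) * (∑ d, δ d * k d) * ∑ u, γ L u * g u := by
  rw [sum_prod_type]
  have h1 : ∀ x : Fin l × (Fin l → Fin l → Bool), ∑ y : Lab l → Fin (Γ.size i),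
      β x.1 * δ x.2 * (∏ L, γ L (y L)) * (f x.1 * k x.2 * g (y L)) =
        β x.1 * f x.1 * (δ x.2 * k x.2) * ∑ u, γ L u * g u := fun x => by
    rw [← sum_pi_mul γ (fun L => (hγ L).2) L g, mul_sum]
    exact sum_congr rfl fun y _ => by ring
  simp only [h1]
  rw [← sum_mul, sum_prod_type]
  simp only [← mul_sum, ← sum_mul]

lemma devTest_decPT (hi : i ≠ 0) (M' : Strat ⌘ i) (b : Fin l) : DecPT inp₃ (fun a => i = 1 → ofNat l (bitsVal (M'.act a.1 (packBits [a.2.1]) a.2.2)) = b) ∧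
    ∀ u, DecPT inp₃ (fun a => DevTest S Γ l a.1 i (fun v => M'.act a.1 v a.2.2) 0 b false u [] a.2.1) := by
  obtain ⟨hN, hx, hr⟩ := PolyTime.args₃
  have hact : ∀ {v : ℕ × Bits × Bits → Bits}, PolyTime inp₃ v → PolyTime inp₃ (fun a => M'.act a.1 (v a) a.2.2) := fun {v} hv =>
    M'.polyTime.comp (fun a : ℕ × Bits × Bits => (a.1, v a, a.2.2))
      [fun a => ones a.1, v, fun a => a.2.2] (by simp [hN, hv, hr]) (fun _ => rfl)
  have hy := hact (v := fun a => packBits [a.2.1]) (PolyTime.packBits [fun a : ℕ × Bits × Bits => a.2.1] (by simpa using hx))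
  have h1 : DecPT inp₃ (fun a => i = 1 → ofNat l (bitsVal (M'.act a.1 (packBits [a.2.1]) a.2.2)) = b) :=
    (DecPT.const (i = 1)).imp (FinPT.bitsVal_mod l hy b)
  refine ⟨h1, fun u => h1.and (FinPT.bitsVal_mod _ (hact ?_) u)⟩
  have h2 : PolyTime inp₃ (fun a => if i = 1 then M'.act a.1 (packBits [a.2.1]) a.2.2 else
        ofFn (♭ b)) := by
    by_cases h : i = 1
    · simpa only [if_pos h] using hy
    · simpa only [if_neg h] using const _
  have h3 := PolyTime.packBits ((fun a : ℕ × Bits × Bits => a.2.1) :: (fun a => if i = 1 then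
    M'.act a.1 (packBits [a.2.1]) a.2.2 else ofFn (♭ b)) ::
    (fun a => ones (size l * a.1)) :: List.replicate (gStage i - 3) (fun _ => [])) (by
      intro g hg
      simp only [List.mem_cons, List.mem_replicate] at hg
      rcases hg with rfl | rfl | rfl | ⟨_, rfl⟩
      · exact hx
      · exact h2
      · exact (ones_const _).ones_mul hN
      · exact const _)
  refine h3.congr (fun a => ?_)
  simp [testView, gView, thirdStr]

lemma devApprox_ne (hi : i ≠ 0) (hW : ∀ j, IsDist (W j))
    (hP : ∀ j, PlanSpec (P j) (W j)) (M' : Strat ⌘ i) : DevApprox S P W i M' := by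
  classical
  obtain ⟨ε, hε, hmix⟩ := mixture (S := S) hW hP
  let Θ := fun n => (Fin (¢ n) → Bool) × (Fin (M'.coins.eval n) → Bool)
  let ρ := fun n (θ : Θ n) v => M'.act n v (ofFn θ.2)
  let x := fun n (a : Fin l) (θ : Θ n) => commitStr S n (♭ a) (ofFn θ.1)
  let q := fun n (a b : Fin l) => prob (fun θ : Θ n =>
    i = 1 → ofNat l (bitsVal (ρ n θ (packBits [x n a θ]))) = b)
  let p := fun n (a b : Fin l) (r : Bool) (u : Fin (Γ.size i)) => prob (fun θ : Θ n =>
    DevTest S Γ l n i (ρ n θ) a b r u (ofFn θ.1) (x n a θ))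
  have hpq : ∀ n a b r, ∑ u, p n a b r u = q n a b := fun n a b r => by
    simp only [p, q, prob_eq_avg]
    rw [← avg_sum]
    congr 1
    funext θ
    simp only [DevTest]
    by_cases h : i = 1 → ofNat l (bitsVal (ρ n θ (packBits [x n a θ]))) = b
    · simp only [eq_true h, true_and, if_true, sum_ite_eq, mem_univ]
    · rw [if_neg h]
      refine sum_eq_zero fun u _ => if_neg (fun h' => h h'.1)
  have hp0 : ∀ n a b r u, 0 ≤ p n a b r u := fun _ _ _ _ _ => prob_nonneg _
  have hple : ∀ n a b r u, p n a b r u ≤ q n a b := fun n a b r u => prob_mono fun θ h => h.1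
  have hq1 : i ≠ 1 → ∀ n a b, q n a b = 1 := fun h n a b => by
    simp only [q]
    rw [prob_congr (E' := fun _ => True) (fun θ => by simp [h]), prob_eq_avg]
    simp [avg_const]
  have hhide : ∀ a b : Fin l, ∃ ε, Negligible ε ∧ ∀ n, 1 ≤ n → |q n a b - q n 0 b| ≤ ε n ∧
      ∀ u, |p n a b false u - p n 0 b false u| ≤ ε n := fun a b => by
    obtain ⟨hd1, hd2⟩ := devTest_decPT hi M' b
    obtain ⟨ε₁, hε₁, h1⟩ := commit_hiding (S := S) (q := M'.coins) (T := fun n x τ =>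
      i = 1 → ofNat l (bitsVal (M'.act n (packBits [x]) τ)) = b) hd1 (♭ a)
      (♭ (0 : Fin l))
    choose ε₂ hε₂ h2 using fun u => commit_hiding (S := S) (q := M'.coins) (T := fun n x τ =>
      DevTest S Γ l n i (fun v => M'.act n v τ) 0 b false u [] x) (hd2 u)
      (♭ a) (♭ (0 : Fin l))
    refine ⟨_, hε₁.add (Negligible.sum Finset.univ fun u _ => hε₂ u), fun n hn => ⟨?_, fun u => ?_⟩⟩
    · exact (h1 n hn).trans (le_add_of_nonneg_right (sum_nonneg fun u _ => (hε₂ u).1 n))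
    · have h3 := (h2 u n hn).trans (single_le_sum (f := fun u => ε₂ u n)
        (fun u _ => (hε₂ u).1 n) (mem_univ u))
      exact h3.trans (le_add_of_nonneg_left (hε₁.1 n))
  choose ε' hε' hhide using hhide
  let γ := fun n (L : Lab l) (u : Fin (Γ.size i)) => if q n (L.1.getD 0) L.2.1 = 0 then
    (if u = 0 then (1 : ℝ) else 0) else p n (L.1.getD 0) L.2.1 L.2.2 u / q n (L.1.getD 0) L.2.1
  let β := fun n (b : Fin l) => if i = 1 then q n 0 b else if b = 0 then (1 : ℝ) else 0
  let δ : (Fin l → Fin l → Bool) → ℝ := fun f => if f = (fun _ _ => false) then 1 else 0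
  have hγ : ∀ n L, IsDist (γ n L) := fun n L => by
    by_cases h : q n (L.1.getD 0) L.2.1 = 0
    · simp only [γ, if_pos h]; exact isDist_dirac (0 : Fin _)
    · simp only [γ, if_neg h]
      refine ⟨fun u => div_nonneg (hp0 _ _ _ _ _) (prob_nonneg _), ?_⟩
      rw [← sum_div, hpq, div_self h]
  have hβ : ∀ n, IsDist (β n) := fun n => by
    by_cases h : i = 1
    · simp only [β, if_pos h]
      refine ⟨fun b => prob_nonneg _, ?_⟩
      simp only [q, h, forall_const]
      exact sum_prob_eq (fun θ : Θ n => ofNat l (bitsVal (ρ n θ (packBits [x n 0 θ]))))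
    · simp only [β, if_neg h]; exact isDist_dirac (0 : Fin _)
  have hδ : IsDist δ := isDist_dirac _
  have hqγ : ∀ n L u, q n (L.1.getD 0) L.2.1 * γ n L u = p n (L.1.getD 0) L.2.1 L.2.2 u := by
    intro n L u
    by_cases h : q n (L.1.getD 0) L.2.1 = 0
    · have := hple n (L.1.getD 0) L.2.1 L.2.2 u
      rw [h, zero_mul]
      rw [h] at this
      exact le_antisymm (hp0 _ _ _ _ _) this
    · simp only [γ, if_neg h]; field_simp
  have hσ : ∀ n (o : Out Γ l), ∑ t : Data Γ l i, β n t.1.1 * δ t.1.2 * (∏ L, γ n L (t.2 L)) *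
      (if Own i t o then 1 else 0) = q n 0 o.2.1 * γ n (labOf i o.1 o.2.1 o.2.2.1) (o.2.2.2 i) := by
    intro n o
    have h1 := sum_data (i := i) (β n) δ (hγ n) (labOf i o.1 o.2.1 o.2.2.1)
      (fun b => if i = 1 → b = o.2.1 then 1 else 0) (fun _ => 1) (fun u => if u = o.2.2.2 i then 1 else 0)
    have h2 : ∑ b, β n b * (if i = 1 → b = o.2.1 then 1 else 0) = q n 0 o.2.1 := by
      by_cases h : i = 1
      · simp [h, β]
      · simp only [h, IsEmpty.forall_iff, if_true, mul_one, (hβ n).2, hq1 h]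
    rw [h2] at h1
    simp only [mul_one, hδ.2] at h1
    simp only [mul_ite, mul_one, mul_zero, sum_ite_eq', mem_univ, if_true] at h1 ⊢
    rw [← h1]
    refine sum_congr rfl fun t _ => ?_
    by_cases h3 : i = 1 → t.1.1 = o.2.1 <;>
      by_cases h4 : t.2 (labOf i o.1 o.2.1 o.2.2.1) = o.2.2.2 i <;> simp [Own, hi, h3, h4]
  have hle : ∀ n, 1 ≤ n → ∀ o : Out Γ l, |p n o.1 o.2.1 o.2.2.1 (o.2.2.2 i) -
      q n 0 o.2.1 * γ n (labOf i o.1 o.2.1 o.2.2.1) (o.2.2.2 i)| ≤ ∑ a, ∑ b, ε' a b n := by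
    rintro n hn ⟨a, b, r, u⟩
    have h0 : ε' a b n ≤ ∑ a, ∑ b, ε' a b n :=
      (single_le_sum (f := fun b => ε' a b n) (fun b _ => (hε' a b).1 n)
        (mem_univ b)).trans (single_le_sum (f := fun a => ∑ b, ε' a b n)
        (fun a _ => sum_nonneg fun b _ => (hε' a b).1 n) (mem_univ a))
    refine le_trans ?_ h0
    have h1 := hqγ n (labOf i a b r) (u i)
    cases r
    · have h2 : labOf i a b false = (none, b, false) := by simp [labOf, hi]
      rw [h2] at h1 ⊢
      simp only [Option.getD_none] at h1
      simp only [h1]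
      exact (hhide a b n hn).2 _
    · have h2 : labOf i a b true = (some a, b, true) := by simp [labOf]
      rw [h2] at h1 ⊢
      simp only [Option.getD_some] at h1
      simp only [← h1, ← sub_mul]
      rw [abs_mul]
      refine (mul_le_of_le_one_right (abs_nonneg _) ?_).trans (hhide a b n hn).1
      rw [abs_of_nonneg ((hγ n _).1 _)]
      exact (hγ n _).le_one _
  refine ⟨fun n t => β n t.1.1 * δ t.1.2 * ∏ L, γ n L (t.2 L),
    fun n => isDist_data (hβ n) hδ (hγ n), _, hε.add (Negligible.sum Finset.univ fun a _ =>
      Negligible.sum Finset.univ fun b _ => hε' a b), fun n hn o => ?_⟩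
  set M := update (fun j => (P j).toStrat S) i M' with hM
  have hcl := coinsOf_le_devCoins (P := P) M' n
  have hpl := prob_play_eq M hn (N' := coinsOf M n) (fun _ => le_rfl) hcl (fun o' => o' = o)
  rw [hpl]
  have hN : ∀ j, ¢ n + (P j).coins.eval n ≤ devCoins S P M' n j := fun j => by
    rw [devCoins]; omega
  have hk : ¢ n ≤ devCoins S P M' n 0 := by rw [devCoins]; omega
  have hk' : M'.coins.eval n ≤ devCoins S P M' n i := by rw [devCoins]; omega
  have h1 := hmix n hn (devCoins S P M' n) hN (Θ n) _ (unif_splice₂ hi.symm hk hk')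
    (fun ω => outR S Γ l n (respOf M n ω) = o)
    (fun θ D => Compat i D o ∧ DevTest S Γ l n i (ρ n θ) o.1 o.2.1 o.2.2.1 (o.2.2.2 i)
      (ofFn θ.1) (x n o.1 θ)) (fun θ ω D hD => by
      set ω' : Coins (devCoins S P M' n) := update (update ω 0 (splice θ.1 (ω 0))) i
        (splice θ.2 (ω i)) with hω'
      have h0 : respOf M n ω' i = ρ n θ := by
        funext v
        rw [respOf, hM, update_self, take_ofFn _ hk']
        simp only [ρ]
        congr 2
        rw [hω', update_self]
        exact prefix_splice hk' _ _
      have hsamp : ∀ j ≠ i, sampCoins S (P j) n (hN j) (ω' j) = sampCoins S (P j) n (hN j) (ω j) := by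
        intro j hj
        rw [hω', update_of_ne hj]
        by_cases h : j = 0
        · subst h
          rw [update_self]
          funext k
          simp [sampCoins, splice]
        · rw [update_of_ne h]
      have hcc : ofFn (fun k : Fin (¢ n) =>
          ω' 0 ⟨k, by have := hN 0; omega⟩) = ofFn θ.1 := by
        rw [hω', update_of_ne hi.symm, update_self]
        congr 1
        exact prefix_splice hk _ _
      have h2 := outR_deviate_iff (S := S) hn hi (ρ := respOf M n ω') (D := D)
        (cc := fun j => ofFn (fun k : Fin (¢ n) => ω' j ⟨k, by have := hN j; omega⟩))
        (junk := fun j => (P j).junk n (ofFn (sampCoins S (P j) n (hN j) (ω' j))))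
        (by simp [commitCoins])
        (fun j hj => by
          rw [Plan.respOf_toStrat P M (by rw [hM, update_of_ne hj]) n (hN j), ← hD j, hsamp j hj]) o
      rw [h2, h0]
      simp only [hcc]
      rfl)
  refine (abs_sub_le _ _ _).trans (add_le_add h1 ?_)
  rw [mixProb, ← sum_sub_distrib]
  have hD : ∀ D : ∀ j, Data Γ l j, |(∏ j, W j (D j)) * prob (fun θ : Θ n => Compat i D o ∧
      DevTest S Γ l n i (ρ n θ) o.1 o.2.1 o.2.2.1 (o.2.2.2 i) (ofFn θ.1) (x n o.1 θ)) -
      (∏ j, W j (D j)) * ∑ t, β n t.1.1 * δ t.1.2 * (∏ L, γ n L (t.2 L)) *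
        (if outOf (update D i t) = o then 1 else 0)| ≤ (∏ j, W j (D j)) * ∑ a, ∑ b, ε' a b n := by
    intro D
    rw [← mul_sub, abs_mul, abs_of_nonneg ((isDist_prod hW).1 D)]
    refine mul_le_mul_of_nonneg_left ?_ ((isDist_prod hW).1 D)
    by_cases hC : Compat i D o
    · simp only [outOf_update_eq_iff, hC, true_and]
      rw [hσ]
      exact hle n hn o
    · simp only [outOf_update_eq_iff, hC, false_and, if_false, mul_zero, Finset.sum_const_zero]
      have : prob (fun _ : Θ n => False) = 0 := by rw [prob_eq_avg]; simp [avg]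
      rw [this]
      simpa using sum_nonneg fun a _ => sum_nonneg fun b _ => (hε' a b).1 n
  refine (abs_sum_le_sum_abs _ _).trans ((sum_le_sum fun D _ => hD D).trans ?_)
  rw [← sum_mul, (isDist_prod hW).2, one_mul]

lemma devApprox (hW : ∀ j, IsDist (W j)) (hP : ∀ j, PlanSpec (P j) (W j)) (i : ℙ)
    (M' : Strat ⌘ i) : DevApprox S P W i M' := by
  by_cases hi : i = 0
  · subst hi; exact devApprox_zero hW hP M'
  · exact devApprox_ne hi hW hP M'

end

/-! ## Mixed strategies as distributions on data -/

/-- The image of a distribution. -/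
def push {ι κ : Type} [Fintype ι] (q : ι → κ) (w : ι → ℝ) (y : κ) : ℝ :=
  open Classical in ∑ x, if q x = y then w x else 0

lemma sum_push {ι κ : Type} [Fintype ι] [Fintype κ] (q : ι → κ) (w : ι → ℝ) (f : κ → ℝ) :
    ∑ y, push q w y * f y = ∑ x, w x * f (q x) := by
  classical
  simp only [push, sum_mul, ite_mul, zero_mul]
  rw [sum_comm]
  simp

lemma IsDist.push {ι κ : Type} [Fintype ι] [Fintype κ] {w : ι → ℝ} (h : IsDist w) (q : ι → κ) :
    IsDist (push q w) := by
  classical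
  refine ⟨fun y => sum_nonneg fun x _ => ?_, ?_⟩
  · split_ifs
    exacts [h.1 x, le_rfl]
  · simpa [h.2] using sum_push q w (fun _ => 1)

lemma sum_pi_push {ι : Type} [Fintype ι] [DecidableEq ι] {X Y : ι → Type} [∀ i, Fintype (X i)]
    [∀ i, Fintype (Y i)] (q : ∀ i, X i → Y i) (w : ∀ i, X i → ℝ) (g : (∀ i, Y i) → ℝ) :
    ∑ y : ∀ i, Y i, (∏ i, push (q i) (w i) (y i)) * g y =
      ∑ x : ∀ i, X i, (∏ i, w i (x i)) * g (fun i => q i (x i)) := by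
  classical
  have h1 : ∀ y : ∀ i, Y i, ∏ i, push (q i) (w i) (y i) =
      push (fun (x : ∀ i, X i) i => q i (x i)) (fun x => ∏ i, w i (x i)) y := fun y => by
    simp only [push]
    rw [prod_univ_sum, piFinset_univ]
    refine sum_congr rfl fun x _ => ?_
    by_cases h : (fun i => q i (x i)) = y
    · rw [if_pos h]
      exact prod_congr rfl fun i _ => if_pos (congrFun h i)
    · rw [if_neg h]
      obtain ⟨i, hi⟩ := Function.ne_iff.1 h
      exact Finset.prod_eq_zero (mem_univ i) (if_neg hi)
  simp only [h1]
  exact sum_push _ _ _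

lemma sum_pi_update {ι : Type} [Fintype ι] [DecidableEq ι] {X : ι → Type} [∀ i, Fintype (X i)]
    {w : ∀ i, X i → ℝ} {i : ι} (hw : ∑ x, w i x = 1) (σ : X i → ℝ) (g : (∀ i, X i) → ℝ) :
    ∑ x : ∀ i, X i, (∏ j, w j (x j)) * ∑ t, σ t * g (update x i t) =
      ∑ x : ∀ i, X i, (∏ j, update w i σ j (x j)) * g x := by
  have hprod : ∀ (v : ∀ i, X i → ℝ) (x : ∀ i, X i),
      ∏ j, v j (x j) = v i (x i) * ∏ j ∈ {i}ᶜ, v j (x j) := fun v x => prod_eq_mul_prod_compl i _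
  have hcongr : ∀ (x : ∀ i, X i) (t : X i), ∏ j ∈ {i}ᶜ, update w i σ j (x j) =
      ∏ j ∈ {i}ᶜ, w j (update x i t j) := fun x t => prod_congr rfl fun j hj => by
      have : j ≠ i := by simpa using hj
      rw [update_of_ne this, update_of_ne this]
  let s : (∀ i, X i) × X i → (∀ i, X i) × X i := fun p => (update p.1 i p.2, p.1 i)
  have hs : Function.Involutive s := fun p => by simp [s]
  have h1 : ∑ x : ∀ i, X i, (∏ j, w j (x j)) * ∑ t, σ t * g (update x i t) =
      ∑ p : (∀ i, X i) × X i, (∏ j, w j (p.1 j)) * (σ p.2 * g (update p.1 i p.2)) := by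
    rw [sum_prod_type]
    exact sum_congr rfl fun x _ => mul_sum _ _ _
  rw [h1, ← Equiv.sum_comp hs.toPerm, sum_prod_type]
  simp only [Function.Involutive.coe_toPerm]
  refine sum_congr rfl fun x _ => ?_
  have h2 : ∀ t, (∏ j, w j ((s (x, t)).1 j)) * (σ (s (x, t)).2 *
      g (update (s (x, t)).1 i (s (x, t)).2)) = w i t * ((∏ j, update w i σ j (x j)) * g x) := by
    intro t
    simp only [s, Function.update_idem, update_eq_self]
    rw [hprod, hprod (update w i σ), update_self, update_self, hcongr x t]
    ring
  simp only [h2, ← sum_mul, hw, one_mul]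

lemma compIndist_of_finite {α : Type} [BitCode α] {X Y : ℕ → α → ℝ} (T : Finset α)
    (hX : ∀ n, 1 ≤ n → ∀ a ∉ T, X n a = 0) (hY : ∀ n, 1 ≤ n → ∀ a ∉ T, Y n a = 0)
    (h : ∃ ε, Negligible ε ∧ ∀ n, 1 ≤ n → ∀ a ∈ T, |X n a - Y n a| ≤ ε n) : CompIndist X Y := by
  classical
  intro D
  obtain ⟨ε, hε, h⟩ := h
  refine ⟨_, hε.const_mul (C := (T.card : ℝ)) (by positivity), fun n hn => ?_⟩
  have hs : ∀ Z : ℕ → α → ℝ, (∀ a ∉ T, Z n a = 0) →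
      ∑ᶠ a, Z n a * D.accept n (code a) = ∑ a ∈ T, Z n a * D.accept n (code a) :=
    fun Z hZ => finsum_eq_sum_of_support_subset _ (fun a ha => by
      by_contra h'
      exact ha (by simp [hZ a h']))
  rw [hs X (hX n hn), hs Y (hY n hn), ← sum_sub_distrib, ← nsmul_eq_mul]
  refine (abs_sum_le_sum_abs _ _).trans (Finset.sum_le_card_nsmul _ _ _ fun a ha => ?_)
  rw [← sub_mul, abs_mul]
  refine (mul_le_of_le_one_right (abs_nonneg _) ?_).trans (h n hn a ha)
  rw [Distinguisher.accept, abs_of_nonneg (prob_nonneg _)]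
  exact prob_le_one _

/-- The distribution on data given by a mixed strategy. -/
def lawData (σ : ✉.Mixed i) : Data Γ l i → ℝ := push toData σ.1

lemma isDist_lawData (σ : ✉.Mixed i) : IsDist (lawData σ) := IsDist.push ⟨σ.2.1, σ.2.2⟩ _

/-- The mixed strategy given by a distribution on data. -/
def mixedOf (W : Data Γ l i → ℝ) (h : IsDist W) : ✉.Mixed i :=
  ⟨push ofData W, (h.push _).1, (h.push _).2⟩

lemma sum_weight (σ : ∀ i, ✉.Mixed i) (g : (∀ i, Data Γ l i) → ℝ) :
    ∑ s, ✉.weight σ s * g (fun i => toData (s i)) = ∑ D, (∏ i, lawData (σ i) (D i)) * g D :=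
  (sum_pi_push (fun _ => toData) (fun i => (σ i).1) g).symm

/-- The expectation of `g` for the outcome of the profile `W`. -/
def expOut (W : ∀ j, Data Γ l j → ℝ) (g : Out Γ l → ℝ) : ℝ := ∑ D, (∏ j, W j (D j)) * g (outOf D)

open Classical in
/-- For the profile `W`, player `i` expects `v` given that the event `E` happens, and no pure
strategy gives him more than `v + δ`. -/
structure Unprofitable (W : ∀ j, Data Γ l j → ℝ) (i : ℙ) (E : Fin l → Fin l → Bool → Prop)
    (v δ : ℝ) : Prop where
  pos : 0 < expOut W (fun o => if E o.1 o.2.1 o.2.2.1 then 1 else 0)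
  value : expOut W (fun o => if E o.1 o.2.1 o.2.2.1 then Γ.payoff o.2.2.2 i else 0) =
    v * expOut W (fun o => if E o.1 o.2.1 o.2.2.1 then 1 else 0)
  le : ∀ t : Data Γ l i, ∑ D, (∏ j, W j (D j)) * (fun o : Out Γ l => if E o.1 o.2.1 o.2.2.1 then
    Γ.payoff o.2.2.2 i - v - δ else 0) (outOf (update D i t)) ≤ 0

lemma outOf_toData_ofData (D : ∀ i, Data Γ l i) :
    outOf (fun i => toData (ofData (D i))) = outOf D :=
  outOf_congr fun i => agree_toData_ofData (D i)

lemma outOf_update_toData_ofData (D : ∀ i, Data Γ l i) (i : ℙ) (t : Data Γ l i) :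
    outOf (update D i (toData (ofData t))) = outOf (update D i t) := outOf_congr fun j => by
    by_cases h : j = i
    · subst h
      rw [update_self, update_self]
      exact agree_toData_ofData t
    · rw [update_of_ne h, update_of_ne h]
      exact ⟨fun _ => rfl, fun _ => rfl, fun _ _ _ => rfl⟩

lemma expOut_mixedOf {W : ∀ j, Data Γ l j → ℝ} (hW : ∀ j, IsDist (W j)) (g : Out Γ l → ℝ) :
    expOut (fun j => lawData (mixedOf (W j) (hW j))) g = expOut W g := by
  rw [expOut, expOut, ← sum_weight]
  have h := sum_pi_push (fun _ => ofData (Γ := Γ) (l := l)) W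
    (fun s => g (outOf fun i => toData (s i)))
  simp only [outOf_toData_ofData] at h
  exact h

lemma rho_eq (σ : ∀ i, ✉.Mixed i) (h : List CorrAct) : ✉.rho σ h =
      expOut (fun j => lawData (σ j)) (fun o => open Classical in if mkHist o = h then 1 else 0) := by
  classical
  rw [expOut, ← sum_weight, ExtGame.rho]
  simp only [outcome_follow, mul_ite, mul_one, mul_zero]

lemma rho_mkHist (σ : ∀ i, ✉.Mixed i) (o : Out Γ l) : ✉.rho σ (mkHist o) =
      expOut (fun j => lawData (σ j)) (fun o' => open Classical in if o' = o then 1 else 0) := by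
  simp only [rho_eq, mkHist_injective.eq_iff]

lemma rho_eq_zero (σ : ∀ i, ✉.Mixed i) {h : List CorrAct}
    (hh : h ∉ ✉.terminals) : ✉.rho σ h = 0 := by
  rw [rho_eq, expOut]
  refine sum_eq_zero fun D _ => ?_
  rw [if_neg, mul_zero]
  intro h'
  rw [corrGame_terminals] at hh
  exact hh (Finset.mem_map.2 ⟨_, mem_univ _, h'⟩)

lemma mixProb_eq {W : ∀ j, Data Γ l j → ℝ} (hW : ∀ j, IsDist (W j)) (i : ℙ)
    (σ : Data Γ l i → ℝ) (o : Out Γ l) : mixProb W i σ o =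
      expOut (update W i σ) (fun o' => open Classical in if o' = o then 1 else 0) :=
  sum_pi_update (hW i).2 σ (fun D => open Classical in if outOf D = o then 1 else 0)

lemma rho_update (σ : ∀ i, ✉.Mixed i) (i : ℙ) {τ : Data Γ l i → ℝ} (hτ : IsDist τ) (o : Out Γ l) :
    ✉.rho (update σ i (mixedOf τ hτ)) (mkHist o) = mixProb (fun j => lawData (σ j)) i τ o := by
  classical
  have h1 : (fun j => lawData (update σ i (mixedOf τ hτ) j)) =
      update (fun j => lawData (σ j)) i (lawData (mixedOf τ hτ)) := by
    funext j
    by_cases h : j = i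
    · subst h; simp
    · simp [h]
  rw [rho_mkHist, h1, ← mixProb_eq (fun j => isDist_lawData (σ j)), mixProb, mixProb]
  refine sum_congr rfl fun D _ => ?_
  congr 1
  have h2 := sum_push (toData (Γ := Γ) (l := l) (i := i)) (mixedOf τ hτ).1
    (fun t => if outOf (update D i t) = o then 1 else 0)
  have h3 := sum_push (ofData (Γ := Γ) (l := l) (i := i)) τ
    (fun s => if outOf (update D i (toData s)) = o then 1 else 0)
  simp only [outOf_update_toData_ofData] at h3
  exact h2.trans h3

/-! ## The strategies that represent mixed strategies -/

lemma exists_genPlan (σ : ✉.EffMixed i) : ∃ P : Plan Γ l i, P.coins = X ∧ PlanSpec P (lawData σ.1) ∧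
      (∀ n r, ∃ D, P.samp n r = cleanBeh D) ∧ ∀ n r, P.junk n r = [] := by
  have : Nonempty (✉.Det i) := ⟨ofData ((0, fun _ _ => false), fun _ => 0)⟩
  obtain ⟨samp, hs, C, hC, h⟩ := exists_sampler σ.1.1 σ.1.2.1 σ.1.2.2 σ.2
  refine ⟨⟨X, fun n r => cleanBeh (toData (samp n r)), fun _ _ => [],
    hs.map (fun s => cleanBeh (toData s)), const _, fun _ _ => Nat.zero_le _⟩, rfl, ?_,
    fun n r => ⟨_, rfl⟩, fun _ _ => rfl⟩
  refine ⟨_, Negligible.two_pow_inv.const_mul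
    (C := card (✉.Det i) * C) (by positivity), fun n hn D => ?_⟩
  classical
  have key : ∀ N, N = n → |prob (fun r : Fin N → Bool => toData (samp n (ofFn r)) = D) -
      lawData σ.1 D| ≤ card (✉.Det i) * C * (1 / 2 ^ n) := ?_
  · simpa only [cleanBeh_injective.eq_iff] using key _ eval_X
  rintro N rfl
  rw [prob_pushforward (fun r : Fin N → Bool => samp N (ofFn r)) (fun s => toData s = D), lawData,
    push, ← sum_sub_distrib, mul_assoc, ← nsmul_eq_mul]
  refine (abs_sum_le_sum_abs _ _).trans (Finset.sum_le_card_nsmul _ _ _ fun s _ => ?_)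
  by_cases h1 : toData s = D
  · simpa [h1] using h N s
  · simp only [h1, if_false, mul_zero, sub_zero, abs_zero]
    positivity

/-- The plan that samples a deterministic strategy. -/
def genPlan (σ : ✉.EffMixed i) : Plan Γ l i := (exists_genPlan σ).choose

lemma genPlan_spec (σ : ✉.EffMixed i) : (genPlan σ).coins = X ∧ PlanSpec (genPlan σ) (lawData σ.1) ∧
      (∀ n r, ∃ D, (genPlan σ).samp n r = cleanBeh D) ∧ ∀ n r, (genPlan σ).junk n r = [] :=
  (exists_genPlan σ).choose_spec

lemma phi_genPlan (σ : ∀ i, ✉.EffMixed i) : ∃ ε, Negligible ε ∧ ∀ n, 1 ≤ n →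
    ∀ o : Out Γ l, |phi ♮ (fun i => (genPlan (σ i)).toStrat S) n (mkHist o) -
      ✉.rho (fun i => (σ i).1) (mkHist o)| ≤ ε n := by
  obtain ⟨ε, hε, h⟩ := phi_plans (S := S) (P := fun i => genPlan (σ i))
    (fun j => isDist_lawData (σ j).1) (fun j => (genPlan_spec (σ j)).2.1)
  refine ⟨ε, hε, fun n hn o => ?_⟩
  have h1 := phi_eq (fun i => (genPlan (σ i)).toStrat S) hn
    (N := coinsOf (fun i => (genPlan (σ i)).toStrat S) n) (fun _ => le_rfl) o
  rw [h1, rho_mkHist, expOut]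
  convert h n hn (fun o' => o' = o) using 6

lemma phi_eq_zero (M : ∀ i, Strat ⌘ i) (hn : 1 ≤ n) {h : List CorrAct}
    (hh : h ∉ ✉.terminals) : phi ♮ M n h = 0 := by
  rw [phi, prob_congr (E' := fun _ => False), prob_eq_avg]
  · simp [avg]
  · intro ω
    rw [corrMap_play M hn (N := coinsOf M n) (fun _ => le_rfl) ω, iff_false]
    intro h'
    rw [corrGame_terminals] at hh
    exact hh (Finset.mem_map.2 ⟨_, mem_univ _, h'⟩)

lemma represents (hS : S.Recognizable) (hΓ : ∀ a i, PolyTimeReal (Γ.payoff a i)) :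
    Represents ⌘ ✉ ♮ (fun i σ => (genPlan σ).toStrat S) where
  uniform := cryptoGame_uniform hS hΓ
  mapsTo := fun n _ h hh => corrMap_mem hh
  surjective := fun n hn => corrMap_surjOn hn
  length_eq := fun n _ h _ => corrMap_length h
  same_mover := fun n hn h hh => ⟨corrMap_NT hn hh, by
    change corrMover m _ = corrMover m _
    rw [corrMap_length]⟩
  subhistory := fun n _ h _ h' hh' => by
    rw [List.prefix_iff_eq_take.1 hh', corrMap_take]
    exact List.take_prefix _ _
  same_info := fun n hn h h' hh _ e => corrObs_corrMap_congr ((cryptoGame_NT hn).1 hh).2 e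
  last_action := fun n hn h h' _ _ e a _ => corrMap_last_action hn h h' e a
  utility := fun n hn h hh => by
    have h1 := (cryptoGame_terminal hn).1 hh
    refine ⟨corrGame_terminal.2 ?_, fun i => ?_⟩
    · obtain ⟨o, ho⟩ := exists_mkHist (corrMap_mem h1.1)
      refine ⟨o, ?_⟩
      rw [ho, corrMap_length, h1.2, take_of_length_le (length_mkHist o).le]
    · change Γ.payoffNat (cryptoChoice h) i = Γ.payoffNat (corrChoice (♮ n h)) i
      rw [funext fun j => (corrChoice_corrMap (S := S) (l := l) (n := n) h j).symm]
  corresponds := fun σ => by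
    obtain ⟨ε, hε, h⟩ := phi_genPlan (S := S) σ
    refine ⟨_, hε.const_mul (C := ✉.terminals.card) (by positivity), fun n hn => ?_⟩
    rw [← nsmul_eq_mul]
    refine Finset.sum_le_card_nsmul _ _ _ fun t ht => ?_
    rw [corrGame_terminals] at ht
    obtain ⟨o, -, rfl⟩ := Finset.mem_map.1 ht
    exact h n hn o
  knows := fun i σ => Plan.knows (genPlan σ)
  deviations := fun σ i M' => by
    obtain ⟨τ, hτ, ε, hε, h⟩ := devApprox (S := S) (P := fun j => genPlan (σ j))
      (fun j => isDist_lawData (σ j).1) (fun j => (genPlan_spec (σ j)).2.1) i M'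
    refine ⟨fun n => mixedOf (τ n) (hτ n), compIndist_of_finite ✉.terminals
      (fun n hn a ha => phi_eq_zero _ hn ha) (fun n _ a ha => rho_eq_zero _ ha)
      ⟨ε, hε, fun n hn a ha => ?_⟩⟩
    rw [corrGame_terminals] at ha
    obtain ⟨o, -, rfl⟩ := Finset.mem_map.1 ha
    have h1 := phi_eq (update (fun j => (genPlan (σ j)).toStrat S) i M') hn
      (N := coinsOf (update (fun j => (genPlan (σ j)).toStrat S) i M') n)
      (fun _ => le_rfl) o
    change |phi _ _ n (mkHist o) - ✉.rho _ (mkHist o)| ≤ _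
    rw [h1, rho_update]
    exact h n hn o

/-! ## Perturbed equilibrium play -/

namespace NormalForm

section

variable (Γ : NormalForm m)

lemma sum_profileProb (y : Γ.Profile) : ∑ u, Γ.profileProb y u = 1 :=
  sum_pi_eq_one (fun j => (y j).1) fun j => (y j).2.2

/-- A bound for the payoffs. -/
def payBound : ℝ := (m + 2) * ∑ u, ∑ i, |Γ.payoff u i|

lemma payBound_nonneg : 0 ≤ Γ.payBound :=
  mul_nonneg (by positivity) (sum_nonneg fun _ _ => sum_nonneg fun _ _ => abs_nonneg _)

lemma profileProb_nonneg (y : Γ.Profile) (u : ∀ i, Fin (Γ.size i)) : 0 ≤ Γ.profileProb y u :=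
  prod_nonneg fun j _ => (y j).2.1 _

lemma sum_abs_payoff_le (i : ℙ) : (m + 2) * ∑ u, |Γ.payoff u i| ≤ Γ.payBound :=
  mul_le_mul_of_nonneg_left (sum_le_sum fun u _ => single_le_sum
    (f := fun i => |Γ.payoff u i|) (fun _ _ => abs_nonneg _) (mem_univ i)) (by positivity)

lemma abs_expPayoff_sub_le {y y' : Γ.Profile} {ε : ℝ} (h : ∀ j u, |(y j).1 u - (y' j).1 u| ≤ ε)
    (hε : 0 ≤ ε) (i : ℙ) : |Γ.expPayoff y i - Γ.expPayoff y' i| ≤ ε * Γ.payBound := by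
  have hd : ∀ (z : Γ.Profile) j u, 0 ≤ (z j).1 u ∧ (z j).1 u ≤ 1 := fun z j u =>
    ⟨(z j).2.1 u, IsDist.le_one ⟨(z j).2.1, (z j).2.2⟩ u⟩
  refine le_trans ?_ (mul_le_mul_of_nonneg_left (Γ.sum_abs_payoff_le i) hε)
  rw [expPayoff, expPayoff, ← sum_sub_distrib, mul_sum, mul_sum]
  refine (abs_sum_le_sum_abs _ _).trans (sum_le_sum fun u _ => ?_)
  rw [← sub_mul, abs_mul, ← mul_assoc]
  refine mul_le_mul_of_nonneg_right ?_ (abs_nonneg _)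
  refine (abs_prod_sub_prod_le _ (fun j => hd y j _) (fun j => hd y' j _)).trans ?_
  refine (sum_le_sum fun j _ => h j (u j)).trans (le_of_eq ?_)
  simp [mul_comm]

lemma abs_expPayoff_le (y : Γ.Profile) (i : ℙ) : |Γ.expPayoff y i| ≤ Γ.payBound := by
  refine le_trans ?_ (Γ.sum_abs_payoff_le i)
  refine le_trans (b := ∑ u, |Γ.payoff u i|) ?_ (le_mul_of_one_le_left
    (sum_nonneg fun _ _ => abs_nonneg _) (by linarith [(Nat.cast_nonneg m : (0 : ℝ) ≤ m)]))
  refine (abs_sum_le_sum_abs _ _).trans (sum_le_sum fun u _ => ?_)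
  rw [abs_mul, abs_of_nonneg (Γ.profileProb_nonneg y u)]
  refine mul_le_of_le_one_left (abs_nonneg _) ?_
  exact Finset.prod_le_one (fun j _ => (y j).2.1 _)
    (fun j _ => IsDist.le_one ⟨(y j).2.1, (y j).2.2⟩ _)

end

end NormalForm

section

lemma natCast_size_pos (i : ℙ) : (0 : ℝ) < Γ.size i := by
  exact_mod_cast pos_of_ne_zero (NeZero.ne (Γ.size i))

lemma natCast_pos_of_neZero (l : ℕ) [NeZero l] : (0 : ℝ) < l := by
  exact_mod_cast pos_of_ne_zero (NeZero.ne l)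

/-- The index of the equilibrium to be played after the first three moves. -/
def recIdx (w a b : Fin l) (r : Bool) : Fin l := if r then a + b else w

/-- The index of the equilibrium to be played, as a function of a player's information. -/
def labIdx (w : Fin l) (L : Lab l) : Fin l := if L.2.2 then L.1.getD 0 + L.2.1 else w

lemma labIdx_labOf (w a b : Fin l) (r : Bool) (i : ℙ) :
    labIdx w (labOf i a b r) = recIdx w a b r := by
  cases r <;> simp [labIdx, labOf, recIdx]

section

variable (x : Fin l → Γ.Profile) (w : Fin l) (ε : ℝ)

/-- An equilibrium strategy, perturbed. -/
def trem (e : Fin l) (j : ℙ) (u : Fin (Γ.size j)) : ℝ := (1 - ε) * (x e j).1 u + ε * (1 / Γ.size j)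

/-- The probability to open the envelope or not. -/
def revProb (r : Bool) : ℝ := if r then 1 - ε else ε

/-- The distribution of the plans to open the envelope. -/
def revDist (f : Fin l → Fin l → Bool) : ℝ := ∏ a, ∏ b, revProb ε (f a b)

/-- The perturbed strategies: the numbers are uniform, the envelope is opened, and then the
equilibrium whose index is the sum of the numbers is played. -/
def corrDist (j : ℙ) (D : Data Γ l j) : ℝ :=
  1 / l * revDist ε D.1.2 * ∏ L, trem x ε (labIdx w L) j (D.2 L)

end

variable {x : Fin l → Γ.Profile} {w : Fin l} {ε : ℝ}

lemma isDist_trem (hε : 0 ≤ ε) (hε' : ε ≤ 1) (e : Fin l) (j : ℙ) : IsDist (trem x ε e j) := by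
  have := natCast_size_pos (Γ := Γ) j
  refine ⟨fun u => add_nonneg (mul_nonneg (by linarith) ((x e j).2.1 u)) (by positivity), ?_⟩
  simp only [trem, sum_add_distrib, ← mul_sum, (x e j).2.2, sum_const,
    card_univ, card_fin, nsmul_eq_mul]
  field_simp
  ring

lemma sum_revProb : ∑ r, revProb ε r = 1 := by simp [revProb]

lemma sum_revDist : ∑ f : Fin l → Fin l → Bool, revDist ε f = 1 :=
  sum_pi_eq_one (X := fun _ : Fin l => Fin l → Bool) (fun _ g => ∏ b, revProb ε (g b))
    fun _ => sum_pi_eq_one (X := fun _ : Fin l => Bool) (fun _ => revProb ε) fun _ => sum_revProb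

lemma sum_revDist_eq (a b : Fin l) (r : Bool) :
    ∑ f : Fin l → Fin l → Bool, revDist ε f * (if f a b = r then 1 else 0) = revProb ε r := by
  have h1 := sum_pi_mul (X := fun _ : Fin l => Fin l → Bool) (fun _ g => ∏ b, revProb ε (g b))
    (fun _ => sum_pi_eq_one (X := fun _ : Fin l => Bool) (fun _ => revProb ε) fun _ => sum_revProb) a
    (fun g => if g b = r then 1 else 0)
  have h2 := sum_pi_mul (X := fun _ : Fin l => Bool) (fun _ => revProb ε) (fun _ => sum_revProb) b
    (fun r' => if r' = r then 1 else 0)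
  exact h1.trans (h2.trans (by simp))

lemma revProb_nonneg (hε : 0 ≤ ε) (hε' : ε ≤ 1) (r : Bool) : 0 ≤ revProb ε r := by
  cases r <;> simp [revProb] <;> linarith

lemma isDist_corrDist (hε : 0 ≤ ε) (hε' : ε ≤ 1) (j : ℙ) : IsDist (corrDist x w ε j) :=
  isDist_data (β := fun _ => 1 / l)
    ⟨fun _ => by positivity, by
      have := natCast_pos_of_neZero l
      simp⟩
    (δ := revDist ε) ⟨fun f => prod_nonneg fun a _ => prod_nonneg fun b _ =>
      revProb_nonneg hε hε' _, sum_revDist⟩ (fun L => isDist_trem hε hε' (labIdx w L) j)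

/-- The perturbed equilibrium. -/
def tremProfile (x : Fin l → Γ.Profile) {ε : ℝ} (hε : 0 ≤ ε) (hε' : ε ≤ 1) (e : Fin l) : Γ.Profile :=
  fun j => ⟨trem x ε e j, (isDist_trem hε hε' e j).1, (isDist_trem hε hε' e j).2⟩

lemma tremProfile_sub_le (hε : 0 ≤ ε) (hε' : ε ≤ 1) (e : Fin l) (j : ℙ)
    (u : Fin (Γ.size j)) : |(tremProfile x hε hε' e j).1 u - (x e j).1 u| ≤ ε := by
  have h1 := natCast_size_pos (Γ := Γ) j
  have h2 : (1 : ℝ) ≤ Γ.size j := by exact_mod_cast pos_of_ne_zero (NeZero.ne (Γ.size j))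
  have h3 : 1 / (Γ.size j : ℝ) ≤ 1 := by rw [div_le_one h1]; exact h2
  have h4 : 0 ≤ 1 / (Γ.size j : ℝ) := by positivity
  have h5 := (x e j).2.1 u
  have h6 := IsDist.le_one ⟨(x e j).2.1, (x e j).2.2⟩ u
  change |(1 - ε) * (x e j).1 u + ε * (1 / Γ.size j) - (x e j).1 u| ≤ ε
  have : (1 - ε) * (x e j).1 u + ε * (1 / Γ.size j) - (x e j).1 u =
    ε * (1 / Γ.size j - (x e j).1 u) := by ring
  rw [this, abs_mul, abs_of_nonneg hε]
  exact mul_le_of_le_one_right hε (abs_le.2 ⟨by linarith, by linarith⟩)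

lemma expPayoff_deviate_le (hx : ∀ e, Γ.IsNash (x e)) (hε : 0 ≤ ε) (hε' : ε ≤ 1) (e : Fin l)
    (i : ℙ) (y : ↥(stdSimplex ℝ (Fin (Γ.size i)))) :
    Γ.expPayoff (update (tremProfile x hε hε' e) i y) i ≤
      Γ.expPayoff (tremProfile x hε hε' e) i + 2 * (ε * Γ.payBound) := by
  have h1 := Γ.abs_expPayoff_sub_le (tremProfile_sub_le (x := x) hε hε' e) hε i
  have h2 := Γ.abs_expPayoff_sub_le (y := update (tremProfile x hε hε' e) i y)
    (y' := update (x e) i y) (ε := ε) (fun j u => by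
      by_cases h : j = i
      · subst h; simp [hε]
      · rw [update_of_ne h, update_of_ne h]
        exact tremProfile_sub_le hε hε' e j u) hε i
  have h3 := hx e i y
  rw [abs_le] at h1 h2
  linarith

/-! ### The distribution of outcomes -/

open Classical in
lemma expOut_of_own {V : ∀ j, Data Γ l j → ℝ} (c : ℙ → Fin l → Fin l → Bool → ℝ)
    (Y : Fin l → Fin l → Bool → Γ.Profile)
    (h : ∀ j a b r (u : ∀ i, Fin (Γ.size i)),
      ∑ d, V j d * (if Own j d (a, b, r, u) then 1 else 0) = c j a b r * (Y a b r j).1 (u j))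
    (F : Out Γ l → ℝ) : expOut V F = ∑ a, ∑ b, ∑ r, (∏ j, c j a b r) *
      ∑ u, Γ.profileProb (Y a b r) u * F (a, b, r, u) := by
  have h1 : ∀ o : Out Γ l, push outOf (fun D => ∏ j, V j (D j)) o =
      ∏ j, ∑ d, V j d * (if Own j d o then 1 else 0) := fun o => by
    rw [prod_univ_sum, piFinset_univ, push]
    refine sum_congr rfl fun D _ => ?_
    rw [outOf_eq_iff, prod_mul_distrib]
    by_cases ho : ∀ j, Own j (D j) o
    · rw [if_pos ho, Finset.prod_eq_one (fun j _ => if_pos (ho j)), mul_one]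
    · obtain ⟨j, hj⟩ := not_forall.1 ho
      rw [if_neg ho, Finset.prod_eq_zero (f := fun j => if Own j (D j) o then (1 : ℝ) else 0)
        (mem_univ j) (if_neg hj), mul_zero]
  rw [expOut, ← sum_push, sum_prod_type]
  refine sum_congr rfl fun a _ => ?_
  rw [sum_prod_type]
  refine sum_congr rfl fun b _ => ?_
  rw [sum_prod_type]
  refine sum_congr rfl fun r _ => ?_
  rw [mul_sum]
  refine sum_congr rfl fun u _ => ?_
  rw [h1, ← mul_assoc]
  congr 1
  simp only [h, prod_mul_distrib]
  rfl

/-- The weights of the first two players' choices for an outcome. -/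
def ownWeight (α β : ℝ) (j : ℙ) : ℝ := (if j = 0 then α else 1) * (if j = 1 then β else 1)

lemma prod_ownWeight (α β : ℝ) : ∏ j : ℙ, ownWeight α β j = α * β := by
  simp only [ownWeight]
  rw [prod_mul_distrib]
  simp

lemma ite_and_mul (A B C : Prop) [Decidable A] [Decidable B] [Decidable C] :
    (if A ∧ B ∧ C then (1 : ℝ) else 0) =
      (if A then 1 else 0) * (if B then 1 else 0) * (if C then 1 else 0) := by
  split_ifs <;> simp_all

open Classical in
lemma corrDist_own (hε : 0 ≤ ε) (hε' : ε ≤ 1) (j : ℙ) (o : Out Γ l) :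
    ∑ d, corrDist x w ε j d * (if Own j d o then 1 else 0) =
      ownWeight (1 / l * revProb ε o.2.2.1) (1 / l) j *
        trem x ε (recIdx w o.1 o.2.1 o.2.2.1) j (o.2.2.2 j) := by
  have h1 := sum_data (i := j) (fun _ => 1 / (l : ℝ)) (revDist ε)
    (γ := fun L => trem x ε (labIdx w L) j)
    (fun L => isDist_trem hε hε' (labIdx w L) j) (labOf j o.1 o.2.1 o.2.2.1)
    (fun t => if (j = 0 → t = o.1) ∧ (j = 1 → t = o.2.1) then 1 else 0)
    (fun f => if j = 0 → f o.1 o.2.1 = o.2.2.1 then 1 else 0)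
    (fun u => if u = o.2.2.2 j then 1 else 0)
  rw [labIdx_labOf] at h1
  have h2 : ∀ d : Data Γ l j, corrDist x w ε j d * (if Own j d o then 1 else 0) =
      1 / (l : ℝ) * revDist ε d.1.2 * (∏ L, trem x ε (labIdx w L) j (d.2 L)) *
      ((if (j = 0 → d.1.1 = o.1) ∧ (j = 1 → d.1.1 = o.2.1) then 1 else 0) *
        (if j = 0 → d.1.2 o.1 o.2.1 = o.2.2.1 then 1 else 0) *
        (if d.2 (labOf j o.1 o.2.1 o.2.2.1) = o.2.2.2 j then 1 else 0)) := fun d => by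
    rw [corrDist, ← ite_and_mul]
    congr 1
    refine if_congr ?_ rfl rfl
    exact ⟨fun h => ⟨⟨fun h0 => (h.1 h0).1, h.2.1⟩, fun h0 => (h.1 h0).2, h.2.2⟩,
      fun h => ⟨fun h0 => ⟨h.1.1 h0, h.2.1 h0⟩, h.1.2, h.2.2⟩⟩
  simp only [h2]
  rw [h1]
  have hl := natCast_pos_of_neZero l
  have h3 : ∑ u, trem x ε (recIdx w o.1 o.2.1 o.2.2.1) j u * (if u = o.2.2.2 j then (1 : ℝ) else 0) =
      trem x ε (recIdx w o.1 o.2.1 o.2.2.1) j (o.2.2.2 j) := by simp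
  rw [h3]
  congr 1
  by_cases h0 : j = 0
  · subst h0
    have h01 : ¬ (0 : ℙ) = 1 := by simp
    simp only [true_imp_iff, h01, false_imp_iff, and_true, sum_revDist_eq]
    simp [ownWeight]
  · by_cases h1 : j = 1
    · subst h1
      simp only [h0, false_imp_iff, true_and, if_true, mul_one, sum_revDist, true_imp_iff]
      simp [ownWeight]
    · simp only [h0, h1, false_imp_iff, true_and, if_true, mul_one, sum_revDist]
      simp [ownWeight, h0, h1]

/-- The expectation for the perturbed strategies. -/
lemma expOut_corrDist (hε : 0 ≤ ε) (hε' : ε ≤ 1) (F : Out Γ l → ℝ) :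
    expOut (corrDist x w ε) F = ∑ a, ∑ b, ∑ r, (1 / l * revProb ε r * (1 / l)) *
      ∑ u, Γ.profileProb (tremProfile x hε hε' (recIdx w a b r)) u * F (a, b, r, u) := by
  have h := expOut_of_own (fun j a b r => ownWeight (1 / l * revProb ε r) (1 / l) j)
    (fun a b r => tremProfile x hε hε' (recIdx w a b r))
    (fun j a b r u => corrDist_own (x := x) (w := w) hε hε' j (a, b, r, u)) F
  simpa only [prod_ownWeight] using h

/-- The pure strategy as a mixed strategy. -/
def pureStrat {k : ℕ} (u : Fin k) : ↥(stdSimplex ℝ (Fin k)) :=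
  ⟨fun v => if v = u then 1 else 0, (isDist_dirac u).1, (isDist_dirac u).2⟩

/-- The weight of the first player's choices when player `i` plays `t`. -/
def devWeight₀ (ε : ℝ) (t : Data Γ l i) (a b : Fin l) (r : Bool) : ℝ :=
  if i = 0 then (if t.1.1 = a ∧ t.1.2 a b = r then 1 else 0) else 1 / l * revProb ε r

/-- The weight of the second player's choice when player `i` plays `t`. -/
def devWeight₁ (t : Data Γ l i) (b : Fin l) : ℝ :=
  if i = 1 then (if t.1.1 = b then 1 else 0) else 1 / l

/-- The expectation when player `i` deviates from the perturbed strategies. -/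
lemma sum_corrDist_update (hε : 0 ≤ ε) (hε' : ε ≤ 1) (t : Data Γ l i) (F : Out Γ l → ℝ) :
    ∑ D, (∏ j, corrDist x w ε j (D j)) * F (outOf (update D i t)) =
      ∑ a, ∑ b, ∑ r, (devWeight₀ ε t a b r * devWeight₁ t b) *
        ∑ u, Γ.profileProb (update (tremProfile x hε hε' (recIdx w a b r)) i
          (pureStrat (t.2 (labOf i a b r)))) u * F (a, b, r, u) := by
  classical
  have h1 := sum_pi_update (i := i) (isDist_corrDist (x := x) (w := w) hε hε' i).2
    (fun t' => if t' = t then 1 else 0) (fun D => F (outOf D))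
  simp only [ite_mul, one_mul, zero_mul, sum_ite_eq', mem_univ, if_true] at h1
  rw [h1]
  have h2 := expOut_of_own (V := update (corrDist x w ε) i (fun t' => if t' = t then 1 else 0))
    (fun j a b r => ownWeight (devWeight₀ ε t a b r) (devWeight₁ t b) j)
    (fun a b r => update (tremProfile x hε hε' (recIdx w a b r)) i
          (pureStrat (t.2 (labOf i a b r)))) (fun j a b r u => by
      by_cases hj : j = i
      · subst hj
        simp only [update_self, ite_mul, one_mul, zero_mul, sum_ite_eq',
          mem_univ, if_true, Own, pureStrat]
        by_cases hu : t.2 (labOf j a b r) = u j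
        · by_cases h0 : j = 0
          · subst h0; simp [ownWeight, devWeight₀, hu]
          · by_cases h1 : j = 1
            · subst h1; simp [ownWeight, devWeight₁, hu]
            · simp [ownWeight, h0, h1, hu]
        · simp [hu, Ne.symm hu]
      · rw [update_of_ne hj, update_of_ne hj, corrDist_own hε hε']
        congr 1
        simp only [ownWeight, devWeight₀, devWeight₁]
        congr 1
        · by_cases h0 : j = 0
          · have : ¬ i = 0 := fun h => hj (h0.trans h.symm)
            simp [h0, this]
          · simp [h0]
        · by_cases h0 : j = 1
          · have : ¬ i = 1 := fun h => hj (h0.trans h.symm)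
            simp [h0, this]
          · simp [h0]) F
  rw [expOut] at h2
  rw [h2]
  simp only [prod_ownWeight]

end

/-! ## Deviations from the perturbed strategies do not pay -/

section

/-- The events that an information set of player `i` is reached, in terms of the first three
moves. -/
def CellEvent (i : ℙ) (E : Fin l → Fin l → Bool → Prop) : Prop :=
  ((i = 0 ∨ i = 1) ∧ E = fun _ _ _ => True) ∨ (i = 0 ∧ ∃ a b, E = fun a' b' _ => a' = a ∧ b' = b) ∨
    ∃ L, (∃ a b r, labOf i a b r = L) ∧ E = fun a b r => labOf i a b r = L

variable {x : Fin l → Γ.Profile} {w : Fin l} {ε : ℝ}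

lemma devWeight_nonneg (hε : 0 ≤ ε) (hε' : ε ≤ 1) (t : Data Γ l i)
    (a b : Fin l) (r : Bool) : 0 ≤ devWeight₀ ε t a b r * devWeight₁ t b := by
  have := revProb_nonneg hε hε' r
  refine mul_nonneg ?_ ?_
  · rw [devWeight₀]; split_ifs <;> positivity
  · rw [devWeight₁]; split_ifs <;> positivity

lemma expPayoff_recIdx_le (hw : ∀ e, Γ.expPayoff (x w) 0 ≤ Γ.expPayoff (x e) 0) (hε : 0 ≤ ε)
    (hε' : ε ≤ 1) (a b : Fin l) (r : Bool) : Γ.expPayoff (tremProfile x hε hε' (recIdx w a b r)) 0 ≤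
      (1 - ε) * Γ.expPayoff (tremProfile x hε hε' (a + b)) 0 +
        ε * Γ.expPayoff (tremProfile x hε hε' w) 0 + 2 * (ε * Γ.payBound) := by
  have hB := Γ.payBound_nonneg
  have h1 := abs_le.1 (Γ.abs_expPayoff_sub_le (tremProfile_sub_le (x := x) hε hε' w) hε 0)
  have h2 := abs_le.1 (Γ.abs_expPayoff_sub_le (tremProfile_sub_le (x := x) hε hε' (a + b)) hε 0)
  have h3 := abs_le.1 (Γ.abs_expPayoff_le (tremProfile x hε hε' w) 0)
  have h4 := abs_le.1 (Γ.abs_expPayoff_le (tremProfile x hε hε' (a + b)) 0)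
  have h5 := hw (a + b)
  cases r
  · simp only [recIdx, Bool.false_eq_true, if_false]
    nlinarith
  · simp only [recIdx, if_true]
    nlinarith

lemma sum_add_left (f : Fin l → ℝ) (a : Fin l) : ∑ b, f (a + b) = ∑ c, f c :=
  Equiv.sum_comp (Equiv.addLeft a) f

lemma sum_add_right (f : Fin l → ℝ) (b : Fin l) : ∑ a, f (a + b) = ∑ c, f c :=
  Equiv.sum_comp (Equiv.addRight b) f

lemma sum_ite_pair (f : Fin l → Fin l → ℝ) (a b : Fin l) :
    ∑ a', ∑ b', (if a' = a ∧ b' = b then f a' b' else 0) = f a b := by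
  rw [sum_eq_single a, sum_eq_single b]
  · simp
  · intro b' _ h; simp [h]
  · simp
  · intro a' _ h; simp [h]
  · simp

open Classical in
lemma corrDist_cell (hx : ∀ e, Γ.IsNash (x e))
    (hw : ∀ e, Γ.expPayoff (x w) 0 ≤ Γ.expPayoff (x e) 0) (hε : 0 < ε) (hε' : ε < 1) {E : Fin l → Fin l → Bool → Prop} (hE : CellEvent i E) :
    ∃ v, Unprofitable (corrDist x w ε) i E v (4 * (ε * Γ.payBound)) := by
  have hB := Γ.payBound_nonneg
  have hεB : 0 ≤ ε * Γ.payBound := mul_nonneg hε.le hB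
  have hl := natCast_pos_of_neZero l
  set Y : Fin l → Γ.Profile := tremProfile x hε.le hε'.le with hY
  set V : Fin l → ℝ := fun e => Γ.expPayoff (Y e) i with hV
  have hrp : ∀ r, 0 < revProb ε r := fun r => by cases r <;> simp [revProb] <;> linarith
  have hQ : ∀ r, 0 < 1 / l * revProb ε r * (1 / (l : ℝ)) := fun r => by have := hrp r; positivity
  have hP : expOut (corrDist x w ε) (fun o => if E o.1 o.2.1 o.2.2.1 then 1 else 0) =
      ∑ a, ∑ b, ∑ r, if E a b r then 1 / l * revProb ε r * (1 / (l : ℝ)) else 0 := by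
    rw [expOut_corrDist hε.le hε'.le]
    refine sum_congr rfl fun a _ => sum_congr rfl fun b _ => sum_congr rfl fun r _ => ?_
    by_cases h : E a b r
    · simp [h, Γ.sum_profileProb]
    · simp [h]
  have hN : expOut (corrDist x w ε) (fun o => if E o.1 o.2.1 o.2.2.1 then Γ.payoff o.2.2.2 i else 0) =
      ∑ a, ∑ b, ∑ r, if E a b r then 1 / l * revProb ε r * (1 / (l : ℝ)) * V (recIdx w a b r)
        else 0 := by
    rw [expOut_corrDist hε.le hε'.le]
    refine sum_congr rfl fun a _ => sum_congr rfl fun b _ => sum_congr rfl fun r _ => ?_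
    by_cases h : E a b r
    · simp only [h, if_true]; rfl
    · simp [h]
  have hpos : 0 < ∑ a, ∑ b, ∑ r, if E a b r then 1 / l * revProb ε r * (1 / (l : ℝ)) else 0 := by
    obtain ⟨a, b, r, h⟩ : ∃ a b r, E a b r := by
      rcases hE with ⟨_, rfl⟩ | ⟨_, a, b, rfl⟩ | ⟨L, ⟨a, b, r, h⟩, rfl⟩
      · exact ⟨0, 0, true, trivial⟩
      · exact ⟨a, b, true, rfl, rfl⟩
      · exact ⟨a, b, r, h⟩
    have h0 : ∀ a b r, 0 ≤ if E a b r then 1 / l * revProb ε r * (1 / (l : ℝ)) else 0 := by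
      intro a b r
      split_ifs
      exacts [(hQ r).le, le_rfl]
    have h1 := single_le_sum (f := fun r => if E a b r then 1 / l * revProb ε r * (1 / (l : ℝ))
      else 0) (fun r _ => h0 a b r) (mem_univ r)
    have h2 := single_le_sum (f := fun b => ∑ r, if E a b r then
      1 / l * revProb ε r * (1 / (l : ℝ)) else 0)
      (fun b _ => sum_nonneg fun r _ => h0 a b r) (mem_univ b)
    have h3 := single_le_sum (f := fun a => ∑ b, ∑ r, if E a b r then
      1 / l * revProb ε r * (1 / (l : ℝ)) else 0)
      (fun a _ => sum_nonneg fun b _ => sum_nonneg fun r _ => h0 a b r)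
      (mem_univ a)
    simp only [h, if_true] at h1
    exact (hQ r).trans_le (h1.trans (h2.trans h3))
  -- it suffices to compare the weights
  have hdev : ∀ v (t : Data Γ l i), ∑ a, ∑ b, ∑ r, (devWeight₀ ε t a b r * devWeight₁ t b) *
      (if E a b r then V (recIdx w a b r) - v - 2 * (ε * Γ.payBound) else 0) ≤ 0 →
      ∑ D, (∏ j, corrDist x w ε j (D j)) * (fun o : Out Γ l => if E o.1 o.2.1 o.2.2.1 then
          Γ.payoff o.2.2.2 i - v - 4 * (ε * Γ.payBound) else 0) (outOf (update D i t)) ≤ 0 := by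
    intro v t h
    refine (sum_corrDist_update hε.le hε'.le t (fun o : Out Γ l => if E o.1 o.2.1 o.2.2.1 then
      Γ.payoff o.2.2.2 i - v - 4 * (ε * Γ.payBound) else 0)).trans_le (le_trans ?_ h)
    refine sum_le_sum fun a _ => sum_le_sum fun b _ => sum_le_sum fun r _ =>
      mul_le_mul_of_nonneg_left ?_ (devWeight_nonneg hε.le hε'.le t a b r)
    by_cases hE' : E a b r
    · simp only [hE', if_true]
      have h1 := expPayoff_deviate_le hx hε.le hε'.le (recIdx w a b r) i
        (pureStrat (t.2 (labOf i a b r)))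
      set Z : Γ.Profile := update (tremProfile x hε.le hε'.le (recIdx w a b r)) i
          (pureStrat (t.2 (labOf i a b r)))
      have h2 : ∑ u, Γ.profileProb Z u * (Γ.payoff u i - v - 4 * (ε * Γ.payBound)) =
          Γ.expPayoff Z i - v - 4 * (ε * Γ.payBound) := by
        simp only [mul_sub, sum_sub_distrib, ← sum_mul, Γ.sum_profileProb, one_mul]
        rfl
      rw [h2]
      have h3 : Γ.expPayoff (tremProfile x hε.le hε'.le (recIdx w a b r)) i = V (recIdx w a b r) := rfl
      linarith
    · simp [hE']
  suffices h : ∃ v, _ ∧ _ ∧ _ from h.imp fun _ h => ⟨h.1, h.2.1, h.2.2⟩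
  rw [hP, hN]
  let z : Fin l → ℝ := fun c => (1 - ε) * V c + ε * V w
  have hz : ∀ a b, ∑ r, 1 / l * revProb ε r * (1 / (l : ℝ)) * V (recIdx w a b r) =
      1 / l * (1 / l) * z (a + b) := fun a b => by
    simp [revProb, recIdx, z]
    ring
  have hrsum : ∑ r, 1 / l * revProb ε r * (1 / (l : ℝ)) = 1 / l * (1 / l) := by
    simp [revProb]
    ring
  rcases hE with ⟨hi, rfl⟩ | ⟨rfl, a₀, b₀, rfl⟩ | ⟨L, -, rfl⟩
  · refine ⟨1 / l * ∑ c, z c, hpos, ?_, fun t => hdev _ t ?_⟩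
    · simp only [if_true, hz, hrsum, ← mul_sum, sum_add_left]
      simp only [sum_const, card_univ, card_fin, nsmul_eq_mul]
      field_simp
    · simp only [if_true]
      rcases hi with rfl | rfl
      · have h01 : ¬ (0 : ℙ) = 1 := by simp
        have h1 : ∀ a b r, devWeight₀ ε t a b r * devWeight₁ t b *
            (V (recIdx w a b r) - 1 / l * ∑ c, z c - 2 * (ε * Γ.payBound)) ≤
            (if t.1.1 = a ∧ t.1.2 a b = r then 1 else 0) * (1 / l * (z (a + b) - 1 / l * ∑ c, z c)) := by
          intro a b r
          have h2 : devWeight₀ ε t a b r * devWeight₁ t b =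
            (if t.1.1 = a ∧ t.1.2 a b = r then 1 else 0) * (1 / l) := by
            simp [devWeight₀, devWeight₁]
          rw [h2, mul_assoc]
          refine mul_le_mul_of_nonneg_left (mul_le_mul_of_nonneg_left ?_ (by positivity))
            (by positivity)
          have := expPayoff_recIdx_le hw hε.le hε'.le a b r
          simp only [V, z]
          linarith
        refine (sum_le_sum fun a _ => sum_le_sum fun b _ => sum_le_sum fun r _ =>
          h1 a b r).trans (le_of_eq ?_)
        have h3 : ∀ a b, ∑ r, (if t.1.1 = a ∧ t.1.2 a b = r then (1 : ℝ) else 0) *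
            (1 / l * (z (a + b) - 1 / l * ∑ c, z c)) =
            if t.1.1 = a then 1 / l * (z (a + b) - 1 / l * ∑ c, z c) else 0 := fun a b => by
          by_cases h : t.1.1 = a <;> simp [h]
        simp only [h3]
        rw [sum_eq_single t.1.1 (fun a _ h => by simp [h.symm]) (by simp)]
        simp only [if_true, ← mul_sum, sum_sub_distrib, sum_add_left]
        simp only [sum_const, card_univ, card_fin, nsmul_eq_mul]
        rw [← mul_assoc, one_div_mul_cancel hl.ne', one_mul, sub_self, mul_zero]
      · have h10 : ¬ (1 : ℙ) = 0 := by simp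
        simp only [devWeight₀, devWeight₁, h10, if_false, if_true]
        have h3 : ∀ a b, ∑ r, 1 / (l : ℝ) * revProb ε r * (if t.1.1 = b then 1 else 0) *
            (V (recIdx w a b r) - 1 / l * ∑ c, z c - 2 * (ε * Γ.payBound)) ≤
            if b = t.1.1 then 1 / l * (z (a + b) - 1 / l * ∑ c, z c) else 0 := fun a b => by
          by_cases h : b = t.1.1
          · subst h
            simp [revProb, recIdx, z]
            have : 0 ≤ (l : ℝ)⁻¹ * (2 * (ε * Γ.payBound)) := by positivity
            nlinarith
          · simp [h, Ne.symm h]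
        refine (sum_le_sum fun a _ => sum_le_sum fun b _ => h3 a b).trans (le_of_eq ?_)
        simp only [sum_ite_eq', mem_univ, if_true, ← mul_sum, sum_sub_distrib, sum_add_right]
        simp only [sum_const, card_univ, card_fin, nsmul_eq_mul]
        rw [← mul_assoc, one_div_mul_cancel hl.ne', one_mul, sub_self, mul_zero]
  · refine ⟨z (a₀ + b₀), hpos, ?_, fun t => hdev _ t ?_⟩
    · refine (sum_congr rfl fun a _ => sum_congr rfl fun b _ => ?_).trans
        ((sum_ite_pair (fun a b => 1 / (l : ℝ) * (1 / l) * z (a + b)) a₀ b₀).trans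
        ((mul_comm _ _).trans (congrArg (z (a₀ + b₀) * ·) (Eq.symm ((sum_congr rfl fun a _ =>
          sum_congr rfl fun b _ => ?_).trans
        (sum_ite_pair (fun _ _ => 1 / (l : ℝ) * (1 / l)) a₀ b₀))))))
      · split_ifs
        exacts [hz a b, by simp]
      · split_ifs
        exacts [hrsum, by simp]
    · refine sum_nonpos fun a _ => sum_nonpos fun b _ => sum_nonpos fun r _ =>
        mul_nonpos_of_nonneg_of_nonpos (devWeight_nonneg hε.le hε'.le t a b r) ?_
      split_ifs with h
      · have := expPayoff_recIdx_le hw hε.le hε'.le a b r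
        rw [← h.1, ← h.2]
        simp only [V, z]
        linarith
      · exact le_rfl
  · have hrec : ∀ a b r, labOf i a b r = L → recIdx w a b r = labIdx w L := fun a b r h => by
      rw [← h, labIdx_labOf]
    refine ⟨V (labIdx w L), hpos, ?_, fun t => hdev _ t ?_⟩
    · simp only [mul_sum]
      refine sum_congr rfl fun a _ => sum_congr rfl fun b _ => sum_congr rfl fun r _ => ?_
      split_ifs with h
      · rw [hrec a b r h]; ring
      · simp
    · refine sum_nonpos fun a _ => sum_nonpos fun b _ => sum_nonpos fun r _ =>
        mul_nonpos_of_nonneg_of_nonpos (devWeight_nonneg hε.le hε'.le t a b r) ?_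
      split_ifs with h
      · rw [hrec a b r h]; linarith
      · exact le_rfl

end

/-! ## Switching strategies at an information set -/

section

variable {Act : Type} {I : Set (List Act)} {lev T : ℕ}

lemma visits_histOf (hI : ∀ h ∈ I, h.length = lev) (hT : lev ≤ T) (p : List Act → Act) :
    Visits I (histOf p T) ↔ histOf p lev ∈ I := by
  constructor
  · rintro ⟨h, hh, hp⟩
    rw [prefix_histOf_iff, hI h hh] at hp
    rwa [← hp.2]
  · exact fun h => ⟨_, h, histOf_prefix p hT⟩

lemma visits_iff (hI : ∀ h ∈ I, h.length = lev) {H : List Act} (hT : lev ≤ H.length) :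
    Visits I H ↔ H.take lev ∈ I := by
  constructor
  · rintro ⟨h, hh, hp⟩
    rwa [← hI h hh, ← List.prefix_iff_eq_take.1 hp]
  · exact fun h => ⟨_, h, List.take_prefix _ _⟩

open Classical in
lemma histOf_switch {p q sw sp : List Act → Act} (hI : ∀ h ∈ I, h.length = lev) (hT : lev ≤ T)
    (hsw : ∀ h, sw h = if ∃ h' ∈ I, h' <+: h then q h else p h)
    (hsp : ∀ h, sp h = if h.length < lev then p h else q h) :
    (Visits I (histOf sw T) ↔ Visits I (histOf p T)) ∧
      (Visits I (histOf sp T) ↔ Visits I (histOf p T)) ∧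
      (Visits I (histOf p T) → histOf sw T = histOf sp T) := by
  have h1 : histOf p lev = histOf sw lev := histOf_congr fun t ht => by
    rw [hsw, if_neg]
    rintro ⟨h', hh, hp⟩
    have := hp.length_le
    rw [hI h' hh, length_histOf] at this
    omega
  have h2 : histOf p lev = histOf sp lev := histOf_congr fun t ht => by
    rw [hsp, if_pos (by rwa [length_histOf])]
  rw [visits_histOf hI hT, visits_histOf hI hT, visits_histOf hI hT, ← h1, ← h2]
  refine ⟨Iff.rfl, Iff.rfl, fun hv => histOf_congr fun t ht => ?_⟩
  rw [h1] at hv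
  rcases Nat.lt_or_ge t lev with h | h
  · rw [hsp, if_pos (by rwa [length_histOf]), hsw, if_neg]
    rintro ⟨h', hh, hp⟩
    have := hp.length_le
    rw [hI h' hh, length_histOf] at this
    omega
  · rw [hsp, if_neg (by rw [length_histOf]; omega), hsw, if_pos ⟨_, hv, histOf_prefix sw h⟩]

end

lemma sum_pi_resample {ι : Type} [Fintype ι] [DecidableEq ι] {X : ι → Type} [∀ i, Fintype (X i)]
    {w : ∀ i, X i → ℝ} {i : ι} (hw : ∑ x, w i x = 1) (h : X i → (∀ i, X i) → ℝ)
    (hh : ∀ d x z, h d (update x i z) = h d x) : ∑ x : ∀ i, X i, (∏ j, w j (x j)) * h (x i) x =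
      ∑ d, w i d * ∑ x : ∀ i, X i, (∏ j, w j (x j)) * h d x := by
  have h1 := sum_pi_update hw (w i) (fun x => h (x i) x)
  rw [update_eq_self] at h1
  simp only [update_self, hh] at h1
  rw [← h1]
  simp only [mul_sum]
  rw [sum_comm]
  exact sum_congr rfl fun d _ => sum_congr rfl fun x _ => by ring

lemma labInfo_injective : Injective (labInfo (l := l) i) := by
  rintro ⟨oa, b, r⟩ ⟨oa', b', r'⟩ h
  simp only [labInfo, List.cons.injEq, Option.some.injEq, pick.injEq] at h
  obtain ⟨ha, hb, hr, -⟩ := h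
  rw [revAct_injective hr, Fin.ext hb]
  cases oa <;> cases oa' <;> simp at ha ⊢
  exact Fin.ext ha

/-- An information set is reached if and only if an event about the first three moves happens. -/
lemma exists_cellEvent (I : ✉.InfoSet i) :
    ∃ (lev : ℕ) (E : Fin l → Fin l → Bool → Prop), lev < m + 5 ∧ corrMover m lev = i ∧ CellEvent i E ∧
      (∀ h ∈ ✉.cell I, h.length = lev) ∧
      ∀ o : Out Γ l, (mkHist o).take lev ∈ ✉.cell I ↔ E o.1 o.2.1 o.2.2.1 := by
  obtain ⟨J, h₀, ht, rfl⟩ := I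
  have hN' := corrGame_NT.1 ht.1
  obtain ⟨o₀, ho⟩ := exists_mkHist hN'.1
  obtain ⟨C, hC⟩ : ∃ C, C = ✉.cell ⟨_, h₀, ht, rfl⟩ := ⟨_, rfl⟩
  have hi : corrMover m h₀.length = i := ht.2
  have hlen : ∀ h ∈ C, h.length = h₀.length := by
    rw [hC]
    rintro h ⟨-, he⟩
    have := congrArg List.length (show corrObs m h = corrObs m h₀ from he)
    simpa [corrObs] using this
  have hiff : ∀ o : Out Γ l, (mkHist o).take h₀.length ∈ C ↔
      corrObs m ((mkHist o).take h₀.length) = corrObs m ((mkHist o₀).take h₀.length) := fun o => by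
    have h1 := mkHist_take_turns o hN'.2
    rw [hi] at h1
    rw [← ho, hC]
    exact ⟨fun h => h.2, fun h => ⟨h1, h⟩⟩
  have hN2 := hN'.2
  rw [← hC]
  clear hC ho hN' ht
  generalize h₀.length = lev at *
  refine ⟨lev, ?_⟩
  obtain ⟨a₀, b₀, r₀, u₀⟩ := o₀
  rcases lev with _ | _ | _ | t
  · exact ⟨_, hN2, hi, Or.inl ⟨Or.inl hi.symm, rfl⟩, hlen, fun o => by rw [hiff]; simp⟩
  · refine ⟨_, hN2, hi, Or.inl ⟨Or.inr hi.symm, rfl⟩, hlen, fun o => ?_⟩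
    rw [hiff, iff_true]
    exact (corrObs_one m _).trans (corrObs_one m _).symm
  · refine ⟨_, hN2, hi, Or.inr (Or.inl ⟨hi.symm, a₀, b₀, rfl⟩), hlen, fun o => ?_⟩
    rw [hiff]
    have h1 : ∀ o : Out Γ l, corrObs m ((mkHist o).take 2) = _ := fun o => corrObs_two m o.1 o.2.1
    rw [h1, h1]
    simp [Fin.ext_iff]
  · subst hi
    refine ⟨_, hN2, rfl, Or.inr (Or.inr ⟨labOf (gOrder m t) a₀ b₀ r₀, ⟨a₀, b₀, r₀, rfl⟩, rfl⟩), hlen,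
      fun o => ?_⟩
    rw [hiff, corrObs_mkHist_take _ (by omega), corrObs_mkHist_take _ (by omega),
      labInfo_injective.eq_iff]
    rfl

/-- The action of a profile of deterministic strategies. -/
def polDet (s : ∀ i, ✉.Det i) (h : List CorrAct) : CorrAct :=
  detAct (s (corrMover m h.length)) (corrObs m h)

lemma follow_eq_polDet (s : ∀ i, ✉.Det i) (h : List CorrAct) (hh) :
    ✉.follow s h hh = polDet s h := by
  have he : ∃ h' ∈ ✉.turns (✉.mover h), ✉.info h' = corrObs m h := ⟨h, ⟨hh, rfl⟩, rfl⟩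
  change _ = detAct (s (✉.mover h)) (corrObs m h)
  rw [detAct, dif_pos he]
  rfl

lemma outcome_eq_histOf {pol : ∀ h, ✉.NT h → CorrAct} {p : List CorrAct → CorrAct}
    (hpol : ∀ h hh, pol h hh = p h) (hp : ∀ h, ∃ s : ∀ i, ✉.Det i, p h = polDet s h) :
    ✉.outcome pol = histOf p (m + 5) :=
  stageGame_outcome (fun t _ => corrActions_nonempty t) hpol fun h hh => by
    obtain ⟨s, hs⟩ := hp h
    rw [hs]
    exact detAct_mem (s _) ⟨hh, rfl⟩

open Classical in
/-- The strategy that follows `s` before stage `lev` and `t` from then on. -/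
def spliceDet (lev : ℕ) (s t : ✉.Det i) : ✉.Det i := fun I => if I.1.length < lev then s I else t I

lemma polDet_update_splice (lev : ℕ) (s : ∀ i, ✉.Det i) (t : ✉.Det i) (h : List CorrAct) :
    polDet (update s i (spliceDet lev (s i) t)) h =
      if h.length < lev then polDet s h else polDet (update s i t) h := by
  have hl : (corrObs m h).length = h.length := by simp [corrObs]
  simp only [polDet]
  generalize corrMover m h.length = j
  by_cases hj : j = i
  · subst hj
    simp only [update_self, detAct]
    by_cases he : ∃ h' ∈ ✉.turns j, ✉.info h' = corrObs m h
    · simp only [dif_pos he, spliceDet, hl]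
      split_ifs <;> rfl
    · simp only [dif_neg he, ite_self]
  · simp only [update_of_ne hj, ite_self]

lemma outcome_followSwitch {lev : ℕ} (hlev : lev ≤ m + 5) {I : Set (List CorrAct)}
    (hI : ∀ h ∈ I, h.length = lev) (s : ∀ i, ✉.Det i) (t : ✉.Det i) :
    (Visits I (✉.outcome (✉.followSwitch s i I t)) ↔ Visits I (✉.outcome (✉.follow s))) ∧
    (Visits I (✉.outcome
        (✉.follow (update s i (spliceDet lev (s i) t)))) ↔ Visits I (✉.outcome (✉.follow s))) ∧
    (Visits I (✉.outcome (✉.follow s)) → ✉.outcome (✉.followSwitch s i I t) =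
        ✉.outcome (✉.follow (update s i (spliceDet lev (s i) t)))) := by
  classical
  rw [outcome_eq_histOf (follow_eq_polDet s) (fun h => ⟨s, rfl⟩),
    outcome_eq_histOf (follow_eq_polDet _) (fun h => ⟨_, rfl⟩),
    outcome_eq_histOf (p := fun h => if ∃ h' ∈ I, h' <+: h then polDet (update s i t) h
      else polDet s h)]
  · exact histOf_switch hI hlev (fun h => rfl) (polDet_update_splice lev s t)
  · intro h hh
    rw [ExtGame.followSwitch, follow_eq_polDet]
    split_ifs <;> rfl
  · intro h
    by_cases h1 : ∃ h' ∈ I, h' <+: h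
    · exact ⟨_, if_pos h1⟩
    · exact ⟨_, if_neg h1⟩

lemma toData_update (s : ∀ i, ✉.Det i) (t : ✉.Det i) : (fun j => toData (update s i t j)) =
      update (fun j => toData (s j)) i (toData t) := by
  funext j
  by_cases h : j = i
  · subst h; simp
  · simp [h]

open Classical in
/-- If no pure strategy is profitable given that an information set is reached, then switching
there does not pay. -/
lemma condExpect_followSwitch_le (σ : ∀ i, ✉.Mixed i)
    (I : ✉.InfoSet i) {lev : ℕ} {E : Fin l → Fin l → Bool → Prop} (hlev : lev ≤ m + 5)
    (hI : ∀ h ∈ ✉.cell I, h.length = lev)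
    (hE : ∀ o : Out Γ l, (mkHist o).take lev ∈ ✉.cell I ↔ E o.1 o.2.1 o.2.2.1)
    {v δ : ℝ} (h : Unprofitable (fun j => lawData (σ j)) i E v δ) (τ : ✉.Mixed i) :
    condExpect (fun x : (∀ j, ✉.Det j) × ✉.Det i => ✉.weight σ x.1 * τ.1 x.2)
        (fun x => Visits (✉.cell I) (✉.outcome (✉.followSwitch x.1 i (✉.cell I) x.2)))
        (fun x => ✉.util
          (✉.outcome (✉.followSwitch x.1 i (✉.cell I) x.2)) i) ≤ condExpect (✉.weight σ)
        (fun s => Visits (✉.cell I) (✉.outcome (✉.follow s)))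
        (fun s => ✉.util (✉.outcome (✉.follow s)) i) + δ := by
  obtain ⟨hpos, hv, hdev⟩ := h
  have hvis : ∀ o : Out Γ l, Visits (✉.cell I) (mkHist o) ↔ E o.1 o.2.1 o.2.2.1 := fun o => by
    rw [visits_iff hI (by rwa [length_mkHist]), hE]
  set Eo : Out Γ l → Prop := fun o => E o.1 o.2.1 o.2.2.1 with hEo
  set W := ✉.weight σ with hW
  set P := expOut (fun j => lawData (σ j)) (fun o => if Eo o then 1 else 0) with hP
  have hP' : P = ∑ s, if Eo (outOf fun j => toData (s j)) then W s else 0 := by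
    rw [hP, expOut, ← sum_weight]
    exact sum_congr rfl fun s _ => by simp [hW]
  have hrhs : condExpect W (fun s => Visits (✉.cell I) (✉.outcome (✉.follow s)))
      (fun s => ✉.util (✉.outcome (✉.follow s)) i) = v := by
    simp only [condExpect, outcome_follow, corrGame_util, hvis]
    rw [← hP', div_eq_iff hpos.ne', ← hv, expOut, ← sum_weight]
    exact sum_congr rfl fun s _ => by simp [hW]
  rw [hrhs]
  have hsp := fun s t => outcome_followSwitch (l := l) (Γ := Γ) (i := i) hlev hI s t
  simp only [outcome_follow, hvis, toData_update] at hsp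
  let Q : (∀ j, ✉.Det j) → ✉.Det i → List CorrAct := fun s t =>
    ✉.outcome (✉.followSwitch s i (✉.cell I) t)
  let O : (∀ j, ✉.Det j) → ✉.Det i → Out Γ l := fun s t => outOf
    (update (fun j => toData (s j)) i (toData (spliceDet lev (s i) t)))
  have hnum : ∀ f : List CorrAct → ℝ, ∑ x : (∀ j, ✉.Det j) × ✉.Det i,
      (if Visits (✉.cell I) (Q x.1 x.2) then W x.1 * τ.1 x.2 * f (Q x.1 x.2) else 0) =
      ∑ t, τ.1 t * ∑ s, W s * (if Eo (O s t) then f (mkHist (O s t)) else 0) := fun f => by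
    rw [sum_prod_type, sum_comm]
    refine sum_congr rfl fun t _ => ?_
    rw [mul_sum]
    refine sum_congr rfl fun s _ => ?_
    obtain ⟨h1, h2, h3⟩ := hsp s t
    by_cases h : Eo (outOf fun j => toData (s j))
    · have hb : Eo (O s t) := h2.2 h
      rw [if_pos (h1.2 h), show Q (s, t).1 (s, t).2 = mkHist (O s t) from h3 h, if_pos hb]
      ring
    · have hb : ¬ Eo (O s t) := fun h' => h (h2.1 h')
      rw [if_neg fun h' => h (h1.1 h'), if_neg hb, mul_zero, mul_zero]
  have hden : ∑ x : (∀ j, ✉.Det j) × ✉.Det i, (if Visits (✉.cell I) (Q x.1 x.2) then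
      W x.1 * τ.1 x.2 else 0) = P := by
    rw [sum_prod_type, hP']
    refine sum_congr rfl fun s _ => ?_
    have h1 : ∀ t, Visits (✉.cell I) (Q s t) ↔ Eo (outOf fun j => toData (s j)) :=
      fun t => (hsp s t).1
    simp only [h1]
    split_ifs
    · rw [← mul_sum, τ.2.2, mul_one]
    · simp
  rw [condExpect, hden, div_le_iff₀ hpos, ← sub_nonpos]
  have hden' := hnum (fun _ => v + δ)
  have hsum : (v + δ) * P = ∑ t, τ.1 t * ∑ s, W s * (if Eo (O s t) then v + δ else 0) := by
    rw [← hden', ← hden, mul_sum]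
    refine sum_congr rfl fun x _ => ?_
    split_ifs <;> ring
  rw [hnum (fun h => ✉.util h i), hsum, ← sum_sub_distrib]
  refine sum_nonpos fun t _ => ?_
  rw [← mul_sub, ← sum_sub_distrib]
  refine mul_nonpos_of_nonneg_of_nonpos (τ.2.1 t) ?_
  let F : Out Γ l → ℝ := fun o => if Eo o then Γ.payoff o.2.2.2 i - v - δ else 0
  have h1 : ∀ s, W s * (if Eo (O s t) then ✉.util (mkHist (O s t)) i else 0) -
      W s * (if Eo (O s t) then v + δ else 0) = W s * F (O s t) := fun s => by
    simp only [F, corrGame_util]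
    split_ifs <;> ring
  simp only [h1]
  have h2 := sum_pi_resample (w := fun j => (σ j).1) (i := i) (σ i).2.2
    (fun d s => F (outOf (update (fun j => toData (s j)) i (toData (spliceDet lev d t)))))
    (fun d s z => by rw [toData_update, Function.update_idem])
  refine h2.trans_le (sum_nonpos fun d _ => mul_nonpos_of_nonneg_of_nonpos ((σ i).2.1 d) ?_)
  have h3 := sum_weight σ (fun D => F (outOf (update D i (toData (spliceDet lev d t)))))
  exact h3.trans_le (hdev _)

/-! ## The sequential equilibrium -/

/-- The probability of trembles. -/
def tremble (l k : ℕ) : ℝ := 1 / ((l * l + card (Lab l) + 2 : ℕ) * 2 ^ k)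

lemma tremble_spec (l k : ℕ) : 0 < tremble l k ∧ tremble l k < 1 ∧ tremble l k ≤ 1 / 2 ^ k ∧
    1 - 1 / 2 ^ k ≤ (1 - tremble l k) ^ (l * l + card (Lab l)) := by
  have hp : (1 : ℝ) ≤ 2 ^ k := one_le_pow₀ (by norm_num)
  have hK : (2 : ℝ) ≤ (l * l + card (Lab l) + 2 : ℕ) := by exact_mod_cast Nat.le_add_left _ _
  have h0 : 0 < tremble l k := by rw [tremble]; positivity
  have h1 : tremble l k < 1 := by
    rw [tremble, div_lt_one (by positivity)]
    nlinarith
  refine ⟨h0, h1, one_div_le_one_div_of_le (by positivity) (by nlinarith), ?_⟩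
  have hb := one_add_mul_le_pow (a := -tremble l k) (by linarith) (l * l + card (Lab l))
  rw [← sub_eq_add_neg] at hb
  refine le_trans ?_ hb
  have : ((l * l + card (Lab l) : ℕ) : ℝ) * tremble l k ≤ 1 / 2 ^ k := by
    rw [tremble, ← div_eq_mul_one_div, div_le_div_iff₀ (by positivity) (by positivity), one_mul]
    refine mul_le_mul_of_nonneg_right ?_ (by positivity)
    exact_mod_cast Nat.le_add_right _ _
  linarith

variable (l) in
lemma tendsto_tremble : Tendsto (tremble l) atTop (𝓝 0) :=
  squeeze_zero (fun k => (tremble_spec l k).1.le) (fun k => (tremble_spec l k).2.2.1)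
    (by simpa [Function.comp_def] using tendsto_inv_atTop_zero.comp (tendsto_pow_atTop_atTop_of_one_lt (one_lt_two (α := ℝ))))

section

variable {x : Fin l → Γ.Profile} {w : Fin l} {ε : ℝ} {hε : 0 ≤ ε ∧ ε ≤ 1}

/-- The perturbed strategies as mixed strategies. -/
def corrMixed (x : Fin l → Γ.Profile) (w : Fin l) {ε : ℝ} (hε : 0 ≤ ε ∧ ε ≤ 1) (j : ℙ) :
    ✉.Mixed j := mixedOf (corrDist x w ε j) (isDist_corrDist hε.1 hε.2 j)

lemma zero_mem_unit : (0 : ℝ) ≤ 0 ∧ (0 : ℝ) ≤ 1 := ⟨le_rfl, zero_le_one⟩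

lemma tremble_mem_unit (l k : ℕ) : 0 ≤ tremble l k ∧ tremble l k ≤ 1 :=
  ⟨(tremble_spec l k).1.le, (tremble_spec l k).2.1.le⟩

lemma expOut_corrMixed (F : Out Γ l → ℝ) :
    expOut (fun j => lawData (corrMixed x w hε j)) F = expOut (corrDist x w ε) F :=
  expOut_mixedOf (fun j => isDist_corrDist hε.1 hε.2 j) F

lemma sum_corrMixed_update (t : Data Γ l i) (F : Out Γ l → ℝ) :
    ∑ D, (∏ j, lawData (corrMixed x w hε j) (D j)) * F (outOf (update D i t)) =
      ∑ D, (∏ j, corrDist x w ε j (D j)) * F (outOf (update D i t)) := by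
  rw [← sum_weight _ (fun D => F (outOf (update D i t)))]
  refine (sum_pi_push (fun _ => ofData (Γ := Γ) (l := l)) (corrDist x w ε)
    (fun s => F (outOf (update (fun j => toData (s j)) i t)))).trans ?_
  refine sum_congr rfl fun D _ => ?_
  congr 2
  refine outOf_congr fun j => ?_
  by_cases h : j = i
  · subst h
    rw [update_self, update_self]
    exact ⟨fun _ => rfl, fun _ => rfl, fun _ _ _ => rfl⟩
  · rw [update_of_ne h, update_of_ne h]
    exact agree_toData_ofData (D j)

open Classical in
lemma corrMixed_cell (hx : ∀ e, Γ.IsNash (x e)) (hw : ∀ e, Γ.expPayoff (x w) 0 ≤ Γ.expPayoff (x e) 0)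
    (h0 : 0 < ε) (h1 : ε < 1) {E : Fin l → Fin l → Bool → Prop}
    (hE : CellEvent i E) : ∃ v, Unprofitable (fun j => lawData (corrMixed x w hε j)) i E v
      (4 * (ε * Γ.payBound)) := by
  obtain ⟨v, h2, h3, h4⟩ := corrDist_cell hx hw h0 h1 hE
  exact ⟨v, by rwa [expOut_corrMixed], by rwa [expOut_corrMixed, expOut_corrMixed],
    fun t => (sum_corrMixed_update t fun o : Out Γ l => if E o.1 o.2.1 o.2.2.1 then
      Γ.payoff o.2.2.2 i - v - 4 * (ε * Γ.payBound) else 0).trans_le (h4 t)⟩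

lemma corrDist_pos (h0 : 0 < ε) (h1 : ε < 1) (j : ℙ) (D : Data Γ l j) : 0 < corrDist x w ε j D := by
  have hl := natCast_pos_of_neZero l
  have hr : ∀ r, 0 < revProb ε r := fun r => by cases r <;> simp [revProb] <;> linarith
  refine mul_pos (mul_pos (by positivity) (Finset.prod_pos fun a _ => Finset.prod_pos fun b _ => hr _))
    (Finset.prod_pos fun L _ => ?_)
  have := natCast_size_pos (Γ := Γ) j
  exact add_pos_of_nonneg_of_pos (mul_nonneg (by linarith) ((x _ j).2.1 _)) (by positivity)

lemma exists_outOf (o : Out Γ l) : ∃ D : ∀ j, Data Γ l j, outOf D = o :=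
  ⟨fun j => ((if j = 0 then o.1 else o.2.1, fun _ _ => o.2.2.1), fun _ => o.2.2.2 j), by simp [outOf]⟩

lemma corrMixed_rho_pos (h0 : 0 < ε) (h1 : ε < 1) {h : List CorrAct}
    (hh : ✉.Terminal h) : 0 < ✉.rho (corrMixed x w hε) h := by
  classical
  obtain ⟨o, rfl⟩ := corrGame_terminal.1 hh
  obtain ⟨D, hD⟩ := exists_outOf o
  have hp := fun (D : ∀ j, Data Γ l j) => Finset.prod_pos (s := Finset.univ)
    (fun j _ => corrDist_pos (x := x) (w := w) h0 h1 j (D j))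
  rw [rho_mkHist, expOut_corrMixed, expOut]
  refine Finset.sum_pos' (fun D _ => mul_nonneg (hp D).le ?_) ⟨D, mem_univ D, ?_⟩
  · split_ifs
    exacts [zero_le_one, le_rfl]
  · rw [if_pos hD, mul_one]
    exact hp D

lemma seqEquilibrium_corrMixed (hx : ∀ e, Γ.IsNash (x e))
    (hw : ∀ e, Γ.expPayoff (x w) 0 ≤ Γ.expPayoff (x e) 0) :
    ✉.SeqEquilibrium (corrMixed x w zero_mem_unit) := by
  classical
  have hB := Γ.payBound_nonneg
  refine ⟨fun k => corrMixed x w (tremble_mem_unit l k), fun k => 4 * (tremble l k * Γ.payBound),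
    fun k => ?_, ?_, fun k h hh => corrMixed_rho_pos (tremble_spec l k).1 (tremble_spec l k).2.1 hh,
    fun i s => ?_, fun k i I τ => ?_⟩
  · have := (tremble_spec l k).1
    positivity
  · simpa using ((tendsto_tremble l).mul_const Γ.payBound).const_mul 4
  · have hc : Continuous fun ε => push ofData (corrDist x w ε i) s := by
      refine continuous_finsetSum _ fun D _ => ?_
      have hr : ∀ r, Continuous fun ε => revProb ε r := fun r => by cases r <;> simp [revProb] <;> fun_prop
      have h1 : Continuous fun ε => corrDist x w ε i D := by
        refine (continuous_const.mul (continuous_finsetProd _ fun a _ =>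
          continuous_finsetProd _ fun b _ => hr _)).mul (continuous_finsetProd _ fun L _ => ?_)
        unfold trem
        fun_prop
      split_ifs
      exacts [h1, continuous_const]
    exact (hc.tendsto 0).comp (tendsto_tremble l)
  · obtain ⟨lev, E, hlev, -, hcell, hlen, hE⟩ := exists_cellEvent I
    obtain ⟨v, hv⟩ := corrMixed_cell (hε := tremble_mem_unit l k) hx hw
      (tremble_spec l k).1 (tremble_spec l k).2.1 hcell
    exact condExpect_followSwitch_le _ I hlev.le hlen hE hv τ

/-! ### Rational probabilities -/

lemma polyTimeReal_of_dist {ι : Type} [Fintype ι] {W : ι → ℝ} (h : IsDist W)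
    (hq : ∀ y, W y ∈ (algebraMap ℚ ℝ).fieldRange) (y : ι) : PolyTimeReal (W y) := by
  obtain ⟨q, hq⟩ := hq y
  have h0 := h.1 y
  have h1 := h.le_one y
  change (q : ℝ) = _ at hq
  rw [← hq] at h0 h1 ⊢
  exact polyTimeReal_rat q (by exact_mod_cast h0) (by exact_mod_cast h1)

lemma corrMixed_rational (hx : ∀ e j u, (x e j).1 u ∈ (algebraMap ℚ ℝ).fieldRange)
    (hq : ε ∈ (algebraMap ℚ ℝ).fieldRange) (j : ℙ) (s : ✉.Det j) :
    (corrMixed x w hε j).1 s ∈ (algebraMap ℚ ℝ).fieldRange := by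
  have hn : ∀ k : ℕ, 1 / (k : ℝ) ∈ (algebraMap ℚ ℝ).fieldRange := fun k =>
    div_mem (one_mem _) (natCast_mem _ k)
  refine sum_mem fun D _ => ?_
  split_ifs
  · refine mul_mem (mul_mem (hn l) (prod_mem fun a _ => prod_mem fun b _ => ?_)) (prod_mem fun L _ =>
      add_mem (mul_mem (sub_mem (one_mem _) hq) (hx _ _ _)) (mul_mem hq (hn _)))
    rw [revProb]
    split_ifs
    exacts [sub_mem (one_mem _) hq, hq]
  · exact zero_mem _

lemma tremble_rational (l k : ℕ) : tremble l k ∈ (algebraMap ℚ ℝ).fieldRange :=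
  div_mem (one_mem _) (mul_mem (natCast_mem _ _) (pow_mem (ofNat_mem _ 2) _))

lemma corrDist_le (h0 : 0 ≤ ε) (h1 : ε ≤ 1) (j : ℙ) (D : Data Γ l j) :
    (1 - ε) ^ (l * l + card (Lab l)) * corrDist x w 0 j D ≤ corrDist x w ε j D := by
  have hε : 0 ≤ 1 - ε := by linarith
  have hr : ∀ r, (1 - ε) * revProb 0 r ≤ revProb ε r := fun r => by cases r <;> simp [revProb, h0]
  have hr0 : ∀ r, 0 ≤ revProb 0 r := revProb_nonneg le_rfl zero_le_one
  have ht0 := fun L => (isDist_trem (x := x) le_rfl zero_le_one (labIdx w L) j).1 (D.2 L)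
  have h2 : (1 - ε) ^ (l * l) * revDist 0 D.1.2 ≤ revDist ε D.1.2 := by
    have : (1 - ε) ^ (l * l) * revDist 0 D.1.2 = ∏ a, ∏ b, (1 - ε) * revProb 0 (D.1.2 a b) := by
      simp [revDist, prod_mul_distrib, pow_mul]
    rw [this]
    exact Finset.prod_le_prod (fun a _ => prod_nonneg fun b _ => mul_nonneg hε (hr0 _))
      fun a _ => Finset.prod_le_prod (fun b _ => mul_nonneg hε (hr0 _)) fun b _ => hr _
  have h3 : (1 - ε) ^ card (Lab l) * ∏ L, trem x 0 (labIdx w L) j (D.2 L) ≤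
      ∏ L, trem x ε (labIdx w L) j (D.2 L) := by
    rw [← card_univ, ← Finset.prod_const, ← prod_mul_distrib]
    refine Finset.prod_le_prod (fun L _ => mul_nonneg hε (ht0 L)) fun L _ => ?_
    have := natCast_size_pos (Γ := Γ) j
    have : 0 ≤ ε * (1 / (Γ.size j : ℝ)) := by positivity
    simp only [trem]
    linarith
  have hl := natCast_pos_of_neZero l
  have h4 := mul_le_mul h2 h3 (mul_nonneg (by positivity) (prod_nonneg fun L _ => ht0 L))
    (prod_nonneg fun a _ => prod_nonneg fun b _ => revProb_nonneg h0 h1 _)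
  have h5 := mul_le_mul_of_nonneg_left h4 (one_div_nonneg.2 hl.le)
  rw [corrDist, corrDist, pow_add]
  linarith

/-- The perturbed strategies are mixtures of the equilibrium strategies with other strategies that
have rational probabilities. -/
lemma exists_mixture (hx : ∀ e j u, (x e j).1 u ∈ (algebraMap ℚ ℝ).fieldRange) (w : Fin l) (k : ℕ)
    (j : ℙ) : ∃ τ : ✉.EffMixed j, ∀ D, lawData (corrMixed x w (tremble_mem_unit l k) j) D =
        (1 - 1 / 2 ^ k) * lawData (corrMixed x w zero_mem_unit j) D + 1 / 2 ^ k * lawData τ.1 D := by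
  set A := corrMixed x w (tremble_mem_unit l k) j with hA
  set B := corrMixed x w zero_mem_unit j with hB
  have hp : (0 : ℝ) < 2 ^ k := by positivity
  have hle : ∀ s, (1 - 1 / 2 ^ k) * B.1 s ≤ A.1 s := fun s => by
    change _ * ∑ D, _ ≤ ∑ D, _
    rw [mul_sum]
    refine sum_le_sum fun D _ => ?_
    split_ifs
    · exact (mul_le_mul_of_nonneg_right (tremble_spec l k).2.2.2
        ((isDist_corrDist le_rfl zero_le_one j).1 D)).trans
        (corrDist_le (tremble_mem_unit l k).1 (tremble_mem_unit l k).2 j D)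
    · rw [mul_zero]
  have hd : IsDist fun s => 2 ^ k * (A.1 s - (1 - 1 / 2 ^ k) * B.1 s) := by
    refine ⟨fun s => mul_nonneg hp.le (sub_nonneg.2 (hle s)), ?_⟩
    rw [← mul_sum, sum_sub_distrib, ← mul_sum, A.2.2, B.2.2]
    field_simp
    ring
  have h2 : ∀ k : ℕ, (2 : ℝ) ^ k ∈ (algebraMap ℚ ℝ).fieldRange := fun k => pow_mem (ofNat_mem _ 2) _
  refine ⟨⟨⟨_, hd.1, hd.2⟩, polyTimeReal_of_dist hd fun s => mul_mem (h2 k) (sub_mem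
    (corrMixed_rational hx (tremble_rational l k) j s) (mul_mem (sub_mem (one_mem _)
      (div_mem (one_mem _) (h2 k))) (corrMixed_rational hx (zero_mem _) j s)))⟩, fun D => ?_⟩
  simp only [lawData, push, mul_sum, ← sum_add_distrib]
  refine sum_congr rfl fun s _ => ?_
  split_ifs
  · field_simp
    ring
  · simp

/-! ### The distribution of action profiles -/

open Classical in
lemma corrMixed_action (a : ∀ i, Fin (Γ.size i)) :
    expOut (fun j => lawData (corrMixed x w zero_mem_unit j))
      (fun o => if o.2.2.2 = a then 1 else 0) = 1 / l * ∑ e, Γ.profileProb (x e) a := by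
  have h0 : ∀ e, tremProfile x le_rfl zero_le_one e = x e := fun e => by
    funext j
    exact Subtype.ext (funext fun u => by simp [tremProfile, trem])
  have hl := (natCast_pos_of_neZero l).ne'
  rw [expOut_corrMixed, expOut_corrDist le_rfl zero_le_one]
  simp only [h0, Fintype.sum_bool, revProb, recIdx, if_true, mul_ite, mul_one, mul_zero,
    sum_ite_eq', mem_univ]
  simp only [Bool.false_eq_true, if_false, zero_mul, add_zero, sub_zero, mul_one,
    ← mul_sum, sum_add_left (fun e => Γ.profileProb (x e) a)]
  simp only [sum_const, card_univ, card_fin, nsmul_eq_mul]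
  field_simp

open Classical in
lemma sum_rho_action (σ : ∀ i, ✉.Mixed i) (a : ∀ i, Fin (Γ.size i)) :
    (∑ h ∈ ✉.terminals with ∀ i, corrChoice h i = (a i : ℕ), ✉.rho σ h) =
      expOut (fun j => lawData (σ j)) (fun o => if o.2.2.2 = a then 1 else 0) := by
  rw [sum_filter, corrGame_terminals, Finset.sum_map]
  simp only [Function.Embedding.coeFn_mk, rho_mkHist, corrChoice_mkHist, expOut]
  have h : ∀ o : Out Γ l, (∀ i, (o.2.2.2 i : ℕ) = a i) ↔ o.2.2.2 = a := fun o =>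
    ⟨fun h => funext fun i => Fin.ext (h i), fun h i => by rw [h]⟩
  simp only [h, ← sum_filter]
  rw [sum_comm]
  refine sum_congr rfl fun D _ => ?_
  rw [← mul_sum, sum_ite_eq]
  simp

end

/-! ## Strategies that make mistakes -/

lemma DecPT.false_not_mem {α : Type} {inp : α → List Bits} [FixedArity inp]
    {u : α → Bits} (hu : PolyTime inp u) : DecPT inp (fun a => false ∉ u a) := by
  have h1 : PolyTime inp (fun a => (u a).foldl (fun acc b => selectBits [b] [] [false] acc) []) :=
    PolyTime.foldl (step := fun _ acc b => selectBits [b] [] [false] acc) hu (PolyTime.const [])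
      (PolyTime.bit.select (PolyTime.const []) (PolyTime.const [false]) PolyTime.acc)
      (PolyBdd.const 1) (fun a acc b => by cases b <;> simp [selectBits])
  refine (eq_nil h1).congr fun a => ?_
  have key : ∀ v acc : Bits, v.foldl (fun acc b => selectBits [b] [] [false] acc) acc = [] ↔
      acc = [] ∧ false ∉ v := fun v => by
    induction v with
    | nil => simp
    | cons b v ih => intro acc; rw [List.foldl_cons, ih]; cases b <;> simp [selectBits]
  simp [key]

lemma prob_false_not_mem {k N : ℕ} (h : k ≤ N) :
    prob (fun ω : Fin N → Bool => false ∉ (ofFn ω).take k) = 1 / 2 ^ k := by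
  classical
  have h1 := (unif_precomp (Fin.castLE_injective h)).prob_comp (fun ω => ω = fun _ => true)
  have h2 : prob (fun ω : Fin k → Bool => ω = fun _ => true) = 1 / 2 ^ k := by
    rw [prob, Finset.card_eq_one.2 ⟨fun _ => true, by ext; simp⟩]
    simp
  rw [← h2, ← h1]
  refine prob_congr fun ω => ?_
  rw [take_ofFn _ h, List.mem_ofFn', funext_iff]
  simp [Fin.castLE]

lemma unif_take_drop {N a b : ℕ} (h : N = a + b) :
    Unif (fun ω : Fin N → Bool => ((fun k => ω ⟨k, by omega⟩, fun k => ω ⟨a + k, by omega⟩) :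
      (Fin a → Bool) × (Fin b → Bool))) :=
  (unif_precomp (j := Sum.elim (fun k : Fin a => (⟨k, by omega⟩ : Fin N))
    (fun k : Fin b => ⟨a + k, by omega⟩)) (by
      rintro (x | x) (y | y) hxy <;> simp [Fin.ext_iff] at hxy ⊢ <;> omega)).comp unif_sum_split

lemma exists_ofFn {N : ℕ} {L : Bits} (h : L.length = N) : ∃ ω : Fin N → Bool, ofFn ω = L := by
  subst h
  exact ⟨_, List.ofFn_getElem⟩

section

variable {c : ℕ} {𝒢 : ℕ → BitGame c} {i : Fin c}

/-- Strategies that rarely differ have similar laws. -/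
lemma sum_abs_law_sub_le {M M' : Strat 𝒢 i} (h : M'.coins.eval n ≤ M.coins.eval n)
    {B : (Fin (M.coins.eval n) → Bool) → Prop} (hB : ∀ r, ¬ B r → ∀ v,
      M.act n v (ofFn r) = M'.act n v ((ofFn r).take (M'.coins.eval n))) :
    ∑ s : (𝒢 n).Det i, |M.law n s - M'.law n s| ≤ 2 * prob B := by
  classical
  have key : ∀ A : (Fin (M.coins.eval n) → Bool) → Bits → Bits,
      ∑ s : (𝒢 n).Det i, prob (fun r => B r ∧ ∀ I, A r I.1 = (s I).1) ≤ prob B := fun A => by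
    simp only [prob_eq_avg]
    rw [← avg_sum]
    refine avg_mono fun r => ?_
    by_cases hr : B r ∧ ∃ s : (𝒢 n).Det i, ∀ I, A r I.1 = (s I).1
    · obtain ⟨h1, s, hs⟩ := hr
      rw [sum_eq_single s, if_pos ⟨h1, hs⟩, if_pos h1]
      · refine fun s' _ hne => if_neg fun h' => hne (funext fun I => Subtype.ext ?_)
        rw [← h'.2 I, hs I]
      · simp
    · refine (sum_eq_zero fun s _ => if_neg fun h' => hr ⟨h'.1, s, h'.2⟩).le.trans ?_
      split_ifs
      exacts [zero_le_one, le_rfl]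
  refine (sum_le_sum fun s _ => ?_).trans (le_trans (le_of_eq sum_add_distrib)
    ((add_le_add (key fun r v => M.act n v (ofFn r))
      (key fun r v => M'.act n v ((ofFn r).take (M'.coins.eval n)))).trans (two_mul _).ge))
  have h2 := (unif_precomp (Fin.castLE_injective h)).prob_comp
    (fun r => ∀ I : (𝒢 n).InfoSet i, M'.act n I.1 (ofFn r) = (s I).1)
  rw [Strat.law, Strat.law, ← h2]
  refine (abs_prob_sub_le (D := fun r => (B r ∧ ∀ I : (𝒢 n).InfoSet i, M.act n I.1 (ofFn r) = (s I).1) ∨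
    (B r ∧ ∀ I : (𝒢 n).InfoSet i, M'.act n I.1 ((ofFn r).take (M'.coins.eval n)) = (s I).1))
    fun r hr => ?_).trans (prob_or_le _ _)
  rw [take_ofFn _ h] at hr
  by_cases h3 : B r
  · have h4 := not_or.1 hr
    exact iff_of_false (fun h5 => h4.1 ⟨h3, h5⟩) (fun h5 => h4.2 ⟨h3, h5⟩)
  · simp only [hB r h3, take_ofFn _ h]
    rfl

end

instance : Nonempty (Beh Γ l i) := ⟨(true, fun _ => true, fun _ _ => true, fun _ => 0)⟩

/-- A string that names a behaviour. -/
def behName (X : Beh Γ l i) : Bits := ones (equivFin _ X)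

lemma behName_injective : Injective (behName (Γ := Γ) (l := l) (i := i)) := fun X Y h => by
  have := congrArg List.length h
  exact (equivFin _).injective (Fin.ext (by simpa [behName, ones] using this))

/-- The strategy follows `P`; with probability `2^{-k}` it follows `Q` instead, and with probability
`2^{-(n+k)}` it behaves at random. -/
def lapsePlan (P Q : Plan Γ l i) (k : ℕ) : Plan Γ l i where
  coins := Polynomial.X + (Polynomial.X + C k +
    (C (2 * card (Beh Γ l i) + 1) + (C (2 * size l) * Polynomial.X + 1)))
  samp n r := open Classical in
    if false ∉ (r.drop n).take (n + k) then
      Classical.epsilon fun X => fstBits ((r.drop n).drop (n + k)) = behName X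
    else if false ∉ (r.drop n).take k then Q.samp n (r.take n) else P.samp n (r.take n)
  junk n r := (fstBits (sndBits ((r.drop n).drop (n + k)))).take (size l * n)
  samp_fin := by
    classical
    obtain ⟨hN, hr⟩ := PolyTime.args₂
    have ht : PolyTime inp₂ (fun a => a.2.take a.1) := (hr.take hN).congr fun a => by rw [length_ones]
    have hd : PolyTime inp₂ (fun a => a.2.drop a.1) := (hr.drop hN).congr fun a => by rw [length_ones]
    have hk : PolyTime inp₂ (fun a => ones (a.1 + k)) := hN.ones_add (ones_const k)
    have hP : ∀ P : Plan Γ l i, FinPT inp₂ (fun a => P.samp a.1 (a.2.take a.1)) := fun P =>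
      P.samp_fin.comp (fun a : ℕ × Bits => (a.1, a.2.take a.1))
        [fun a => ones a.1, fun a => a.2.take a.1]
        (by simp [hN, ht]) (fun _ => rfl)
    exact FinPT.ite ((DecPT.false_not_mem (hd.take hk)).congr fun a => by rw [length_ones])
      ((FinPT.decode (hd.drop hk).fstBits behName Classical.epsilon).congr fun a => by rw [length_ones])
      (FinPT.ite ((DecPT.false_not_mem (hd.take (ones_const k))).congr fun a => by
        rw [length_ones]) (hP Q) (hP P))
  junk_poly := by
    obtain ⟨hN, hr⟩ := PolyTime.args₂
    exact ((((hr.drop hN).drop (hN.ones_add (ones_const k))).sndBits.fstBits).take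
      ((ones_const (size l)).ones_mul hN)).congr fun a => by simp only [length_ones]
  junk_length n r := by simp

lemma lapsePlan_coins (P Q : Plan Γ l i) (k n : ℕ) : (lapsePlan P Q k).coins.eval n =
    n + (n + k + ((2 * card (Beh Γ l i) + 1) + (2 * size l * n + 1))) := by
  simp [lapsePlan]

lemma lapsePlan_samp {P Q : Plan Γ l i} {k n : ℕ} {r : Bits} (h : false ∈ (r.drop n).take k) :
    (lapsePlan P Q k).samp n r = P.samp n (r.take n) := by
  have h1 : false ∈ (r.drop n).take (n + k) := (List.take_subset_take_left _ (Nat.le_add_left k n)) h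
  simp only [lapsePlan]
  rw [if_neg (not_not.2 h1), if_neg (not_not.2 h)]

lemma lapsePlan_spec {P Q : Plan Γ l i} {WP WQ : Data Γ l i → ℝ} (hP : PlanSpec P WP)
    (hQ : PlanSpec Q WQ) (hPc : P.coins = X) (hQc : Q.coins = X) (k : ℕ) :
    PlanSpec (lapsePlan P Q k) (fun D => (1 - 1 / 2 ^ k) * WP D + 1 / 2 ^ k * WQ D) := by
  classical
  obtain ⟨ε, hε, h⟩ := hP
  obtain ⟨ε', hε', h'⟩ := hQ
  refine ⟨_, Negligible.two_pow_inv.add (hε.add hε'), fun n hn D => ?_⟩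
  have h := h n hn D
  have h' := h' n hn D
  rw [hPc] at h
  rw [hQc] at h'
  rw [eval_X] at h h'
  have hN := lapsePlan_coins P Q k n
  set N := (lapsePlan P Q k).coins.eval n
  set R := n + k + ((2 * card (Beh Γ l i) + 1) + (2 * size l * n + 1)) with hR
  have hU := unif_take_drop hN
  have htd : ∀ ω : Fin N → Bool, (ofFn ω).take n = ofFn (fun k : Fin n => ω ⟨k, by omega⟩) ∧
      (ofFn ω).drop n = ofFn (fun k : Fin R => ω ⟨n + k, by omega⟩) := fun ω =>
    ⟨take_ofFn ω (by omega), drop_ofFn ω hN⟩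
  let F : (Fin n → Bool) × (Fin R → Bool) → Prop := fun p =>
    (if false ∉ (ofFn p.2).take k then Q.samp n (ofFn p.1) else P.samp n (ofFn p.1)) = cleanBeh D
  have h1 : |prob (fun r : Fin N → Bool => (lapsePlan P Q k).samp n (ofFn r) = cleanBeh D) -
      prob F| ≤ 1 / 2 ^ n := by
    have hb := hU.prob_comp (fun p => false ∉ (ofFn p.2).take (n + k))
    have hb' := (Unif.snd (Ω := Fin n → Bool) (Ω' := Fin R → Bool)).prob_comp
      (fun p => false ∉ (ofFn p).take (n + k))
    rw [← hU.prob_comp F]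
    refine (abs_prob_sub_le fun r hr => ?_).trans ((hb.trans (hb'.trans
      (prob_false_not_mem (by omega)))).le.trans ?_)
    · simp only [F, lapsePlan, htd]
      rw [if_neg hr]
    · exact one_div_le_one_div_of_le (by positivity) (pow_le_pow_right₀ (by norm_num) (by omega))
  have h2 : prob F = (1 - 1 / 2 ^ k) * prob (fun r : Fin n → Bool => P.samp n (ofFn r) = cleanBeh D) +
      1 / 2 ^ k * prob (fun r : Fin n → Bool => Q.samp n (ofFn r) = cleanBeh D) := by
    rw [← prob_false_not_mem (show k ≤ R by omega)]
    simp only [prob_eq_avg]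
    rw [avg_prod]
    refine (avg_comm _).trans ?_
    refine (congrArg avg (funext fun q : Fin R → Bool => (?_ : _ =
      (1 - if false ∉ (ofFn q).take k then (1 : ℝ) else 0) *
          avg (fun p : Fin n → Bool => if P.samp n (ofFn p) = cleanBeh D then (1 : ℝ) else 0) +
        (if false ∉ (ofFn q).take k then 1 else 0) *
          avg (fun p : Fin n → Bool => if Q.samp n (ofFn p) = cleanBeh D then (1 : ℝ) else 0)))).trans ?_
    · by_cases hq : false ∉ (ofFn q).take k
      · simp only [F, if_pos hq, sub_self, zero_mul, zero_add, one_mul]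
      · simp only [F, if_neg hq, sub_zero, zero_mul, add_zero, one_mul]
    · rw [avg_add, avg_mul_right, avg_mul_right, avg_sub, avg_const]
      congr!
  have hk : (0 : ℝ) ≤ 1 / 2 ^ k := by positivity
  have hk' : (1 : ℝ) / 2 ^ k ≤ 1 := by
    rw [div_le_one (by positivity)]
    exact one_le_pow₀ (by norm_num)
  rw [h2] at h1
  rw [abs_le] at *
  constructor <;> nlinarith

/-- Every history can be reached when lapses are possible. -/
lemma exists_lapse (P Q : Plan Γ l i) (k : ℕ) (X : Beh Γ l i) {cc z : Bits}
    (hc : cc.length = ¢ n) (hz : z.length ≤ size l * n) :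
    ∃ ω : Fin (((lapsePlan P Q k).toStrat S).coins.eval n) → Bool,
      ∀ v, ((lapsePlan P Q k).toStrat S).act n v (ofFn ω) = behAct S n X cc z v := by
  have hX : (behName X).length < card (Beh Γ l i) := by
    rw [behName, length_ones]
    exact Fin.isLt _
  have hl1 := length_delimit (behName X)
  have hl2 := length_delimit z
  obtain ⟨u, hu⟩ : ∃ u : Bits, (delimit (behName X) ++ (delimit z ++ u)).length =
      (2 * card (Beh Γ l i) + 1) + (2 * size l * n + 1) :=
    ⟨ones ((2 * card (Beh Γ l i) + 1) + (2 * size l * n + 1) -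
      ((delimit (behName X)).length + (delimit z).length)), by
      have : 2 * size l * n = 2 * (size l * n) := mul_assoc _ _ _
      simp only [length_append, length_ones]
      omega⟩
  set V := delimit (behName X) ++ (delimit z ++ u) with hV
  obtain ⟨ω, hω⟩ := exists_ofFn (N := ((lapsePlan P Q k).toStrat S).coins.eval n)
    (L := cc ++ (ones n ++ (ones (n + k) ++ V))) (by
      rw [Plan.toStrat_coins, lapsePlan_coins, ← hu]
      simp only [length_append, length_ones, hc])
  refine ⟨ω, fun v => ?_⟩
  change (lapsePlan P Q k).act S n v _ = _
  have hd : ((ones n ++ (ones (n + k) ++ V)).drop n) = ones (n + k) ++ V := List.drop_left' (length_ones n)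
  have ht : (ones (n + k) ++ V).take (n + k) = ones (n + k) := List.take_left' (length_ones _)
  have hd' : (ones (n + k) ++ V).drop (n + k) = V := List.drop_left' (length_ones _)
  have hs : (lapsePlan P Q k).samp n (ones n ++ (ones (n + k) ++ V)) = X := by
    simp only [lapsePlan, hd, ht, hd']
    rw [if_pos (by simp [ones]), hV, fstBits_delimit]
    exact behName_injective (Classical.epsilon_spec (p := fun Y => behName X = behName Y) ⟨X, rfl⟩).symm
  have hj : (lapsePlan P Q k).junk n (ones n ++ (ones (n + k) ++ V)) = z := by
    simp only [lapsePlan]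
    rw [hd, hd', hV, sndBits_delimit, fstBits_delimit, take_of_length_le hz]
  rw [Plan.act, hω, List.drop_left' hc, List.take_left' hc, hs, hj]

lemma lapse_psi_pos (P Q : ∀ i, Plan Γ l i) (k : ℕ) (hn : 1 ≤ n) {h : List Bits}
    (hh : (⌘ n).Terminal h) : 0 < psi (fun i => (lapsePlan (P i) (Q i) k).toStrat S) n h := by
  obtain ⟨hH, hlen⟩ := (cryptoGame_terminal hn).1 hh
  rcases h with _ | ⟨x, _ | ⟨y, _ | ⟨z, ws⟩⟩⟩
  · simp at hlen
  · simp at hlen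
  · simp at hlen
  have hx : x ∈ cryptoActions S Γ l n 0 := hH.2 0 x rfl
  have hy : y.length = size l := hH.2 1 y rfl
  have hz : z.length ≤ size l * n := hH.2 2 z rfl
  have hw : ∀ i : ℙ, ∃ a : Fin (Γ.size i), ws[gStage i - 3]? = some (bits a) := fun i => by
    have h3 := three_le_gStage i
    have hlt := gStage_lt i
    have hl : gStage i - 3 < ws.length := by simp at hlen; omega
    obtain ⟨a, ha, he⟩ := hH.2 (gStage i - 3 + 3) ws[gStage i - 3] (by simp [hl])
    rw [gOrder_gStage] at ha
    exact ⟨⟨a, ha⟩, by rw [getElem?_eq_getElem hl, he]⟩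
  choose a ha using hw
  obtain ⟨e, cc, hcc, hxe⟩ := exists_commitStr hx
  obtain ⟨e', he'⟩ := exists_ofFn hy
  let X : ∀ i, Beh Γ l i := fun i => (true, if i = 0 then e else e', fun _ _ => false, fun _ => a i)
  choose ω hω using fun i => exists_lapse (S := S) (P i) (Q i) k (X i) hcc hz
  let M : ∀ i, Strat ⌘ i := fun i => (lapsePlan (P i) (Q i) k).toStrat S
  let ω' : Coins (coinsOf M n) := ω
  have hρ : ∀ i, respOf M n ω' i = behAct S n (X i) cc z := fun i => funext fun v =>
    (congrArg (fun r => (M i).act n v r) (take_of_length_le length_ofFn.le)).trans (hω i v)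
  refine prob_pos (ω := ω') ?_
  change play M n ω' = _
  rw [play_eq M hn (N := coinsOf M n) (fun _ => le_rfl), playR, funext hρ]
  have h0 : act₀ (fun i => behAct S n (X i) cc z) = x := hxe
  have h1 : act₁ (fun i => behAct S n (X i) cc z) = y := (behAct_one _).trans he'
  have h2 : act₂ (fun i => behAct S n (X i) cc z) = z := behAct_two _ _
  rw [h0, h1, h2, cHist]
  congr 3
  refine ext_getElem (by simp at hlen ⊢; omega) fun t ht1 ht2 => ?_
  have hg := gStage_gOrder (m := m) ⟨t, by simp at ht1; omega⟩
  have h3 := ha (gOrder m t)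
  rw [show gStage (gOrder m t) - 3 = t by simp only at hg; omega, getElem?_eq_getElem ht2] at h3
  rw [getElem_ofFn, Option.some.inj h3]
  exact behAct_three _ _ _ _

/-! ## Switching strategies in the cryptographic games -/

lemma abs_avg_sub_sum_le {Ω ι : Type} [Fintype Ω] [Fintype ι] (X : Ω → ι) {q : ι → ℝ} {e : ℝ}
    (h : ∀ o, |prob (fun ω => X ω = o) - q o| ≤ e) (G : ι → ℝ) :
    |avg (fun ω => G (X ω)) - ∑ o, q o * G o| ≤ (∑ o, |G o|) * e := by
  rw [← finsum_prob_mul X G, finsum_eq_sum_of_fintype, ← sum_sub_distrib, sum_mul]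
  refine (abs_sum_le_sum_abs _ _).trans (sum_le_sum fun o _ => ?_)
  rw [← sub_mul, abs_mul, mul_comm]
  exact mul_le_mul_of_nonneg_left (h o) (abs_nonneg _)

open Classical in
lemma condExpect_eq_avg {Ω ι : Type} [Fintype Ω] [Nonempty Ω] {V : Ω → Prop} {u : Ω → ℝ}
    {x : Ω → ι} {E : ι → Prop} {f : ι → ℝ} (hV : ∀ ω, V ω ↔ E (x ω))
    (hu : ∀ ω, V ω → u ω = f (x ω)) (c : ℝ) : condExpect (fun _ => 1) V u =
      (avg (fun ω => if E (x ω) then f (x ω) - c else 0) + c * prob V) / prob V := by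
  have : (card Ω : ℝ) ≠ 0 := by exact_mod_cast Fintype.card_ne_zero
  rw [prob_eq_avg, ← avg_mul_left, ← avg_add, avg, avg, div_div_div_cancel_right₀ this]
  simp only [condExpect, one_mul]
  congr 1
  refine sum_congr rfl fun ω _ => ?_
  by_cases h : V ω
  · simp [h, (hV ω).1 h, hu ω h]
  · simp [h, mt (hV ω).2 h]

lemma sum_expOut_mul (W : ∀ j, Data Γ l j → ℝ) (g : Out Γ l → ℝ) :
    ∑ o, expOut W (fun o' => if o' = o then 1 else 0) * g o = expOut W g := by
  simp only [expOut, sum_mul]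
  rw [sum_comm]
  exact sum_congr rfl fun D _ => by simp

open Classical in
lemma sum_mixProb_mul (W : ∀ j, Data Γ l j → ℝ) (τ : Data Γ l i → ℝ) (g : Out Γ l → ℝ) :
    ∑ o, mixProb W i τ o * g o = ∑ t, τ t * ∑ D, (∏ j, W j (D j)) * g (outOf (update D i t)) := by
  simp only [mixProb, sum_mul, mul_sum]
  rw [sum_comm, sum_comm (s := Finset.univ (α := Data Γ l i))]
  refine sum_congr rfl fun D _ => ?_
  rw [sum_comm]
  exact sum_congr rfl fun t _ => by simp; ring

lemma prob_outR_plans {P : ∀ j, Plan Γ l j} {M : ∀ i, Strat ⌘ i} {W : ∀ j, Data Γ l j → ℝ} (hM : M = fun j => (P j).toStrat S)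
    (hW : ∀ j, IsDist (W j)) (hP : ∀ j, PlanSpec (P j) (W j)) :
    ∃ ε, Negligible ε ∧ ∀ n, 1 ≤ n → ∀ (E : Out Γ l → Prop) [DecidablePred E],
      |prob (fun ω : Coins (coinsOf M n) => E (outR S Γ l n (respOf M n ω))) -
        expOut W (fun o => if E o then 1 else 0)| ≤ ε n := by
  obtain ⟨ε, hε, h⟩ := phi_plans (S := S) hW hP
  refine ⟨ε, hε, fun n hn E _ => ?_⟩
  subst hM
  simp only [expOut]
  convert h n hn E using 6

lemma Negligible.eventually_lt {ε : ℕ → ℝ} (h : Negligible ε) {p : ℝ} (hp : 0 < p) :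
    ∀ᶠ n in atTop, ε n < p := by
  filter_upwards [h.2 1, tendsto_one_div_atTop_nhds_zero_nat.eventually_lt_const hp] with n h1 h2
  rw [pow_one] at h1
  exact h1.trans h2

section

lemma sndBits_cryptoObs (lev : ℕ) (h : List Bits) :
    sndBits^[lev] (false :: cryptoObs h) = [] ↔ h.length < lev := by
  have : false :: cryptoObs h = packBits ([] :: (h.take 3 ++ List.replicate (h.length - 3) [])) := rfl
  rw [this, sndBits_iterate, packBits_eq_nil, List.drop_eq_nil_iff]
  simp
  omega

/-- The strategy that follows `M` before stage `lev` and `M'` from then on. -/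
def spliceStrat (lev : ℕ) (M M' : Strat ⌘ i) : Strat ⌘ i where
  coins := M.coins + M'.coins
  act n v r := if sndBits^[lev] (false :: v) = [] then M.act n v (r.take (M.coins.eval n))
    else M'.act n v (r.take (M'.coins.eval n))
  polyTime := by
    obtain ⟨hN, hv, hr⟩ := PolyTime.args₃
    have hM : ∀ M : Strat ⌘ i,
        PolyTime inp₃ (fun a => M.act a.1 a.2.1 (a.2.2.take (M.coins.eval a.1))) := fun M =>
      M.polyTime.comp (fun a : ℕ × Bits × Bits => (a.1, a.2.1, a.2.2.take (M.coins.eval a.1)))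
        [fun a => ones a.1, fun a => a.2.1, fun a => a.2.2.take (M.coins.eval a.1)]
        (by simp [hN, hv, (hr.take (ones_eval M.coins hN)).congr fun a => by rw [length_ones]])
        (fun _ => rfl)
    exact (PolyTime.ite (DecPT.eq_nil ((hv.cons false).sndBits_iterate lev)) (hM M) (hM M')).congr
      fun a => by split_ifs <;> rfl
  legal n hn h hh r hr := by
    rw [eval_add] at hr
    split_ifs
    · exact M.legal n hn h hh _ (by simp [hr])
    · exact M'.legal n hn h hh _ (by simp [hr])

/-- The responses when player `i` switches to `M'` at stage `lev`. -/
def respSplice (M : ∀ i, Strat ⌘ i) (i : ℙ) (M' : Strat ⌘ i) (lev n : ℕ) {N : ℙ → ℕ} (ω : Coins N) :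
    ℙ → Bits → Bits :=
  update (respOf M n ω) i fun v => if sndBits^[lev] (false :: v) = [] then respOf M n ω i v
    else M'.act n v ((ofFn (ω i)).take (M'.coins.eval n))

variable (M : ∀ i, Strat (cryptoGame S Γ l) i) (M' : Strat (cryptoGame S Γ l) i) {lev n : ℕ}

lemma respOf_spliceStrat {N : ℙ → ℕ} (ω : Coins N) :
    respOf (update M i (spliceStrat lev (M i) M')) n ω = respSplice M i M' lev n ω := by
  funext j v
  by_cases hj : j = i
  · subst hj
    simp only [respOf, respSplice, update_self, spliceStrat, take_take, eval_add]
    rw [min_eq_left (Nat.le_add_right _ _), min_eq_left (Nat.le_add_left _ _)]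
  · simp only [respOf, respSplice, update_of_ne hj]

lemma prob_respSplice (hn : 1 ≤ n) {N : ℙ → ℕ} (hN : ∀ j, coinsOf M n j ≤ N j)
    (hN' : M'.coins.eval n ≤ N i) (E : Out Γ l → Prop) :
    prob (fun ω : Coins N => E (outR S Γ l n (respSplice M i M' lev n ω))) =
      prob (fun ω : Coins (coinsOf (update M i (spliceStrat lev (M i) M')) n) =>
        E (outR S Γ l n (respOf (update M i (spliceStrat lev (M i) M')) n ω))) := by
  have hc : ∀ j, coinsOf (update M i (spliceStrat lev (M i) M')) n j ≤
      N j + M'.coins.eval n := fun j => by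
    have := hN j
    by_cases hj : j = i
    · subst hj
      simp only [coinsOf, update_self, spliceStrat, eval_add] at *
      omega
    · simp only [coinsOf, update_of_ne hj] at *
      omega
  rw [prob_play_eq (update M i (spliceStrat lev (M i) M')) hn
      (N' := coinsOf (update M i (spliceStrat lev (M i) M')) n) (fun _ => le_rfl) hc E,
    ← (unif_shorten fun j => Nat.le_add_right (N j) (M'.coins.eval n)).prob_comp]
  refine prob_congr fun ω => ?_
  rw [respOf_spliceStrat]
  simp only [respSplice, respOf_shorten M n (fun j => Nat.le_add_right (N j) (M'.coins.eval n)) hN]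
  rw [take_ofFn _ hN', take_ofFn _ (hN'.trans (Nat.le_add_right _ _))]
  rfl

lemma visits_playR (hn : 1 ≤ n) (hlev : lev < m + 5) {I : Set (List CorrAct)}
    (hI : ∀ h ∈ I, h.length = lev) {ρ : ℙ → Bits → Bits}
    (hρ : ∀ j, LegalResp S Γ l n j (ρ j)) : Visits (liftSet ⌘ ♮ n I) (playR ρ) ↔
      (mkHist (outR S Γ l n ρ)).take lev ∈ I := by
  rw [visits_iff (lev := lev) (fun h hh => by
      rw [← corrMap_length (S := S) (l := l) (n := n) h]; exact hI _ hh.2)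
    (by simp [playR, cHist]; omega), ← corrMap_playR hn hρ, ← corrMap_take]
  exact and_iff_right ((cryptoGame_NT hn).1 (playR_take_turns hn hρ hlev).1).1

lemma visits_play (hn : 1 ≤ n) (hlev : lev < m + 5) {I : Set (List CorrAct)}
    (hI : ∀ h ∈ I, h.length = lev) {N : ℙ → ℕ} (hN : ∀ j, coinsOf M n j ≤ N j)
    (ω : Coins N) : Visits (liftSet ⌘ ♮ n I) (play M n ω) ↔
      (mkHist (outR S Γ l n (respOf M n ω))).take lev ∈ I := by
  rw [play_eq M hn hN]
  exact visits_playR hn hlev hI (respOf_legal M hn hN ω)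

lemma playSwitch_spec (hn : 1 ≤ n) (hlev : lev < m + 5) {I : Set (List CorrAct)}
    (hI : ∀ h ∈ I, h.length = lev) {N : ℙ → ℕ} (hN : ∀ j, coinsOf M n j ≤ N j)
    (hN' : M'.coins.eval n ≤ N i) (ω : Coins N) {J : Set (List Bits)}
    (hJ : J = liftSet ⌘ ♮ n I) : (Visits J (playSwitch M i J M' n ω) ↔
      (mkHist (outR S Γ l n (respSplice M i M' lev n ω))).take lev ∈ I) ∧
    (Visits J (playSwitch M i J M' n ω) ↔ Visits J (play M n ω)) ∧
    (Visits J (playSwitch M i J M' n ω) → ♮ n (playSwitch M i J M' n ω) =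
      mkHist (outR S Γ l n (respSplice M i M' lev n ω))) := by
  classical
  have hJl : ∀ h ∈ J, h.length = lev := fun h hh => by
    rw [hJ] at hh
    rw [← corrMap_length (S := S) (l := l) (n := n) h]
    exact hI _ hh.2
  let ρ' : Bits → Bits := fun v => M'.act n v ((ofFn (ω i)).take (M'.coins.eval n))
  have hρ := respOf_legal M hn hN ω
  have hρ' : ∀ j, LegalResp S Γ l n j (update (respOf M n ω) i ρ' j) := fun j => by
    by_cases hj : j = i
    · subst hj
      rw [update_self]
      exact M'.legalResp hn (by simp [hN'])
    · rw [update_of_ne hj]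
      exact hρ j
  have hs : ∀ j h, respSplice M i M' lev n ω j (cryptoObs h) = if h.length < lev then
      respOf M n ω j (cryptoObs h) else update (respOf M n ω) i ρ' j (cryptoObs h) := fun j h => by
    rw [respSplice]
    by_cases hj : j = i
    · subst hj
      simp only [update_self, sndBits_cryptoObs]
      rfl
    · simp only [update_of_ne hj, ite_self]
  have hρs : ∀ j, LegalResp S Γ l n j (respSplice M i M' lev n ω j) := fun j h hh => by
    rw [hs]
    split_ifs
    exacts [hρ j h hh, hρ' j h hh]
  have h1 : ∀ ρ : ℙ → Bits → Bits, (∀ j, LegalResp S Γ l n j (ρ j)) →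
      histOf (fun h => ρ (corrMover m h.length) (cryptoObs h)) (m + 5) = playR ρ ∧
      (Visits J (playR ρ) ↔ (mkHist (outR S Γ l n ρ)).take lev ∈ I) := fun ρ hρ => by
    have h2 := stageGame_outcome (fun t _ => cryptoActions_nonempty hn t)
      (pol := fun h (_ : (⌘ n).NT h) => ρ (corrMover m h.length) (cryptoObs h))
      (fun h hh => rfl) (fun h hh => hρ _ h ⟨hh, rfl⟩)
    exact ⟨h2.symm.trans (cryptoGame_outcome hn hρ fun h hh => rfl), hJ ▸ visits_playR hn hlev hI hρ⟩
  let sw : List Bits → Bits := fun h => if ∃ h' ∈ J, h' <+: h then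
    update (respOf M n ω) i ρ' (corrMover m h.length) (cryptoObs h)
    else respOf M n ω (corrMover m h.length) (cryptoObs h)
  have h3 : playSwitch M i J M' n ω = histOf sw (m + 5) := by
    refine stageGame_outcome (fun t _ => cryptoActions_nonempty hn t) (fun h hh => ?_) fun h hh => ?_
    · change (if _ then update M i M' (corrMover m h.length) else M (corrMover m h.length)).move
        n h (ofFn (ω (corrMover m h.length))) = _
      simp only [sw]
      generalize corrMover m h.length = j
      split_ifs
      · by_cases hj : j = i
        · subst hj
          simp only [update_self]
          rfl
        · simp only [update_of_ne hj]
          rfl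
      · rfl
    · simp only [sw]
      split_ifs
      exacts [hρ' _ h ⟨hh, rfl⟩, hρ _ h ⟨hh, rfl⟩]
  have h4 := histOf_switch (T := m + 5) hJl hlev.le (fun h => (rfl : sw h = _)) (fun h => hs (corrMover m h.length) h)
  rw [(h1 _ hρs).1, (h1 _ hρ).1, ← h3, ← play_eq M hn hN] at h4
  refine ⟨h4.1.trans (h4.2.1.symm.trans (h1 _ hρs).2), h4.1, fun h => ?_⟩
  · rw [h4.2.2 (h4.1.1 h), corrMap_playR hn hρs]

open Classical in
/-- If no pure strategy of the envelope game is profitable given that a cell is reached, then no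
strategy of the cryptographic games is profitable there. -/
lemma condExpect_playSwitch_le {P : ∀ j, Plan Γ l j} {W : ∀ j, Data Γ l j → ℝ}
    (hW : ∀ j, IsDist (W j)) (hP : ∀ j, PlanSpec (P j) (W j)) (hM : M = fun j => (P j).toStrat S)
    {I : Set (List CorrAct)} {E : Fin l → Fin l → Bool → Prop} (hlev : lev < m + 5)
    (hI : ∀ h ∈ I, h.length = lev) (hE : ∀ o : Out Γ l, (mkHist o).take lev ∈ I ↔ E o.1 o.2.1 o.2.2.1)
    {v δ : ℝ} (h : Unprofitable W i E v δ) : ∃ ε, Negligible ε ∧ ∀ n, 1 ≤ n →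
      condExpect (fun _ : Coins (fun j => max (coinsOf M n j) (M'.coins.eval n)) => 1)
          (fun ω => Visits (liftSet ⌘ ♮ n I)
            (playSwitch M i (liftSet ⌘ ♮ n I) M' n ω))
          (fun ω => ✉.util (♮ n
            (playSwitch M i (liftSet ⌘ ♮ n I) M' n ω)) i) ≤
        condExpect (fun _ : Coins (coinsOf M n) => 1)
          (fun ω => Visits (liftSet ⌘ ♮ n I) (play M n ω))
          (fun ω => ✉.util (♮ n (play M n ω)) i) + ε n + δ := by
  obtain ⟨hpos, hv, hdev⟩ := h
  set Eo : Out Γ l → Prop := fun o => E o.1 o.2.1 o.2.2.1 with hEo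
  set p := expOut W (fun o => if Eo o then 1 else 0) with hp
  let f : Out Γ l → ℝ := fun o => Γ.payoff o.2.2.2 i
  let G : ℝ → Out Γ l → ℝ := fun c o => if Eo o then f o - c else 0
  obtain ⟨ε₂, hε₂, hphi⟩ := prob_outR_plans (S := S) hM hW hP
  obtain ⟨σ, hσ, ε₁, hε₁, hdv⟩ := devApprox (S := S) hW hP i (spliceStrat lev (M i) M')
  rw [← hM] at hdv
  let A : ℕ → ℝ := fun n => avg fun ω : Coins (fun j => max (coinsOf M n j) (M'.coins.eval n)) =>
    G (v + δ) (outR S Γ l n (respSplice M i M' lev n ω))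
  let B : ℕ → ℝ := fun n => avg fun ω : Coins (coinsOf M n) => G v (outR S Γ l n (respOf M n ω))
  let b : ℕ → ℝ := fun n => prob fun ω : Coins (coinsOf M n) => Eo (outR S Γ l n (respOf M n ω))
  have hA : ∀ n, 1 ≤ n → A n ≤ (∑ o, |G (v + δ) o|) * ε₁ n := fun n hn => by
    have h1 := abs_avg_sub_sum_le (fun ω : Coins (fun j => max (coinsOf M n j) (M'.coins.eval n)) =>
      outR S Γ l n (respSplice M i M' lev n ω)) (fun o => by
        rw [prob_respSplice M M' hn (fun j => le_max_left _ _) (le_max_right _ _) (fun o' => o' = o)]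
        exact hdv n hn o) (G (v + δ))
    have h2 : ∑ o, mixProb W i (σ n) o * G (v + δ) o ≤ 0 := by
      rw [sum_mixProb_mul]
      refine sum_nonpos fun t _ => mul_nonpos_of_nonneg_of_nonpos ((hσ n).1 t) ?_
      simpa only [G, f, sub_sub] using hdev t
    linarith [(abs_le.1 h1).2]
  have hB : ∀ n, 1 ≤ n → |B n| ≤ (∑ o, |G v o|) * ε₂ n := fun n hn => by
    have h1 := abs_avg_sub_sum_le (fun ω : Coins (coinsOf M n) => outR S Γ l n (respOf M n ω))
      (fun o => hphi n hn (fun o' => o' = o)) (G v)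
    have h2 : expOut W (G v) = 0 := by
      refine Eq.trans ?_ (sub_eq_zero.2 hv)
      rw [expOut, expOut, hp, expOut, mul_sum, ← sum_sub_distrib]
      refine sum_congr rfl fun D _ => ?_
      simp only [G, Eo, f]
      split_ifs <;> ring
    rwa [sum_expOut_mul, h2, sub_zero] at h1
  have hb : ∀ n, 1 ≤ n → |b n - p| ≤ ε₂ n := fun n hn => hphi n hn Eo
  have hG : ∀ c, 0 ≤ ∑ o, |G c o| := fun c => sum_nonneg fun o _ => abs_nonneg (G c o)
  have hC := (hε₁.const_mul (hG (v + δ))).add (hε₂.const_mul (hG v))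
  let J := fun n => liftSet ⌘ ♮ n I
  let L : ℕ → ℝ := fun n =>
    condExpect (fun _ : Coins (fun j => max (coinsOf M n j) (M'.coins.eval n)) => 1)
      (fun ω => Visits (J n) (playSwitch M i (J n) M' n ω))
      (fun ω => ✉.util (♮ n (playSwitch M i (J n) M' n ω)) i)
  let R : ℕ → ℝ := fun n => condExpect (fun _ : Coins (coinsOf M n) => 1)
    (fun ω => Visits (J n) (play M n ω))
    (fun ω => ✉.util (♮ n (play M n ω)) i)
  have hR : ∀ n, 1 ≤ n → R n = (B n + v * b n) / b n := fun n hn => by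
    have hs' : ∀ ω : Coins (coinsOf M n), Visits (J n) (play M n ω) ↔
        Eo (outR S Γ l n (respOf M n ω)) := fun ω => (visits_play M hn hlev hI (fun _ => le_rfl) ω).trans (hE _)
    rw [show b n = _ from prob_congr fun ω => (hs' ω).symm]
    refine condExpect_eq_avg (f := f) hs' (fun ω _ => ?_) v
    rw [corrMap_play M hn (N := coinsOf M n) (fun _ => le_rfl) ω, corrGame_util]
  have hL : ∀ n, 1 ≤ n → L n = (A n + (v + δ) * b n) / b n := fun n hn => by
    have hs := fun ω => playSwitch_spec M M' hn hlev hI (N := fun j => max (coinsOf M n j)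
      (M'.coins.eval n)) (fun j => le_max_left _ _) (le_max_right _ _) ω rfl
    have hab : b n = prob fun ω : Coins (fun j => max (coinsOf M n j) (M'.coins.eval n)) =>
        Visits (J n) (playSwitch M i (J n) M' n ω) := by
      rw [show b n = _ from prob_play_eq M hn (N := fun j => max (coinsOf M n j) (M'.coins.eval n))
        (N' := coinsOf M n) (fun _ => le_rfl) (fun j => le_max_left _ _) Eo]
      exact prob_congr fun ω => ((hE _).symm.trans (visits_play M hn hlev hI (fun j => le_max_left _ _) ω).symm).trans
        (hs ω).2.1.symm
    rw [hab]
    refine condExpect_eq_avg (E := Eo) (f := f) (fun ω => (hs ω).1.trans (hE _)) (fun ω h => ?_)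
      (v + δ)
    rw [(hs ω).2.2 h, corrGame_util]
  refine ⟨fun n => max 0 (L n - R n - δ), Negligible.of_eventually (fun n => le_max_left _ _)
    ⟨_, hC.const_mul (C := 2 / p) (by positivity), ?_⟩, fun n hn => by
      change L n ≤ R n + _ + δ
      linarith [le_max_right 0 (L n - R n - δ)]⟩
  filter_upwards [hε₂.eventually_lt (half_pos hpos), eventually_ge_atTop 1] with n h2 hn
  have hbn : p / 2 ≤ b n := by linarith [(abs_le.1 (hb n hn)).1]
  have hb0 : 0 < b n := by linarith
  have hX := hC.1 n
  simp only at hX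
  refine max_le (by positivity) ?_
  rw [hL n hn, hR n hn, show (A n + (v + δ) * b n) / b n - (B n + v * b n) / b n - δ =
    (A n - B n) / b n by field_simp; ring, div_le_iff₀ hb0]
  have h5 := mul_le_mul_of_nonneg_left hbn (mul_nonneg (div_nonneg zero_le_two hpos.le) hX)
  have h6 : ∀ X : ℝ, 2 / p * X * (p / 2) = X := fun X => by field_simp
  rw [h6] at h5
  linarith [hA n hn, (abs_le.1 (hB n hn)).1]

end

/-! ## Consistency of the information sets -/

section

variable (M : ∀ i, Strat (cryptoGame S Γ l) i) {lev n : ℕ}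

/-- The view of player `i` at stage `lev`. -/
def viewOf (i : ℙ) (lev n : ℕ) (ω : Coins (coinsOf M n)) : View :=
  (cryptoObs ((play M n ω).take lev), ofFn (ω i))

variable {M} (hn : 1 ≤ n) (hlev : lev < m + 5) (hi : corrMover m lev = i) {K : Set (List CorrAct)}
  (hK : ∀ h ∈ K, h.length = lev)

lemma mem_turns_of_corrMap (hn : 1 ≤ n) (hlev : lev < m + 5) (hi : corrMover m lev = i)
    {h : List Bits} (hh : h ∈ (⌘ n).H) (hl : h.length = lev) : h ∈ (⌘ n).turns i :=
  ⟨(cryptoGame_NT hn).2 ⟨hh, by omega⟩, by subst hl; exact hi⟩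

lemma play_take_turns (hn : 1 ≤ n) (hlev : lev < m + 5) (hi : corrMover m lev = i)
    (ω : Coins (coinsOf M n)) : (play M n ω).take lev ∈ (⌘ n).turns i := by
  rw [play_eq M hn (N := coinsOf M n) (fun _ => le_rfl), ← hi]
  exact playR_take_turns hn (respOf_legal M hn (N := coinsOf M n) (fun _ => le_rfl) ω) hlev

lemma viewOf_mem (hn : 1 ≤ n) (hlev : lev < m + 5) (hi : corrMover m lev = i)
    (hK : ∀ h ∈ K, h.length = lev) (ω : Coins (coinsOf M n)) :
    viewOf M i lev n ω ∈ views M i n (liftSet ⌘ ♮ n K) ↔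
      ∃ h ∈ (⌘ n).H, ♮ n h ∈ K ∧ cryptoObs ((play M n ω).take lev) = cryptoObs h := by
  constructor
  · rintro ⟨h, ⟨hh, hk⟩, -, he, -⟩
    exact ⟨h, hh, hk, he⟩
  · rintro ⟨h, hh, hk, he⟩
    refine ⟨h, ⟨hh, hk⟩, mem_turns_of_corrMap hn hlev hi hh ?_, he, length_ofFn⟩
    rw [← hK _ hk, corrMap_length]

open Classical in
lemma finsum_views (hn : 1 ≤ n) (hlev : lev < m + 5) (hi : corrMover m lev = i)
    (hK : ∀ h ∈ K, h.length = lev) {V : Set View}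
    (hV : V = views M i n (liftSet ⌘ ♮ n K)) (φ : View → ℝ) :
    ∑ᶠ v, (if v ∈ V then xi M i n v * φ v else 0) =
      avg (fun ω => if viewOf M i lev n ω ∈ V then φ (viewOf M i lev n ω) else 0) := by
  rw [← finsum_prob_mul (viewOf M i lev n) (fun v => if v ∈ V then φ v else 0)]
  refine finsum_congr fun v => ?_
  split_ifs with hv
  · rw [hV] at hv
    obtain ⟨h, ⟨hh, hk⟩, -, he, -⟩ := hv
    congr 1
    refine prob_congr fun ω => ⟨?_, ?_⟩
    · rintro ⟨h1, h', ht, hp, h2⟩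
      have h3 := (cryptoObs_eq ((show cryptoObs h' = v.1 from h2).trans he)).1
      rw [← corrMap_length (S := S) (l := l) (n := n) h, hK _ hk] at h3
      rw [List.prefix_iff_eq_take, h3] at hp
      rw [viewOf, ← hp, h1]
      exact Prod.ext h2 rfl
    · rintro rfl
      exact ⟨rfl, _, play_take_turns hn hlev hi ω, List.take_prefix _ _, rfl⟩
  · rw [mul_zero]

lemma xiSet_views (hn : 1 ≤ n) (hlev : lev < m + 5) (hi : corrMover m lev = i)
    (hK : ∀ h ∈ K, h.length = lev) {V : Set View}
    (hV : V = views M i n (liftSet ⌘ ♮ n K)) :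
    xiSet M i n V = prob (fun ω => viewOf M i lev n ω ∈ V) := by
  classical
  rw [xiSet, finsum_mem_def, prob_eq_avg, ← finsum_views hn hlev hi hK hV (fun _ => 1)]
  refine finsum_congr fun v => ?_
  simp [Set.indicator]

open Classical in
lemma finsum_viewDist (hn : 1 ≤ n) (hlev : lev < m + 5) (hi : corrMover m lev = i)
    (hK : ∀ h ∈ K, h.length = lev) {V : Set View}
    (hV : V = views M i n (liftSet ⌘ ♮ n K))
    (hp : 0 < prob (fun ω => viewOf M i lev n ω ∈ V)) (A : View → ℝ) :
    ∑ᶠ v, viewDist M i n V v * A v =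
      avg (fun ω => if viewOf M i lev n ω ∈ V then A (viewOf M i lev n ω) else 0) /
        prob (fun ω => viewOf M i lev n ω ∈ V) := by
  have h1 := xiSet_views hn hlev hi hK hV
  rw [div_eq_mul_inv, ← avg_mul_right]
  have h2 := finsum_views hn hlev hi hK hV fun v => A v * (prob fun ω => viewOf M i lev n ω ∈ V)⁻¹
  simp only [ite_mul, zero_mul]
  rw [← h2]
  refine finsum_congr fun v => ?_
  rw [viewDist, h1, if_pos hp]
  split_ifs
  · ring
  · rw [zero_mul]

/-- Histories whose first three moves agree cannot be told apart by later views. -/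
lemma views_subset {K K' : Set (List CorrAct)} (hn : 1 ≤ n) (hlev : lev < m + 5) (h3 : 3 ≤ lev)
    (hi : corrMover m lev = i) (hK : ∀ h ∈ K, h.length = lev) {h' : List CorrAct}
    (hh' : h' ∈ K') (hG : h' ∈ ✉.H) (hl' : h'.length = lev)
    (he : ∀ h ∈ K, h.take 3 = h'.take 3) : views M i n (liftSet ⌘ ♮ n K) ⊆
      views M i n (liftSet ⌘ ♮ n K') := by
  rintro v ⟨h₁, ⟨hH, hk⟩, -, hv, hv'⟩
  obtain ⟨h₂, hH₂, rfl⟩ := corrMap_surjOn (S := S) hn hG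
  have hl := hK _ hk
  have h4 := he _ hk
  rw [corrMap_length] at hl hl'
  obtain ⟨hb, hL⟩ := hH
  obtain ⟨hb₂, hL₂⟩ := hH₂
  rcases h₁ with _ | ⟨x, _ | ⟨y, _ | ⟨z, ws⟩⟩⟩ <;> try (simp at hl; omega)
  rcases h₂ with _ | ⟨x', _ | ⟨y', _ | ⟨z', ws'⟩⟩⟩ <;> try (simp at hl'; omega)
  have h5 : x :: y :: z :: ws' ∈ (⌘ n).H := by
    refine ⟨hb₂, fun t a ha => ?_⟩
    rcases t with _ | _ | _ | t
    exacts [hL 0 a ha, hL 1 a ha, hL 2 a ha, hL₂ _ a ha]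
  have h6 : ♮ n (x :: y :: z :: ws') = ♮ n (x' :: y' :: z' :: ws') := by
    rw [corrMap_cons₃] at h4 ⊢
    rw [corrMap_cons₃] at h4 ⊢
    simp only [List.take_succ_cons, List.take_zero, List.cons.injEq, and_true] at h4
    rw [h4.1, h4.2.1, h4.2.2]
  refine ⟨_, ⟨h5, h6.symm ▸ hh'⟩, mem_turns_of_corrMap hn hlev hi h5 (by simpa using hl'), ?_, hv'⟩
  rw [hv]
  change cryptoObs _ = cryptoObs _
  have : ws.length = ws'.length := by simp at hl hl'; omega
  rw [cryptoObs_cons₃, cryptoObs_cons₃, this]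

lemma take_three_of_info (hlev : lev < m + 5) (h3 : 3 ≤ lev) {h h' : List CorrAct}
    (hh : h ∈ ✉.H) (hh' : h' ∈ ✉.H) (hl : h.length = lev)
    (hl' : h'.length = lev) (e : corrObs m h = corrObs m h') (hr : reveal ∈ h.take 3) :
    h'.take 3 = h.take 3 := by
  obtain ⟨o, ho⟩ := exists_mkHist hh
  obtain ⟨o', ho'⟩ := exists_mkHist hh'
  obtain ⟨t, rfl⟩ := Nat.exists_eq_add_of_le' h3
  rw [hl] at ho
  rw [hl'] at ho'
  rw [ho, ho', corrObs_mkHist_take _ (by omega), corrObs_mkHist_take _ (by omega)] at e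
  have h1 := labInfo_injective e
  rw [ho, take_take, min_eq_left h3] at hr ⊢
  rw [ho', take_take, min_eq_left h3]
  have h2 : o.2.2.1 = true := by
    by_contra hf
    simp [mkHist, revAct, hf] at hr
  simp only [labOf, Prod.mk.injEq, h2] at h1
  obtain ⟨ha, hb, hc⟩ := h1
  simp [← hc] at ha
  simp [mkHist, hb, ← hc, h2, ha]

end

lemma prob_prod {Ω Ω' : Type} [Fintype Ω] [Fintype Ω'] (E : Ω × Ω' → Prop) :
    prob E = avg (fun ω => prob (fun ω' => E (ω, ω'))) := by
  classical
  simp only [prob_eq_avg]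
  exact avg_prod _

section

variable {P : ∀ j, Plan Γ l j} {M : ∀ i, Strat (cryptoGame S Γ l) i} {K : Set (List CorrAct)}

lemma corrMap_play_take (hn : 1 ≤ n) (ω : Coins (coinsOf M n)) (t : ℕ) :
    ♮ n ((play M n ω).take t) = (mkHist (outR S Γ l n (respOf M n ω))).take t := by
  rw [corrMap_take, corrMap_play M hn (N := coinsOf M n) (fun _ => le_rfl) ω]

lemma viewOf_one_mem (hn : 1 ≤ n) (hK : ∀ h ∈ K, h.length = 1) (ω : Coins (coinsOf M n)) :
    viewOf M 1 1 n ω ∈ views M 1 n (liftSet ⌘ ♮ n K) ↔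
      [enclose (outR S Γ l n (respOf M n ω)).1] ∈ K := by
  have h1 : ♮ n ((play M n ω).take 1) = [enclose (outR S Γ l n (respOf M n ω)).1] :=
    corrMap_play_take hn ω 1
  rw [viewOf_mem (i := 1) hn (by omega) rfl hK, ← h1]
  constructor
  · rintro ⟨h, hh, hk, e⟩
    have h2 := hK _ hk
    rw [corrMap_length] at h2
    have h3 := (cryptoObs_eq e).2
    rw [take_take, take_of_length_le (by omega : h.length ≤ 3)] at h3
    rw [show min 3 1 = 1 from rfl] at h3
    rwa [h3]
  · intro hk
    exact ⟨_, ((cryptoGame_NT hn).1 (play_take_turns hn (by omega) (rfl : corrMover m 1 = 1) ω).1).1, hk, rfl⟩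

lemma act₀_plan (hM : M = fun j => (P j).toStrat S) (hc : ∀ n r, ∃ D, (P 0).samp n r = cleanBeh D)
    (hn : 1 ≤ n) (hN : ¢ n + (P 0).coins.eval n ≤ coinsOf M n 0)
    (ω : Coins (coinsOf M n)) {a : Fin l}
    (ha : a = bitsNum l ((P 0).samp n (ofFn (sampCoins S (P 0) n hN (ω 0)))).2.1) :
    act₀ (respOf M n ω) = commitStr S n (♭ a)
      (ofFn fun k : Fin (¢ n) => ω 0 ⟨k, by omega⟩) ∧
    (outR S Γ l n (respOf M n ω)).1 = a := by
  obtain ⟨D, hD⟩ := hc n (ofFn (sampCoins S (P 0) n hN (ω 0)))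
  rw [hD] at ha
  have ha' : a = D.1.1 := ha.trans (bitsNum_num _)
  have h1 : act₀ (respOf M n ω) = commitStr S n (♭ a)
      (ofFn fun k : Fin (¢ n) => ω 0 ⟨k, by omega⟩) := by
    rw [act₀, Plan.respOf_toStrat P M (by rw [hM]) n hN ω, behAct_zero, hD, ha']
    rfl
  refine ⟨h1, ?_⟩
  change ofNat l (committedVal S (size l) n (act₀ (respOf M n ω))) = a
  rw [h1, committedVal_commitStr hn (by simp [commitCoins]), bitsVal_num]
  simp

open Classical in
/-- The number in the envelope is independent of the random bits of the commitments and of those of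
player `1`. -/
lemma avg_commit (hM : M = fun j => (P j).toStrat S) (hc : ∀ n r, ∃ D, (P 0).samp n r = cleanBeh D)
    (hn : 1 ≤ n) (a : Fin l) (φ : Bits → Bits → ℝ) :
    avg (fun ω : Coins (coinsOf M n) => if (outR S Γ l n (respOf M n ω)).1 = a then
        φ (act₀ (respOf M n ω)) (ofFn (ω 1)) else 0) =
      prob (fun ω : Coins (coinsOf M n) => (outR S Γ l n (respOf M n ω)).1 = a) *
        avg (fun p : (Fin (¢ n) → Bool) × (Fin (coinsOf M n 1) → Bool) =>
          φ (commitStr S n (♭ a) (ofFn p.1)) (ofFn p.2)) := by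
  have hN : ¢ n + (P 0).coins.eval n ≤ coinsOf M n 0 := by
    rw [coinsOf, hM, Plan.toStrat_coins]
  have h01 : (0 : ℙ) ≠ 1 := by simp
  have hk : ¢ n ≤ coinsOf M n 0 := by omega
  rw [← unif_splice₂ (N := coinsOf M n) h01 hk (le_refl (coinsOf M n 1))
    (fun ω : Coins (coinsOf M n) => if (outR S Γ l n (respOf M n ω)).1 = a then
        φ (act₀ (respOf M n ω)) (ofFn (ω 1)) else 0), avg_prod, prob_eq_avg, mul_comm,
    ← avg_mul_right]
  congr 1
  funext p
  rw [← avg_mul_left]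
  congr 1
  funext ω
  set ω' : Coins (coinsOf M n) := update (update ω 0 (splice p.1 (ω 0))) 1
    (splice p.2 (ω 1)) with hω'
  change (if (outR S Γ l n (respOf M n ω')).1 = a then
    φ (act₀ (respOf M n ω')) (ofFn (ω' 1)) else 0) = _
  have h0 : ω' 0 = splice p.1 (ω 0) := by rw [hω', update_of_ne h01, update_self]
  have h1 : ω' 1 = p.2 := by
    rw [hω', update_self]
    funext t
    simp [splice]
  have hs : sampCoins S (P 0) n hN (ω' 0) = sampCoins S (P 0) n hN (ω 0) := by
    rw [h0]
    funext t
    simp [sampCoins, splice]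
  have h2 := act₀_plan (Γ := Γ) hM hc hn hN ω' rfl
  have h3 := act₀_plan (Γ := Γ) hM hc hn hN ω rfl
  have h4 : (fun k : Fin (¢ n) => ω' 0 ⟨k, by omega⟩) = p.1 := by
    rw [h0]
    exact prefix_splice hk _ _
  rw [hs, h4] at h2
  rw [h2.2, h3.2, h2.1, h1]
  split_ifs with h
  · rw [h, mul_one]
  · rw [mul_zero]

/-- The probability that a view of player `1` is accepted depends only negligibly on the number in
the envelope. -/
lemma exists_accept (hM : M = fun j => (P j).toStrat S)
    (hc : ∀ n r, ∃ D, (P 0).samp n r = cleanBeh D) (D : Distinguisher) :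
    ∃ (acc ε : ℕ → ℝ), Negligible ε ∧ ∀ n, 1 ≤ n → ∀ K : Set (List CorrAct),
      (∀ h ∈ K, h.length = 1) → ∀ V, V = views M 1 n (liftSet ⌘ ♮ n K) →
      0 < prob (fun ω => viewOf M 1 1 n ω ∈ V) →
      |(∑ᶠ v, viewDist M 1 n V v * D.accept n (code v)) - acc n| ≤ ε n := by
  classical
  let q := (M 1).coins + D.coins
  let T : ℕ → Bits → Bits → Prop := fun n x y =>
    D.run n (packBits [packBits [x], y.take ((M 1).coins.eval n)]) (y.drop ((M 1).coins.eval n)) = true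
  have hT : DecPT inp₃ (fun a => T a.1 a.2.1 a.2.2) := by
    obtain ⟨hN, hx, hr⟩ := PolyTime.args₃
    have hC := ones_eval (M 1).coins hN
    have h1 := PolyTime.packBits [fun a : ℕ × Bits × Bits => a.2.1] (inp := inp₃) (by simp [hx])
    have ht : PolyTime inp₃ (fun a => a.2.2.take ((M 1).coins.eval a.1)) :=
      (hr.take hC).congr fun a => by rw [length_ones]
    have hd : PolyTime inp₃ (fun a => a.2.2.drop ((M 1).coins.eval a.1)) :=
      (hr.drop hC).congr fun a => by rw [length_ones]
    have h2 : PolyTime inp₃ (fun a => packBits [packBits [a.2.1], a.2.2.take ((M 1).coins.eval a.1)]) :=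
      PolyTime.packBits [fun a : ℕ × Bits × Bits => packBits [a.2.1],
        fun a => a.2.2.take ((M 1).coins.eval a.1)] (by simp [ht]; exact h1)
    exact DecPT.of_bool (D.polyTime.comp (fun a : ℕ × Bits × Bits => (a.1,
        packBits [packBits [a.2.1], a.2.2.take ((M 1).coins.eval a.1)],
        a.2.2.drop ((M 1).coins.eval a.1)))
      [fun a => ones a.1, fun a => packBits [packBits [a.2.1], a.2.2.take ((M 1).coins.eval a.1)],
        fun a => a.2.2.drop ((M 1).coins.eval a.1)] (by simp; exact ⟨hN, h2, hd⟩) (fun _ => rfl))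
  let acc : Fin l → ℕ → ℝ := fun a n => commitProb S q T n (♭ a)
  choose ε hε hacc using fun a : Fin l =>
    commit_hiding (S := S) (q := q) hT (♭ a) (♭ (0 : Fin l))
  refine ⟨acc 0, fun n => ∑ a, ε a n, Negligible.sum _ fun a _ => hε a, fun n hn K hK V hV hp => ?_⟩
  have hq : q.eval n = (M 1).coins.eval n + D.coins.eval n := eval_add
  have hφ : ∀ a, acc a n = avg (fun p : (Fin (¢ n) → Bool) ×
      (Fin (coinsOf M n 1) → Bool) => D.accept n (code ((packBits
        [commitStr S n (♭ a) (ofFn p.1)], ofFn p.2) : View))) := fun a => by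
    rw [show acc a n = commitProb S q T n (♭ a) from rfl, commitProb, prob_prod, avg_prod]
    refine congrArg avg (funext fun cc => ?_)
    simp only [Distinguisher.accept]
    refine Eq.trans ?_ (prob_prod fun p : (Fin (coinsOf M n 1) → Bool) × (Fin (D.coins.eval n) → Bool) =>
      D.run n (code ((packBits [commitStr S n (♭ a) (ofFn cc)],
        ofFn p.1) : View)) (ofFn p.2) = true)
    refine Eq.trans ?_ ((unif_take_drop hq).prob_comp _)
    refine prob_congr fun y => ?_
    simp only [T]
    rw [take_ofFn _ (by omega), drop_ofFn _ hq]
    rfl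
  rw [finsum_viewDist (i := 1) hn (by omega) rfl hK hV hp]
  have hmem : ∀ ω, viewOf M 1 1 n ω ∈ V ↔ [enclose (outR S Γ l n (respOf M n ω)).1] ∈ K :=
    fun ω => hV ▸ viewOf_one_mem hn hK ω
  let w : Fin l → ℝ := fun a => if [enclose a] ∈ K then
    prob (fun ω : Coins (coinsOf M n) => (outR S Γ l n (respOf M n ω)).1 = a) else 0
  have hw : ∀ a, 0 ≤ w a := fun a => by
    simp only [w]
    split_ifs
    exacts [prob_nonneg _, le_rfl]
  have hsum : ∀ φ : Bits → Bits → ℝ, avg (fun ω => if viewOf M 1 1 n ω ∈ V then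
      φ (act₀ (respOf M n ω)) (ofFn (ω 1)) else 0) = ∑ a, w a *
        avg (fun p : (Fin (¢ n) → Bool) × (Fin (coinsOf M n 1) → Bool) =>
          φ (commitStr S n (♭ a) (ofFn p.1)) (ofFn p.2)) := fun φ => by
    simp only [w, ite_mul, zero_mul, ← avg_commit hM hc hn]
    simp only [← sum_filter, ← avg_sum]
    congr 1
    funext ω
    rw [sum_filter, sum_filter,
      sum_eq_single (outR S Γ l n (respOf M n ω)).1 (fun a _ ha => by simp [ha.symm]) (by simp)]
    simp only [hmem, if_true]
  have hden : prob (fun ω => viewOf M 1 1 n ω ∈ V) = ∑ a, w a := by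
    rw [prob_eq_avg, hsum fun _ _ => 1]
    simp only [avg_const, mul_one]
  have hnum : avg (fun ω => if viewOf M 1 1 n ω ∈ V then
      D.accept n (code (viewOf M 1 1 n ω)) else 0) = ∑ a, w a * acc a n := by
    simp only [hφ]
    rw [← hsum fun x y => D.accept n (code ((packBits [x], y) : View))]
    congr 1
    funext ω
    rw [viewOf, play_eq M hn (N := coinsOf M n) (fun _ => le_rfl)]
    rfl
  rw [hden] at hp
  rw [hnum, hden, div_sub' hp.ne', abs_div, abs_of_pos hp, div_le_iff₀ hp, sum_mul,
    ← sum_sub_distrib, mul_comm, sum_mul]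
  refine (abs_sum_le_sum_abs _ _).trans (sum_le_sum fun a _ => ?_)
  rw [← mul_sub, abs_mul, abs_of_nonneg (hw a)]
  exact mul_le_mul_of_nonneg_left ((hacc a n hn).trans
    (single_le_sum (fun b _ => (hε b).1 n) (mem_univ a))) (hw a)

lemma exists_pos_viewOf {W : ∀ j, Data Γ l j → ℝ} (hM : M = fun j => (P j).toStrat S)
    (hW : ∀ j, IsDist (W j)) (hP : ∀ j, PlanSpec (P j) (W j)) {a : Fin l}
    (ha : 0 < expOut W (fun o => if o.1 = a then 1 else 0)) (hK : ∀ h ∈ K, h.length = 1)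
    (hm : [enclose a] ∈ K) : ∀ᶠ n in atTop, 0 < prob (fun ω => viewOf M 1 1 n ω ∈
      views M 1 n (liftSet ⌘ ♮ n K)) := by
  obtain ⟨ε, hε, h⟩ := prob_outR_plans hM hW hP
  filter_upwards [hε.eventually_lt ha, eventually_ge_atTop 1] with n h1 hn
  have h2 := (abs_le.1 (h n hn (fun o => o.1 = a))).1
  refine lt_of_lt_of_le ?_ (prob_mono fun ω (h' : (outR S Γ l n (respOf M n ω)).1 = a) =>
    (viewOf_one_mem hn hK ω).2 (h' ▸ hm))
  linarith

/-- The information sets of the envelope game are consistent. -/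
lemma consistent_cells {W : ∀ j, Data Γ l j → ℝ} (hM : M = fun j => (P j).toStrat S)
    (hc : ∀ n r, ∃ D, (P 0).samp n r = cleanBeh D) (hW : ∀ j, IsDist (W j))
    (hP : ∀ j, PlanSpec (P j) (W j))
    (ha : ∀ a, 0 < expOut W (fun o => if o.1 = a then 1 else 0))
    (hr : expOut W (fun o => if o.2.2.1 = false then 1 else 0) = 0) (i : ℙ) :
    Consistent ♮ M i (Set.range (✉.cell (i := i))) := by
  rintro _ ⟨I, rfl⟩ hnt h hh hneg -
  obtain ⟨h', hh', hne⟩ := hnt.exists_ne h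
  have hH := (corrGame_NT.1 hh.1.1).1
  have hH' := (corrGame_NT.1 hh'.1.1).1
  have hlt := (corrGame_NT.1 hh.1.1).2
  have he : ∀ g ∈ ✉.cell I, corrObs m g = corrObs m h := fun g hg => hg.2.trans hh.2.symm
  have hlen : ∀ g ∈ ✉.cell I, g.length = h.length := fun g hg => by
    simpa [corrObs] using congrArg List.length (he g hg)
  have hi : corrMover m h.length = i := hh.1.2
  have hl' := hlen h' hh'
  obtain ⟨o, ho⟩ := exists_mkHist hH
  obtain ⟨o', ho'⟩ := exists_mkHist hH'
  rw [hl'] at ho'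
  obtain h3 | h3 : 3 ≤ h.length ∨ h.length < 3 := by omega
  · have hK : ∀ g ∈ ({h} : Set (List CorrAct)), g.length = h.length := by simp
    have hK' : ∀ g ∈ ✉.cell I \ {h}, g.length = h.length := fun g hg => hlen g hg.1
    by_cases hrev : reveal ∈ h.take 3
    · have h4 : ∀ g ∈ ✉.cell I, g.take 3 = h.take 3 := fun g hg =>
        take_three_of_info hlt h3 hH (corrGame_NT.1 hg.1.1).1 rfl (hlen g hg) (he g hg).symm hrev
      refine fun D => ⟨fun _ => 0, Negligible.zero, fun n hn => ?_⟩
      beta_reduce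
      rw [(views_subset (M := M) (K' := ✉.cell I \ {h}) hn hlt h3 hi hK ⟨hh', hne⟩ hH' hl' (by simp [h4 h' hh'])).antisymm
        (views_subset hn hlt h3 hi hK' rfl hH rfl fun g hg => h4 g hg.1), sub_self, abs_zero]
    · refine absurd ?_ hneg
      obtain ⟨ε, hε, hphi⟩ := prob_outR_plans hM hW hP
      refine Negligible.of_eventually (fun n => finsum_nonneg fun v => finsum_nonneg fun _ => prob_nonneg _)
        ⟨ε, hε, ?_⟩
      filter_upwards [eventually_ge_atTop 1] with n hn
      rw [xiSet_views hn hlt hi hK rfl]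
      have h5 := (abs_le.1 (hphi n hn fun o => o.2.2.1 = false)).2
      refine (prob_mono (E' := fun ω => (outR S Γ l n (respOf M n ω)).2.2.1 = false) fun ω hω => ?_).trans
        (by linarith)
      obtain ⟨g, hg, hk, hv⟩ := (viewOf_mem hn hlt hi hK ω).1 hω
      have h6 := congrArg (♮ n) (cryptoObs_eq hv).2
      rw [corrMap_take, corrMap_play_take hn, corrMap_take, Set.mem_singleton_iff.1 hk, take_take,
        min_eq_left h3] at h6
      rw [← h6] at hrev
      by_contra hf
      simp [mkHist, revAct, hf] at hrev
  · generalize hlv : h.length = lev at *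
    obtain rfl | rfl | rfl : lev = 0 ∨ lev = 1 ∨ lev = 2 := by omega
    · exact absurd (ho'.trans ho.symm) hne
    · obtain rfl : 1 = i := hi
      have hK : ∀ g ∈ ({h} : Set (List CorrAct)), g.length = 1 := by simp [hlv]
      have hK' : ∀ g ∈ ✉.cell I \ {h}, g.length = 1 := fun g hg => hlen g hg.1
      intro D
      obtain ⟨acc, ε, hε, hacc⟩ := exists_accept hM hc D
      refine ⟨_, Negligible.of_eventually (fun n => abs_nonneg _) ⟨_, hε.add hε, ?_⟩, fun n _ => le_rfl⟩
      filter_upwards [exists_pos_viewOf hM hW hP (ha o.1) hK (by rw [ho]; rfl),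
        exists_pos_viewOf hM hW hP (ha o'.1) hK' (by
          rw [show [enclose o'.1] = h' from ho'.symm]; exact ⟨hh', hne⟩),
        eventually_ge_atTop 1] with n h1 h2 hn
      have h3 := abs_le.1 (hacc n hn _ hK _ rfl h1)
      have h4 := abs_le.1 (hacc n hn _ hK' _ rfl h2)
      exact abs_le.2 ⟨by linarith [h3.1, h4.2], by linarith [h3.2, h4.1]⟩
    · refine absurd ?_ hne
      have h1 := he h' hh'
      rw [ho, ho'] at h1 ⊢
      simpa [mkHist, corrObs_two] using h1

end

/-! ## The computational sequential equilibrium -/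

section

variable {x : Fin l → Γ.Profile} {w : Fin l}

lemma corrMixed_destroy : expOut (fun j => lawData (corrMixed x w zero_mem_unit j))
    (fun o => if o.2.2.1 = false then 1 else 0) = 0 := by
  rw [expOut_corrMixed, expOut_corrDist le_rfl zero_le_one]
  refine sum_eq_zero fun a _ => sum_eq_zero fun b _ => ?_
  simp [revProb]

lemma corrMixed_enclose_pos (a : Fin l) : 0 < expOut (fun j => lawData (corrMixed x w zero_mem_unit j))
    (fun o => if o.1 = a then 1 else 0) := by
  have hl := natCast_pos_of_neZero l
  rw [expOut_corrMixed, expOut_corrDist le_rfl zero_le_one]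
  simp [revProb, NormalForm.sum_profileProb, hl]

lemma cells_partition (i : ℙ) : IsPartitionOf (Set.range (✉.cell (i := i))) (✉.turns i) := by
  refine ⟨?_, ?_, Set.ext fun h => ⟨?_, fun hh => ?_⟩⟩
  · rintro ⟨⟨J, h, hh, rfl⟩, hI⟩
    exact (hI ▸ ⟨hh, rfl⟩ : h ∈ (∅ : Set (List CorrAct)))
  · rintro _ ⟨I, rfl⟩ _ ⟨I', rfl⟩ hne
    refine Set.disjoint_left.2 fun h h1 h2 => hne ?_
    rw [Subtype.ext (h1.2.symm.trans h2.2) (a1 := I) (a2 := I')]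
  · rintro ⟨_, ⟨I, rfl⟩, hh⟩
    exact hh.1
  · exact ⟨_, ⟨⟨_, h, hh, rfl⟩, rfl⟩, hh, rfl⟩

lemma behAct_cleanBeh_junk (n : ℕ) (D : Data Γ l i) (cc j j' v : Bits) :
    behAct S n (cleanBeh D) cc j v = behAct S n (cleanBeh D) cc j' v := by
  simp [behAct, cleanBeh]

lemma sum_abs_law_lapse_le {P Q : Plan Γ l i} (hP : P.coins = X)
    (hc : ∀ n r, ∃ D, P.samp n r = cleanBeh D) (k n : ℕ) :
    ∑ s : (⌘ n).Det i, |((lapsePlan P Q k).toStrat S).law n s - (P.toStrat S).law n s| ≤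
      2 * (1 / 2 ^ k) := by
  have h1 : (P.toStrat S).coins.eval n = ¢ n + n := by
    rw [Plan.toStrat_coins, hP, eval_X]
  obtain ⟨q, hq⟩ : ∃ q, ((lapsePlan P Q k).toStrat S).coins.eval n = ¢ n + n + (n + k + q) :=
    ⟨_, by rw [Plan.toStrat_coins, lapsePlan_coins, ← add_assoc, ← add_assoc (n + k)]⟩
  refine (sum_abs_law_sub_le (M := (lapsePlan P Q k).toStrat S) (M' := P.toStrat S) (by omega)
    (B := fun r => false ∉ ((ofFn r).drop (¢ n + n)).take k) fun r hr v => ?_).trans ?_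
  · rw [h1]
    set R := ofFn r
    rw [not_not, ← List.drop_drop] at hr
    change behAct S n ((lapsePlan P Q k).samp n (R.drop (¢ n))) _ _ v =
      behAct S n (P.samp n ((R.take (¢ n + n)).drop (¢ n)))
        ((R.take (¢ n + n)).take (¢ n)) _ v
    rw [lapsePlan_samp hr, List.drop_take, take_take, min_eq_left (Nat.le_add_right _ _),
      Nat.add_sub_cancel_left]
    obtain ⟨D, hD⟩ := hc n ((R.drop (¢ n)).take n)
    rw [hD]
    exact behAct_cleanBeh_junk n D _ _ _ v
  · refine mul_le_mul_of_nonneg_left (le_of_eq ?_) zero_le_two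
    rw [← prob_false_not_mem (show k ≤ n + k + q by omega), ← (unif_precomp
      (j := fun t : Fin (n + k + q) => (⟨¢ n + n + t, by omega⟩ :
        Fin (((lapsePlan P Q k).toStrat S).coins.eval n)))
      fun a b h => Fin.ext (by simpa using h)).prob_comp]
    exact prob_congr fun r => by rw [drop_ofFn _ hq]

lemma compSeqEquilibrium (hx : ∀ e, Γ.IsNash (x e))
    (hw : ∀ e, Γ.expPayoff (x w) 0 ≤ Γ.expPayoff (x e) 0)
    (hq : ∀ e j u, (x e j).1 u ∈ (algebraMap ℚ ℝ).fieldRange) {σ : ∀ i, ✉.EffMixed i}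
    (hσ : ∀ i, (σ i).1 = corrMixed x w zero_mem_unit i) :
    CompSeqEquilibrium ✉ ♮ (fun i => (genPlan (σ i)).toStrat S) := by
  choose τ hτ using fun k j => exists_mixture hq w k j
  let Q := fun k j => lapsePlan (genPlan (σ j)) (genPlan (τ k j)) k
  have hP := fun j => genPlan_spec (σ j)
  have hQ : ∀ k j, PlanSpec (Q k j) (lawData (corrMixed x w (tremble_mem_unit l k) j)) := fun k j => by
    have h := lapsePlan_spec (hP j).2.1 (genPlan_spec (τ k j)).2.1 (hP j).1 (genPlan_spec (τ k j)).1 k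
    rw [hσ] at h
    rwa [← funext (hτ k j)] at h
  refine ⟨fun k j => (Q k j).toStrat S, fun k => 4 * (tremble l k * Γ.payBound), fun k => ?_, ?_,
    fun k n hn h hh => lapse_psi_pos _ _ k hn hh, fun η hη => ?_, fun k i => ⟨_, cells_partition i, ?_, ?_⟩⟩
  · have := (tremble_mem_unit l k).1
    have := Γ.payBound_nonneg
    positivity
  · simpa using ((tendsto_tremble l).mul_const Γ.payBound).const_mul 4
  · have h := (tendsto_pow_atTop_nhds_zero_of_lt_one (r := (1 / 2 : ℝ)) (by norm_num)
      (by norm_num)).const_mul 2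
    rw [mul_zero] at h
    filter_upwards [h.eventually_le_const hη] with k hk n hn i
    rw [one_div_pow] at hk
    exact (sum_abs_law_lapse_le (hP i).1 (hP i).2.2.1 k n).trans hk
  · refine consistent_cells (P := fun j => genPlan (σ j))
      (W := fun j => lawData (corrMixed x w zero_mem_unit j)) rfl (hP 0).2.2.1
      (fun j => isDist_lawData _) (fun j => by rw [← hσ]; exact (hP j).2.1)
      corrMixed_enclose_pos corrMixed_destroy i
  · rintro _ ⟨I, rfl⟩ M'
    obtain ⟨lev, E, hlev, -, hE, hI, hIE⟩ := exists_cellEvent I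
    obtain ⟨v, hv⟩ := corrMixed_cell (hε := tremble_mem_unit l k) hx hw (tremble_spec l k).1
      (tremble_spec l k).2.1 hE
    exact condExpect_playSwitch_le _ M' (P := Q k) (fun j => isDist_lawData _) (hQ k) rfl hlev hI hIE hv

end

end

/-! ## The theorem -/

section

variable {m : ℕ} {Γ : NormalForm m} (π : Γ.NiceCCNE)

lemma NormalForm.NiceCCNE.neZero_lcd : NeZero π.lcd := ⟨fun h => by
    obtain ⟨j, -, hj⟩ := Finset.lcm_eq_zero_iff.1 h
    exact (π.coeff j).den_nz hj⟩

lemma NormalForm.NiceCCNE.neZero_size (π : Γ.NiceCCNE) (i : Fin (m + 2)) : NeZero (Γ.size i) := by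
  have h0 : Nonempty (Fin π.count) := by
    by_contra h
    rw [not_nonempty_iff] at h
    simpa using π.coeff_sum
  have h1 := (π.eqm h0.some i).2.2
  refine ⟨fun h => ?_⟩
  have : IsEmpty (Fin (Γ.size i)) := by rw [h]; infer_instance
  simp at h1

/-- A convex combination with least common denominator `l` is the uniform distribution on a family
of `l` equilibria. -/
lemma NormalForm.NiceCCNE.exists_family : ∃ j : Fin π.lcd → Fin π.count,
    ∀ a, 1 / (π.lcd : ℝ) * ∑ e, Γ.profileProb (π.eqm (j e)) a = π.dist a := by
  have hl := π.neZero_lcd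
  let k : Fin π.count → ℕ := fun j => (π.coeff j).num.toNat * (π.lcd / (π.coeff j).den)
  have hk : ∀ j, (k j : ℚ) = π.coeff j * π.lcd := fun j => by
    have h1 : ((π.coeff j).num.toNat : ℚ) = (π.coeff j).num := by
      exact_mod_cast Int.toNat_of_nonneg (Rat.num_nonneg.2 (π.coeff_pos j).le)
    have h2 : (π.coeff j).den ∣ π.lcd := Finset.dvd_lcm (mem_univ j)
    have h3 : ((π.coeff j).den : ℚ) ≠ 0 := by exact_mod_cast (π.coeff j).den_nz
    rw [Nat.cast_mul, h1, Nat.cast_div h2 h3, ← mul_div_assoc, mul_div_right_comm, Rat.num_div_den]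
  have hs : ∑ j, k j = π.lcd := by
    have h : ((∑ j, k j : ℕ) : ℚ) = π.lcd := by
      rw [Nat.cast_sum]
      simp only [hk, ← sum_mul, π.coeff_sum, one_mul]
    exact_mod_cast h
  let e : Fin π.lcd ≃ (j : Fin π.count) × Fin (k j) := Fintype.equivOfCardEq (by simp [hs])
  refine ⟨fun c => (e c).1, fun a => ?_⟩
  rw [e.sum_comp fun p => Γ.profileProb (π.eqm p.1) a, Fintype.sum_sigma, mul_sum]
  refine sum_congr rfl fun j _ => ?_
  have h1 : (k j : ℝ) = π.coeff j * π.lcd := by exact_mod_cast congrArg (Rat.cast (K := ℝ)) (hk j)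
  have h2 : (π.lcd : ℝ) ≠ 0 := by exact_mod_cast hl.out
  simp only [sum_const, card_univ, card_fin, nsmul_eq_mul, h1]
  field_simp

end

theorem mainTheorem5 {m : ℕ} (S : CommitmentScheme) (hS : S.Recognizable)
    (Γ : NormalForm m) (hΓ : ∀ a i, PolyTimeReal (Γ.payoff a i)) (π : Γ.NiceCCNE) :
    ∃ F : ∀ i, (corrGame Γ π.lcd).EffMixed i → Strat (cryptoGame S Γ π.lcd) i,
      Represents (cryptoGame S Γ π.lcd) (corrGame Γ π.lcd) (corrMap S π.lcd) F ∧
      ∃ σ : ∀ i, (corrGame Γ π.lcd).EffMixed i,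
        (corrGame Γ π.lcd).SeqEquilibrium (fun i => (σ i).1) ∧ Implements π (fun i => (σ i).1) ∧
        CompSeqEquilibrium (corrGame Γ π.lcd) (corrMap S π.lcd) (fun i => F i (σ i)) ∧
        CompImplements S π (fun i => F i (σ i)) := by
  have := π.neZero_lcd
  have := π.neZero_size
  obtain ⟨j, hj⟩ := π.exists_family
  let x : Fin π.lcd → Γ.Profile := fun e => π.eqm (j e)
  obtain ⟨w, hw⟩ := Finite.exists_min fun e => Γ.expPayoff (x e) 0
  have hx : ∀ e, Γ.IsNash (x e) := fun e => π.isNash _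
  have hq : ∀ e j u, (x e j).1 u ∈ (algebraMap ℚ ℝ).fieldRange := fun e i u => by
    obtain ⟨q, hq⟩ := π.rational (j e) i u
    exact ⟨q, hq.symm⟩
  let τ : ∀ i, (corrGame Γ π.lcd).Mixed i := corrMixed x w zero_mem_unit
  have hact : ∀ a, expOut (fun i => lawData (τ i)) (fun o => if o.2.2.2 = a then 1 else 0) = π.dist a :=
    fun a => by
      refine Eq.trans ?_ ((corrMixed_action (x := x) (w := w) a).trans (hj a))
      congr!
  let σ : ∀ i, (corrGame Γ π.lcd).EffMixed i := fun i =>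
    ⟨τ i, polyTimeReal_of_dist (τ i).2 (corrMixed_rational hq (zero_mem _) i)⟩
  refine ⟨fun i σ => (genPlan σ).toStrat S, represents hS hΓ, σ, seqEquilibrium_corrMixed hx hw,
    fun a => ?_, compSeqEquilibrium hx hw hq fun _ => rfl, ?_⟩
  · exact (sum_rho_action τ a).trans (hact a)
  · obtain ⟨ε, hε, h⟩ := prob_outR_plans (S := S) (P := fun i => genPlan (σ i))
      (W := fun i => lawData (τ i)) rfl (fun i => isDist_lawData _) fun i => (genPlan_spec (σ i)).2.1
    refine ⟨_, hε.const_mul (C := card (∀ i, Fin (Γ.size i))) (by positivity), fun n hn => ?_⟩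
    rw [← nsmul_eq_mul]
    refine Finset.sum_le_card_nsmul _ _ _ fun a _ => ?_
    rw [← hact a]
    refine le_of_eq_of_le ?_ (h n hn fun o => o.2.2.2 = a)
    congr 2
    refine prob_congr fun ω => ?_
    have h1 := corrMap_play (fun i => (genPlan (σ i)).toStrat S) hn
      (N := coinsOf (fun i => (genPlan (σ i)).toStrat S) n) (fun _ => le_rfl) ω
    simp only [← corrChoice_corrMap (S := S) (l := π.lcd) (n := n), h1, corrChoice_mkHist]
    exact ⟨fun h => funext fun i => Fin.ext (h i), fun h i => by rw [h]⟩

end
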